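/- Conventions. Let $(M,\omega)$ be a connected symplectic $4$-manifold. For a smooth $H:M\to\mathbb R$ let $X_H$ be the vector field with $\omega(X_H,\cdot)=dH$ and $\phi^t_H$ its flow. A subset $S\subset M$ is displaceable if there is a compactly supported smooth $H:M\to\mathbb R$ with $\phi^1_H(S)\cap\overline S=\emptyset$. A Lagrangian fibration $F:(M,\omega)\to B$ over a $2$-manifold $B$ with boundary (and corners) is a smooth surjection whose set $B_r$ of regular values is open and dense in $B$ and which over $B_r$ is a locally trivial fibration with Lagrangian fibres. For $b\in B_r$ let $\Lambda_b^*\subset T_b^*B$ be the set of covectors $\alpha$ such that the time-one map of the vector field $X_\alpha$ on $F^{-1}(b)$ given by $\omega(X_\alpha,\cdot)=F^*\alpha$ is the identity. An integral affine structure on $B$ (a lattice in $TB$, locally spanned by a smooth frame) is induced by $F$ if over each $b\in B_r$ its lattice is dual to $\Lambda^*_b$. The standard structure $\mathcal A_0$ on $\mathbb R^2$ is given by $\mathbb Z^2$. The fibration $F:(M,\omega)\to(B,\mathcal A)$, where $\mathcal A$ is induced by $F$, is a toric fibration if there are a Hamiltonian action of the torus $\mathbb T^2=(\mathbb R/\mathbb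 Z)^2$ on $M$ and a smooth immersion $\Phi:(B,\mathcal A)\to(\mathbb R^2,\mathcal A_0)$ mapping lattice onto lattice such that $\Phi\circ F$ is the momentum map of the action. An affine embedding of a rectangle $([0,R]\times[0,a],\mathcal A_0)$ into $(B,\mathcal A)$ is a smooth embedding $j$ whose derivative maps $\mathbb Z^2$ onto the lattice of $\mathcal A$ at every point. We say that $j$ starts on the reduced boundary if for every $y\in[0,a]$ there is an integer $l\ge 0$ such that $F^{-1}(j(0,y))$ is a torus of dimension $l$ and $F^{-1}(j(x,y))$ is a torus of dimension $l+1$ for all $0<x<R$. (This holds, for instance, if $j$ maps the corner $(0,0)$ to a vertex and the rest of the left and the lower edge to $1$-dimensional strata, while all other points of the rectangle go to $B_r$; then the preimage of the rectangle is a product of two closed disks.) Statement. Let $F:(M,\omega)\to B$ be a toric fibration which is proper and has connected fibres, and let $\mathcal A$ be the integral affine structure on $B$ induced by $F$. (1) Let $R>0$ and $0<h<\frac R2$, and let $j$ be an affine embedding of $([0,R]\times[0,h],\mathcal A_0)$ into $(B,\mathcal A)$ that starts on the reduced boundary. Then $F^{-1}(j([0,h]\times[0,h]))\subset M$ is displaceable.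 (2) Let $R,a>0$ and $0<h<\frac R2$, and let $j$ be an affine embedding of $([0,R]\times[0,a],\mathcal A_0)$ into $(B,\mathcal A)$ that starts on the reduced boundary. Then $F^{-1}(j([0,h]\times[0,a]))\subset M$ is displaceable. -/

import Mathlib

open Set Filter Topology
open scoped Manifold ContDiff

noncomputable section

/-! ### Symplectic manifolds -/

section Symplectic

variable {E : Type*} [NormedAddCommGroup E] [NormedSpace ℝ E]
variable {M : Type*} [TopologicalSpace M] [ChartedSpace E M]

/-- The expression, in the preferred chart around `x₀`, of a field `η` of alternating
2-linear forms on the tangent spaces of `M` (the pullback of `η` under the inverse chart). -/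
def twoFormInChart (η : ∀ x : M, TangentSpace 𝓘(ℝ, E) x [⋀^Fin 2]→L[ℝ] ℝ) (x₀ : M) (y : E) :
    E [⋀^Fin 2]→L[ℝ] ℝ :=
  (η ((extChartAt 𝓘(ℝ, E) x₀).symm y)).compContinuousLinearMap
    (mfderiv 𝓘(ℝ, E) 𝓘(ℝ, E) (extChartAt 𝓘(ℝ, E) x₀).symm y)

variable (E M) in
/-- A symplectic form: a smooth, closed, non-degenerate 2-form. -/
structure SymplecticForm where
  /-- the value of the form at each point -/
  form : ∀ x : M, TangentSpace 𝓘(ℝ, E) x [⋀^Fin 2]→L[ℝ] ℝ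
  smooth : ∀ x₀ : M, ContDiffOn ℝ ∞ (twoFormInChart form x₀) (extChartAt 𝓘(ℝ, E) x₀).target
  closed : ∀ x₀ : M, ∀ y ∈ (extChartAt 𝓘(ℝ, E) x₀).target,
    extDeriv (twoFormInChart form x₀) y = 0
  nondegenerate : ∀ (x : M) (v : TangentSpace 𝓘(ℝ, E) x),
    (∀ w : TangentSpace 𝓘(ℝ, E) x, form x ![v, w] = 0) → v = 0

/-- A linear subspace `L` of `T_x M` is Lagrangian: `Ω` vanishes on it and its dimension is half
that of `T_x M`. -/
def IsLagrangianSubspace (Ω : SymplecticForm E M) (x : M)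
    (L : Submodule ℝ (TangentSpace 𝓘(ℝ, E) x)) : Prop :=
  (∀ v ∈ L, ∀ w ∈ L, Ω.form x ![v, w] = 0) ∧
    2 * Module.finrank ℝ L = Module.finrank ℝ (TangentSpace 𝓘(ℝ, E) x)

/-- `X` is the Hamiltonian vector field of `H`: `Ω(X, ·) = dH`. -/
def IsHamiltonianVectorField (Ω : SymplecticForm E M) (H : M → ℝ)
    (X : ∀ x : M, TangentSpace 𝓘(ℝ, E) x) : Prop :=
  ∀ (x : M) (w : TangentSpace 𝓘(ℝ, E) x),
    Ω.form x ![X x, w] = mfderiv 𝓘(ℝ, E) 𝓘(ℝ, ℝ) H x w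

/-- `φ` is the Hamiltonian flow of `H` (defined for all times). -/
def IsHamiltonianFlow (Ω : SymplecticForm E M) (H : M → ℝ) (φ : ℝ → M → M) : Prop :=
  ∃ X : ∀ x : M, TangentSpace 𝓘(ℝ, E) x, IsHamiltonianVectorField Ω H X ∧
    ∀ x : M, φ 0 x = x ∧ IsMIntegralCurve (I := 𝓘(ℝ, E)) (fun t => φ t x) X

/-- `S` is displaceable: for some compactly supported smooth `H : M → ℝ`, the time-one map of its
Hamiltonian flow moves `S` off the closure of `S`. -/
def IsDisplaceable (Ω : SymplecticForm E M) (S : Set M) : Prop :=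
  ∃ (H : M → ℝ) (φ : ℝ → M → M), ContMDiff 𝓘(ℝ, E) 𝓘(ℝ, ℝ) ∞ H ∧ HasCompactSupport H ∧
    IsHamiltonianFlow Ω H φ ∧ φ 1 '' S ∩ closure S = ∅

end Symplectic

/-! ### Tori and the standard integral lattice -/

/-- The standard lattice `ℤⁿ` in `ℝⁿ`. -/
def stdLattice (n : ℕ) : Set (EuclideanSpace ℝ (Fin n)) :=
  {v | ∀ i, ∃ k : ℤ, v i = k}

/-- The torus `𝕋ⁿ = (ℝ/ℤ)ⁿ`. -/
abbrev StdTorus (n : ℕ) : Type := Fin n → UnitAddCircle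

/-- The projection `ℝⁿ → 𝕋ⁿ`, the exponential map of the torus. -/
def torusExp {n : ℕ} (ξ : EuclideanSpace ℝ (Fin n)) : StdTorus n := fun i => (ξ i : UnitAddCircle)

section Torus

variable {E : Type*} [NormedAddCommGroup E] [NormedSpace ℝ E]
variable {M : Type*} [TopologicalSpace M] [ChartedSpace E M]

/-- `S ⊆ M` is an (embedded, smooth) torus of dimension `l`. -/
def IsEmbeddedTorus (E : Type*) [NormedAddCommGroup E] [NormedSpace ℝ E]
    {M : Type*} [TopologicalSpace M] [ChartedSpace E M] (l : ℕ) (S : Set M) : Prop :=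
  ∃ f : StdTorus l → M, Function.Injective f ∧ range f = S ∧
    ContMDiff 𝓘(ℝ, EuclideanSpace ℝ (Fin l)) 𝓘(ℝ, E) ∞ (fun ξ => f (torusExp ξ)) ∧
    ∀ ξ, Function.Injective
      (mfderiv 𝓘(ℝ, EuclideanSpace ℝ (Fin l)) 𝓘(ℝ, E) (fun ξ => f (torusExp ξ)) ξ)

/-- A smooth action of `𝕋ⁿ` on `M` is Hamiltonian with momentum map `μ`: for each `ξ` in the Lie
algebra `ℝⁿ`, the one-parameter group `t ↦ exp(tξ)` acts as the Hamiltonian flow of `⟨μ, ξ⟩`. -/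
structure IsHamiltonianTorusAction {n : ℕ} (Ω : SymplecticForm E M) [AddAction (StdTorus n) M]
    (μ : M → EuclideanSpace ℝ (Fin n)) : Prop where
  smooth_action : ContMDiff (𝓘(ℝ, EuclideanSpace ℝ (Fin n)).prod 𝓘(ℝ, E)) 𝓘(ℝ, E) ∞
    (fun p : EuclideanSpace ℝ (Fin n) × M => torusExp p.1 +ᵥ p.2)
  smooth_momentum : ContMDiff 𝓘(ℝ, E) 𝓘(ℝ, EuclideanSpace ℝ (Fin n)) ∞ μ
  flow : ∀ ξ : EuclideanSpace ℝ (Fin n),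
    IsHamiltonianFlow Ω (fun x => inner ℝ (μ x) ξ) (fun t x => torusExp (t • ξ) +ᵥ x)

end Torus

/-! ### Integral affine structures

The base `B` is an `n`-manifold with boundary (and corners): it is locally modelled on `[0,∞)ⁿ`. -/

/-- The model with corners for the bases of fibrations. -/
abbrev baseModel (n : ℕ) : ModelWithCorners ℝ (EuclideanSpace ℝ (Fin n)) (EuclideanQuadrant n) :=
  modelWithCornersEuclideanQuadrant n

/-- An integral affine structure on `B`: a lattice in the tangent bundle, that is, a subgroup of
each tangent space which locally is the `ℤ`-span of a smooth frame of the tangent bundle. -/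
structure IntegralAffineStructure (n : ℕ) (B : Type*) [TopologicalSpace B]
    [ChartedSpace (EuclideanQuadrant n) B] [IsManifold (baseModel n) ∞ B] where
  /-- the lattice in each tangent space -/
  lattice : ∀ b : B, AddSubgroup (TangentSpace (baseModel n) b)
  smooth : ∀ b₀ : B, ∃ U : Set B, IsOpen U ∧ b₀ ∈ U ∧
    ∃ e : Fin n → ∀ b : B, TangentSpace (baseModel n) b,
      (∀ i, ContMDiffOn (baseModel n) (baseModel n).tangent ∞
        (fun b => (⟨b, e i b⟩ : TangentBundle (baseModel n) B)) U) ∧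
      ∀ b ∈ U, LinearIndependent ℝ (fun i => e i b) ∧
        lattice b = AddSubgroup.closure (range fun i => e i b)

section Fibration

variable {E : Type*} [NormedAddCommGroup E] [NormedSpace ℝ E]
variable {M : Type*} [TopologicalSpace M] [ChartedSpace E M]
variable {n : ℕ} {B : Type*} [TopologicalSpace B] [ChartedSpace (EuclideanQuadrant n) B]

/-- An integral affine immersion `Φ : (B, 𝒜) → (ℝⁿ, 𝒜₀)`: a smooth immersion whose derivative
carries the lattice of `𝒜` to the standard lattice `ℤⁿ`. -/
def IsIntegralAffineImmersion [IsManifold (baseModel n) ∞ B] (A : IntegralAffineStructure n B)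
    (Φ : B → EuclideanSpace ℝ (Fin n)) : Prop :=
  ContMDiff (baseModel n) 𝓘(ℝ, EuclideanSpace ℝ (Fin n)) ∞ Φ ∧
  ∀ b : B,
    Function.Injective (mfderiv (baseModel n) 𝓘(ℝ, EuclideanSpace ℝ (Fin n)) Φ b) ∧
    mfderiv (baseModel n) 𝓘(ℝ, EuclideanSpace ℝ (Fin n)) Φ b '' (A.lattice b : Set _)
      = stdLattice n

/-- `j` restricts to an affine embedding of `(K, 𝒜₀)` into `(B, 𝒜)`, for a compact domain
`K ⊆ ℝⁿ`: it is smooth and injective on `K`, and its derivative carries the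
standard lattice `ℤⁿ` to the lattice of `𝒜`. -/
def IsAffineEmbeddingOn [IsManifold (baseModel n) ∞ B] (A : IntegralAffineStructure n B)
    (K : Set (EuclideanSpace ℝ (Fin n))) (j : EuclideanSpace ℝ (Fin n) → B) : Prop :=
  ContMDiffOn 𝓘(ℝ, EuclideanSpace ℝ (Fin n)) (baseModel n) ∞ j K ∧ InjOn j K ∧
  ∀ p ∈ K,
    Function.Injective (mfderivWithin 𝓘(ℝ, EuclideanSpace ℝ (Fin n)) (baseModel n) j K p) ∧
    mfderivWithin 𝓘(ℝ, EuclideanSpace ℝ (Fin n)) (baseModel n) j K p '' stdLattice n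
      = (A.lattice (j p) : Set _)

/-! ### Lagrangian and toric fibrations -/

/-- The set of regular values of `π : M → B`. -/
def regularValues (n : ℕ) (E : Type*) [NormedAddCommGroup E] [NormedSpace ℝ E]
    {M : Type*} [TopologicalSpace M] [ChartedSpace E M]
    {B : Type*} [TopologicalSpace B] [ChartedSpace (EuclideanQuadrant n) B]
    (π : M → B) : Set B :=
  {b | ∀ x : M, π x = b → Function.Surjective (mfderiv 𝓘(ℝ, E) (baseModel n) π x)}

/-- A (singular) Lagrangian fibration `π : (M, Ω) → B`: a smooth surjection whose set of regular
values is open and dense, and which over the regular values is a locally trivial fibration with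
Lagrangian fibres. The tangent space of a regular fibre at `x` is the kernel of `dπ` at `x`. -/
structure IsLagrangianFibration (Ω : SymplecticForm E M) (π : M → B) : Prop where
  smooth : ContMDiff 𝓘(ℝ, E) (baseModel n) ∞ π
  surjective : Function.Surjective π
  isOpen_regular : IsOpen (regularValues n E π)
  dense_regular : Dense (regularValues n E π)
  locally_trivial : ∀ b ∈ regularValues n E π,
    ∃ e : Bundle.Trivialization (π ⁻¹' {b}) π, b ∈ e.baseSet
  lagrangian : ∀ x : M, π x ∈ regularValues n E π →
    IsLagrangianSubspace Ω x
      (LinearMap.ker (mfderiv 𝓘(ℝ, E) (baseModel n) π x).toLinearMap)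

/-- The isotropy `Λ*_b ⊆ T*_b B` of the action of covectors on the fibre over `b`. A covector `α`
defines along the fibre the vector field `X_α` with `Ω(X_α, ·) = π^* α`; it belongs to the isotropy
when the time-one map of `X_α` is the identity of the fibre. -/
def isotropyCovectors (Ω : SymplecticForm E M) (π : M → B) (b : B) :
    Set (TangentSpace (baseModel n) b →L[ℝ] ℝ) :=
  {α | ∀ X : (∀ x : M, TangentSpace 𝓘(ℝ, E) x),
    (∀ x : M, π x = b → ∀ w : TangentSpace 𝓘(ℝ, E) x,
      Ω.form x ![X x, w] = α (mfderiv 𝓘(ℝ, E) (baseModel n) π x w)) →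
    ∀ γ : ℝ → M, IsMIntegralCurve (I := 𝓘(ℝ, E)) γ X → (∀ t, π (γ t) = b) → γ 1 = γ 0}

/-- `𝒜` is the integral affine structure on `B` induced by `π`: over each regular value, its lattice
is dual to the isotropy lattice of covectors. -/
def IsInducedAffineStructure [IsManifold (baseModel n) ∞ B] (Ω : SymplecticForm E M) (π : M → B)
    (A : IntegralAffineStructure n B) : Prop :=
  ∀ b ∈ regularValues n E π, ∀ v : TangentSpace (baseModel n) b,
    v ∈ A.lattice b ↔ ∀ α ∈ isotropyCovectors Ω π b, ∃ k : ℤ, α v = k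

/-- `π : (M, Ω) → (B, 𝒜)` is a toric fibration: a Lagrangian fibration inducing `𝒜`, for which there
are a Hamiltonian `n`-torus action and an integral affine immersion `Φ : (B, 𝒜) → (ℝⁿ, 𝒜₀)` such that
`Φ ∘ π` is the momentum map of the action. -/
structure IsToricFibration [IsManifold (baseModel n) ∞ B] (Ω : SymplecticForm E M) (π : M → B)
    (A : IntegralAffineStructure n B) : Prop where
  lagrangianFibration : IsLagrangianFibration (n := n) Ω π
  induced : IsInducedAffineStructure Ω π A
  exists_action : ∃ (_ : AddAction (StdTorus n) M) (Φ : B → EuclideanSpace ℝ (Fin n)),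
    IsIntegralAffineImmersion A Φ ∧ IsHamiltonianTorusAction Ω (Φ ∘ π)

/-- The `l`-stratum of the base: the points whose fibre is a torus of dimension `l`. -/
def baseStratum (E : Type*) [NormedAddCommGroup E] [NormedSpace ℝ E]
    {M : Type*} [TopologicalSpace M] [ChartedSpace E M] {B : Type*} (π : M → B) (l : ℕ) : Set B :=
  {b | IsEmbeddedTorus E l (π ⁻¹' {b})}

end Fibration

/-! ### Rectangles -/

/-- The rectangle `[0, r] × [0, s]` in `ℝ²`. -/
def rectangle (r s : ℝ) : Set (EuclideanSpace ℝ (Fin 2)) :=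
  {p | 0 ≤ p 0 ∧ p 0 ≤ r ∧ 0 ≤ p 1 ∧ p 1 ≤ s}

/-- The edge `{0} × [0, s]` of the rectangle `[0, r] × [0, s]`, mapped to `B` by `j`, lies on the
reduced boundary, where exactly one circle collapses along each horizontal segment: for every
`y ∈ [0, s]`, the fibres over `j (x, y)`, `0 < x < r`, are tori of one and the same dimension
`l + 1`, and the fibre over `j (0, y)` is a torus of dimension `l`. -/
def StartsOnReducedBoundary (E : Type*) [NormedAddCommGroup E] [NormedSpace ℝ E]
    {M : Type*} [TopologicalSpace M] [ChartedSpace E M] {B : Type*} (π : M → B)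
    (r s : ℝ) (j : EuclideanSpace ℝ (Fin 2) → B) : Prop :=
  ∀ y ∈ Icc 0 s, ∃ l : ℕ, j !₂[0, y] ∈ baseStratum E π l ∧
    ∀ x ∈ Ioo 0 r, j !₂[x, y] ∈ baseStratum E π (l + 1)

end

/-! ### Parametric integrals and Fourier coefficients -/

noncomputable section

section ParametricIntegral

set_option linter.unusedSectionVars false

variable {G : Type} [NormedAddCommGroup G] [NormedSpace ℝ G]

/-! Part (1) is part (2) with `a = h`. Let `Φ ∘ F` be the momentum map. The derivative of `Φ ∘ j`
carries ℤ² onto ℤ² at every point of the rectangle, so it is constant and `Φ ∘ j` is integral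
affine. After an automorphism of the torus and a shift of the momenta, the momentum over `j (x, y)`
is `(x, y)` (`exists_affine_of_fderivWithin`, `exists_toricModel`).

Choose `b` with `2h < b < R`. The central object is a complex function `z` near the preimage of `[0,
b] × [0, a]` on which the torus acts through its first character, with `π|z|²` equal to the first
momentum (`RectModel.exists_coordinate`). The real and imaginary parts of `z` then have a constant
Poisson bracket, and functions of `z` commute with the second momentum. Hence a Hamiltonian `-G(z)`,
cut off outside a compact set, moves `z` by the planar flow of `G` and keeps the second momentum. A
disc of area `h < b/2` can be moved off itself inside the disc of area `b`
(`exists_planar_hamiltonian`). The lifted trajectories stay over the large rectangle and end with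
first momentum greater than `h` (`RectModel.isDisplaceable`).

The planar Hamiltonian is close to a multiple of `arg z`, whose flow increases `|z|²` at a constant
rate. Near the slit it is replaced by a large multiple of `Im z`, which quickly translates points
out of the bad region. The disc thus ends up in an annulus.

To construct `z`, functions on `M` are decomposed into isotypical components by Fourier averaging.
Such equivariant functions separate tangent vectors, and every character trivial on the stabiliser
of a point occurs in a function not vanishing there. At a fixed point of a circle subgroup they give
charts in which the circle rotates one complex coordinate, and the momentum of the circle is the
squared norm of this coordinate times a non-vanishing function (`CircleChart.exists_mom`). It
follows that momentum levels locally lie in orbits, and fibres, being connected, are orbits. Since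
the affine structure is induced by `F`, points with stabiliser ℤ² are dense, which makes the
collapsing circles integral.

The dimensions of the fibres force the first circle to collapse along the left edge, so `z` exists
locally up to a positive factor in the norm. Two local choices differ by a smooth non-vanishing
factor; they are glued along segments cutting the rectangle (`RectModel.glued_merge`) and finally
normalised. -/

theorem exists_nhds_forall_Icc {G : Type} [TopologicalSpace G] {p : G → ℝ → Prop} {y₀ : G}
    (h : ∀ t ∈ Icc (0 : ℝ) 1, ∀ᶠ q in 𝓝 (y₀, t), p q.1 q.2) :
    ∀ᶠ y in 𝓝 y₀, ∀ t ∈ Icc (0 : ℝ) 1, p y t := by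
  refine (isCompact_Icc (a := (0 : ℝ)) (b := 1)).eventually_forall_of_forall_eventually ?_
  intro t ht
  exact h t ht

theorem intervalIntegrable_of_continuousAt_Icc {F : Type} [NormedAddCommGroup F]
    {f : ℝ → F} (h : ∀ t ∈ Icc (0 : ℝ) 1, ContinuousAt f t) :
    IntervalIntegrable f MeasureTheory.volume 0 1 := by
  apply ContinuousOn.intervalIntegrable
  rw [uIcc_of_le zero_le_one]
  exact fun t ht => (h t ht).continuousWithinAt

/-- Dominated convergence. By compactness of `[0, 1]` the oscillation `‖f (y, t) - f (y₀, t)‖` is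
below one for all `t` at once, so `‖f (y₀, ·)‖ + 1` dominates. -/
theorem continuousAt_intervalIntegral {F : Type} [NormedAddCommGroup F] [NormedSpace ℝ F]
    {f : G × ℝ → F} {y₀ : G} (h : ∀ t ∈ Icc (0 : ℝ) 1, ∀ᶠ q in 𝓝 (y₀, t), ContinuousAt f q) :
    ContinuousAt (fun y => ∫ t in (0 : ℝ)..1, f (y, t)) y₀ := by
  have h1 := exists_nhds_forall_Icc (p := fun y t => ContinuousAt f (y, t)) h
  have h2 : ∀ᶠ y in 𝓝 y₀, ∀ t ∈ Icc (0 : ℝ) 1, ‖f (y, t) - f (y₀, t)‖ < 1 := by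
    apply exists_nhds_forall_Icc
    intro t ht
    have hc : ContinuousAt (fun q : G × ℝ => f (q.1, q.2) - f (y₀, q.2)) (y₀, t) := by
      have := (h t ht).self_of_nhds
      refine ContinuousAt.sub this ?_
      exact ContinuousAt.comp (g := f) (f := fun q : G × ℝ => (y₀, q.2)) (x := (y₀, t)) this
        (by fun_prop)
    have := hc.norm.eventually (gt_mem_nhds (show ‖f (y₀, t) - f (y₀, t)‖ < 1 by simp))
    exact this
  have hs : ∀ y : G, (∀ t ∈ Icc (0 : ℝ) 1, ContinuousAt f (y, t)) →
      ∀ t ∈ Icc (0 : ℝ) 1, ContinuousAt (fun t => f (y, t)) t := fun y hy t ht =>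
    ContinuousAt.comp (g := f) (hy t ht) (by fun_prop)
  have hi := intervalIntegrable_of_continuousAt_Icc (hs y₀ h1.self_of_nhds)
  apply intervalIntegral.continuousAt_of_dominated_interval
    (bound := fun t => ‖f (y₀, t)‖ + 1)
  · filter_upwards [h1] with y hy
    exact (intervalIntegrable_iff.1
      (intervalIntegrable_of_continuousAt_Icc (hs y hy))).aestronglyMeasurable
  · filter_upwards [h2] with y hy
    refine Filter.Eventually.of_forall fun t ht => ?_
    rw [uIoc_of_le zero_le_one] at ht
    have := hy t ⟨ht.1.le, ht.2⟩
    have h3 := norm_le_norm_sub_add (f (y, t)) (f (y₀, t))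
    linarith
  · exact hi.norm.add intervalIntegrable_const
  · refine Filter.Eventually.of_forall fun t ht => ?_
    rw [uIoc_of_le zero_le_one] at ht
    exact ContinuousAt.comp (g := f) ((h t ⟨ht.1.le, ht.2⟩).self_of_nhds) (by fun_prop)

/-- Differentiation under the integral sign, with the partial derivative dominated in the same way
by its norm at `y₀` plus one. -/
theorem hasFDerivAt_intervalIntegral_param {F : Type} [NormedAddCommGroup F] [NormedSpace ℝ F]
    {f : G × ℝ → F} {y₀ : G} (h : ∀ t ∈ Icc (0 : ℝ) 1, ContDiffAt ℝ 1 f (y₀, t)) :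
    HasFDerivAt (fun y => ∫ t in (0 : ℝ)..1, f (y, t))
      (∫ t in (0 : ℝ)..1, (fderiv ℝ f (y₀, t)).comp (ContinuousLinearMap.inl ℝ G ℝ)) y₀ := by
  set f' : G × ℝ → G →L[ℝ] F := fun q => (fderiv ℝ f q).comp (ContinuousLinearMap.inl ℝ G ℝ)
  have h1 : ∀ᶠ y in 𝓝 y₀, ∀ t ∈ Icc (0 : ℝ) 1, ContDiffAt ℝ 1 f (y, t) :=
    exists_nhds_forall_Icc fun t ht => (h t ht).eventually (by simp)
  have hf' : ∀ q, ContDiffAt ℝ 1 f q → ContinuousAt f' q := fun q hq => by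
    have : ContinuousAt (fderiv ℝ f) q :=
      (hq.fderiv_right (m := 0) (by simp)).continuousAt
    exact this.clm_comp continuousAt_const
  have h2 : ∀ᶠ y in 𝓝 y₀, ∀ t ∈ Icc (0 : ℝ) 1, ‖f' (y, t) - f' (y₀, t)‖ < 1 := by
    apply exists_nhds_forall_Icc
    intro t ht
    have hc : ContinuousAt (fun q : G × ℝ => f' (q.1, q.2) - f' (y₀, q.2)) (y₀, t) := by
      have := hf' _ (h t ht)
      refine ContinuousAt.sub this ?_
      exact ContinuousAt.comp (g := f') (f := fun q : G × ℝ => (y₀, q.2)) (x := (y₀, t)) this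
        (by fun_prop)
    exact hc.norm.eventually (gt_mem_nhds (show ‖f' (y₀, t) - f' (y₀, t)‖ < 1 by simp))
  have hs : ∀ y : G, (∀ t ∈ Icc (0 : ℝ) 1, ContDiffAt ℝ 1 f (y, t)) →
      ∀ t ∈ Icc (0 : ℝ) 1, ContinuousAt (fun t => f (y, t)) t := fun y hy t ht =>
    ContinuousAt.comp (g := f) (hy t ht).continuousAt (by fun_prop)
  have hs' : ∀ t ∈ Icc (0 : ℝ) 1, ContinuousAt (fun t => f' (y₀, t)) t := fun t ht =>
    ContinuousAt.comp (g := f') (hf' _ (h t ht)) (by fun_prop)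
  have hi' := intervalIntegrable_of_continuousAt_Icc hs'
  refine intervalIntegral.hasFDerivAt_integral_of_dominated_of_fderiv_le
    (bound := fun t => ‖f' (y₀, t)‖ + 1) (h1.and h2) ?_ ?_ ?_ ?_ ?_ ?_
    (F := fun y t => f (y, t)) (F' := fun y t => f' (y, t))
  · filter_upwards [h1] with y hy
    exact (intervalIntegrable_iff.1
      (intervalIntegrable_of_continuousAt_Icc (hs y hy))).aestronglyMeasurable
  · exact intervalIntegrable_of_continuousAt_Icc (hs y₀ h)
  · exact (intervalIntegrable_iff.1 hi').aestronglyMeasurable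
  · refine Filter.Eventually.of_forall fun t ht y hy => ?_
    rw [uIoc_of_le zero_le_one] at ht
    have := hy.2 t ⟨ht.1.le, ht.2⟩
    have h3 := norm_le_norm_sub_add (f' (y, t)) (f' (y₀, t))
    linarith
  · exact hi'.norm.add intervalIntegrable_const
  · refine Filter.Eventually.of_forall fun t ht y hy => ?_
    rw [uIoc_of_le zero_le_one] at ht
    have h3 := ((hy.1 t ⟨ht.1.le, ht.2⟩).differentiableAt (by simp)).hasFDerivAt
    exact h3.comp (f := fun y => (y, t)) y (hasFDerivAt_prodMk_left y t)

/-- The induction runs over all target spaces simultaneously, because the derivative takes its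
values in `G →L[ℝ] F`. -/
theorem contDiffAt_intervalIntegral_nat (n : ℕ) : ∀ {F : Type} [NormedAddCommGroup F]
    [NormedSpace ℝ F] {f : G × ℝ → F} {y₀ : G},
    (∀ t ∈ Icc (0 : ℝ) 1, ContDiffAt ℝ n f (y₀, t)) →
    ContDiffAt ℝ n (fun y => ∫ t in (0 : ℝ)..1, f (y, t)) y₀ := by
  induction n with
  | zero =>
    intro F _ _ f y₀ h
    have h0 : ∀ t ∈ Icc (0 : ℝ) 1, ∀ᶠ q in 𝓝 (y₀, t), ContDiffAt ℝ 0 f q :=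
      fun t ht => (h t ht).eventually (by simp)
    have h1 := exists_nhds_forall_Icc (p := fun y t => ContDiffAt ℝ 0 f (y, t)) h0
    simp only [Nat.cast_zero] at *
    rw [← contDiffWithinAt_univ, contDiffWithinAt_zero (mem_univ _)]
    refine ⟨_, by rw [nhdsWithin_univ]; exact h1, ?_⟩
    intro y hy
    refine (continuousAt_intervalIntegral fun t ht => ?_).continuousWithinAt
    have hy' : ContDiffAt ℝ 0 f (y, t) := hy.2 t ht
    filter_upwards [hy'.eventually (by simp)] with q hq using hq.continuousAt
  | succ n ih =>
    intro F _ _ f y₀ h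
    rw [Nat.cast_succ, contDiffAt_succ_iff_hasFDerivAt]
    refine ⟨fun y => ∫ t in (0 : ℝ)..1, (fderiv ℝ f (y, t)).comp (ContinuousLinearMap.inl ℝ G ℝ),
      ⟨_, exists_nhds_forall_Icc (p := fun y t => ContDiffAt ℝ 1 f (y, t)) fun t ht => ?_,
      fun y hy => hasFDerivAt_intervalIntegral_param hy⟩, ?_⟩
    · exact ((h t ht).of_le (by exact_mod_cast Nat.le_add_left 1 n)).eventually (by simp)
    · refine ih (f := fun q => (fderiv ℝ f q).comp (ContinuousLinearMap.inl ℝ G ℝ)) fun t ht => ?_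
      exact ((h t ht).fderiv_right (m := n) (by simp)).clm_comp contDiffAt_const

/-- A parametric integral of a smooth function is smooth. -/
theorem contDiffAt_intervalIntegral {F : Type} [NormedAddCommGroup F]
    [NormedSpace ℝ F] {f : G × ℝ → F} {y₀ : G}
    (h : ∀ t ∈ Icc (0 : ℝ) 1, ContDiffAt ℝ ∞ f (y₀, t)) :
    ContDiffAt ℝ ∞ (fun y => ∫ t in (0 : ℝ)..1, f (y, t)) y₀ :=
  contDiffAt_infty.2 fun n => contDiffAt_intervalIntegral_nat n fun t ht =>
    contDiffAt_infty.1 (h t ht) n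

end ParametricIntegral

/-! ### Characters of the circle. -/

section Characters

/-- The character `t ↦ exp (2πit)` of `ℝ/ℤ`. -/
def expi (t : ℝ) : ℂ := Complex.exp (2 * Real.pi * Complex.I * t)

theorem expi_add (s t : ℝ) : expi (s + t) = expi s * expi t := by
  rw [expi, expi, expi, ← Complex.exp_add]; push_cast; ring_nf

@[simp] theorem expi_zero : expi 0 = 1 := by simp [expi]

theorem expi_ne_zero (t : ℝ) : expi t ≠ 0 := Complex.exp_ne_zero _

theorem expi_neg (t : ℝ) : expi (-t) = (expi t)⁻¹ := by
  rw [expi, expi, ← Complex.exp_neg]; push_cast; ring_nf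

@[simp] theorem expi_int (n : ℤ) : expi n = 1 := by
  rw [expi, Complex.exp_eq_one_iff]; exact ⟨n, by push_cast; ring⟩

@[simp] theorem norm_expi (t : ℝ) : ‖expi t‖ = 1 := by
  rw [expi, show (2 * Real.pi * Complex.I * t : ℂ) = ((2 * Real.pi * t : ℝ) : ℂ) * Complex.I by
    push_cast; ring, Complex.norm_exp_ofReal_mul_I]

theorem conj_expi (t : ℝ) : (starRingEnd ℂ) (expi t) = expi (-t) := by
  rw [expi_neg, Complex.inv_def, Complex.normSq_eq_norm_sq]; simp

theorem contDiff_expi : ContDiff ℝ ∞ expi := by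
  unfold expi
  exact (contDiff_const.mul Complex.ofRealCLM.contDiff).cexp

theorem continuous_expi : Continuous expi := contDiff_expi.continuous

theorem hasDerivAt_expi (t : ℝ) : HasDerivAt expi (2 * Real.pi * Complex.I * expi t) t := by
  have h1 : HasDerivAt (fun t : ℝ => (2 * Real.pi * Complex.I * t : ℂ))
      (2 * Real.pi * Complex.I * 1) t := (Complex.ofRealCLM.hasDerivAt (x := t)).const_mul _
  have := h1.cexp
  rw [mul_one, mul_comm (Complex.exp _)] at this
  exact this

theorem expi_one_half : expi (1 / 2) = -1 := by
  rw [expi, show (2 * Real.pi * Complex.I * ((1 / 2 : ℝ) : ℂ)) = Real.pi * Complex.I by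
    push_cast; ring, Complex.exp_pi_mul_I]

theorem expi_one_quarter : expi (1 / 4) = Complex.I := by
  rw [expi, show (2 * Real.pi * Complex.I * ((1 / 4 : ℝ) : ℂ)) = Real.pi / 2 * Complex.I by
    push_cast; ring, Complex.exp_pi_div_two_mul_I]

end Characters

/-! ### Uniqueness of Fourier coefficients. -/

section Fourier

/-- A continuous function on the circle all of whose Fourier coefficients vanish is zero. -/
theorem eq_zero_of_fourier_eq_zero {f : ℝ → ℂ} (hf : Continuous f) (hp : ∀ t, f (t + 1) = f t)
    (h : ∀ n : ℤ, ∫ t in (0 : ℝ)..1, expi (-(n * t)) * f t = 0) (t : ℝ) : f t = 0 := by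
  have hper : Function.Periodic f 1 := hp
  set F : AddCircle (1 : ℝ) → ℂ := hper.lift
  have hF : ∀ t : ℝ, F t = f t := fun t => Function.Periodic.lift_coe hper t
  have hFc : Continuous F := continuous_quot_lift _ hf
  have hcoef : ∀ n, fourierCoeff F n = 0 := by
    intro n
    rw [fourierCoeff_eq_intervalIntegral F n 0]
    simp only [zero_add, div_one, one_smul]
    rw [← h n]
    apply intervalIntegral.integral_congr
    intro t _
    simp only [hF, smul_eq_mul, fourier_coe_apply, expi]
    congr 2
    push_cast; ring
  -- Vanishing coefficients are summable, so the Fourier series converges to the function at every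
  -- point.
  have := has_pointwise_sum_fourier_series_of_summable (f := ⟨F, hFc⟩) (T := 1)
    ((summable_zero (α := ℂ) (β := ℤ)).congr fun n => (hcoef n).symm) (t : AddCircle (1 : ℝ))
  have h0 : (⟨F, hFc⟩ : C(AddCircle (1 : ℝ), ℂ)) (t : AddCircle (1 : ℝ)) = 0 := by
    refine this.unique ?_
    have : ∀ i, fourierCoeff (⟨F, hFc⟩ : C(AddCircle (1 : ℝ), ℂ)) i = 0 := hcoef
    simp only [this, zero_smul]
    exact hasSum_zero
  rw [← hF t]; exact h0

/-- A continuous function on the two-torus all of whose Fourier coefficients vanish is zero. -/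
theorem eq_zero_of_fourier_eq_zero₂ {f : ℝ × ℝ → ℂ} (hf : Continuous f)
    (hp : ∀ (m n : ℤ) (p : ℝ × ℝ), f (p + ((m : ℝ), (n : ℝ))) = f p)
    (h : ∀ m n : ℤ, ∫ t in (0 : ℝ)..1, ∫ s in (0 : ℝ)..1, expi (-(m * s + n * t)) * f (s, t) = 0)
    (p : ℝ × ℝ) : f p = 0 := by
  -- For fixed `m`, the partial coefficient in `s` is a continuous periodic function of `t` all of
  -- whose Fourier coefficients vanish.
  have key : ∀ (m : ℤ) (t : ℝ), ∫ s in (0 : ℝ)..1, expi (-(m * s)) * f (s, t) = 0 := by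
    intro m
    apply eq_zero_of_fourier_eq_zero
    · refine continuous_iff_continuousAt.2 fun t => ?_
      refine continuousAt_intervalIntegral (G := ℝ)
        (f := fun q : ℝ × ℝ => expi (-(m * q.2)) * f (q.2, q.1)) fun s _ => ?_
      refine Filter.Eventually.of_forall fun q => Continuous.continuousAt ?_
      have := continuous_expi
      fun_prop
    · intro t
      simp_rw [fun s => show f (s, t + 1) = f (s, t) by simpa using hp 0 1 (s, t)]
    · intro n
      rw [← h m n]
      apply intervalIntegral.integral_congr
      intro t _
      simp only
      rw [← intervalIntegral.integral_const_mul]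
      apply intervalIntegral.integral_congr
      intro s _
      simp only
      rw [show -(m * s + n * t : ℝ) = -(n * t) + -(m * s) by ring, expi_add]
      ring
  refine eq_zero_of_fourier_eq_zero (f := fun s => f (s, p.2)) (by fun_prop) (fun t => ?_)
    (fun m => key m p.2) p.1
  simpa using hp 1 0 (t, p.2)

end Fourier

end

/-! ### Derivatives of functions on manifolds -/

noncomputable section

section Toolkit

set_option linter.unusedSectionVars false

variable {E : Type} [NormedAddCommGroup E] [NormedSpace ℝ E]
variable {M : Type*} [TopologicalSpace M] [ChartedSpace E M] [IsManifold 𝓘(ℝ, E) ∞ M]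
variable {V : Type} [NormedAddCommGroup V] [NormedSpace ℝ V]

/-- Smoothness of a map from a manifold to a normed space. -/
abbrev SmoothAt (f : M → V) (x : M) : Prop := ContMDiffAt 𝓘(ℝ, E) 𝓘(ℝ, V) ∞ f x

variable (E) in
/-- The preferred extended chart at `p`. -/
abbrev ch (p : M) : PartialEquiv M E := extChartAt 𝓘(ℝ, E) p

/-- The derivative at `x` of a vector-valued function on a manifold, read in the preferred chart
at `x`. -/
def dM (f : M → V) (x : M) : E →L[ℝ] V := fderiv ℝ (f ∘ (ch E x).symm) (ch E x x)

theorem mem_ch_source (p : M) : p ∈ (ch E p).source := mem_extChartAt_source p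

theorem ch_left_inv {p x : M} (hx : x ∈ (ch E p).source) : (ch E p).symm (ch E p x) = x :=
  (ch E p).left_inv hx

theorem ch_left_inv_self (p : M) : (ch E p).symm (ch E p p) = p := ch_left_inv (mem_ch_source p)

theorem ch_source_mem_nhds {p x : M} (hx : x ∈ (ch E p).source) : (ch E p).source ∈ 𝓝 x :=
  extChartAt_source_mem_nhds' hx

theorem contMDiffAt_ch {p x : M} (hx : x ∈ (ch E p).source) :
    SmoothAt (E := E) (V := E) (ch E p) x :=
  contMDiffAt_extChartAt' (by rwa [← extChartAt_source 𝓘(ℝ, E)])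

theorem contMDiffAt_ch_symm (p : M) {y : E} (hy : y ∈ (ch E p).target) :
    ContMDiffAt 𝓘(ℝ, E) 𝓘(ℝ, E) ∞ (ch E p).symm y :=
  (contMDiffOn_extChartAt_symm (I := 𝓘(ℝ, E)) p).contMDiffAt
    ((isOpen_extChartAt_target p).mem_nhds hy)

theorem eventually_mem_target {p : M} {y : E} (hy : y ∈ (ch E p).target) :
    ∀ᶠ y in 𝓝 y, y ∈ (ch E p).target :=
  (isOpen_extChartAt_target p).mem_nhds hy

theorem ch_eventually_left_inv {p x : M} (hx : x ∈ (ch E p).source) :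
    ∀ᶠ x in 𝓝 x, (ch E p).symm (ch E p x) = x := by
  filter_upwards [ch_source_mem_nhds hx] with x hx using ch_left_inv hx

theorem ch_continuousAt {p x : M} (hx : x ∈ (ch E p).source) : ContinuousAt (ch E p) x :=
  (contMDiffAt_ch hx).continuousAt

theorem smoothAt_comp_ch_symm {f : M → V} {p : M} {y : E} (hy : y ∈ (ch E p).target)
    (hf : SmoothAt (E := E) f ((ch E p).symm y)) :
    ContDiffAt ℝ ∞ (f ∘ (ch E p).symm) y :=
  (ContMDiffAt.comp y hf (contMDiffAt_ch_symm p hy)).contDiffAt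

theorem smoothAt_comp_ch_symm' {f : M → V} {p x : M} (hx : x ∈ (ch E p).source)
    (hf : SmoothAt (E := E) f x) :
    ContDiffAt ℝ ∞ (f ∘ (ch E p).symm) (ch E p x) :=
  smoothAt_comp_ch_symm ((ch E p).map_source hx) (by rwa [ch_left_inv hx])

theorem smoothAt_of_comp_ch_symm {f : M → V} {p x : M} (hx : x ∈ (ch E p).source)
    (hf : ContDiffAt ℝ ∞ (f ∘ (ch E p).symm) (ch E p x)) :
    SmoothAt (E := E) f x := by
  have h2 := hf.contMDiffAt.comp x (contMDiffAt_ch hx)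
  refine h2.congr_of_eventuallyEq ?_
  filter_upwards [ch_eventually_left_inv hx] with x hx
  simp only [Function.comp_apply, hx]

theorem SmoothAt.hasFDerivAt {f : M → V} {x : M} (hf : SmoothAt (E := E) f x) :
    HasFDerivAt (f ∘ (ch E x).symm) (dM f x) (ch E x x) :=
  ((smoothAt_comp_ch_symm' (mem_ch_source x) hf).differentiableAt (by simp)).hasFDerivAt

/-- The transition derivative relating the chart at `p` and the chart at `x`. -/
def chTrans (p x : M) : E →L[ℝ] E := fderiv ℝ (ch E x ∘ (ch E p).symm) (ch E p x)

/-- `dM f x` is read in the chart at `x`, which may jump with `x`. The transition derivative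
converts it to the derivative in one fixed chart, where smooth dependence on the point makes sense.
-/
theorem dM_chTrans {f : M → V} {p x : M} (hx : x ∈ (ch E p).source)
    (hf : SmoothAt (E := E) f x) :
    (dM f x).comp (chTrans p x) = fderiv ℝ (f ∘ (ch E p).symm) (ch E p x) := by
  have h1 : HasFDerivAt (ch E x ∘ (ch E p).symm) (chTrans p x) (ch E p x) :=
    ((smoothAt_comp_ch_symm' hx (contMDiffAt_ch (mem_ch_source x))).differentiableAt
      (by simp)).hasFDerivAt
  have h2 := hf.hasFDerivAt
  have h3 : (ch E x ∘ (ch E p).symm) (ch E p x) = ch E x x := by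
    simp only [Function.comp_apply, ch_left_inv hx]
  rw [← h3] at h2
  have h4 := (h2.comp _ h1).fderiv
  rw [← h4]
  refine Filter.EventuallyEq.fderiv_eq ?_
  have hc : ContinuousAt (ch E p).symm (ch E p x) :=
    (contMDiffAt_ch_symm p ((ch E p).map_source hx)).continuousAt
  have hev := hc.eventually (p := fun x' => (ch E x).symm (ch E x x') = x')
    (by rw [ch_left_inv hx]; exact ch_eventually_left_inv (mem_ch_source x))
  filter_upwards [hev] with y hy
  simp only [Function.comp_apply, hy]

theorem dM_ch_self (x : M) : dM (ch E x) x = ContinuousLinearMap.id ℝ E := by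
  rw [dM, ← fderiv_id (x := ch E x x)]
  refine Filter.EventuallyEq.fderiv_eq ?_
  filter_upwards [eventually_mem_target ((ch E x).map_source (mem_ch_source x))] with y hy
  simp only [Function.comp_apply, (ch E x).right_inv hy, id]

theorem chTrans_bijective {p x : M} (hx : x ∈ (ch E p).source) :
    Function.Bijective (chTrans p x : E → E) := by
  have h1 : (dM (ch E p) x).comp (chTrans p x) = ContinuousLinearMap.id ℝ E := by
    rw [dM_chTrans hx (contMDiffAt_ch hx), ← fderiv_id (x := ch E p x)]
    refine Filter.EventuallyEq.fderiv_eq ?_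
    filter_upwards [eventually_mem_target ((ch E p).map_source hx)] with y hy
    simp only [Function.comp_apply, (ch E p).right_inv hy, id]
  have h2 : (chTrans p x).comp (dM (ch E p) x) = ContinuousLinearMap.id ℝ E := by
    rw [← dM_ch_self x]
    have h3 : HasFDerivAt (ch E x ∘ (ch E p).symm) (chTrans p x) (ch E p x) :=
      ((smoothAt_comp_ch_symm' hx (contMDiffAt_ch (mem_ch_source x))).differentiableAt
        (by simp)).hasFDerivAt
    have h4 := (contMDiffAt_ch hx).hasFDerivAt
    have h5 : (ch E p ∘ (ch E x).symm) (ch E x x) = ch E p x := by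
      simp only [Function.comp_apply, ch_left_inv_self]
    rw [← h5] at h3
    rw [← (h3.comp _ h4).fderiv, dM]
    refine Filter.EventuallyEq.fderiv_eq ?_
    have hc : ContinuousAt (ch E x).symm (ch E x x) :=
      (contMDiffAt_ch_symm x ((ch E x).map_source (mem_ch_source x))).continuousAt
    have hev := hc.eventually (p := fun x' => (ch E p).symm (ch E p x') = x')
      (by rw [ch_left_inv_self]; exact ch_eventually_left_inv hx)
    filter_upwards [hev] with y hy
    simp only [Function.comp_apply, hy]
  constructor
  · intro a b hab
    have := congrArg (dM (ch E p) x) hab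
    rwa [← ContinuousLinearMap.comp_apply, ← ContinuousLinearMap.comp_apply, h1] at this
  · intro b
    exact ⟨dM (ch E p) x b, by rw [← ContinuousLinearMap.comp_apply, h2]; rfl⟩

theorem dM_congr {f g : M → V} {x : M} (h : f =ᶠ[𝓝 x] g) : dM f x = dM (E := E) g x := by
  refine Filter.EventuallyEq.fderiv_eq ?_
  have hc : ContinuousAt (ch E x).symm (ch E x x) :=
    (contMDiffAt_ch_symm x ((ch E x).map_source (mem_ch_source x))).continuousAt
  exact hc.eventually (p := fun x' => f x' = g x') (by rw [ch_left_inv_self]; exact h)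

theorem dM_comp {W : Type} [NormedAddCommGroup W] [NormedSpace ℝ W] {f : M → V} {g : V → W} {x : M}
    (hf : SmoothAt (E := E) f x) {g' : V →L[ℝ] W} (hg : HasFDerivAt g g' (f x)) :
    dM (g ∘ f) x = g'.comp (dM (E := E) f x) := by
  have h1 := hf.hasFDerivAt
  have h5 : (f ∘ (ch E x).symm) (ch E x x) = f x := by
    simp only [Function.comp_apply, ch_left_inv_self]
  rw [← h5] at hg
  exact (hg.comp _ h1).fderiv

theorem dM_const (c : V) (x : M) : dM (fun _ => c) x = (0 : E →L[ℝ] V) := by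
  rw [dM]; exact fderiv_const_apply c

theorem dM_prodMk {W : Type} [NormedAddCommGroup W] [NormedSpace ℝ W] {f : M → V} {g : M → W} {x : M}
    (hf : SmoothAt (E := E) f x) (hg : SmoothAt (E := E) g x) :
    dM (fun x => (f x, g x)) x = (dM (E := E) f x).prod (dM g x) :=
  (hf.hasFDerivAt.prodMk hg.hasFDerivAt).fderiv

theorem dM_mul {f g : M → ℂ} {x : M}
    (hf : SmoothAt (E := E) f x) (hg : SmoothAt (E := E) g x) (v : E) :
    dM (fun x => f x * g x) x v = f x * dM g x v + g x * dM f x v := by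
  have := (hf.hasFDerivAt.mul hg.hasFDerivAt).fderiv
  rw [show dM (fun x => f x * g x) x = _ from this]
  simp only [Function.comp_apply, ch_left_inv_self]
  simp

/-- A smooth map with injective derivative at `p` is injective near `p`. -/
theorem exists_injOn_of_injective [FiniteDimensional ℝ E] [FiniteDimensional ℝ V]
    {ψ : M → V} {p : M} (hψ : SmoothAt (E := E) ψ p) (hinj : Function.Injective (dM ψ p : E → V)) :
    ∃ W ∈ 𝓝 p, InjOn ψ W := by
  have : CompleteSpace E := FiniteDimensional.complete ℝ E
  have h1 := smoothAt_comp_ch_symm' (mem_ch_source p) hψ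
  -- After composition with a left inverse of the derivative the inverse function theorem applies,
  -- and injectivity of the composite suffices.
  obtain ⟨L, hL⟩ := ContinuousLinearMap.HasLeftInverse.of_injective_of_finiteDimensional hinj
  have h2 : HasStrictFDerivAt (L ∘ (ψ ∘ (ch E p).symm))
      ((ContinuousLinearEquiv.refl ℝ E : E ≃L[ℝ] E) : E →L[ℝ] E) (ch E p p) := by
    have h3 : HasStrictFDerivAt (L ∘ (ψ ∘ (ch E p).symm)) (L.comp (dM ψ p)) (ch E p p) :=
      L.hasStrictFDerivAt.comp (ch E p p) (h1.hasStrictFDerivAt (by simp))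
    have h4 : L.comp (dM ψ p) = ((ContinuousLinearEquiv.refl ℝ E : E ≃L[ℝ] E) : E →L[ℝ] E) := by
      ext v
      exact hL v
    rwa [h4] at h3
  set e := h2.toOpenPartialHomeomorph
  have he : ∀ y, e y = L (ψ ((ch E p).symm y)) := fun y => rfl
  refine ⟨(ch E p).source ∩ (ch E p) ⁻¹' e.source, inter_mem (ch_source_mem_nhds (mem_ch_source p))
    ((ch_continuousAt (mem_ch_source p)).preimage_mem_nhds
      (e.open_source.mem_nhds h2.mem_toOpenPartialHomeomorph_source)), ?_⟩
  intro x hx y hy hxy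
  have h4 : ch E p x = ch E p y := by
    refine e.injOn hx.2 hy.2 ?_
    rw [he, he, ch_left_inv hx.1, ch_left_inv hy.1, hxy]
  rw [← ch_left_inv hx.1, h4, ch_left_inv hy.1]

/-- The inverse function theorem for vector-valued maps on a manifold. -/
theorem exists_local_inverse [FiniteDimensional ℝ E] [FiniteDimensional ℝ V]
    {ψ : M → V} {p : M} (hψ : ContMDiff 𝓘(ℝ, E) 𝓘(ℝ, V) ∞ ψ)
    (hbij : Function.Bijective (dM ψ p : E → V)) :
    ∃ G : V → M, G (ψ p) = p ∧ (∀ᶠ y in 𝓝 (ψ p), ψ (G y) = y) ∧ (∀ᶠ x in 𝓝 p, G (ψ x) = x) ∧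
      ∀ᶠ y in 𝓝 (ψ p), ContMDiffAt 𝓘(ℝ, V) 𝓘(ℝ, E) ∞ G y := by
  have : CompleteSpace E := FiniteDimensional.complete ℝ E
  have hp := mem_ch_source (E := E) p
  have hs : ∀ y ∈ (ch E p).target, ContDiffAt ℝ ∞ (ψ ∘ (ch E p).symm) y := fun y hy =>
    smoothAt_comp_ch_symm hy (hψ _)
  have hpt := (ch E p).map_source hp
  set f := ψ ∘ (ch E p).symm with hf
  set A : E ≃L[ℝ] V := (LinearEquiv.ofBijective (dM (E := E) ψ p).toLinearMap hbij).toContinuousLinearEquiv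
  have hA : (A : E →L[ℝ] V) = dM ψ p := by ext v; rfl
  have h2 : HasStrictFDerivAt f (A : E →L[ℝ] V) (ch E p p) := by
    rw [hA]; exact (hs _ hpt).hasStrictFDerivAt (by simp)
  set e := h2.toOpenPartialHomeomorph
  have he : ∀ y, e y = f y := fun y => rfl
  have hfp : f (ch E p p) = ψ p := by rw [hf, Function.comp_apply, ch_left_inv_self]
  have hes : ch E p p ∈ e.source := h2.mem_toOpenPartialHomeomorph_source
  have het : ψ p ∈ e.target := by
    have := e.map_source hes
    rwa [he, hfp] at this
  have hesp : e.symm (ψ p) = ch E p p := by rw [← hfp, ← he, e.left_inv hes]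
  have hc : ContinuousAt e.symm (ψ p) := e.continuousAt_symm het
  refine ⟨(ch E p).symm ∘ e.symm, ?_, ?_, ?_, ?_⟩
  · rw [Function.comp_apply, hesp, ch_left_inv_self]
  · filter_upwards [e.open_target.mem_nhds het] with y hy
    have := e.right_inv hy
    rwa [he] at this
  · filter_upwards [ch_source_mem_nhds hp, (ch_continuousAt hp).preimage_mem_nhds
      (e.open_source.mem_nhds hes)] with x hx hx'
    rw [Function.comp_apply]
    have h3 : e (ch E p x) = ψ x := by rw [he, hf, Function.comp_apply, ch_left_inv hx]
    rw [← h3, e.left_inv hx', ch_left_inv hx]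
  -- Smoothness of the inverse at nearby points requires invertible derivatives there; invertibility
  -- is an open condition.
  · have h4 : ∀ᶠ y in 𝓝 (ch E p p), y ∈ (ch E p).target ∧
        ∃ A' : E ≃L[ℝ] V, HasFDerivAt f (A' : E →L[ℝ] V) y := by
      have h5 : ContinuousAt (fderiv ℝ f) (ch E p p) :=
        ((hs _ hpt).fderiv_right (m := 0) (by simp)).continuousAt
      have h6 : fderiv ℝ f (ch E p p) = A := h2.hasFDerivAt.fderiv
      have h7 : range ((↑) : (E ≃L[ℝ] V) → E →L[ℝ] V) ∈ 𝓝 (fderiv ℝ f (ch E p p)) := by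
        rw [h6]; exact A.nhds
      filter_upwards [h5.eventually h7, eventually_mem_target hpt] with y hy hy'
      obtain ⟨A', hA'⟩ := hy
      exact ⟨hy', A', by rw [hA']; exact ((hs y hy').differentiableAt (by simp)).hasFDerivAt⟩
    have h8 := hc.eventually (by rw [hesp]; exact h4)
    filter_upwards [h8, e.open_target.mem_nhds het] with y hy hy'
    obtain ⟨hy1, A', hA'⟩ := hy
    exact (contMDiffAt_ch_symm p hy1).comp y
      (e.contDiffAt_symm hy' hA' (hs _ hy1)).contMDiffAt

end Toolkit

end

/-! ### Derivatives of maps and symplectic linear algebra -/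

noncomputable section

section MapDerivative

set_option linter.unusedSectionVars false

variable {E : Type} [NormedAddCommGroup E] [NormedSpace ℝ E]
variable {M : Type*} [TopologicalSpace M] [ChartedSpace E M] [IsManifold 𝓘(ℝ, E) ∞ M]
variable {E' : Type} [NormedAddCommGroup E'] [NormedSpace ℝ E']
variable {N : Type*} [TopologicalSpace N] [ChartedSpace E' N] [IsManifold 𝓘(ℝ, E') ∞ N]
variable {V : Type} [NormedAddCommGroup V] [NormedSpace ℝ V]

/-- The derivative of a map between manifolds, read in the preferred charts. -/
def dMap (g : N → M) (x : N) : E' →L[ℝ] E := dM (ch E (g x) ∘ g) x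

theorem dM_comp_map {f : M → V} {g : N → M} {x : N} (hf : SmoothAt (E := E) f (g x))
    (hg : ContMDiffAt 𝓘(ℝ, E') 𝓘(ℝ, E) ∞ g x) :
    dM (f ∘ g) x = (dM (E := E) f (g x)).comp (dMap (E := E) (E' := E') g x) := by
  have h1 : f ∘ g =ᶠ[𝓝 x] (f ∘ (ch E (g x)).symm) ∘ (ch E (g x) ∘ g) := by
    filter_upwards [hg.continuousAt.eventually
      (ch_eventually_left_inv (mem_ch_source (E := E) (g x)))] with y hy
    simp only [Function.comp_apply, hy]
  rw [dM_congr h1]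
  exact dM_comp (ContMDiffAt.comp x (contMDiffAt_ch (mem_ch_source (g x))) hg) hf.hasFDerivAt

theorem dMap_comp {E'' : Type} [NormedAddCommGroup E''] [NormedSpace ℝ E'']
    {N' : Type*} [TopologicalSpace N'] [ChartedSpace E'' N'] [IsManifold 𝓘(ℝ, E'') ∞ N']
    {g : N → M} {h : N' → N} {x : N'}
    (hg : ContMDiffAt 𝓘(ℝ, E') 𝓘(ℝ, E) ∞ g (h x))
    (hh : ContMDiffAt 𝓘(ℝ, E'') 𝓘(ℝ, E') ∞ h x) :
    dMap (E := E) (E' := E'') (g ∘ h) x =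
      (dMap (E := E) (E' := E') g (h x)).comp (dMap (E := E') (E' := E'') h x) := by
  rw [dMap, dMap, Function.comp_apply]
  exact dM_comp_map (f := ch E (g (h x)) ∘ g)
    (ContMDiffAt.comp _ (contMDiffAt_ch (mem_ch_source (g (h x)))) hg) hh

theorem dM_model (f : E → V) (y : E) : dM (E := E) f y = fderiv ℝ f y := by
  simp only [dM, ch, extChartAt_model_space_eq_id]
  rfl

/-- A smooth map from a normed space to a manifold with vanishing derivative is constant. -/
theorem eq_of_dMap_eq_zero {c : V → M} (hc : ContMDiff 𝓘(ℝ, V) 𝓘(ℝ, E) ∞ c)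
    (h : ∀ y, dMap (E := E) (E' := V) c y = 0) (a b : V) : c a = c b := by
  have hl : IsLocallyConstant c := by
    rw [IsLocallyConstant.iff_eventually_eq]
    intro y
    have h1 : ∀ᶠ y' in 𝓝 y, c y' ∈ (ch E (c y)).source :=
      hc.continuous.continuousAt.eventually (ch_source_mem_nhds (mem_ch_source (c y)))
    obtain ⟨r, hr, hball⟩ := Metric.eventually_nhds_iff_ball.1 h1
    have hd : ∀ y' ∈ Metric.ball y r, HasFDerivAt (ch E (c y) ∘ c) (0 : V →L[ℝ] E) y' := by
      intro y' hy'
      have hs : SmoothAt (E := E) (ch E (c y)) (c y') := contMDiffAt_ch (hball y' hy')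
      have h2 := dM_comp_map (x := y') hs (hc y')
      rw [h y', ContinuousLinearMap.comp_zero, dM_model] at h2
      rw [← h2]
      exact ((ContMDiffAt.comp y' hs (hc y')).contDiffAt.differentiableAt (by simp)).hasFDerivAt
    filter_upwards [Metric.ball_mem_nhds y hr] with y' hy'
    have h3 : (ch E (c y) ∘ c) y' = (ch E (c y) ∘ c) y := by
      refine (convex_ball y r).is_const_of_fderivWithin_eq_zero (𝕜 := ℝ)
        (fun z hz => (hd z hz).differentiableAt.differentiableWithinAt) (fun z hz => ?_) hy'
        (Metric.mem_ball_self hr)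
      rw [fderivWithin_of_isOpen Metric.isOpen_ball hz]
      exact (hd z hz).fderiv
    rw [← ch_left_inv (hball y' hy')]
    rw [Function.comp_apply, Function.comp_apply] at h3
    rw [h3, ch_left_inv_self]
  exact hl.apply_eq_of_preconnectedSpace a b

end MapDerivative

/-! ### Linear algebra of the symplectic form. -/

section Form

variable {E : Type} [NormedAddCommGroup E] [NormedSpace ℝ E]
variable {M : Type*} [TopologicalSpace M] [ChartedSpace E M]

/-- The value of a symplectic form on two vectors of the model space. -/
def SymplecticForm.om (Ω : SymplecticForm E M) (x : M) (v w : E) : ℝ :=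
  (show E [⋀^Fin 2]→L[ℝ] ℝ from Ω.form x) ![v, w]

variable (Ω : SymplecticForm E M) (x : M)

theorem SymplecticForm.om_add_left (a b c : E) : Ω.om x (a + b) c = Ω.om x a c + Ω.om x b c :=
  (show E [⋀^Fin 2]→L[ℝ] ℝ from Ω.form x).toMultilinearMap.cons_add ![c] a b

theorem SymplecticForm.om_smul_left (r : ℝ) (a c : E) : Ω.om x (r • a) c = r * Ω.om x a c :=
  (show E [⋀^Fin 2]→L[ℝ] ℝ from Ω.form x).toMultilinearMap.cons_smul ![c] r a

theorem SymplecticForm.om_self (a : E) : Ω.om x a a = 0 :=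
  (show E [⋀^Fin 2]→L[ℝ] ℝ from Ω.form x).map_eq_zero_of_eq ![a, a] (i := 0) (j := 1) rfl
    (by decide)

theorem SymplecticForm.om_swap (a b : E) : Ω.om x a b = -Ω.om x b a := by
  have := (show E [⋀^Fin 2]→L[ℝ] ℝ from Ω.form x).toAlternatingMap.map_swap ![b, a]
    (i := 0) (j := 1) (by decide)
  have h2 : (![b, a] ∘ Equiv.swap (0 : Fin 2) 1) = ![a, b] := by
    ext i; fin_cases i <;> simp
  rw [h2] at this
  exact this

theorem SymplecticForm.om_nondeg {v : E} (h : ∀ w, Ω.om x v w = 0) : v = 0 :=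
  Ω.nondegenerate x v h

theorem SymplecticForm.om_add_right (a b c : E) : Ω.om x c (a + b) = Ω.om x c a + Ω.om x c b := by
  rw [Ω.om_swap, Ω.om_add_left, Ω.om_swap x a, Ω.om_swap x b]; ring

theorem SymplecticForm.om_smul_right (r : ℝ) (a c : E) : Ω.om x c (r • a) = r * Ω.om x c a := by
  rw [Ω.om_swap, Ω.om_smul_left, Ω.om_swap x a]; ring

/-- The linear isomorphism-to-be `v ↦ Ω(v, ·)`. -/
def SymplecticForm.flat [FiniteDimensional ℝ E] (Ω : SymplecticForm E M) (x : M) :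
    E →ₗ[ℝ] (E →L[ℝ] ℝ) where
  toFun v := LinearMap.toContinuousLinearMap
    { toFun := fun w => Ω.om x v w
      map_add' := fun a b => Ω.om_add_right x a b v
      map_smul' := fun r a => Ω.om_smul_right x r a v }
  map_add' a b := by ext w; exact Ω.om_add_left x a b w
  map_smul' r a := by ext w; exact Ω.om_smul_left x r a w

@[simp] theorem SymplecticForm.flat_apply [FiniteDimensional ℝ E] (v w : E) :
    Ω.flat x v w = Ω.om x v w := rfl

theorem SymplecticForm.flat_bijective [FiniteDimensional ℝ E] :
    Function.Bijective (Ω.flat x) := by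
  have hinj : Function.Injective (Ω.flat x) := by
    rw [injective_iff_map_eq_zero]
    intro v hv
    exact Ω.om_nondeg x fun w => by rw [← Ω.flat_apply, hv]; rfl
  refine ⟨hinj, ?_⟩
  refine (LinearMap.injective_iff_surjective_of_finrank_eq_finrank ?_).1 hinj
  rw [← (LinearMap.toContinuousLinearMap : (E →ₗ[ℝ] ℝ) ≃ₗ[ℝ] _).finrank_eq]
  exact (Subspace.dual_finrank_eq (K := ℝ) (V := E)).symm

end Form

end

/-! ### Hamiltonian torus actions -/

noncomputable section

/-- The pairing between momenta and Lie algebra elements of the two-torus. -/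
def dot (a b : ℝ × ℝ) : ℝ := a.1 * b.1 + a.2 * b.2

/-- The pairing with a fixed Lie algebra element, as a linear map. -/
def dotL (ξ : ℝ × ℝ) : ℝ × ℝ →L[ℝ] ℝ :=
  ξ.1 • ContinuousLinearMap.fst ℝ ℝ ℝ + ξ.2 • ContinuousLinearMap.snd ℝ ℝ ℝ

@[simp] theorem dotL_apply (ξ a : ℝ × ℝ) : dotL ξ a = dot a ξ := by simp [dotL, dot]; ring

/-- A weight (a character of the two-torus) as a linear form on the Lie algebra. -/
def wt (w : ℤ × ℤ) (ξ : ℝ × ℝ) : ℝ := w.1 * ξ.1 + w.2 * ξ.2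

theorem wt_sub (w : ℤ × ℤ) (a b : ℝ × ℝ) : wt w (a - b) = wt w a - wt w b := by
  simp [wt]; ring

theorem wt_smul (w : ℤ × ℤ) (r : ℝ) (a : ℝ × ℝ) : wt w (r • a) = r * wt w a := by
  simp [wt]; ring

section

variable {E : Type} [NormedAddCommGroup E] [NormedSpace ℝ E]
variable {M : Type*} [TopologicalSpace M] [ChartedSpace E M]

/-- The infinitesimal generators at `x` of an action of the plane. -/
def gener (act : ℝ × ℝ → M → M) (x : M) : ℝ × ℝ →L[ℝ] E :=
  dMap (E := E) (E' := ℝ × ℝ) (fun ξ => act ξ x) 0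

/-- A Hamiltonian action of the two-torus, given as a `ℤ²`-periodic action of the plane. -/
structure TorusHam (Ω : SymplecticForm E M) where
  /-- the action -/
  act : ℝ × ℝ → M → M
  /-- the momentum map -/
  mom : M → ℝ × ℝ
  act_zero : ∀ x, act 0 x = x
  act_add : ∀ ξ ζ x, act (ξ + ζ) x = act ξ (act ζ x)
  act_int : ∀ (m n : ℤ) x, act ((m : ℝ), (n : ℝ)) x = x
  smooth_act : ContMDiff (𝓘(ℝ, ℝ × ℝ).prod 𝓘(ℝ, E)) 𝓘(ℝ, E) ∞
    (fun p : (ℝ × ℝ) × M => act p.1 p.2)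
  smooth_mom : ContMDiff 𝓘(ℝ, E) 𝓘(ℝ, ℝ × ℝ) ∞ mom
  ham : ∀ x ξ w, Ω.om x (gener act x ξ) w = dot (dM mom x w) ξ

end

namespace TorusHam

set_option linter.unusedSectionVars false

variable {E : Type} [NormedAddCommGroup E] [NormedSpace ℝ E]
variable {M : Type*} [TopologicalSpace M] [ChartedSpace E M] [IsManifold 𝓘(ℝ, E) ∞ M]
variable {V : Type} [NormedAddCommGroup V] [NormedSpace ℝ V]
variable {Ω : SymplecticForm E M} (T : TorusHam Ω)

/-- The infinitesimal generators of the torus action at `x`. -/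
def gen (x : M) : ℝ × ℝ →L[ℝ] E := gener T.act x

theorem om_gen (x : M) (ξ : ℝ × ℝ) (w : E) : Ω.om x (T.gen x ξ) w = dot (dM T.mom x w) ξ :=
  T.ham x ξ w

theorem continuous_act : Continuous (fun p : (ℝ × ℝ) × M => T.act p.1 p.2) :=
  T.smooth_act.continuous

theorem smooth_act_right (ξ : ℝ × ℝ) : ContMDiff 𝓘(ℝ, E) 𝓘(ℝ, E) ∞ (T.act ξ) :=
  T.smooth_act.comp (contMDiff_const.prodMk contMDiff_id)

theorem smooth_act_left (x : M) : ContMDiff 𝓘(ℝ, ℝ × ℝ) 𝓘(ℝ, E) ∞ (fun ξ => T.act ξ x) :=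
  T.smooth_act.comp (contMDiff_id.prodMk contMDiff_const)

theorem act_neg_act (ξ : ℝ × ℝ) (x : M) : T.act (-ξ) (T.act ξ x) = x := by
  rw [← T.act_add, neg_add_cancel, T.act_zero]

theorem act_act_neg (ξ : ℝ × ℝ) (x : M) : T.act ξ (T.act (-ξ) x) = x := by
  rw [← T.act_add, add_neg_cancel, T.act_zero]

theorem act_comm (ξ ζ : ℝ × ℝ) (x : M) : T.act ξ (T.act ζ x) = T.act ζ (T.act ξ x) := by
  rw [← T.act_add, ← T.act_add, add_comm]

/-- The action of a group element, as a homeomorphism. -/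
def actHomeo (ξ : ℝ × ℝ) : M ≃ₜ M where
  toFun := T.act ξ
  invFun := T.act (-ξ)
  left_inv := T.act_neg_act ξ
  right_inv := T.act_act_neg ξ
  continuous_toFun := (T.smooth_act_right ξ).continuous
  continuous_invFun := (T.smooth_act_right (-ξ)).continuous

theorem dMap_act_zero (x : M) :
    dMap (E := E) (E' := ℝ × ℝ) (fun ξ => T.act ξ x) 0 = T.gen x := rfl

/-- Translation in the group moves the base point of the derivative to `0`. -/
theorem dMap_act_left (x : M) (ζ : ℝ × ℝ) :
    dMap (E := E) (E' := ℝ × ℝ) (fun ξ => T.act ξ x) ζ = T.gen (T.act ζ x) := by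
  have h1 : (fun ξ => T.act ξ x) = (fun ξ => T.act ξ (T.act ζ x)) ∘ (fun ξ => ξ - ζ) := by
    ext ξ; simp [← T.act_add]
  have hs : ContMDiff 𝓘(ℝ, ℝ × ℝ) 𝓘(ℝ, ℝ × ℝ) ∞ (fun ξ : ℝ × ℝ => ξ - ζ) :=
    (contDiff_id.sub contDiff_const).contMDiff
  have h3 : dMap (E := ℝ × ℝ) (E' := ℝ × ℝ) (fun ξ : ℝ × ℝ => ξ - ζ) ζ =
      ContinuousLinearMap.id ℝ _ := by
    rw [dMap, dM_model]
    have : (ch (ℝ × ℝ) (ζ - ζ) ∘ fun ξ : ℝ × ℝ => ξ - ζ) = fun ξ => ξ - ζ := by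
      simp only [ch, extChartAt_model_space_eq_id]
      rfl
    rw [this, fderiv_sub_const]
    exact fderiv_id
  rw [h1, dMap_comp (T.smooth_act_left _ _) (hs ζ), h3, sub_self, T.dMap_act_zero]
  rfl

theorem hasFDerivAt_act {f : M → V} (x : M) (ζ : ℝ × ℝ) (hf : SmoothAt (E := E) f (T.act ζ x)) :
    HasFDerivAt (fun ξ => f (T.act ξ x)) ((dM f (T.act ζ x)).comp (T.gen (T.act ζ x))) ζ := by
  have h1 := dM_comp_map (f := f) (g := fun ξ => T.act ξ x) (x := ζ) hf (T.smooth_act_left x ζ)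
  rw [T.dMap_act_left, dM_model] at h1
  rw [← h1]
  exact ((ContMDiffAt.comp ζ hf (T.smooth_act_left x ζ)).contDiffAt.differentiableAt
    (by simp)).hasFDerivAt

theorem hasDerivAt_act {f : M → V} (x : M) (ξ : ℝ × ℝ) (t : ℝ)
    (hf : SmoothAt (E := E) f (T.act (t • ξ) x)) :
    HasDerivAt (fun t : ℝ => f (T.act (t • ξ) x))
      (dM f (T.act (t • ξ) x) (T.gen (T.act (t • ξ) x) ξ)) t := by
  have h2 : HasDerivAt (fun t : ℝ => t • ξ) ξ t := by
    simpa using (hasDerivAt_id t).smul_const ξ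
  exact (T.hasFDerivAt_act x (t • ξ) hf).comp_hasDerivAt t h2

theorem dM_gen_eq {f : M → V} {x : M} (hf : SmoothAt (E := E) f x) {ξ : ℝ × ℝ} {v : V}
    (h : HasDerivAt (fun t : ℝ => f (T.act (t • ξ) x)) v 0) : dM f x (T.gen x ξ) = v := by
  have := T.hasDerivAt_act x ξ 0 (by simpa [T.act_zero] using hf)
  simp only [zero_smul, T.act_zero] at this
  exact this.unique h

/-- The group is abelian, so the differential of a group element carries generators to generators.
-/
theorem gen_act (τ : ℝ × ℝ) (x : M) :
    T.gen (T.act τ x) = (dMap (E := E) (E' := E) (T.act τ) x).comp (T.gen x) := by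
  have h := dMap_comp (g := T.act τ) (h := fun ξ => T.act ξ x) (x := (0 : ℝ × ℝ))
    (T.smooth_act_right τ _) (T.smooth_act_left x 0)
  rw [T.dMap_act_zero, T.act_zero] at h
  rw [← h, ← T.dMap_act_zero]
  congr 1
  ext ξ
  exact T.act_comm ξ τ x

theorem gen_act_eq_zero {τ ξ : ℝ × ℝ} {x : M} (h : T.gen x ξ = 0) : T.gen (T.act τ x) ξ = 0 := by
  rw [T.gen_act, ContinuousLinearMap.comp_apply, h, map_zero]

theorem gen_act_eq_zero_iff {τ ξ : ℝ × ℝ} {x : M} : T.gen (T.act τ x) ξ = 0 ↔ T.gen x ξ = 0 := by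
  refine ⟨fun h => ?_, T.gen_act_eq_zero⟩
  simpa [T.act_neg_act] using T.gen_act_eq_zero (τ := -τ) h

theorem injective_gen_iff {x : M} :
    Function.Injective (T.gen x) ↔ ∀ ξ, T.gen x ξ = 0 → ξ = 0 :=
  injective_iff_map_eq_zero _

theorem injective_gen_act_iff {τ : ℝ × ℝ} {x : M} :
    Function.Injective (T.gen (T.act τ x)) ↔ Function.Injective (T.gen x) := by
  simp only [T.injective_gen_iff, T.gen_act_eq_zero_iff]

/-- A point where a generator vanishes is fixed by the corresponding one-parameter group. -/
theorem act_smul_eq_self {x : M} {ξ : ℝ × ℝ} (h : T.gen x ξ = 0) (t : ℝ) : T.act (t • ξ) x = x := by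
  have hs : ContMDiff 𝓘(ℝ, ℝ) 𝓘(ℝ, E) ∞ (fun t : ℝ => T.act (t • ξ) x) :=
    (T.smooth_act_left x).comp (contDiff_id.smul contDiff_const).contMDiff
  have := eq_of_dMap_eq_zero hs (fun s => ?_) t 0
  · simpa [T.act_zero] using this
  · have hs' : SmoothAt (E := E) (ch E (T.act (s • ξ) x)) (T.act (s • ξ) x) :=
      contMDiffAt_ch (mem_ch_source _)
    have h1 := T.hasDerivAt_act x ξ s hs'
    rw [T.gen_act_eq_zero h, map_zero] at h1
    rw [dMap, dM_model]
    have h2 := h1.hasFDerivAt.fderiv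
    have h3 : (ContinuousLinearMap.toSpanSingleton ℝ (0 : E)) = 0 := by ext; simp
    exact h2.trans (by ext; simp)

theorem gen_eq_zero_of_act {x : M} {ξ : ℝ × ℝ} (h : ∀ᶠ t : ℝ in 𝓝 0, T.act (t • ξ) x = x) :
    T.gen x ξ = 0 := by
  have hs : SmoothAt (E := E) (ch E x) x := contMDiffAt_ch (mem_ch_source x)
  have h1 : dM (ch E x) x (T.gen x ξ) = 0 := by
    refine T.dM_gen_eq hs ?_
    refine (hasDerivAt_const (0 : ℝ) (ch E x x)).congr_of_eventuallyEq ?_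
    filter_upwards [h] with t ht
    rw [ht]
  rwa [dM_ch_self] at h1

/-- The momentum map is invariant under the action. -/
theorem mom_act (ξ : ℝ × ℝ) (x : M) : T.mom (T.act ξ x) = T.mom x := by
  -- Along an orbit, the derivative of the momentum of `η` in the direction `ξ` is the value of `Ω`
  -- on the two generators.
  have hd : ∀ ζ ξ η : ℝ × ℝ, HasDerivAt (fun t : ℝ => dot (T.mom (T.act (ζ + t • ξ) x)) η)
      (Ω.om (T.act ζ x) (T.gen (T.act ζ x) η) (T.gen (T.act ζ x) ξ)) 0 := by
    intro ζ ξ η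
    have h1 := T.hasFDerivAt_act x ζ (T.smooth_mom _)
    have h2 : HasDerivAt (fun t : ℝ => ζ + t • ξ) ξ 0 := by
      simpa using ((hasDerivAt_id (0 : ℝ)).smul_const ξ).const_add ζ
    have h0 : ζ = ζ + (0 : ℝ) • ξ := by simp
    rw [h0] at h1
    have h3 := (dotL η).hasFDerivAt.comp_hasDerivAt (0 : ℝ) (h1.comp_hasDerivAt (0 : ℝ) h2)
    simp only [dotL_apply, zero_smul, add_zero] at h3
    rw [T.om_gen]
    simpa [Function.comp_def] using h3
  set f : ℝ × ℝ → ℝ := fun ζ => (T.mom (T.act ζ x)).1 with hfdef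
  set g : ℝ × ℝ → ℝ := fun ζ => (T.mom (T.act ζ x)).2 with hgdef
  set k : ℝ × ℝ → ℝ := fun ζ => Ω.om (T.act ζ x) (T.gen (T.act ζ x) (1, 0))
    (T.gen (T.act ζ x) (0, 1)) with hk
  have shift : ∀ (φ : ℝ → ℝ) (a v : ℝ), HasDerivAt (fun t => φ (a + t)) v 0 → HasDerivAt φ v a := by
    intro φ a v h
    have h1 : HasDerivAt (fun b : ℝ => b - a) 1 a := (hasDerivAt_id a).sub_const a
    have h2 : HasDerivAt (fun t => φ (a + t)) v (a - a) := by rwa [sub_self]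
    have h3 := HasDerivAt.comp (h₂ := fun t => φ (a + t)) (h := fun b : ℝ => b - a) a h2 h1
    simpa [Function.comp_def] using h3
  have hf1 : ∀ s t, HasDerivAt (fun s => f (s, t)) 0 s := by
    intro s t
    apply shift
    have := hd (s, t) (1, 0) (1, 0)
    rw [Ω.om_self] at this
    simpa [dot, hfdef] using this
  have hf2 : ∀ s t, HasDerivAt (fun t => f (s, t)) (k (s, t)) t := by
    intro s t
    apply shift
    have := hd (s, t) (0, 1) (1, 0)
    simpa [dot, hfdef, hk] using this
  have hg1 : ∀ s t, HasDerivAt (fun s => g (s, t)) (-k (s, t)) s := by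
    intro s t
    apply shift
    have := hd (s, t) (1, 0) (0, 1)
    rw [Ω.om_swap] at this
    simpa [dot, hgdef, hk] using this
  have hg2 : ∀ s t, HasDerivAt (fun t => g (s, t)) 0 t := by
    intro s t
    apply shift
    have := hd (s, t) (0, 1) (0, 1)
    rw [Ω.om_self] at this
    simpa [dot, hgdef] using this
  have cst : ∀ (φ : ℝ → ℝ), (∀ t, HasDerivAt φ 0 t) → ∀ a b, φ a = φ b := fun φ h a b =>
    is_const_of_deriv_eq_zero (fun t => (h t).differentiableAt) (fun t => (h t).deriv) a b
  have hf3 : ∀ s s' t, f (s, t) = f (s', t) := fun s s' t => cst _ (fun s => hf1 s t) s s'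
  have hg3 : ∀ s t t', g (s, t) = g (s, t') := fun s t t' => cst _ (fun t => hg2 s t) t t'
  -- `k` is both `∂f/∂t` and `-∂g/∂s`. As `f` does not depend on `s` and `g` does not depend on `t`,
  -- it is constant.
  have hk1 : ∀ s s' t, k (s, t) = k (s', t) := by
    intro s s' t
    refine (hf2 s t).unique ?_
    have := hf2 s' t
    simpa only [hf3 s' s] using this
  have hk2 : ∀ s t t', k (s, t) = k (s, t') := by
    intro s t t'
    have h1 := hg1 s t
    have h2 := hg1 s t'
    simp only [hg3 _ t' t] at h2
    exact neg_injective (h1.unique h2)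
  set c := k (0, 0) with hc
  have hkc : ∀ s t, k (s, t) = c := fun s t => by rw [hk1 s 0, hk2 0 t 0]
  have per : ∀ (m n : ℤ), T.mom (T.act ((m : ℝ), (n : ℝ)) x) = T.mom x := fun m n => by
    rw [T.act_int]
  -- Here periodicity is essential: `f` is affine in `t` with slope `c` and takes equal values at
  -- `0` and `1`.
  have hc0 : c = 0 := by
    have h1 : ∀ t, HasDerivAt (fun t => f (0, t) - c * t) 0 t := by
      intro t
      have := (hf2 0 t).fun_sub ((hasDerivAt_id' t).const_mul c)
      rw [hkc] at this
      simpa using this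
    have h2 := cst _ h1 0 1
    have h3 : f (0, 1) = f (0, 0) := by
      simp only [hfdef]
      have a := per 0 1
      have b := per 0 0
      norm_num at a b
      rw [a, b]
    simp only [mul_zero, mul_one, h3] at h2
    linarith
  have hf4 : ∀ s t t', f (s, t) = f (s, t') := fun s t t' =>
    cst (fun t => f (s, t)) (fun t => by simpa [hkc, hc0] using hf2 s t) t t'
  have hg4 : ∀ s s' t, g (s, t) = g (s', t) := fun s s' t =>
    cst (fun s => g (s, t)) (fun s => by simpa [hkc, hc0] using hg1 s t) s s'
  have h0 : T.mom (T.act (0, 0) x) = T.mom x := by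
    have := T.act_zero x
    rw [show ((0 : ℝ), (0 : ℝ)) = (0 : ℝ × ℝ) from rfl, this]
  rw [← h0]
  ext
  · exact (hf3 ξ.1 0 ξ.2).trans (hf4 0 ξ.2 0)
  · exact (hg3 ξ.1 ξ.2 0).trans (hg4 ξ.1 0 0)

theorem dM_mom_gen (x : M) (ξ : ℝ × ℝ) : dM T.mom x (T.gen x ξ) = 0 := by
  refine T.dM_gen_eq (T.smooth_mom x) ?_
  simp only [T.mom_act]
  exact hasDerivAt_const _ _

end TorusHam

end

/-! ### Equivariant functions -/

noncomputable section

section DoubleIntegral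

variable {G F : Type} [NormedAddCommGroup G] [NormedSpace ℝ G] [NormedAddCommGroup F]
  [NormedSpace ℝ F]

theorem contDiffAt_double_integral {K : (G × ℝ) × ℝ → F} {y₀ : G}
    (hK : ∀ s t, ContDiffAt ℝ ∞ K ((y₀, s), t)) :
    ContDiffAt ℝ ∞ (fun y => ∫ s in (0 : ℝ)..1, ∫ t in (0 : ℝ)..1, K ((y, s), t)) y₀ :=
  contDiffAt_intervalIntegral (f := fun q : G × ℝ => ∫ t in (0 : ℝ)..1, K (q, t)) fun s _ =>
    contDiffAt_intervalIntegral fun t _ => hK s t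

theorem fderiv_double_integral [CompleteSpace F] {K : (G × ℝ) × ℝ → F} {y₀ : G}
    (hK : ∀ s t, ContDiffAt ℝ ∞ K ((y₀, s), t)) (v : G) :
    fderiv ℝ (fun y => ∫ s in (0 : ℝ)..1, ∫ t in (0 : ℝ)..1, K ((y, s), t)) y₀ v =
      ∫ s in (0 : ℝ)..1, ∫ t in (0 : ℝ)..1, fderiv ℝ K ((y₀, s), t) ((v, 0), 0) := by
  set h : G × ℝ → F := fun q => ∫ t in (0 : ℝ)..1, K (q, t) with hh
  have h1 : ∀ s, ContDiffAt ℝ ∞ h (y₀, s) := fun s =>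
    contDiffAt_intervalIntegral fun t _ => hK s t
  have h2 := (hasFDerivAt_intervalIntegral_param (f := h) (y₀ := y₀)
    fun s _ => (h1 s).of_le (by norm_num)).fderiv
  have e1 : ∀ s, fderiv ℝ h (y₀, s) =
      ∫ t in (0 : ℝ)..1, (fderiv ℝ K ((y₀, s), t)).comp (ContinuousLinearMap.inl ℝ (G × ℝ) ℝ) :=
    fun s => (hasFDerivAt_intervalIntegral_param (f := K) (y₀ := (y₀, s))
      fun t _ => (hK s t).of_le (by norm_num)).fderiv
  rw [show (fun y => ∫ s in (0 : ℝ)..1, ∫ t in (0 : ℝ)..1, K ((y, s), t)) =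
    fun y => ∫ s in (0 : ℝ)..1, h (y, s) from rfl, h2]
  rw [ContinuousLinearMap.intervalIntegral_apply]
  · refine intervalIntegral.integral_congr fun s _ => ?_
    simp only [ContinuousLinearMap.comp_apply, ContinuousLinearMap.inl_apply]
    rw [e1, ContinuousLinearMap.intervalIntegral_apply]
    · rfl
    · refine intervalIntegrable_of_continuousAt_Icc fun t _ => ?_
      have h3 : ContinuousAt (fun t => fderiv ℝ K ((y₀, s), t)) t :=
        ContinuousAt.comp (f := fun t => (((y₀, s), t) : (G × ℝ) × ℝ))
          ((hK s t).fderiv_right (m := 0) (by norm_num)).continuousAt (by fun_prop)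
      exact h3.clm_comp continuousAt_const
  · refine intervalIntegrable_of_continuousAt_Icc fun s _ => ?_
    have h3 : ContinuousAt (fun s => fderiv ℝ h (y₀, s)) s :=
      ContinuousAt.comp (f := fun s => ((y₀, s) : G × ℝ))
        ((h1 s).fderiv_right (m := 0) (by norm_num)).continuousAt (by fun_prop)
    exact h3.clm_comp continuousAt_const

end DoubleIntegral

namespace TorusHam

set_option linter.unusedSectionVars false

variable {E : Type} [NormedAddCommGroup E] [NormedSpace ℝ E]
variable {M : Type*} [TopologicalSpace M] [ChartedSpace E M] [IsManifold 𝓘(ℝ, E) ∞ M]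
variable {V : Type} [NormedAddCommGroup V] [NormedSpace ℝ V]
variable {Ω : SymplecticForm E M} (T : TorusHam Ω)

theorem act_add_int (ξ : ℝ × ℝ) (m n : ℤ) (x : M) :
    T.act (ξ + ((m : ℝ), (n : ℝ))) x = T.act ξ x := by
  rw [T.act_add, T.act_int]

theorem act_periodic_left (s t : ℝ) (x : M) : T.act (s + 1, t) x = T.act (s, t) x := by
  have := T.act_add_int (s, t) 1 0 x
  simpa using this

theorem act_periodic_right (s t : ℝ) (x : M) : T.act (s, t + 1) x = T.act (s, t) x := by
  have := T.act_add_int (s, t) 0 1 x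
  simpa using this

/-- A smooth complex function on which the torus acts through a character. -/
structure EqFun (w : ℤ × ℤ) (z : M → ℂ) : Prop where
  smooth : ContMDiff 𝓘(ℝ, E) 𝓘(ℝ, ℂ) ∞ z
  act : ∀ ξ x, z (T.act ξ x) = expi (wt w ξ) * z x

/-- The isotypical component of a function for a character of the torus. -/
def avg (w : ℤ × ℤ) (g : M → ℂ) (x : M) : ℂ :=
  ∫ t in (0 : ℝ)..1, ∫ s in (0 : ℝ)..1, expi (-(w.1 * s + w.2 * t)) * g (T.act (s, t) x)

/-- A function moved by the action, in the chart at `p`. -/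
def actChart (g : M → ℂ) (p : M) (q : E × (ℝ × ℝ)) : ℂ := g (T.act q.2 ((ch E p).symm q.1))

theorem contDiffAt_actChart {g : M → ℂ} (hg : ContMDiff 𝓘(ℝ, E) 𝓘(ℝ, ℂ) ∞ g) (p : M)
    {y : E} (hy : y ∈ (ch E p).target) (ζ : ℝ × ℝ) :
    ContDiffAt ℝ ∞ (T.actChart g p) (y, ζ) := by
  rw [← contMDiffAt_iff_contDiffAt]
  have h1 : ContMDiffAt 𝓘(ℝ, E × (ℝ × ℝ)) 𝓘(ℝ, E) ∞ (fun q : E × (ℝ × ℝ) => (ch E p).symm q.1)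
      (y, ζ) :=
    ContMDiffAt.comp (y, ζ) (g := (ch E p).symm) (contMDiffAt_ch_symm p hy)
      contDiff_fst.contMDiff.contMDiffAt
  have h2 : ContMDiffAt 𝓘(ℝ, E × (ℝ × ℝ)) 𝓘(ℝ, ℝ × ℝ) ∞ (fun q : E × (ℝ × ℝ) => q.2) (y, ζ) :=
    contDiff_snd.contMDiff.contMDiffAt
  have h3 : ContMDiffAt 𝓘(ℝ, E × (ℝ × ℝ)) 𝓘(ℝ, E) ∞
      (fun q : E × (ℝ × ℝ) => T.act q.2 ((ch E p).symm q.1)) (y, ζ) :=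
    ContMDiffAt.comp (y, ζ) (T.smooth_act _) (h2.prodMk h1)
  exact ContMDiffAt.comp (y, ζ) (hg _) h3

/-- The integrand of `avg` in the chart at `p`. -/
def avgKernel (w : ℤ × ℤ) (g : M → ℂ) (p : M) (q : (E × ℝ) × ℝ) : ℂ :=
  expi (-(w.1 * q.2 + w.2 * q.1.2)) * T.actChart g p (q.1.1, (q.2, q.1.2))

theorem contDiffAt_avgKernel {g : M → ℂ} (hg : ContMDiff 𝓘(ℝ, E) 𝓘(ℝ, ℂ) ∞ g) (w : ℤ × ℤ) (p : M)
    {y : E} (hy : y ∈ (ch E p).target) (s t : ℝ) :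
    ContDiffAt ℝ ∞ (T.avgKernel w g p) ((y, s), t) := by
  have h1 : ContDiffAt ℝ ∞ (fun q : (E × ℝ) × ℝ => (q.1.1, (q.2, q.1.2))) ((y, s), t) := by
    fun_prop
  have h2 := ContDiffAt.comp ((y, s), t) (T.contDiffAt_actChart hg p hy (t, s)) h1
  have h3 : ContDiff ℝ ∞ (fun q : (E × ℝ) × ℝ => expi (-(w.1 * q.2 + w.2 * q.1.2))) :=
    contDiff_expi.comp (by fun_prop)
  exact h3.contDiffAt.mul h2

theorem avg_chart (w : ℤ × ℤ) (g : M → ℂ) (p : M) :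
    T.avg w g ∘ (ch E p).symm = fun y => ∫ s in (0 : ℝ)..1, ∫ t in (0 : ℝ)..1,
      T.avgKernel w g p ((y, s), t) := rfl

theorem contMDiff_avg {g : M → ℂ} (hg : ContMDiff 𝓘(ℝ, E) 𝓘(ℝ, ℂ) ∞ g) (w : ℤ × ℤ) :
    ContMDiff 𝓘(ℝ, E) 𝓘(ℝ, ℂ) ∞ (T.avg w g) := by
  intro p
  refine smoothAt_of_comp_ch_symm (mem_ch_source p) ?_
  rw [T.avg_chart]
  exact contDiffAt_double_integral fun s t =>
    T.contDiffAt_avgKernel hg w p ((ch E p).map_source (mem_ch_source p)) s t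

/-- Invariance under shifts of the integral over a period; the integrand is periodic because the
weight is integral. -/
theorem avg_act {g : M → ℂ} (w : ℤ × ℤ) (ξ : ℝ × ℝ) (x : M) :
    T.avg w g (T.act ξ x) = expi (wt w ξ) * T.avg w g x := by
  set k : ℝ → ℝ → ℂ := fun s t => expi (-(w.1 * s + w.2 * t)) * g (T.act (s, t) x) with hk
  have hper1 : ∀ t, Function.Periodic (fun s => k s t) 1 := by
    intro t s
    simp only [hk, T.act_periodic_left]
    rw [show -((w.1 : ℝ) * (s + 1) + w.2 * t) = -(w.1 * s + w.2 * t) + ((-w.1 : ℤ) : ℝ) by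
      push_cast; ring, expi_add, expi_int, mul_one]
  have hper2 : ∀ s, Function.Periodic (fun t => k s t) 1 := by
    intro s t
    simp only [hk, T.act_periodic_right]
    rw [show -((w.1 : ℝ) * s + w.2 * (t + 1)) = -(w.1 * s + w.2 * t) + ((-w.2 : ℤ) : ℝ) by
      push_cast; ring, expi_add, expi_int, mul_one]
  have shift : ∀ (f : ℝ → ℂ), Function.Periodic f 1 → ∀ a,
      ∫ t in (0 : ℝ)..1, f (t + a) = ∫ t in (0 : ℝ)..1, f t := by
    intro f hf a
    rw [intervalIntegral.integral_comp_add_right, zero_add, add_comm 1 a]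
    have := hf.intervalIntegral_add_eq a 0
    simpa using this
  have e1 : T.avg w g x = ∫ t in (0 : ℝ)..1, ∫ s in (0 : ℝ)..1, k s t := rfl
  have e2 : T.avg w g (T.act ξ x) = ∫ t in (0 : ℝ)..1, ∫ s in (0 : ℝ)..1,
      expi (wt w ξ) * k (s + ξ.1) (t + ξ.2) := by
    refine intervalIntegral.integral_congr fun t _ => ?_
    refine intervalIntegral.integral_congr fun s _ => ?_
    simp only [hk, ← T.act_add]
    rw [← mul_assoc, ← expi_add]
    congr 2
    simp only [wt]; ring
  rw [e2, e1]
  simp only [intervalIntegral.integral_const_mul]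
  congr 1
  rw [← shift (fun t => ∫ s in (0 : ℝ)..1, k s t) (fun t => by
    refine intervalIntegral.integral_congr fun s _ => hper2 s t) ξ.2]
  refine intervalIntegral.integral_congr fun t _ => ?_
  exact shift (fun s => k s (t + ξ.2)) (hper1 _) ξ.1

theorem eqFun_avg {g : M → ℂ} (hg : ContMDiff 𝓘(ℝ, E) 𝓘(ℝ, ℂ) ∞ g) (w : ℤ × ℤ) :
    T.EqFun w (T.avg w g) :=
  ⟨T.contMDiff_avg hg w, fun ξ x => T.avg_act w ξ x⟩

/-- The differentials of the isotypical components of `g`, applied to `v`, are the Fourier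
coefficients of the function `ζ ↦ d(g ∘ act ζ) v` on the torus. -/
theorem dM_avg {g : M → ℂ} (hg : ContMDiff 𝓘(ℝ, E) 𝓘(ℝ, ℂ) ∞ g) (w : ℤ × ℤ) (p : M) (v : E) :
    dM (T.avg w g) p v = ∫ t in (0 : ℝ)..1, ∫ s in (0 : ℝ)..1,
      expi (-(w.1 * s + w.2 * t)) * dM (fun x => g (T.act (s, t) x)) p v := by
  have hy : ch E p p ∈ (ch E p).target := (ch E p).map_source (mem_ch_source p)
  rw [dM, T.avg_chart, fderiv_double_integral fun s t => T.contDiffAt_avgKernel hg w p hy s t]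
  refine intervalIntegral.integral_congr fun t _ => ?_
  refine intervalIntegral.integral_congr fun s _ => ?_
  have h1 := (((T.contDiffAt_avgKernel hg w p hy t s).differentiableAt (by simp)).hasFDerivAt).comp
    (ch E p p) (f := fun y => ((y, t), s)) (((hasFDerivAt_id (ch E p p)).prodMk
      (hasFDerivAt_const t _)).prodMk (hasFDerivAt_const s _))
  have hs : SmoothAt (E := E) (fun x => g (T.act (s, t) x)) p :=
    ContMDiffAt.comp p (hg _) (T.smooth_act_right _ p)
  have h2 := hs.hasFDerivAt.const_mul (expi (-(w.1 * s + w.2 * t)))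
  have h3 := congrArg (fun L => L v) (h1.unique h2)
  simpa using h3

theorem continuous_dM_act {g : M → ℂ} (hg : ContMDiff 𝓘(ℝ, E) 𝓘(ℝ, ℂ) ∞ g) (p : M) (v : E) :
    Continuous (fun ζ => dM (fun x => g (T.act ζ x)) p v) := by
  have hy : ch E p p ∈ (ch E p).target := (ch E p).map_source (mem_ch_source p)
  have h1 : (fun ζ => dM (fun x => g (T.act ζ x)) p v) =
      fun ζ => fderiv ℝ (T.actChart g p) (ch E p p, ζ) (v, 0) := by
    ext ζ
    have h1 := (((T.contDiffAt_actChart hg p hy ζ).differentiableAt (by simp)).hasFDerivAt).comp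
      (ch E p p) (f := fun y => (y, ζ)) ((hasFDerivAt_id (ch E p p)).prodMk
        (hasFDerivAt_const ζ _))
    have hs : SmoothAt (E := E) (fun x => g (T.act ζ x)) p :=
      ContMDiffAt.comp p (hg _) (T.smooth_act_right _ p)
    have h3 := congrArg (fun L => L v) (h1.unique hs.hasFDerivAt)
    simpa using h3.symm
  rw [h1, continuous_iff_continuousAt]
  intro ζ
  have h2 : ContinuousAt (fun ζ => fderiv ℝ (T.actChart g p) (ch E p p, ζ)) ζ :=
    ContinuousAt.comp (f := fun ζ => (ch E p p, ζ))
      ((T.contDiffAt_actChart hg p hy ζ).fderiv_right (m := 0) (by norm_num)).continuousAt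
      (by fun_prop)
  exact h2.clm_apply continuousAt_const

/-- The differentials of the equivariant functions separate tangent vectors. -/
theorem eq_zero_of_dM_eqFun [FiniteDimensional ℝ E] [T2Space M] (p : M) (v : E)
    (h : ∀ w z, T.EqFun w z → dM z p v = 0) : v = 0 := by
  -- By uniqueness of Fourier coefficients, `v` is killed by the differential of every smooth
  -- function, equivariant or not.
  have key : ∀ g : M → ℂ, ContMDiff 𝓘(ℝ, E) 𝓘(ℝ, ℂ) ∞ g → dM g p v = 0 := by
    intro g hg
    have h1 := eq_zero_of_fourier_eq_zero₂ (f := fun ζ => dM (fun x => g (T.act ζ x)) p v)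
      (T.continuous_dM_act hg p v) (fun m n ζ => by simp only [T.act_add_int])
      (fun m n => by
        have := h (m, n) _ (T.eqFun_avg hg (m, n))
        rwa [T.dM_avg hg] at this) 0
    simpa [T.act_zero] using h1
  by_contra hv
  obtain ⟨ℓ, hℓ⟩ := SeparatingDual.exists_ne_zero (R := ℝ) hv
  obtain ⟨f⟩ : Nonempty (SmoothBumpFunction 𝓘(ℝ, E) p) := inferInstance
  -- The test function is a linear form in the chart that does not kill `v`, cut off by a bump
  -- function.
  have hg : ContMDiff 𝓘(ℝ, E) 𝓘(ℝ, ℂ) ∞ (fun x => f x • (Complex.ofRealCLM (ℓ (ch E p x)))) := by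
    refine f.contMDiff_smul ?_
    intro x hx
    have h1 : ContMDiffAt 𝓘(ℝ, E) 𝓘(ℝ, E) ∞ (ch E p) x := contMDiffAt_ch (by
      rwa [ch, extChartAt_source])
    exact (ContMDiffAt.comp x (Complex.ofRealCLM.comp ℓ).contDiff.contMDiff.contMDiffAt
      h1).contMDiffWithinAt
  have h1 := key _ hg
  have h2 : (fun x => f x • (Complex.ofRealCLM (ℓ (ch E p x)))) =ᶠ[𝓝 p]
      (Complex.ofRealCLM.comp ℓ) ∘ (ch E p) := by
    filter_upwards [f.eventuallyEq_one] with x hx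
    simp [hx]
  rw [dM_congr h2, dM_comp (contMDiffAt_ch (mem_ch_source p))
    (Complex.ofRealCLM.comp ℓ).hasFDerivAt, dM_ch_self] at h1
  simp at h1
  exact hℓ h1

/-- A character that is trivial on the stabilizer of `p` occurs in a function not vanishing
at `p`. -/
theorem exists_eqFun_ne_zero [FiniteDimensional ℝ E] [T2Space M] (w : ℤ × ℤ) (p : M)
    (h : ∀ ξ, T.act ξ p = p → ∃ n : ℤ, wt w ξ = n) : ∃ z, T.EqFun w z ∧ z p ≠ 0 := by
  -- On `K` the character is far from one. The stabiliser of `p` avoids `K`, so a bump function at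
  -- `p` can be chosen to vanish on the corresponding part of the orbit. The integrand of its
  -- average at `p` then has non-negative real part, which is positive at the parameter `0`.
  set K : Set (ℝ × ℝ) := (Icc 0 1 ×ˢ Icc 0 1) ∩ {ξ | (expi (-(w.1 * ξ.1 + w.2 * ξ.2))).re ≤ 1 / 2}
  have hcont : Continuous fun ξ : ℝ × ℝ => (expi (-(w.1 * ξ.1 + w.2 * ξ.2))).re :=
    Complex.continuous_re.comp (continuous_expi.comp (by fun_prop))
  have hK : IsCompact K := (isCompact_Icc.prod isCompact_Icc).inter_right
    (isClosed_le hcont continuous_const)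
  have hactp : Continuous (fun ξ => T.act ξ p) := (T.smooth_act_left p).continuous
  have hC : IsClosed ((fun ξ => T.act ξ p) '' K) := (hK.image hactp).isClosed
  have hp : p ∉ (fun ξ => T.act ξ p) '' K := by
    rintro ⟨ξ, hξ, hξp⟩
    obtain ⟨n, hn⟩ := h ξ hξp
    have h2 := hξ.2
    have h3 : -((w.1 : ℝ) * ξ.1 + w.2 * ξ.2) = ((-n : ℤ) : ℝ) := by
      push_cast; rw [← hn]; rfl
    simp only [mem_ofPred_eq, h3, expi_int] at h2
    norm_num at h2
  obtain ⟨f, -, hf⟩ := (SmoothBumpFunction.nhds_basis_support (I := 𝓘(ℝ, E))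
    (hC.isOpen_compl.mem_nhds hp)).mem_iff.1 (hC.isOpen_compl.mem_nhds hp)
  set g : M → ℂ := fun x => Complex.ofRealCLM (f x)
  have hg : ContMDiff 𝓘(ℝ, E) 𝓘(ℝ, ℂ) ∞ g := Complex.ofRealCLM.contDiff.contMDiff.comp f.contMDiff
  refine ⟨_, T.eqFun_avg hg w, ?_⟩
  set k : ℝ → ℝ → ℂ := fun s t => expi (-(w.1 * s + w.2 * t)) * g (T.act (s, t) p)
  have hfc : Continuous fun x => f x := f.contMDiff.continuous
  have hgc : Continuous g := hg.continuous
  have hkc : Continuous (fun q : ℝ × ℝ => k q.1 q.2) := by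
    refine (continuous_expi.comp (by fun_prop)).mul (hgc.comp (hactp.comp (by fun_prop)))
  have hkc1 : ∀ t, Continuous fun s => k s t := fun t =>
    hkc.comp (f := fun s : ℝ => (s, t)) (by fun_prop)
  have hk0 : ∀ s ∈ Icc (0 : ℝ) 1, ∀ t ∈ Icc (0 : ℝ) 1, 0 ≤ (k s t).re := by
    intro s hs t ht
    have e : (k s t).re = (expi (-(w.1 * s + w.2 * t))).re * f (T.act (s, t) p) := by
      simp [k, g]
    rw [e]
    by_cases h0 : f (T.act (s, t) p) = 0
    · rw [h0, mul_zero]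
    · refine mul_nonneg ?_ f.nonneg
      have h1 := hf (show T.act (s, t) p ∈ Function.support f from h0)
      by_contra hneg
      exact h1 ⟨(s, t), ⟨⟨hs, ht⟩, by simp only [mem_ofPred_eq]; linarith⟩, rfl⟩
  have hre : (T.avg w g p).re = ∫ t in (0 : ℝ)..1, ∫ s in (0 : ℝ)..1, (k s t).re := by
    have h1 : ∀ t, (∫ s in (0 : ℝ)..1, k s t).re = ∫ s in (0 : ℝ)..1, (k s t).re := fun t =>
      (Complex.reCLM.intervalIntegral_comp_comm ((hkc1 t).intervalIntegrable 0 1)).symm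
    have hc : Continuous fun t => ∫ s in (0 : ℝ)..1, k s t :=
      intervalIntegral.continuous_parametric_intervalIntegral_of_continuous'
        (f := fun t s => k s t) (hkc.comp (f := fun q : ℝ × ℝ => (q.2, q.1)) (by fun_prop)) 0 1
    have h2 := (Complex.reCLM.intervalIntegral_comp_comm
      (hc.intervalIntegrable (μ := MeasureTheory.volume) 0 1)).symm
    refine h2.trans ?_
    simp only [Complex.reCLM_apply, h1]
  have hpos : 0 < (T.avg w g p).re := by
    rw [hre]
    have hkr : Continuous (fun q : ℝ × ℝ => (k q.2 q.1).re) :=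
      Complex.continuous_re.comp (hkc.comp (f := fun q : ℝ × ℝ => (q.2, q.1)) (by fun_prop))
    have hc : Continuous fun t => ∫ s in (0 : ℝ)..1, (k s t).re :=
      intervalIntegral.continuous_parametric_intervalIntegral_of_continuous'
        (f := fun t s => (k s t).re) hkr 0 1
    refine intervalIntegral.integral_pos zero_lt_one hc.continuousOn (fun t ht => ?_)
      ⟨0, by simp, ?_⟩
    · exact intervalIntegral.integral_nonneg zero_le_one fun s hs => hk0 s hs t (Ioc_subset_Icc_self ht)
    · refine intervalIntegral.integral_pos zero_lt_one
        (Complex.continuous_re.comp (hkc1 0)).continuousOn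
        (fun s hs => hk0 s (Ioc_subset_Icc_self hs) 0 (by simp)) ⟨0, by simp, ?_⟩
      have : T.act (0, 0) p = p := T.act_zero p
      simp [k, g, this]
  intro h0
  rw [h0] at hpos
  simp at hpos

/-- If the differentials at `p` of functions invariant under a one-parameter group separate
tangent vectors, then the group acts trivially near `p`. -/
theorem eventually_gen_eq_zero [FiniteDimensional ℝ E] {ξ : ℝ × ℝ} {p : M}
    (h : ∀ v : E, v ≠ 0 → ∃ f : M → ℂ, ContMDiff 𝓘(ℝ, E) 𝓘(ℝ, ℂ) ∞ f ∧
      (∀ (t : ℝ) x, f (T.act (t • ξ) x) = f x) ∧ dM f p v ≠ 0) :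
    ∀ᶠ x in 𝓝 p, T.gen x ξ = 0 := by
  have hy : ch E p p ∈ (ch E p).target := (ch E p).map_source (mem_ch_source p)
  -- A differential that is non-zero on one direction stays so for nearby points and directions;
  -- compactness of the unit sphere makes the neighbourhood of `p` uniform.
  have h1 : ∀ᶠ y in 𝓝 (ch E p p), ∀ v ∈ Metric.sphere (0 : E) 1, ∃ f : M → ℂ,
      ContMDiff 𝓘(ℝ, E) 𝓘(ℝ, ℂ) ∞ f ∧ (∀ (t : ℝ) x, f (T.act (t • ξ) x) = f x) ∧
      fderiv ℝ (f ∘ (ch E p).symm) y v ≠ 0 := by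
    refine (isCompact_sphere (0 : E) 1).eventually_forall_of_forall_eventually ?_
    intro v hv
    have hv0 : v ≠ 0 := by
      rintro rfl
      simp at hv
    obtain ⟨f, hf, hinv, hd⟩ := h v hv0
    have hc : ContinuousAt (fun q : E × E => fderiv ℝ (f ∘ (ch E p).symm) q.1 q.2) (ch E p p, v) := by
      have h2 : ContinuousAt (fderiv ℝ (f ∘ (ch E p).symm)) (ch E p p) :=
        ((smoothAt_comp_ch_symm' (mem_ch_source p) (hf p)).fderiv_right (m := 0)
          (by norm_num)).continuousAt
      exact (ContinuousAt.comp (f := fun q : E × E => q.1) h2 continuousAt_fst).clm_apply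
        continuousAt_snd
    filter_upwards [hc.eventually_ne hd] with q hq
    exact ⟨f, hf, hinv, hq⟩
  filter_upwards [(ch_continuousAt (E := E) (mem_ch_source p)).eventually h1,
    ch_source_mem_nhds (E := E) (mem_ch_source p)] with x hx hxs
  obtain ⟨u, hu⟩ := (chTrans_bijective (E := E) hxs).2 (T.gen x ξ)
  by_contra hne
  have hu0 : u ≠ 0 := by
    rintro rfl
    exact hne (by rw [← hu, map_zero])
  -- A non-zero generator would be detected by some invariant function, but invariant functions have
  -- zero derivative along the generator.
  obtain ⟨f, hf, hinv, hd⟩ := hx (‖u‖⁻¹ • u) (by simp [norm_smul, hu0])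
  apply hd
  rw [map_smul, ← dM_chTrans hxs (hf x), ContinuousLinearMap.comp_apply, hu,
    T.dM_gen_eq (hf x) (v := 0), smul_zero]
  simp only [hinv]
  exact hasDerivAt_const _ _

theorem EqFun.dM_gen {w : ℤ × ℤ} {z : M → ℂ} {T : TorusHam Ω} (hz : T.EqFun w z) (x : M)
    (ξ : ℝ × ℝ) : dM z x (T.gen x ξ) = 2 * Real.pi * Complex.I * wt w ξ * z x := by
  refine T.dM_gen_eq (hz.smooth x) ?_
  simp only [hz.act, wt_smul]
  have h1 : HasDerivAt (fun t : ℝ => t * wt w ξ) (wt w ξ) 0 := by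
    simpa using (hasDerivAt_id (0 : ℝ)).mul_const (wt w ξ)
  have h2 := (hasDerivAt_expi (0 * wt w ξ)).scomp (0 : ℝ) h1
  have h3 := h2.mul_const (z x)
  refine h3.congr_deriv ?_
  simp only [zero_mul, expi_zero, Complex.real_smul]
  ring

theorem EqFun.mul {w w' : ℤ × ℤ} {z z' : M → ℂ} {T : TorusHam Ω} (hz : T.EqFun w z)
    (hz' : T.EqFun w' z') : T.EqFun (w + w') (fun x => z x * z' x) := by
  refine ⟨fun x => ?_, fun ξ x => ?_⟩
  · have h2 : ContDiff ℝ ∞ (fun q : ℂ × ℂ => q.1 * q.2) := contDiff_mul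
    exact ContMDiffAt.comp x (h2.contMDiff (z x, z' x)) ((hz.smooth x).prodMk_space (hz'.smooth x))
  · rw [hz.act, hz'.act, show wt (w + w') ξ = wt w ξ + wt w' ξ by simp [wt]; ring, expi_add]
    ring

theorem EqFun.conj {w : ℤ × ℤ} {z : M → ℂ} {T : TorusHam Ω} (hz : T.EqFun w z) :
    T.EqFun (-w) (fun x => starRingEnd ℂ (z x)) := by
  refine ⟨Complex.conjCLE.contDiff.contMDiff.comp hz.smooth, fun ξ x => ?_⟩
  rw [hz.act, map_mul, conj_expi, show wt (-w) ξ = -wt w ξ by simp [wt]; ring]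

end TorusHam

end

/-! ### Division by the squared norm -/

noncomputable section

section Division

variable {U F : Type} [NormedAddCommGroup U] [NormedSpace ℝ U] [NormedAddCommGroup F]
  [NormedSpace ℝ F] [CompleteSpace F]

/-- A smooth function on `ℂ × U`, invariant under rotations of the first factor and vanishing
on `0 × U`, is divisible by `|z|²`. -/
theorem exists_smooth_quotient_normSq {f : ℂ × U → F} {u₀ : U}
    (hf : ∀ᶠ q in 𝓝 ((0, u₀) : ℂ × U), ContDiffAt ℝ ∞ f q)
    (hrot : ∀ᶠ q in 𝓝 ((0, u₀) : ℂ × U), ∀ s : ℝ, f (expi s * q.1, q.2) = f q)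
    (h0 : ∀ᶠ q in 𝓝 ((0, u₀) : ℂ × U), q.1 = 0 → f q = 0) :
    ∃ g : ℂ × U → F, (∀ᶠ q in 𝓝 ((0, u₀) : ℂ × U), ContDiffAt ℝ ∞ g q) ∧
      ∀ᶠ q in 𝓝 ((0, u₀) : ℂ × U), f q = Complex.normSq q.1 • g q := by
  obtain ⟨ε, hε, hball⟩ := Metric.eventually_nhds_iff_ball.1 (hf.and (hrot.and h0))
  set W := Metric.ball ((0, u₀) : ℂ × U) ε with hW
  have hmem : ∀ q : ℂ × U, q ∈ W ↔ ‖q.1‖ < ε ∧ ‖q.2 - u₀‖ < ε := by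
    intro q
    rw [hW, Metric.mem_ball, Prod.dist_eq, max_lt_iff, dist_eq_norm, dist_eq_norm, sub_zero]
  have hWo : IsOpen W := Metric.isOpen_ball
  have hle : ∀ {q : ℂ × U} {z : ℂ}, q ∈ W → ‖z‖ ≤ ‖q.1‖ → (z, q.2) ∈ W := by
    intro q z hq hz
    rw [hmem] at hq ⊢
    exact ⟨hz.trans_lt hq.1, hq.2⟩
  have hfW : ∀ q ∈ W, ContDiffAt ℝ ∞ f q := fun q hq => (hball q hq).1
  have hrotW : ∀ q ∈ W, ∀ s : ℝ, f (expi s * q.1, q.2) = f q := fun q hq => (hball q hq).2.1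
  have h0W : ∀ q ∈ W, q.1 = 0 → f q = 0 := fun q hq => (hball q hq).2.2
  have hfd : ∀ q ∈ W, HasFDerivAt f (fderiv ℝ f q) q := fun q hq =>
    ((hfW q hq).differentiableAt (by simp)).hasFDerivAt
  have hts : ∀ (z : ℂ) {t : ℝ}, t ∈ Icc (0 : ℝ) 1 → ‖(t : ℂ) * z‖ ≤ ‖z‖ := by
    intro z t ht
    rw [norm_mul, Complex.norm_real, Real.norm_of_nonneg ht.1]
    exact mul_le_of_le_one_left (norm_nonneg _) ht.2
  -- partial derivatives
  set D : ℂ → ℂ × U → F := fun e q => fderiv ℝ f q (e, 0) with hD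
  have hDs : ∀ e, ∀ q ∈ W, ContDiffAt ℝ ∞ (D e) q := fun e q hq =>
    ((hfW q hq).fderiv_right (m := ∞) (by simp)).clm_apply contDiffAt_const
  have hDz : ∀ z q, D z q = z.re • D 1 q + z.im • D Complex.I q := by
    intro z q
    simp only [hD]
    rw [← map_smul, ← map_smul, ← map_add]
    congr 1
    ext <;> simp
  -- Differentiating the invariance under rotations at `s = 0` gives `x ∂_y f = y ∂_x f`.
  have hDrot : ∀ q ∈ W, q.1.re • D Complex.I q = q.1.im • D 1 q := by
    intro q hq
    have h1 : HasDerivAt (fun s : ℝ => (expi s * q.1, q.2))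
        (2 * Real.pi * Complex.I * expi 0 * q.1, (0 : U)) 0 :=
      ((hasDerivAt_expi 0).mul_const q.1).prodMk (hasDerivAt_const _ _)
    have e0 : (expi 0 * q.1, q.2) = q := by simp
    have h2 := (e0.symm ▸ hfd q hq : HasFDerivAt f (fderiv ℝ f q) (expi 0 * q.1, q.2))
    have h3 := h2.comp_hasDerivAt (0 : ℝ) h1
    have h4 : HasDerivAt (f ∘ fun s : ℝ => (expi s * q.1, q.2)) 0 0 := by
      have : (f ∘ fun s : ℝ => (expi s * q.1, q.2)) = fun _ => f q := by
        ext s; exact hrotW q hq s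
      rw [this]; exact hasDerivAt_const _ _
    have h5 := h3.unique h4
    have h6 : D (2 * Real.pi * Complex.I * expi 0 * q.1) q = 0 := h5
    rw [hDz] at h6
    have e1 : (2 * Real.pi * Complex.I * expi 0 * q.1).re = -(2 * Real.pi) * q.1.im := by
      simp
    have e2 : (2 * Real.pi * Complex.I * expi 0 * q.1).im = (2 * Real.pi) * q.1.re := by
      simp
    rw [e1, e2, mul_smul, mul_smul, neg_smul, neg_add_eq_zero] at h6
    exact (smul_right_injective F (by positivity : (2 * Real.pi) ≠ 0) h6).symm
  -- The half-turn makes `f` even in `z`, so its first derivative vanishes at `z = 0`.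
  have hD0 : ∀ q ∈ W, q.1 = 0 → D 1 q = 0 := by
    intro q hq hq0
    have e0 : q = (0, q.2) := by rw [← hq0]
    have hl : ∀ c : ℝ, HasDerivAt (fun t : ℝ => f (((c * t : ℝ) : ℂ), q.2)) (c • D 1 q) 0 := by
      intro c
      have h1 : HasDerivAt (fun t : ℝ => (((c * t : ℝ) : ℂ), q.2)) ((c : ℂ), (0 : U)) 0 := by
        refine HasDerivAt.prodMk ?_ (hasDerivAt_const _ _)
        have := ((hasDerivAt_id (0 : ℝ)).const_mul c).ofReal_comp
        simpa using this
      have h2 : HasFDerivAt f (fderiv ℝ f q) (((c * 0 : ℝ) : ℂ), q.2) := by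
        have := hfd q hq
        rw [e0] at this ⊢
        simpa using this
      have h3 := h2.comp_hasDerivAt (0 : ℝ) h1
      have e : fderiv ℝ f q ((c : ℂ), (0 : U)) = c • D 1 q := by
        simp only [hD]
        rw [← map_smul]
        congr 1
        ext <;> simp
      rw [e] at h3
      exact h3
    have h1 := hl 1
    have h2 := hl (-1)
    have h3 : (fun t : ℝ => f (((1 * t : ℝ) : ℂ), q.2)) =ᶠ[𝓝 0]
        fun t : ℝ => f (((-1 * t : ℝ) : ℂ), q.2) := by
      have hc : ContinuousAt (fun t : ℝ => (((1 * t : ℝ) : ℂ), q.2)) 0 := by fun_prop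
      have hm : ∀ᶠ t : ℝ in 𝓝 0, (((1 * t : ℝ) : ℂ), q.2) ∈ W := by
        apply hc.eventually (hWo.mem_nhds _)
        rw [e0] at hq
        simpa using hq
      filter_upwards [hm] with t ht
      rw [← hrotW _ ht (1 / 2), expi_one_half]
      simp
    have h4 := (h1.congr_of_eventuallyEq h3.symm).unique h2
    rw [one_smul, neg_smul, one_smul] at h4
    have h5 : (2 : ℝ) • D 1 q = 0 := by
      rw [two_smul]
      nth_rewrite 1 [h4]
      simp
    exact (smul_eq_zero.1 h5).resolve_left (by norm_num)
  -- first step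
  set A : ℂ → ℂ × U → F := fun e q => ∫ t in (0 : ℝ)..1, D e ((t : ℂ) * q.1, q.2) with hA
  have hpath : ∀ q : ℂ × U, ∀ t : ℝ,
      ContDiffAt ℝ ∞ (fun r : (ℂ × U) × ℝ => (((r.2 : ℝ) : ℂ) * r.1.1, r.1.2)) (q, t) := by
    intro q t
    have : ContDiff ℝ ∞ (fun r : (ℂ × U) × ℝ => ((r.2 : ℝ) : ℂ)) :=
      Complex.ofRealCLM.contDiff.comp contDiff_snd
    exact ((this.mul (contDiff_fst.comp contDiff_fst)).prodMk
      (contDiff_snd.comp contDiff_fst)).contDiffAt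
  have hAs : ∀ e, ∀ q ∈ W, ContDiffAt ℝ ∞ (A e) q := by
    intro e q hq
    refine contDiffAt_intervalIntegral
      (f := fun r : (ℂ × U) × ℝ => D e ((r.2 : ℂ) * r.1.1, r.1.2)) fun t ht => ?_
    exact ContDiffAt.comp (q, t) (hDs e ((t : ℂ) * q.1, q.2) (hle hq (hts q.1 ht)))
      (hpath q t)
  have hint : ∀ e, ∀ q ∈ W, IntervalIntegrable (fun t : ℝ => D e ((t : ℂ) * q.1, q.2))
      MeasureTheory.volume 0 1 := by
    intro e q hq
    refine intervalIntegrable_of_continuousAt_Icc fun t ht => ?_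
    exact ContinuousAt.comp (f := fun t : ℝ => ((t : ℂ) * q.1, q.2))
      (hDs e _ (hle hq (hts q.1 ht))).continuousAt (by fun_prop)
  -- Integration along the ray from `(0, u)`, where `f` vanishes.
  have hfA : ∀ q ∈ W, f q = q.1.re • A 1 q + q.1.im • A Complex.I q := by
    intro q hq
    have h1 : ∀ t ∈ uIcc (0 : ℝ) 1, HasDerivAt (fun t : ℝ => f ((t : ℂ) * q.1, q.2))
        (q.1.re • D 1 ((t : ℂ) * q.1, q.2) + q.1.im • D Complex.I ((t : ℂ) * q.1, q.2)) t := by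
      intro t ht
      rw [uIcc_of_le zero_le_one] at ht
      have h1 : HasDerivAt (fun t : ℝ => ((t : ℂ) * q.1, q.2)) (q.1, (0 : U)) t := by
        refine HasDerivAt.prodMk ?_ (hasDerivAt_const _ _)
        have := (Complex.ofRealCLM.hasDerivAt (x := t)).mul_const q.1
        simpa using this
      have h2 := (hfd _ (hle hq (hts q.1 ht))).comp_hasDerivAt t h1
      rw [← hDz]
      exact h2
    have h2 := intervalIntegral.integral_eq_sub_of_hasDerivAt h1
      (((hint 1 q hq).smul q.1.re).add ((hint Complex.I q hq).smul q.1.im))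
    have h3 : f ((0 : ℂ) * q.1, q.2) = 0 := h0W _ (by
      have := hle hq (hts q.1 (t := 0) (by simp))
      simpa using this) (by simp)
    simp only [Complex.ofReal_one, one_mul, Complex.ofReal_zero, h3, sub_zero] at h2
    refine h2.symm.trans ((intervalIntegral.integral_add ((hint 1 q hq).smul q.1.re)
      ((hint Complex.I q hq).smul q.1.im)).trans ?_)
    simp only [Pi.smul_apply, intervalIntegral.integral_smul]
    rfl
  have hAB : ∀ q ∈ W, q.1.re • A Complex.I q = q.1.im • A 1 q := by
    intro q hq
    simp only [hA]
    rw [← intervalIntegral.integral_smul, ← intervalIntegral.integral_smul]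
    refine intervalIntegral.integral_congr_ae (Eventually.of_forall fun t ht => ?_)
    rw [uIoc_of_le zero_le_one] at ht
    have h1 := hDrot _ (hle hq (hts q.1 (Ioc_subset_Icc_self ht)))
    simp only [Complex.re_ofReal_mul, Complex.im_ofReal_mul, mul_smul] at h1
    exact smul_right_injective F ht.1.ne' h1
  -- From `x A_I = y A_1`: on `x = 0` either `y ≠ 0`, and `A_1 = 0`, or `z = 0`, where `∂_x f`
  -- vanishes.
  have hA0 : ∀ q ∈ W, q.1.re = 0 → A 1 q = 0 := by
    intro q hq hre
    by_cases him : q.1.im = 0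
    · have hz : q.1 = 0 := Complex.ext hre him
      simp only [hA, hz, mul_zero]
      have : D 1 ((0 : ℂ), q.2) = 0 := hD0 _ (by rwa [← hz]) rfl
      simp [this]
    · have := hAB q hq
      rw [hre, zero_smul] at this
      exact (smul_eq_zero.1 this.symm).resolve_left him
  -- second step
  set g : ℂ × U → F := fun q => ∫ t in (0 : ℝ)..1,
    fderiv ℝ (A 1) (((t * q.1.re : ℝ) : ℂ) + q.1.im * Complex.I, q.2) (1, 0) with hg
  have hnorm : ∀ (z : ℂ) {t : ℝ}, t ∈ Icc (0 : ℝ) 1 →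
      ‖((t * z.re : ℝ) : ℂ) + z.im * Complex.I‖ ≤ ‖z‖ := by
    intro z t ht
    rw [← sq_le_sq₀ (norm_nonneg _) (norm_nonneg _), ← Complex.normSq_eq_norm_sq,
      ← Complex.normSq_eq_norm_sq, Complex.normSq_add_mul_I, Complex.normSq_apply]
    have : t ^ 2 ≤ 1 := by nlinarith [ht.1, ht.2]
    nlinarith [mul_self_nonneg z.re]
  have hdA : ∀ q ∈ W, ContDiffAt ℝ ∞ (fun q => fderiv ℝ (A 1) q (1, 0)) q := fun q hq =>
    ((hAs 1 q hq).fderiv_right (m := ∞) (by simp)).clm_apply contDiffAt_const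
  have hpath2 : ContDiff ℝ ∞ (fun r : (ℂ × U) × ℝ =>
      (((r.2 * r.1.1.re : ℝ) : ℂ) + r.1.1.im * Complex.I, r.1.2)) := by
    have h1 : ContDiff ℝ ∞ (fun r : (ℂ × U) × ℝ => r.1.1.re) :=
      Complex.reCLM.contDiff.comp (contDiff_fst.comp contDiff_fst)
    have h2 : ContDiff ℝ ∞ (fun r : (ℂ × U) × ℝ => (r.1.1.im : ℂ)) :=
      Complex.ofRealCLM.contDiff.comp
        (Complex.imCLM.contDiff.comp (contDiff_fst.comp contDiff_fst))
    have h3 : ContDiff ℝ ∞ (fun r : (ℂ × U) × ℝ => ((r.2 * r.1.1.re : ℝ) : ℂ)) :=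
      Complex.ofRealCLM.contDiff.comp (contDiff_snd.mul h1)
    exact (h3.add (h2.mul contDiff_const)).prodMk (contDiff_snd.comp contDiff_fst)
  have hgs : ∀ q ∈ W, ContDiffAt ℝ ∞ g q := by
    intro q hq
    refine contDiffAt_intervalIntegral (f := fun r : (ℂ × U) × ℝ => fderiv ℝ (A 1)
      (((r.2 * r.1.1.re : ℝ) : ℂ) + r.1.1.im * Complex.I, r.1.2) (1, 0)) fun t ht => ?_
    exact ContDiffAt.comp (q, t) (hdA (((t * q.1.re : ℝ) : ℂ) + q.1.im * Complex.I, q.2)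
      (hle hq (hnorm q.1 ht))) hpath2.contDiffAt
  -- Integration in `Re z` alone, starting on `Re z = 0`, where `A 1` vanishes.
  have hAg : ∀ q ∈ W, A 1 q = q.1.re • g q := by
    intro q hq
    have h1 : ∀ t ∈ uIcc (0 : ℝ) 1, HasDerivAt
        (fun t : ℝ => A 1 (((t * q.1.re : ℝ) : ℂ) + q.1.im * Complex.I, q.2))
        (q.1.re • fderiv ℝ (A 1) (((t * q.1.re : ℝ) : ℂ) + q.1.im * Complex.I, q.2) (1, 0)) t := by
      intro t ht
      rw [uIcc_of_le zero_le_one] at ht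
      have h1 : HasDerivAt (fun t : ℝ => (((t * q.1.re : ℝ) : ℂ) + q.1.im * Complex.I, q.2))
          ((q.1.re : ℂ), (0 : U)) t := by
        refine HasDerivAt.prodMk ?_ (hasDerivAt_const _ _)
        have := ((hasDerivAt_id t).mul_const q.1.re).ofReal_comp.add_const (q.1.im * Complex.I)
        simpa using this
      have h2 := ((hAs 1 _ (hle hq (hnorm q.1 ht))).differentiableAt
        (by simp)).hasFDerivAt.comp_hasDerivAt t h1
      have e : q.1.re • ((1 : ℂ), (0 : U)) = ((q.1.re : ℂ), 0) := by ext <;> simp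
      rw [← map_smul, e]
      exact h2
    have hi : IntervalIntegrable (fun t : ℝ =>
        fderiv ℝ (A 1) (((t * q.1.re : ℝ) : ℂ) + q.1.im * Complex.I, q.2) (1, 0))
        MeasureTheory.volume 0 1 := by
      refine intervalIntegrable_of_continuousAt_Icc fun t ht => ?_
      exact ContinuousAt.comp
        (f := fun t : ℝ => (((t * q.1.re : ℝ) : ℂ) + q.1.im * Complex.I, q.2))
        (hdA _ (hle hq (hnorm q.1 ht))).continuousAt (by fun_prop)
    have h2 := intervalIntegral.integral_eq_sub_of_hasDerivAt h1 (hi.smul q.1.re)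
    have h3 : A 1 (((0 * q.1.re : ℝ) : ℂ) + q.1.im * Complex.I, q.2) = 0 :=
      hA0 _ (hle hq (hnorm q.1 (by simp))) (by simp)
    rw [h3, sub_zero, intervalIntegral.integral_smul] at h2
    have e : (((1 * q.1.re : ℝ) : ℂ) + q.1.im * Complex.I, q.2) = q := by ext <;> simp
    rw [e] at h2
    exact h2.symm
  -- For `x ≠ 0` the relation `x A_I = y A_1 = x y g` gives `A_I = y g`, hence `f = x A_1 + y A_I =
  -- (x² + y²) g`.
  have hgood : ∀ q ∈ W, q.1.re ≠ 0 → f q = Complex.normSq q.1 • g q := by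
    intro q hq hre
    have h1 := hAB q hq
    rw [hAg q hq, smul_comm] at h1
    have h2 := smul_right_injective F hre h1
    rw [hfA q hq, h2, hAg q hq, ← mul_smul, ← mul_smul, ← add_smul, Complex.normSq_apply]
  refine ⟨g, ?_, ?_⟩
  · filter_upwards [hWo.mem_nhds (Metric.mem_ball_self hε)] with q hq using hgs q hq
  · filter_upwards [hWo.mem_nhds (Metric.mem_ball_self hε)] with q hq
    by_cases hre : q.1.re = 0
    -- The identity extends to `Re z = 0` by continuity, approaching along real translates.
    · have hc : Continuous (fun t : ℝ => ((q.1 + t, q.2) : ℂ × U)) := by fun_prop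
      have hc0 : (q.1 + ((0 : ℝ) : ℂ), q.2) = q := by simp
      have hm : ∀ᶠ t : ℝ in 𝓝[≠] 0, (q.1 + (t : ℂ), q.2) ∈ W :=
        (hc.continuousAt.eventually (hWo.mem_nhds (by simpa using hq))).filter_mono nhdsWithin_le_nhds
      have h1 : Tendsto (fun t : ℝ => f (q.1 + t, q.2)) (𝓝[≠] 0) (𝓝 (f q)) := by
        have := (hfW q hq).continuousAt
        rw [← hc0] at this
        have h := ContinuousAt.comp (f := fun t : ℝ => ((q.1 + t, q.2) : ℂ × U)) this hc.continuousAt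
        have h' := h.tendsto.mono_left (nhdsWithin_le_nhds (s := {0}ᶜ))
        simpa [Function.comp_def] using h'
      have h2 : Tendsto (fun t : ℝ => Complex.normSq (q.1 + t) • g (q.1 + t, q.2)) (𝓝[≠] 0)
          (𝓝 (Complex.normSq q.1 • g q)) := by
        have h3 : ContinuousAt (fun q : ℂ × U => Complex.normSq q.1 • g q) q :=
          (Complex.continuous_normSq.comp continuous_fst).continuousAt.smul
            (hgs q hq).continuousAt
        rw [← hc0] at h3
        have h := ContinuousAt.comp (f := fun t : ℝ => ((q.1 + t, q.2) : ℂ × U)) h3 hc.continuousAt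
        have h' := h.tendsto.mono_left (nhdsWithin_le_nhds (s := {0}ᶜ))
        simpa [Function.comp_def] using h'
      refine tendsto_nhds_unique h1 (h2.congr' ?_)
      filter_upwards [hm, self_mem_nhdsWithin] with t ht ht0
      refine (hgood _ ht ?_).symm
      simpa [hre] using ht0
    · exact hgood q hq hre

end Division

end

/-! ### Hamiltonian vector fields and flows -/

noncomputable section

set_option linter.unusedSectionVars false

section ChartLemmas

variable {E : Type} [NormedAddCommGroup E] [NormedSpace ℝ E]
variable {M : Type*} [TopologicalSpace M] [ChartedSpace E M] [IsManifold 𝓘(ℝ, E) ∞ M]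
variable {V : Type} [NormedAddCommGroup V] [NormedSpace ℝ V]

theorem dM_ch_chTrans {p x : M} (hx : x ∈ (ch E p).source) (v : E) :
    dM (ch E p) x (chTrans p x v) = v := by
  have h1 : (dM (ch E p) x).comp (chTrans p x) = ContinuousLinearMap.id ℝ E := by
    rw [dM_chTrans hx (contMDiffAt_ch hx), ← fderiv_id (x := ch E p x)]
    refine Filter.EventuallyEq.fderiv_eq ?_
    filter_upwards [eventually_mem_target ((ch E p).map_source hx)] with y hy
    simp only [Function.comp_apply, (ch E p).right_inv hy, id]
  exact congrArg (fun L => L v) h1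

theorem chTrans_dM_ch {p x : M} (hx : x ∈ (ch E p).source) (v : E) :
    chTrans p x (dM (ch E p) x v) = v := by
  obtain ⟨u, rfl⟩ := (chTrans_bijective (E := E) hx).2 v
  rw [dM_ch_chTrans hx]

theorem hasMFDerivAt_dM {f : M → V} {x : M} (hf : SmoothAt (E := E) f x) :
    HasMFDerivAt 𝓘(ℝ, E) 𝓘(ℝ, V) f x
      (show TangentSpace 𝓘(ℝ, E) x →L[ℝ] TangentSpace 𝓘(ℝ, V) (f x) from
        dM (E := E) (V := V) f x) := by
  refine ⟨hf.continuousAt, ?_⟩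
  simp only [writtenInExtChartAt, extChartAt_model_space_eq_id, modelWithCornersSelf_coe, range_id]
  exact hf.hasFDerivAt.hasFDerivWithinAt

theorem mfderiv_eq_dM {f : M → V} {x : M} (hf : SmoothAt (E := E) f x) :
    mfderiv 𝓘(ℝ, E) 𝓘(ℝ, V) f x =
      (show TangentSpace 𝓘(ℝ, E) x →L[ℝ] TangentSpace 𝓘(ℝ, V) (f x) from
        dM (E := E) (V := V) f x) :=
  (hasMFDerivAt_dM hf).mfderiv

theorem mfderiv_symm_eq_chTrans {p : M} {y : E} (hy : y ∈ (ch E p).target) :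
    mfderiv 𝓘(ℝ, E) 𝓘(ℝ, E) (ch E p).symm y =
      (show TangentSpace 𝓘(ℝ, E) y →L[ℝ] TangentSpace 𝓘(ℝ, E) ((ch E p).symm y) from
        chTrans (E := E) p ((ch E p).symm y)) := by
  refine HasMFDerivAt.mfderiv ⟨(contMDiffAt_ch_symm p hy).continuousAt, ?_⟩
  simp only [writtenInExtChartAt, extChartAt_model_space_eq_id, modelWithCornersSelf_coe, range_id]
  have hx := (ch E p).map_target hy
  have h3 := ((smoothAt_comp_ch_symm' hx
    (contMDiffAt_ch (mem_ch_source ((ch E p).symm y)))).differentiableAt (by simp)).hasFDerivAt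
  rw [(ch E p).right_inv hy] at h3
  have e : chTrans (E := E) p ((ch E p).symm y) =
      fderiv ℝ (ch E ((ch E p).symm y) ∘ (ch E p).symm) y := by
    rw [chTrans, (ch E p).right_inv hy]
  have h4 := e ▸ h3
  exact h4.hasFDerivWithinAt

end ChartLemmas

/-! ### Hamiltonian vector fields in charts and existence of flows. -/

namespace SymplecticForm

variable {E : Type} [NormedAddCommGroup E] [NormedSpace ℝ E]
variable {M : Type*} [TopologicalSpace M] [ChartedSpace E M] [IsManifold 𝓘(ℝ, E) ∞ M]
variable (Ω : SymplecticForm E M)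

/-- The symplectic form in the chart at `p`, as a map into the dual. -/
def omc (p : M) (y : E) : E →L[ℝ] E →L[ℝ] ℝ :=
  ((ContinuousAlternatingMap.ofSubsingletonLIE (𝕜 := ℝ) (E := E) (F := ℝ)
      (0 : Fin 1)).symm.toContinuousLinearEquiv.toContinuousLinearMap).comp
    (twoFormInChart Ω.form p y).curryLeft

theorem omc_eq (p : M) (y v w : E) : Ω.omc p y v w = twoFormInChart Ω.form p y ![v, w] := by
  have : Ω.omc p y v w = twoFormInChart Ω.form p y (Matrix.vecCons v (fun _ => w)) := rfl
  rw [this]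
  congr 1
  ext i
  fin_cases i <;> rfl

theorem contDiffAt_omc (p : M) {y : E} (hy : y ∈ (ch E p).target) :
    ContDiffAt ℝ ∞ (Ω.omc p) y := by
  have h : ContDiff ℝ ∞ (fun η : E [⋀^Fin 2]→L[ℝ] ℝ => η.curryLeft) :=
    LinearIsometry.contDiff (𝕜 := ℝ) (E := E [⋀^Fin 2]→L[ℝ] ℝ)
      (F := E →L[ℝ] E [⋀^Fin 1]→L[ℝ] ℝ) (ContinuousAlternatingMap.curryLeftLI (n := 1))
  exact contDiffAt_const.clm_comp
    (h.contDiffAt.comp y ((Ω.smooth p).contDiffAt (eventually_mem_target hy)))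

theorem omc_apply {p x : M} (hx : x ∈ (ch E p).source) (v w : E) :
    Ω.omc p (ch E p x) v w = Ω.om x (chTrans p x v) (chTrans p x w) := by
  rw [omc_eq]
  have hy := (ch E p).map_source hx
  have h1 := mfderiv_symm_eq_chTrans (E := E) hy
  have h2 : twoFormInChart Ω.form p (ch E p x) ![v, w] =
      Ω.om ((ch E p).symm (ch E p x)) (chTrans p ((ch E p).symm (ch E p x)) v)
        (chTrans p ((ch E p).symm (ch E p x)) w) := by
    rw [twoFormInChart, h1, om]
    refine (ContinuousAlternatingMap.compContinuousLinearMap_apply _ _ _).trans ?_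
    congr 1
    ext i
    fin_cases i <;> rfl
  rw [h2, ch_left_inv hx]

variable [FiniteDimensional ℝ E]

/-- The Hamiltonian vector of a function at a point. -/
def ham (H : M → ℝ) (x : M) : E := (LinearEquiv.ofBijective (Ω.flat x) (Ω.flat_bijective x)).symm
  (dM H x)

theorem om_ham (H : M → ℝ) (x : M) (w : E) : Ω.om x (Ω.ham H x) w = dM H x w := by
  have := (LinearEquiv.ofBijective (Ω.flat x) (Ω.flat_bijective x)).apply_symm_apply (dM H x)
  exact congrArg (fun L => L w) this

theorem ham_unique {H : M → ℝ} {x : M} {v : E} (h : ∀ w, Ω.om x v w = dM H x w) :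
    v = Ω.ham H x := by
  have : ∀ w, Ω.om x (v - Ω.ham H x) w = 0 := by
    intro w
    rw [sub_eq_add_neg, Ω.om_add_left, ← neg_one_smul ℝ, Ω.om_smul_left, Ω.om_ham, h]
    ring
  exact sub_eq_zero.1 (Ω.om_nondeg x this)

theorem omc_bijective {p : M} {y : E} (hy : y ∈ (ch E p).target) :
    Function.Bijective (Ω.omc p y : E → (E →L[ℝ] ℝ)) := by
  obtain ⟨x, hx, rfl⟩ : ∃ x ∈ (ch E p).source, ch E p x = y :=
    ⟨(ch E p).symm y, (ch E p).map_target hy, (ch E p).right_inv hy⟩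
  have hinj : Function.Injective (Ω.omc p (ch E p x)).toLinearMap := by
    rw [injective_iff_map_eq_zero]
    intro v hv
    have h1 : chTrans p x v = 0 := by
      refine Ω.om_nondeg x fun w => ?_
      obtain ⟨u, rfl⟩ := (chTrans_bijective (E := E) hx).2 w
      rw [← Ω.omc_apply hx]
      exact congrArg (fun L => L u) hv
    exact (chTrans_bijective (E := E) hx).1 (by rw [h1, map_zero])
  refine ⟨hinj, ?_⟩
  have hd : Module.finrank ℝ E = Module.finrank ℝ (E →L[ℝ] ℝ) := by
    rw [← (LinearMap.toContinuousLinearMap (𝕜 := ℝ) (E := E) (F' := ℝ)).finrank_eq]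
    exact (Subspace.dual_finrank_eq (K := ℝ) (V := E)).symm
  exact (LinearMap.injective_iff_surjective_of_finrank_eq_finrank hd).1 hinj

/-- The Hamiltonian vector field in the chart at `p`. -/
def hamc (H : M → ℝ) (p : M) (y : E) : E :=
  (Ω.omc p y).inverse (fderiv ℝ (H ∘ (ch E p).symm) y)

theorem omc_hamc (H : M → ℝ) {p : M} {y : E} (hy : y ∈ (ch E p).target) :
    Ω.omc p y (Ω.hamc H p y) = fderiv ℝ (H ∘ (ch E p).symm) y := by
  set A : E ≃L[ℝ] (E →L[ℝ] ℝ) := (LinearEquiv.ofBijective (Ω.omc p y).toLinearMap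
    (Ω.omc_bijective hy)).toContinuousLinearEquiv with hA
  have h1 : (A : E →L[ℝ] (E →L[ℝ] ℝ)) = Ω.omc p y := by ext v w; rfl
  rw [hamc, ← h1, ContinuousLinearMap.inverse_equiv]
  exact A.apply_symm_apply _

theorem chTrans_hamc {H : M → ℝ} {p x : M} (hx : x ∈ (ch E p).source)
    (hH : SmoothAt (E := E) H x) : chTrans p x (Ω.hamc H p (ch E p x)) = Ω.ham H x := by
  refine Ω.ham_unique fun w => ?_
  obtain ⟨u, rfl⟩ := (chTrans_bijective (E := E) hx).2 w
  rw [← Ω.omc_apply hx, Ω.omc_hamc H ((ch E p).map_source hx), ← dM_chTrans hx hH]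
  rfl

theorem contDiffAt_hamc {H : M → ℝ} {p : M} {y : E} (hy : y ∈ (ch E p).target)
    (hH : SmoothAt (E := E) H ((ch E p).symm y)) : ContDiffAt ℝ ∞ (Ω.hamc H p) y := by
  have : CompleteSpace E := FiniteDimensional.complete ℝ E
  set A : E ≃L[ℝ] (E →L[ℝ] ℝ) := (LinearEquiv.ofBijective (Ω.omc p y).toLinearMap
    (Ω.omc_bijective hy)).toContinuousLinearEquiv with hA
  have h1 : (A : E →L[ℝ] (E →L[ℝ] ℝ)) = Ω.omc p y := by ext v w; rfl
  have h2 : ContDiffAt ℝ ∞ (fun y => (Ω.omc p y).inverse) y := by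
    refine ContDiffAt.comp (g := ContinuousLinearMap.inverse) y ?_ (Ω.contDiffAt_omc p hy)
    rw [← h1]
    exact contDiffAt_map_inverse A
  exact h2.clm_apply ((smoothAt_comp_ch_symm hy hH).fderiv_right (m := ∞) (by simp))

/-- The derivative of a function along a Hamiltonian vector field is smooth. -/
theorem smoothAt_dM_ham {V : Type} [NormedAddCommGroup V] [NormedSpace ℝ V] {f : M → V}
    {H : M → ℝ} {p : M} (hf : ∀ᶠ x in 𝓝 p, SmoothAt (E := E) f x)
    (hH : ∀ᶠ x in 𝓝 p, SmoothAt (E := E) H x) :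
    SmoothAt (E := E) (fun x => dM f x (Ω.ham H x)) p := by
  have hp := mem_ch_source (E := E) p
  have hy := (ch E p).map_source hp
  have h1 : ContDiffAt ℝ ∞ (fun y => fderiv ℝ (f ∘ (ch E p).symm) y (Ω.hamc H p y)) (ch E p p) :=
    ((smoothAt_comp_ch_symm' hp hf.self_of_nhds).fderiv_right (m := ∞) (by simp)).clm_apply
      (Ω.contDiffAt_hamc hy (by rw [ch_left_inv hp]; exact hH.self_of_nhds))
  have h2 := ContMDiffAt.comp p h1.contMDiffAt (contMDiffAt_ch (E := E) hp)
  refine h2.congr_of_eventuallyEq ?_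
  filter_upwards [hf, hH, ch_source_mem_nhds hp] with x hx1 hx2 hxs
  simp only [Function.comp_apply]
  rw [← dM_chTrans hxs hx1, ← Ω.chTrans_hamc hxs hx2]
  rfl

theorem contMDiff_ham {H : M → ℝ} (hH : ContMDiff 𝓘(ℝ, E) 𝓘(ℝ, ℝ) ∞ H) :
    ContMDiff 𝓘(ℝ, E) 𝓘(ℝ, E).tangent ∞
      (fun x => (⟨x, (show TangentSpace 𝓘(ℝ, E) x from Ω.ham H x)⟩ : TangentBundle 𝓘(ℝ, E) M)) := by
  intro p
  refine (Bundle.contMDiffAt_section (F := E) (E := (TangentSpace 𝓘(ℝ, E) : M → Type))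
    (s := fun x => (show TangentSpace 𝓘(ℝ, E) x from Ω.ham H x)) p).2 ?_
  have h1 : SmoothAt (E := E) (fun x => dM (ch E p) x (Ω.ham H x)) p := by
    refine Ω.smoothAt_dM_ham ?_ (Eventually.of_forall fun x => hH x)
    filter_upwards [ch_source_mem_nhds (mem_ch_source (E := E) p)] with x hx
    exact contMDiffAt_ch hx
  refine h1.congr_of_eventuallyEq (Eventually.of_forall fun x => ?_)
  simp only [TangentBundle.trivializationAt_apply, modelWithCornersSelf_coe, range_id]
  rw [fderivWithin_univ]
  rfl

/-- A curve in the chart at `p` solving the Hamiltonian equation gives an integral curve. -/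
theorem hasMFDerivAt_of_chart {H : M → ℝ} (hH : ContMDiff 𝓘(ℝ, E) 𝓘(ℝ, ℝ) ∞ H) {p : M}
    {α : ℝ → E} {t : ℝ} (ht : α t ∈ (ch E p).target) (hα : HasDerivAt α (Ω.hamc H p (α t)) t) :
    HasMFDerivAt 𝓘(ℝ, ℝ) 𝓘(ℝ, E) (fun t => (ch E p).symm (α t)) t
      ((1 : ℝ →L[ℝ] ℝ).smulRight
        (show TangentSpace 𝓘(ℝ, E) ((ch E p).symm (α t)) from Ω.ham H ((ch E p).symm (α t)))) := by
  set x := (ch E p).symm (α t) with hx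
  have hxs : x ∈ (ch E p).source := (ch E p).map_target ht
  have hax : ch E p x = α t := (ch E p).right_inv ht
  refine ⟨ContinuousAt.comp (contMDiffAt_ch_symm p ht).continuousAt hα.continuousAt, ?_⟩
  simp only [writtenInExtChartAt, extChartAt_model_space_eq_id, modelWithCornersSelf_coe, range_id]
  apply HasFDerivAt.hasFDerivWithinAt
  have h3 : HasFDerivAt (ch E x ∘ (ch E p).symm) (chTrans p x) (ch E p x) :=
    ((smoothAt_comp_ch_symm' hxs (contMDiffAt_ch (mem_ch_source x))).differentiableAt
      (by simp)).hasFDerivAt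
  rw [hax] at h3
  have h4 := (h3.comp_hasDerivAt t hα).hasFDerivAt
  rw [← hax, Ω.chTrans_hamc hxs (hH x)] at h4
  exact h4

/-- A compactly supported smooth Hamiltonian has a flow. -/
theorem exists_flow [T2Space M] {H : M → ℝ} (hH : ContMDiff 𝓘(ℝ, E) 𝓘(ℝ, ℝ) ∞ H)
    (hc : HasCompactSupport H) : ∃ φ : ℝ → M → M, ∀ x, φ 0 x = x ∧
      IsMIntegralCurve (I := 𝓘(ℝ, E)) (fun t => φ t x) (fun x => Ω.ham H x) := by
  have : CompleteSpace E := FiniteDimensional.complete ℝ E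
  set X : ∀ x : M, TangentSpace 𝓘(ℝ, E) x := fun x => Ω.ham H x with hX
  have hm : IsManifold 𝓘(ℝ, E) 1 M := IsManifold.of_le (n := ∞) (by simp)
  have hX1 : ContMDiff 𝓘(ℝ, E) 𝓘(ℝ, E).tangent 1
      (fun x => (⟨x, X x⟩ : TangentBundle 𝓘(ℝ, E) M)) := (Ω.contMDiff_ham hH).of_le (by simp)
  -- Picard–Lindelöf in a chart, with a time of existence common to all starting points near `p`.
  have hloc : ∀ p : M, ∃ U ∈ 𝓝 p, ∃ ε > 0, ∀ x ∈ U, ∃ γ : ℝ → M, γ 0 = x ∧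
      IsMIntegralCurveOn (I := 𝓘(ℝ, E)) γ X (Ioo (-ε) ε) := by
    intro p
    have hp := mem_ch_source (E := E) p
    have hy := (ch E p).map_source hp
    have h1 : ContDiffAt ℝ 1 (Ω.hamc H p) (ch E p p) :=
      (Ω.contDiffAt_hamc hy (hH _)).of_le (by simp)
    obtain ⟨ε, hε, a, r, L, K, hr, hpl⟩ := IsPicardLindelof.of_contDiffAt_one h1
    obtain ⟨α, hα, hαc⟩ := (hpl 0).exists_forall_mem_closedBall_eq_hasDerivWithinAt_continuousOn
    have hr' : (0 : ℝ) < r := hr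
    have hnb : Metric.closedBall (ch E p p) r ×ˢ Icc (0 - ε) (0 + ε) ∈ 𝓝 (ch E p p, (0 : ℝ)) :=
      prod_mem_nhds (Metric.closedBall_mem_nhds _ hr') (Icc_mem_nhds (by linarith) (by linarith))
    have hcat := hαc.continuousAt hnb
    have h0 : α (ch E p p, 0) = ch E p p := (hα _ (Metric.mem_closedBall_self hr'.le)).1
    have hev := (hcat.eventually (by rw [h0]; exact eventually_mem_target hy)).and hnb
    rw [nhds_prod_eq, eventually_prod_iff] at hev
    obtain ⟨pa, hpa, pb, hpb, hab⟩ := hev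
    obtain ⟨δ, hδ, hδb⟩ := Metric.eventually_nhds_iff_ball.1 hpb
    refine ⟨{x | x ∈ (ch E p).source ∧ pa (ch E p x)},
      inter_mem (ch_source_mem_nhds hp) ((ch_continuousAt hp).eventually hpa),
      min δ ε, lt_min hδ hε, ?_⟩
    rintro x ⟨hxs, hxa⟩
    have hxball : ch E p x ∈ Metric.closedBall (ch E p p) r := (hab hxa hpb.self_of_nhds).2.1
    refine ⟨fun t => (ch E p).symm (α (ch E p x, t)), ?_, fun t ht => ?_⟩
    · simp only [(hα _ hxball).1, ch_left_inv hxs]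
    · have ht1 : t ∈ Metric.ball (0 : ℝ) δ := by
        rw [Metric.mem_ball, Real.dist_eq, sub_zero, abs_lt]
        exact ⟨(neg_le_neg (min_le_left _ _)).trans_lt ht.1, ht.2.trans_le (min_le_left _ _)⟩
      have ht2 : t ∈ Ioo (0 - ε) (0 + ε) := by
        rw [zero_sub, zero_add]
        exact ⟨(neg_le_neg (min_le_right _ _)).trans_lt ht.1, ht.2.trans_le (min_le_right _ _)⟩
      have hd := ((hα _ hxball).2 t (Ioo_subset_Icc_self ht2)).hasDerivAt
        (Icc_mem_nhds ht2.1 ht2.2)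
      exact (Ω.hasMFDerivAt_of_chart hH (hab hxa (hδb t ht1)).1 hd).hasMFDerivWithinAt
  have hK : IsCompact (tsupport H) := hc
  choose U hU ε hε hγ using hloc
  obtain ⟨s, hs⟩ := hK.elim_nhds_subcover U fun x _ => hU x
  obtain ⟨δ, hδ, hδs⟩ : ∃ δ > 0, ∀ p ∈ s, δ ≤ ε p := by
    rcases s.eq_empty_or_nonempty with rfl | hne
    · exact ⟨1, one_pos, by simp⟩
    · refine ⟨s.inf' hne ε, ?_, fun p hp => Finset.inf'_le _ hp⟩
      rw [gt_iff_lt, Finset.lt_inf'_iff]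
      exact fun p _ => hε p
  -- One `δ` serves all points: on the support of `H` by compactness, and outside it because the
  -- field vanishes and curves are constant. Curves of uniform length can then be continued for all
  -- times.
  have hall : ∀ x : M, ∃ γ : ℝ → M, γ 0 = x ∧
      IsMIntegralCurveOn (I := 𝓘(ℝ, E)) γ X (Ioo (-δ) δ) := by
    intro x
    by_cases hx : x ∈ tsupport H
    · obtain ⟨p, hp, hxp⟩ := mem_iUnion₂.1 (hs.2 hx)
      obtain ⟨γ, h0, h1⟩ := hγ p x hxp
      exact ⟨γ, h0, h1.mono (Ioo_subset_Ioo (neg_le_neg (hδs p hp)) (hδs p hp))⟩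
    · have hz : Ω.ham H x = 0 := by
        symm
        refine Ω.ham_unique fun w => ?_
        have h1 : H =ᶠ[𝓝 x] fun _ => 0 := notMem_tsupport_iff_eventuallyEq.1 hx
        rw [dM_congr h1, dM_const]
        have := Ω.om_smul_left x 0 0 w
        simpa using this
      refine ⟨fun _ => x, rfl, fun t _ => ?_⟩
      have h1 := hasMFDerivAt_const (I := 𝓘(ℝ, ℝ)) (I' := 𝓘(ℝ, E)) x t
      have h2 : ((1 : ℝ →L[ℝ] ℝ).smulRight (X x)) = 0 := by
        ext
        have : X x = 0 := hz
        simp [this]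
      rw [h2]
      exact h1.hasMFDerivWithinAt
  choose γ h0 h1 using exists_isMIntegralCurve_of_isMIntegralCurveOn hX1 hδ hall
  exact ⟨fun t x => γ x t, fun x => ⟨h0 x, h1 x⟩⟩

/-- The derivative of a function along an integral curve. -/
theorem hasDerivAt_comp_integralCurve {V : Type} [NormedAddCommGroup V] [NormedSpace ℝ V]
    {X : ∀ x : M, TangentSpace 𝓘(ℝ, E) x} {γ : ℝ → M}
    (hγ : IsMIntegralCurve (I := 𝓘(ℝ, E)) γ X) {f : M → V} {t : ℝ}
    (hf : SmoothAt (E := E) f (γ t)) :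
    HasDerivAt (fun t => f (γ t)) (dM (E := E) f (γ t) (show E from X (γ t))) t := by
  have h1 := hasMFDerivAt_dM hf
  have h2 := (h1.comp t (hγ t)).2
  simp only [writtenInExtChartAt, extChartAt_model_space_eq_id, modelWithCornersSelf_coe,
    range_id] at h2
  have h3 := HasFDerivAt.hasDerivAt (𝕜 := ℝ) (F := V) (hasFDerivWithinAt_univ.1 h2)
  refine h3.congr_deriv ?_
  change dM (E := E) f (γ t) ((1 : ℝ) • (show E from X (γ t))) = _
  rw [one_smul]

end SymplecticForm

end

/-! ### Circle charts -/

noncomputable section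

set_option linter.unusedSectionVars false

namespace TorusHam

variable {E : Type} [NormedAddCommGroup E] [NormedSpace ℝ E]
variable {M : Type*} [TopologicalSpace M] [ChartedSpace E M] [IsManifold 𝓘(ℝ, E) ∞ M]
variable {Ω : SymplecticForm E M} (T : TorusHam Ω)

/-- Smooth functions forming a chart at a fixed point `p` of a circle subgroup, which acts by
rotations on the first, complex, coordinate and trivially on the others. -/
structure CircleChart (ξ : ℝ × ℝ) (p : M) (z : M → ℂ) (u : M → ℝ × ℝ) : Prop where
  smooth_z : ContMDiff 𝓘(ℝ, E) 𝓘(ℝ, ℂ) ∞ z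
  smooth_u : ContMDiff 𝓘(ℝ, E) 𝓘(ℝ, ℝ × ℝ) ∞ u
  rot : ∀ (s : ℝ) x, z (T.act (s • ξ) x) = expi s * z x
  inv : ∀ (s : ℝ) x, u (T.act (s • ξ) x) = u x
  z_eq : z p = 0
  bij : Function.Bijective (dM (fun x => (z x, u x)) p : E → ℂ × (ℝ × ℝ))

theorem dM_dot_mom (x : M) (ξ : ℝ × ℝ) (c : ℝ) (w : E) :
    dM (fun x => dot (T.mom x) ξ - c) x w = dot (dM T.mom x w) ξ := by
  have h1 : (fun x => dot (T.mom x) ξ - c) = (fun a => dotL ξ a - c) ∘ T.mom := by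
    ext x; simp
  rw [h1, dM_comp (T.smooth_mom x) ((dotL ξ).hasFDerivAt.sub_const c)]
  simp

theorem smooth_dot_mom (ξ : ℝ × ℝ) (c : ℝ) :
    ContMDiff 𝓘(ℝ, E) 𝓘(ℝ, ℝ) ∞ (fun x => dot (T.mom x) ξ - c) := by
  have h1 : (fun x => dot (T.mom x) ξ - c) = (fun a => dotL ξ a - c) ∘ T.mom := by
    ext x; simp
  rw [h1]
  exact ((dotL ξ).contDiff.sub contDiff_const).contMDiff.comp T.smooth_mom

namespace CircleChart

variable {T} [FiniteDimensional ℝ E]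
variable {ξ : ℝ × ℝ} {p : M} {z : M → ℂ} {u : M → ℝ × ℝ} (C : T.CircleChart ξ p z u)

include C

theorem smooth_pair : ContMDiff 𝓘(ℝ, E) 𝓘(ℝ, ℂ × (ℝ × ℝ)) ∞ (fun x => (z x, u x)) :=
  C.smooth_z.prodMk_space C.smooth_u

theorem gen_center : T.gen p ξ = 0 := by
  have h : dM (fun x => (z x, u x)) p (T.gen p ξ) = 0 := by
    refine T.dM_gen_eq (C.smooth_pair p) ?_
    simp only [C.rot, C.inv, C.z_eq, mul_zero]
    exact hasDerivAt_const _ _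
  exact C.bij.1 (by rw [h, map_zero])

theorem act_center (s : ℝ) : T.act (s • ξ) p = p := T.act_smul_eq_self C.gen_center s

/-- The centre is fixed by the circle, so whole circle orbits of nearby points remain near it, by
compactness of the parameter interval. -/
theorem eventually_forall_Icc {P : M → Prop} (hP : ∀ᶠ x in 𝓝 p, P x) :
    ∀ᶠ x in 𝓝 p, ∀ s ∈ Icc (0 : ℝ) 1, P (T.act (s • ξ) x) := by
  refine isCompact_Icc.eventually_forall_of_forall_eventually fun s _ => ?_
  have hc : Continuous fun q : M × ℝ => T.act (q.2 • ξ) q.1 :=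
    T.continuous_act.comp (f := fun q : M × ℝ => (q.2 • ξ, q.1)) (by fun_prop)
  refine (hc.continuousAt (x := (p, s))).eventually ?_
  simpa only [C.act_center] using hP

/-- If `z x = 0`, all chart coordinates are constant along the circle orbit of `x`, so `x` is fixed
by injectivity of the chart. Conversely, at a fixed point the half-turn gives `z x = -z x`. -/
theorem eventually_eq_zero_iff : ∀ᶠ x in 𝓝 p, (z x = 0 ↔ T.gen x ξ = 0) := by
  obtain ⟨W, hW, hinj⟩ := exists_injOn_of_injective (C.smooth_pair p) C.bij.1
  filter_upwards [C.eventually_forall_Icc hW] with x hx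
  constructor
  · intro hz
    have h1 : ∀ s ∈ Icc (0 : ℝ) 1, T.act (s • ξ) x = x := by
      intro s hs
      have h0 := hx 0 (by simp)
      rw [zero_smul, T.act_zero] at h0
      refine hinj (hx s hs) h0 ?_
      simp only [C.rot, C.inv, hz, mul_zero]
    refine T.gen_eq_zero_of_act ?_
    filter_upwards [Icc_mem_nhds (show (-1 : ℝ) < 0 by norm_num) zero_lt_one] with t ht
    rcases le_total 0 t with h | h
    · exact h1 t ⟨h, ht.2⟩
    · have h2 := h1 (-t) ⟨by linarith, by linarith [ht.1]⟩
      nth_rewrite 1 [← h2]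
      rw [neg_smul, T.act_act_neg]
  · intro hg
    have h1 := T.act_smul_eq_self hg (1 / 2)
    have h2 := C.rot (1 / 2) x
    rw [h1, expi_one_half] at h2
    have h3 : (2 : ℂ) * z x = 0 := by linear_combination h2
    simpa using h3

/-- Division of invariant functions by the squared norm of the complex coordinate. -/
theorem exists_quotient {F : Type} [NormedAddCommGroup F] [NormedSpace ℝ F] [CompleteSpace F]
    {f : M → F} (hf : ∀ᶠ x in 𝓝 p, SmoothAt (E := E) f x)
    (hinv : ∀ᶠ x in 𝓝 p, ∀ s : ℝ, f (T.act (s • ξ) x) = f x)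
    (h0 : ∀ᶠ x in 𝓝 p, z x = 0 → f x = 0) :
    ∃ g : M → F, (∀ᶠ x in 𝓝 p, SmoothAt (E := E) g x) ∧
      ∀ᶠ x in 𝓝 p, f x = Complex.normSq (z x) • g x := by
  obtain ⟨G, hGp, hψG, hGψ, hGs⟩ := exists_local_inverse C.smooth_pair C.bij
  rw [C.z_eq] at hGp hψG hGs
  have hGc : Tendsto G (𝓝 (0, u p)) (𝓝 p) := by
    have := hGs.self_of_nhds.continuousAt.tendsto
    rwa [hGp] at this
  have hψc : Tendsto (fun x => (z x, u x)) (𝓝 p) (𝓝 (0, u p)) := by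
    have := (C.smooth_pair).continuous.tendsto p
    rwa [C.z_eq] at this
  have k1 : ∀ᶠ q in 𝓝 ((0, u p) : ℂ × (ℝ × ℝ)), ContDiffAt ℝ ∞ (f ∘ G) q := by
    filter_upwards [hGs, hGc.eventually hf] with q h1 h2
    exact (ContMDiffAt.comp q h2 h1).contDiffAt
  have k2 : ∀ᶠ q in 𝓝 ((0, u p) : ℂ × (ℝ × ℝ)), ∀ s : ℝ,
      (f ∘ G) (expi s * q.1, q.2) = (f ∘ G) q := by
    filter_upwards [hψG, hGc.eventually hinv, hGc.eventually (C.eventually_forall_Icc hGψ)]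
      with q h1 h2 h3 s
    -- Orbits are known to stay in the chart only for parameters in `[0, 1]`; periodicity reduces to
    -- these.
    have hs : expi s = expi (Int.fract s) := by
      conv_lhs => rw [← Int.floor_add_fract s]
      rw [expi_add, expi_int, one_mul]
    have h4 := h3 (Int.fract s) ⟨Int.fract_nonneg s, (Int.fract_lt_one s).le⟩
    simp only [C.rot, C.inv] at h4
    have e1 : z (G q) = q.1 := congrArg Prod.fst h1
    have e2 : u (G q) = q.2 := congrArg Prod.snd h1
    rw [e1, e2, ← hs] at h4
    simp only [Function.comp_apply]
    rw [h4, h2]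
  have k3 : ∀ᶠ q in 𝓝 ((0, u p) : ℂ × (ℝ × ℝ)), q.1 = 0 → (f ∘ G) q = 0 := by
    filter_upwards [hψG, hGc.eventually h0] with q h1 h2 hq
    have e1 : z (G q) = q.1 := congrArg Prod.fst h1
    exact h2 (by rw [e1, hq])
  obtain ⟨g, hg, hfg⟩ := exists_smooth_quotient_normSq k1 k2 k3
  refine ⟨fun x => g (z x, u x), ?_, ?_⟩
  · filter_upwards [hψc.eventually hg] with x hx
    exact ContMDiffAt.comp x hx.contMDiffAt (C.smooth_pair x)
  · filter_upwards [hψc.eventually hfg, hGψ] with x hx hx2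
    simp only [Function.comp_apply, hx2] at hx
    exact hx

/-- The momentum of the circle is constant along its fixed points. -/
theorem eventually_mom_eq_of_eq_zero :
    ∀ᶠ x in 𝓝 p, z x = 0 → dot (T.mom x) ξ - dot (T.mom p) ξ = 0 := by
  obtain ⟨G, hGp, hψG, hGψ, hGs⟩ := exists_local_inverse C.smooth_pair C.bij
  rw [C.z_eq] at hGp hψG hGs
  have hGc : Tendsto G (𝓝 (0, u p)) (𝓝 p) := by
    have := hGs.self_of_nhds.continuousAt.tendsto
    rwa [hGp] at this
  set f : M → ℝ := fun x => dot (T.mom x) ξ - dot (T.mom p) ξ with hf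
  have hι : Continuous (fun v : ℝ × ℝ => ((0 : ℂ), v)) := by fun_prop
  have hev := (hι.tendsto (u p)).eventually
    ((hψG.and hGs).and (hGc.eventually C.eventually_eq_zero_iff))
  obtain ⟨r, hr, hball⟩ := Metric.eventually_nhds_iff_ball.1 hev
  have hsm : ∀ v ∈ Metric.ball (u p) r,
      ContMDiffAt 𝓘(ℝ, ℝ × ℝ) 𝓘(ℝ, E) ∞ (fun v : ℝ × ℝ => G (0, v)) v := by
    intro v hv
    have h1 : ContMDiff 𝓘(ℝ, ℝ × ℝ) 𝓘(ℝ, ℂ × (ℝ × ℝ)) ∞ (fun v : ℝ × ℝ => ((0 : ℂ), v)) :=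
      (contDiff_const.prodMk contDiff_id).contMDiff
    exact ContMDiffAt.comp v (hball v hv).1.2 (h1 v)
  have hd : ∀ v ∈ Metric.ball (u p) r,
      HasFDerivAt (fun v : ℝ × ℝ => f (G (0, v))) (0 : ℝ × ℝ →L[ℝ] ℝ) v := by
    intro v hv
    have hs := T.smooth_dot_mom ξ (dot (T.mom p) ξ) (G (0, v))
    have h1 := dM_comp_map (f := f) (g := fun v : ℝ × ℝ => G (0, v)) (x := v) hs (hsm v hv)
    -- Where `z = 0` the generator vanishes, and with it the differential of its Hamiltonian. The
    -- slice `z = 0` is a ball in the chart, so the momentum is constant on it.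
    have h2 : dM (E := E) f (G (0, v)) = 0 := by
      ext w
      have e1 : z (G (0, v)) = 0 := congrArg Prod.fst (hball v hv).1.1
      have h3 := (hball v hv).2.1 e1
      rw [hf, T.dM_dot_mom, ← T.om_gen, h3]
      have := Ω.om_smul_left (G (0, v)) 0 0 w
      simpa using this
    rw [h2, dM_model, ContinuousLinearMap.zero_comp] at h1
    rw [← h1]
    exact ((ContMDiffAt.comp v hs (hsm v hv)).contDiffAt.differentiableAt (by simp)).hasFDerivAt
  filter_upwards [hGψ, (C.smooth_u.continuous.tendsto p).eventually
    (Metric.ball_mem_nhds (u p) hr)] with x hx hxu hz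
  have h1 := Metric.isOpen_ball.is_const_of_fderiv_eq_zero (𝕜 := ℝ)
    (convex_ball (u p) r).isPreconnected
    (fun v hv => (hd v hv).differentiableAt.differentiableWithinAt)
    (fun v hv => (hd v hv).fderiv) hxu (Metric.mem_ball_self hr)
  simp only [hGp] at h1
  rw [hz] at hx
  rw [hx] at h1
  rw [← hf] at *
  exact h1.trans (sub_self _)

/-- The momentum of the circle vanishes to second order exactly along its fixed points. -/
theorem exists_mom : ∃ m : M → ℝ, (∀ᶠ x in 𝓝 p, SmoothAt (E := E) m x) ∧
    (∀ᶠ x in 𝓝 p, dot (T.mom x) ξ - dot (T.mom p) ξ = Complex.normSq (z x) * m x) ∧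
    m p ≠ 0 := by
  set f : M → ℝ := fun x => dot (T.mom x) ξ - dot (T.mom p) ξ with hf
  have hfs := T.smooth_dot_mom ξ (dot (T.mom p) ξ)
  obtain ⟨m, hm, hfm⟩ := C.exists_quotient (f := f) (Eventually.of_forall fun x => hfs x)
    (Eventually.of_forall fun x s => by simp only [hf, T.mom_act]) C.eventually_mom_eq_of_eq_zero
  -- If `m p = 0`, the momentum vanishes to higher order than the generator along a ray towards `p`,
  -- which contradicts non-degeneracy of the form.
  refine ⟨m, hm, hfm, fun hmp => ?_⟩
  obtain ⟨G, hGp, hψG, hGψ, hGs⟩ := exists_local_inverse C.smooth_pair C.bij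
  rw [C.z_eq] at hGp hψG hGs
  have hGc : Tendsto G (𝓝 (0, u p)) (𝓝 p) := by
    have := hGs.self_of_nhds.continuousAt.tendsto
    rwa [hGp] at this
  have hps := mem_ch_source (E := E) p
  have hpt := (ch E p).map_source hps
  have hsrc := ch_source_mem_nhds (E := E) hps
  set q₀ : ℂ × (ℝ × ℝ) := (0, u p) with hq₀
  set c : ℂ × (ℝ × ℝ) → E := fun q => ch E p (G q) with hc
  have hcs : ∀ᶠ q in 𝓝 q₀, ContDiffAt ℝ ∞ c q := by
    filter_upwards [hGs, hGc.eventually hsrc] with q h1 h2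
    exact (ContMDiffAt.comp q (contMDiffAt_ch h2) h1).contDiffAt
  have hc0 : c q₀ = ch E p p := by rw [hc]; simp only [hGp]
  -- `e q` is the vector with chart coordinates `(2πi, 0)`. At the point with coordinates `(r, u p)`
  -- the generator is `r` times it.
  set e : ℂ × (ℝ × ℝ) → E := fun q => fderiv ℝ c q (2 * Real.pi * Complex.I, 0) with he
  have hec : ContinuousAt e q₀ :=
    ((hcs.self_of_nhds.fderiv_right (m := 0) (by simp)).continuousAt).clm_apply continuousAt_const
  have hι : Tendsto (fun r : ℝ => (((r : ℂ), u p) : ℂ × (ℝ × ℝ))) (𝓝[≠] 0) (𝓝 q₀) := by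
    have : Continuous (fun r : ℝ => (((r : ℂ), u p) : ℂ × (ℝ × ℝ))) := by fun_prop
    have h := this.tendsto 0
    simp only [Complex.ofReal_zero] at h
    exact h.mono_left nhdsWithin_le_nhds
  -- the Hamiltonian equation along a ray
  have key : ∀ w : E, ∀ᶠ r : ℝ in 𝓝[≠] 0, Ω.omc p (c (r, u p)) (e (r, u p)) w =
      2 * m (G (r, u p)) * (fderiv ℝ (z ∘ (ch E p).symm) (c (r, u p)) w).re +
        r * fderiv ℝ (m ∘ (ch E p).symm) (c (r, u p)) w := by
    intro w
    filter_upwards [hι.eventually hψG, hι.eventually hcs,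
      hι.eventually (hGc.eventually hsrc), hι.eventually (hGc.eventually hm),
      hι.eventually (hGc.eventually (eventually_eventually_nhds.2 hfm)),
      hι.eventually (hGc.eventually (eventually_eventually_nhds.2 hGψ)),
      self_mem_nhdsWithin] with r h1 h2 h3 h4 h5 h6 hr
    set x := G (r, u p) with hx
    have ez : z x = r := congrArg Prod.fst h1
    have eu : u x = u p := congrArg Prod.snd h1
    have hgen : dM (ch E p) x (T.gen x ξ) = r • e (r, u p) := by
      refine T.dM_gen_eq (contMDiffAt_ch h3) ?_
      have hcur : HasDerivAt (fun t : ℝ => ((expi t * r, u p) : ℂ × (ℝ × ℝ)))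
          (2 * Real.pi * Complex.I * expi 0 * r, 0) 0 :=
        ((hasDerivAt_expi 0).mul_const _).prodMk (hasDerivAt_const _ _)
      have e0 : ((expi 0 * r, u p) : ℂ × (ℝ × ℝ)) = ((r : ℂ), u p) := by simp
      have hd := (h2.differentiableAt (by simp)).hasFDerivAt
      rw [← e0] at hd
      have h7 := hd.comp_hasDerivAt (0 : ℝ) hcur
      rw [e0] at h7
      have e1 : fderiv ℝ c (r, u p) (2 * Real.pi * Complex.I * expi 0 * r, 0) = r • e (r, u p) := by
        rw [he]
        simp only
        rw [← map_smul]
        congr 1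
        ext <;> simp [mul_comm]
      rw [e1] at h7
      refine h7.congr_of_eventuallyEq ?_
      have hcc : Tendsto (fun t : ℝ => T.act (t • ξ) x) (𝓝 0) (𝓝 x) := by
        have hcc : Continuous (fun t : ℝ => T.act (t • ξ) x) :=
          (T.smooth_act_left x).continuous.comp (by fun_prop)
        have := hcc.tendsto 0
        rwa [zero_smul, T.act_zero] at this
      filter_upwards [hcc.eventually h6] with t ht
      simp only [C.rot, C.inv, ez, eu] at ht
      simp only [hc, Function.comp_apply]
      rw [ht]
    have hgen' : T.gen x ξ = chTrans p x (r • e (r, u p)) := by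
      rw [← hgen, chTrans_dM_ch h3]
    have hL : Ω.omc p (ch E p x) (r • e (r, u p)) w = dM f x (chTrans p x w) := by
      rw [Ω.omc_apply h3, ← hgen', T.om_gen, hf, T.dM_dot_mom]
    have hfe : f =ᶠ[𝓝 x] fun x => Complex.normSq (z x) * m x := h5
    have hzx : SmoothAt (E := E) z x := C.smooth_z x
    have hns : HasFDerivAt (fun a : ℂ => Complex.normSq a)
        (2 • (r : ℝ) • Complex.reCLM) (z x) := by
      have h7 : (fun a : ℂ => Complex.normSq a) = fun a : ℂ => a.re * a.re + a.im * a.im := by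
        ext a; exact Complex.normSq_apply a
      rw [h7]
      have hre := Complex.reCLM.hasFDerivAt (x := z x)
      have him := Complex.imCLM.hasFDerivAt (x := z x)
      refine ((hre.mul hre).add (him.mul him)).congr_fderiv ?_
      ext a
      simp [ez]
      ring
    have hdm : dM f x (chTrans p x w) = r * (2 * m x * (dM z x (chTrans p x w)).re +
        r * dM m x (chTrans p x w)) := by
      rw [dM_congr hfe]
      have hAs : SmoothAt (E := E) (fun x => Complex.normSq (z x)) x := by
        have h7 : ContDiff ℝ ∞ (fun a : ℂ => Complex.normSq a) := by
          have : (fun a : ℂ => Complex.normSq a) = fun a : ℂ => a.re * a.re + a.im * a.im := by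
            ext a; exact Complex.normSq_apply a
          rw [this]
          exact (Complex.reCLM.contDiff.mul Complex.reCLM.contDiff).add
            (Complex.imCLM.contDiff.mul Complex.imCLM.contDiff)
        exact ContMDiffAt.comp x (h7.contMDiff _) hzx
      have hdA : dM (fun x => Complex.normSq (z x)) x = _ := dM_comp hzx hns
      have h8 := hAs.hasFDerivAt.mul h4.hasFDerivAt
      have h9 : dM (fun x => Complex.normSq (z x) * m x) x = _ := h8.fderiv
      rw [h9, hdA]
      simp [ez, Complex.normSq_apply]
      ring
    rw [hdm, map_smul] at hL
    have hL' : r * Ω.omc p (c (r, u p)) (e (r, u p)) w = r * (2 * m x *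
        (dM z x (chTrans p x w)).re + r * dM m x (chTrans p x w)) := hL
    -- Both the generator and the differential of `|z|² m` contain a factor `r`, which may be
    -- cancelled before the limit `r → 0`.
    have h10 := mul_left_cancel₀ hr hL'
    rw [h10]
    have e3 : dM z x (chTrans p x w) = fderiv ℝ (z ∘ (ch E p).symm) (c (r, u p)) w :=
      congrArg (fun L => L w) (dM_chTrans h3 hzx)
    have e4 : dM m x (chTrans p x w) = fderiv ℝ (m ∘ (ch E p).symm) (c (r, u p)) w :=
      congrArg (fun L => L w) (dM_chTrans h3 h4)
    rw [e3, e4]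
  -- In the limit the right-hand side of `key` vanishes, one term because `m p = 0` and the other
  -- because of its factor `r`.
  have hzero : Ω.omc p (ch E p p) (e q₀) = 0 := by
    ext w
    have hcc : ContinuousAt c q₀ := hcs.self_of_nhds.continuousAt
    have h1 : ContinuousAt (fun q => Ω.omc p (c q) (e q) w) q₀ := by
      have h2 : ContinuousAt (fun q => Ω.omc p (c q)) q₀ :=
        ContinuousAt.comp (g := Ω.omc p) (by
          rw [hc0]; exact (Ω.contDiffAt_omc p hpt).continuousAt) hcc
      exact (h2.clm_apply hec).clm_apply continuousAt_const
    have hfz : ∀ {V : Type} [NormedAddCommGroup V] [NormedSpace ℝ V] {g : M → V},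
        SmoothAt (E := E) g p →
        ContinuousAt (fun q => fderiv ℝ (g ∘ (ch E p).symm) (c q) w) q₀ := by
      intro V _ _ g hg
      have h2 : ContinuousAt (fun q => fderiv ℝ (g ∘ (ch E p).symm) (c q)) q₀ :=
        ContinuousAt.comp (g := fderiv ℝ (g ∘ (ch E p).symm)) (by
          rw [hc0]
          exact ((smoothAt_comp_ch_symm' hps hg).fderiv_right (m := 0) (by simp)).continuousAt) hcc
      exact h2.clm_apply continuousAt_const
    have hmG : Tendsto (fun r : ℝ => m (G (r, u p))) (𝓝[≠] 0) (𝓝 0) := by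
      have h2 := hm.self_of_nhds.continuousAt.tendsto
      rw [hmp] at h2
      exact h2.comp (hGc.comp hι)
    have hr0 : Tendsto (fun r : ℝ => r) (𝓝[≠] 0) (𝓝 0) := nhdsWithin_le_nhds
    have hA : Tendsto (fun r : ℝ => Ω.omc p (c (r, u p)) (e (r, u p)) w) (𝓝[≠] 0)
        (𝓝 (Ω.omc p (c q₀) (e q₀) w)) := h1.tendsto.comp hι
    have hB := ((hmG.const_mul 2).mul
      ((Complex.continuous_re.tendsto _).comp ((hfz (C.smooth_z p)).tendsto.comp hι))).add
        (hr0.mul ((hfz hm.self_of_nhds).tendsto.comp hι))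
    have h3 := tendsto_nhds_unique (hA.congr' (key w)) hB
    rw [hc0] at h3
    rw [h3]
    simp
  -- Non-degeneracy gives `e q₀ = 0`, while the differential of the chart maps `e q₀` to `(2πi, 0)`.
  have he0 : e q₀ = 0 := (Ω.omc_bijective hpt).1 (by rw [hzero, map_zero])
  have hcomp : HasFDerivAt (((fun x => (z x, u x)) ∘ (ch E p).symm) ∘ c)
      ((dM (fun x => (z x, u x)) p).comp (fderiv ℝ c q₀)) q₀ := by
    refine HasFDerivAt.comp q₀ ?_ (hcs.self_of_nhds.differentiableAt (by simp)).hasFDerivAt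
    rw [hc0]
    exact SmoothAt.hasFDerivAt (C.smooth_pair p)
  have hid : HasFDerivAt (((fun x => (z x, u x)) ∘ (ch E p).symm) ∘ c)
      (ContinuousLinearMap.id ℝ (ℂ × (ℝ × ℝ))) q₀ := by
    refine (hasFDerivAt_id q₀).congr_of_eventuallyEq ?_
    filter_upwards [hψG, hGc.eventually hsrc] with q h1 h2
    simp only [Function.comp_apply, hc, ch_left_inv h2]
    exact h1
  have h4 := congrArg (fun L => L ((2 * Real.pi * Complex.I, 0) : ℂ × (ℝ × ℝ))) (hcomp.unique hid)
  have h5 : dM (fun x => (z x, u x)) p (e q₀) = (2 * Real.pi * Complex.I, 0) := h4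
  rw [he0, map_zero] at h5
  have h6 := congrArg Prod.fst h5
  simp [Real.pi_ne_zero] at h6

end CircleChart

end TorusHam

end

/-! ### Local orbits -/

noncomputable section

set_option linter.unusedSectionVars false

section LinearAlgebra

theorem bijective_prod_of_surjective {X V W : Type} [AddCommGroup X] [Module ℝ X]
    [AddCommGroup V] [Module ℝ V] [AddCommGroup W] [Module ℝ W] [FiniteDimensional ℝ X]
    [FiniteDimensional ℝ V] [FiniteDimensional ℝ W] (L : X →ₗ[ℝ] V) (g : X →ₗ[ℝ] W)
    (hd : Module.finrank ℝ X = Module.finrank ℝ V + Module.finrank ℝ W)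
    (hL : Function.Surjective L) (hg : ∀ c, ∃ v, L v = 0 ∧ g v = c) :
    Function.Bijective (L.prod g) := by
  have hs : Function.Surjective (L.prod g) := by
    rintro ⟨a, c⟩
    obtain ⟨v₀, hv₀⟩ := hL a
    obtain ⟨v, hv, hv'⟩ := hg (c - g v₀)
    exact ⟨v₀ + v, by simp [hv₀, hv, hv']⟩
  refine ⟨?_, hs⟩
  exact (LinearMap.injective_iff_surjective_of_finrank_eq_finrank
    (by rw [hd, Module.finrank_prod])).2 hs

theorem wt_det (w w' : ℤ × ℤ) (ξ η : ℝ × ℝ) :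
    ((w.1 * w'.2 - w.2 * w'.1 : ℤ) : ℝ) * (ξ.1 * η.2 - ξ.2 * η.1) =
      wt w ξ * wt w' η - wt w η * wt w' ξ := by
  simp only [wt]; push_cast; ring

theorem wt_cramer {w w' : ℤ × ℤ} (h : w.1 * w'.2 - w.2 * w'.1 ≠ 0) (a b : ℝ) :
    wt w ((a * w'.2 - b * w.2) / (w.1 * w'.2 - w.2 * w'.1),
      (b * w.1 - a * w'.1) / (w.1 * w'.2 - w.2 * w'.1)) = a ∧
    wt w' ((a * w'.2 - b * w.2) / (w.1 * w'.2 - w.2 * w'.1),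
      (b * w.1 - a * w'.1) / (w.1 * w'.2 - w.2 * w'.1)) = b := by
  have hd : ((w.1 : ℝ) * w'.2 - w.2 * w'.1) ≠ 0 := by exact_mod_cast h
  constructor <;>
  · simp only [wt]
    rw [← mul_div_assoc, ← mul_div_assoc, ← add_div, div_eq_iff hd]
    ring

theorem exists_wt_eq {w w' : ℤ × ℤ} (h : w.1 * w'.2 - w.2 * w'.1 ≠ 0) (a b : ℝ) :
    ∃ ξ, wt w ξ = a ∧ wt w' ξ = b :=
  ⟨_, wt_cramer h a b⟩

theorem eq_zero_of_wt_eq_zero {w w' : ℤ × ℤ} (h : w.1 * w'.2 - w.2 * w'.1 ≠ 0) {ξ : ℝ × ℝ}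
    (h1 : wt w ξ = 0) (h2 : wt w' ξ = 0) : ξ = 0 := by
  have hd : ((w.1 : ℝ) * w'.2 - w.2 * w'.1) ≠ 0 := by exact_mod_cast h
  simp only [wt] at h1 h2
  have e1 : ((w.1 : ℝ) * w'.2 - w.2 * w'.1) * ξ.1 = 0 := by linear_combination w'.2 * h1 - w.2 * h2
  have e2 : ((w.1 : ℝ) * w'.2 - w.2 * w'.1) * ξ.2 = 0 := by linear_combination w.1 * h2 - w'.1 * h1
  ext
  · simpa [hd] using e1
  · simpa [hd] using e2

/-- The imaginary part of the quotient by `c`. -/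
def imDiv (c : ℂ) : ℂ →L[ℝ] ℝ := Complex.imCLM.comp (ContinuousLinearMap.mul ℝ ℂ c⁻¹)

theorem imDiv_apply (c a : ℂ) : imDiv c a = (c⁻¹ * a).im := rfl

theorem im_expi (t : ℝ) : (expi t).im = Real.sin (2 * Real.pi * t) := by
  rw [expi, show (2 * Real.pi * Complex.I * t : ℂ) = ((2 * Real.pi * t : ℝ) : ℂ) * Complex.I by
    push_cast; ring, Complex.exp_ofReal_mul_I_im]

theorem tendsto_arcsin_div {X : Type*} [TopologicalSpace X] {p : X} {f : X → ℝ} (hf : ContinuousAt f p) (h0 : f p = 0) :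
    Tendsto (fun x => Real.arcsin (f x) / (2 * Real.pi)) (𝓝 p) (𝓝 0) := by
  have h1 : ContinuousAt (fun x => Real.arcsin (f x) / (2 * Real.pi)) p :=
    (Real.continuous_arcsin.continuousAt.comp hf).div_const _
  have := h1.tendsto
  simpa [h0] using this

end LinearAlgebra

namespace TorusHam

variable {E : Type} [NormedAddCommGroup E] [NormedSpace ℝ E]
variable {M : Type*} [TopologicalSpace M] [ChartedSpace E M] [IsManifold 𝓘(ℝ, E) ∞ M]
variable {V : Type} [NormedAddCommGroup V] [NormedSpace ℝ V]
variable {Ω : SymplecticForm E M} (T : TorusHam Ω)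

theorem dM_act_fixed {f : M → V} {p : M} {τ : ℝ × ℝ} (hp : T.act τ p = p)
    (hf : SmoothAt (E := E) f p) (v : E) :
    dM f p (dMap (E := E) (E' := E) (T.act τ) p v) = dM (fun x => f (T.act τ x)) p v := by
  have h := dM_comp_map (f := f) (g := T.act τ) (x := p) (by rwa [hp]) (T.smooth_act_right τ p)
  rw [hp] at h
  exact (congrArg (fun L => L v) h).symm

variable {T}

theorem EqFun.dM_act_fixed {w : ℤ × ℤ} {z : M → ℂ} (hz : T.EqFun w z) {p : M} {τ : ℝ × ℝ}
    (hp : T.act τ p = p) (v : E) :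
    dM z p (dMap (E := E) (E' := E) (T.act τ) p v) = expi (wt w τ) * dM z p v := by
  rw [T.dM_act_fixed hp (hz.smooth p)]
  simp only [hz.act]
  rw [dM_mul contMDiffAt_const (hz.smooth p), dM_const]
  simp

/-- The derivative of `z` along the generator of `ζ` is `2πi ⟨w, ζ⟩ z`, and the generator vanishes
at `p`. -/
theorem EqFun.eq_zero_of_fixed {w : ℤ × ℤ} {z : M → ℂ} (hz : T.EqFun w z) {p : M} {ζ : ℝ × ℝ}
    (hg : T.gen p ζ = 0) (hw : wt w ζ ≠ 0) : z p = 0 := by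
  have h := hz.dM_gen p ζ
  rw [hg, map_zero] at h
  have h2 := h.symm
  simp only [mul_eq_zero, Complex.ofReal_eq_zero, hw, Real.pi_ne_zero, Complex.I_ne_zero,
    OfNat.ofNat_ne_zero, false_or] at h2
  exact h2

theorem EqFun.wt_eq_zero {w : ℤ × ℤ} {z : M → ℂ} (hz : T.EqFun w z) {x : M} {ζ : ℝ × ℝ}
    (hg : T.gen x ζ = 0) (hx : z x ≠ 0) : wt w ζ = 0 := by
  by_contra h
  exact hx (hz.eq_zero_of_fixed hg h)

/-- The differential of an equivariant function on an invariant subspace is zero or onto. -/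
theorem EqFun.surjective_of_rotation {w : ℤ × ℤ} {z : M → ℂ} (hz : T.EqFun w z) {p : M}
    {ζ : ℝ × ℝ} (hfix : ∀ t : ℝ, T.act (t • ζ) p = p) (hw : wt w ζ ≠ 0) {K : E → Prop}
    (hadd : ∀ (a b : ℝ) (v v' : E), K v → K v' → K (a • v + b • v'))
    (hK : ∀ (t : ℝ) (v : E), K v → K (dMap (E := E) (E' := E) (T.act (t • ζ)) p v)) {v : E}
    (hv : K v) (hne : dM z p v ≠ 0) (c : ℂ) : ∃ v, K v ∧ dM z p v = c := by
  -- A quarter-turn multiplies `dz v` by `i`, so `v` and its image under the quarter-turn already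
  -- reach all of `ℂ`.
  set t := 1 / 4 / wt w ζ
  have h1 := hz.dM_act_fixed (hfix t) v
  have h2 : wt w (t • ζ) = 1 / 4 := by rw [wt_smul]; exact div_mul_cancel₀ _ hw
  rw [h2, expi_one_quarter] at h1
  set q := c / dM z p v with hq
  refine ⟨q.re • v + q.im • dMap (E := E) (E' := E) (T.act (t • ζ)) p v,
    hadd _ _ _ _ hv (hK t v hv), ?_⟩
  rw [map_add, map_smul, map_smul, h1]
  have h3 : c = q * dM z p v := by rw [hq]; field_simp
  rw [h3]
  conv_rhs => rw [← Complex.re_add_im q]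
  simp only [Complex.real_smul]
  ring

variable (T)

/-- Near `p`, the momentum level set through `p` lies in the orbit of `p`. -/
def LocalOrbit (p : M) : Prop :=
  ∀ᶠ x in 𝓝 p, T.mom x = T.mom p → ∃ ξ, x = T.act ξ p

variable [FiniteDimensional ℝ E] [T2Space M]

/-- Some equivariant function has non-zero derivative along the generator, and this derivative is
`2πi ⟨w, ξ⟩ z p`. -/
theorem exists_eqFun_of_gen_ne_zero {p : M} {ξ : ℝ × ℝ} (h : T.gen p ξ ≠ 0) :
    ∃ w z, T.EqFun w z ∧ z p ≠ 0 ∧ wt w ξ ≠ 0 := by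
  by_contra hcon
  push Not at hcon
  refine h (T.eq_zero_of_dM_eqFun p _ fun w z hz => ?_)
  rw [hz.dM_gen]
  by_cases hp : z p = 0
  · rw [hp, mul_zero]
  · rw [hcon w z hz hp]; simp

theorem dM_imDiv {w : ℤ × ℤ} {z : M → ℂ} (hz : T.EqFun w z) (c : ℂ) (x : M) :
    dM (fun x => imDiv c (z x)) x = (imDiv c).comp (dM (E := E) z x) :=
  dM_comp (hz.smooth x) (imDiv c).hasFDerivAt

theorem imDiv_gen {w : ℤ × ℤ} {z : M → ℂ} (hz : T.EqFun w z) {p : M} (hp : z p ≠ 0) (ξ : ℝ × ℝ) :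
    imDiv (z p) (dM z p (T.gen p ξ)) = 2 * Real.pi * wt w ξ := by
  rw [hz.dM_gen, imDiv_apply]
  have : (z p)⁻¹ * (2 * Real.pi * Complex.I * wt w ξ * z p) =
      ((2 * Real.pi * wt w ξ : ℝ) : ℂ) * Complex.I := by
    push_cast; field_simp
  rw [this]
  simp

theorem imDiv_act {w : ℤ × ℤ} {z : M → ℂ} (hz : T.EqFun w z) {p : M} (hp : z p ≠ 0) (ξ : ℝ × ℝ) :
    imDiv (z p) (z (T.act ξ p)) = Real.sin (2 * Real.pi * wt w ξ) := by
  rw [hz.act, imDiv_apply, ← im_expi]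
  congr 1
  field_simp

theorem smooth_imDiv {w : ℤ × ℤ} {z : M → ℂ} (hz : T.EqFun w z) (c : ℂ) :
    ContMDiff 𝓘(ℝ, E) 𝓘(ℝ, ℝ) ∞ (fun x => imDiv c (z x)) :=
  (imDiv c).contDiff.contMDiff.comp hz.smooth

/-- A linear form vanishing on the image of the differential of the momentum map is the pairing with
some `ξ`. The generator of `ξ` is then `Ω`-orthogonal to every vector, hence zero. -/
theorem surjective_dM_mom {p : M} (h : Function.Injective (T.gen p)) :
    Function.Surjective (dM T.mom p : E → ℝ × ℝ) := by
  rw [← ContinuousLinearMap.coe_coe, ← LinearMap.range_eq_top]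
  by_contra hne
  obtain ⟨f, hf, hle⟩ := Submodule.exists_le_ker_of_lt_top _ (lt_top_iff_ne_top.2 hne)
  have hfd : ∀ a : ℝ × ℝ, f a = dot a (f (1, 0), f (0, 1)) := by
    intro a
    have : a = a.1 • ((1, 0) : ℝ × ℝ) + a.2 • ((0, 1) : ℝ × ℝ) := by ext <;> simp
    conv_lhs => rw [this, map_add, map_smul, map_smul]
    simp only [dot, smul_eq_mul]
  have h1 : T.gen p (f (1, 0), f (0, 1)) = 0 := by
    refine Ω.om_nondeg p fun w => ?_
    rw [T.om_gen, ← hfd]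
    exact hle ⟨w, rfl⟩
  have h2 := T.injective_gen_iff.1 h _ h1
  apply hf
  ext
  · simpa using congrArg Prod.fst h2
  · simpa using congrArg Prod.snd h2

/-- The two momenta and the angles of two equivariant functions with independent weights, non-zero
at `p`, form a chart. Moving `p` in its orbit realises all small changes of the angles. A
stabilising element preserves all four coordinates and therefore acts trivially near `p`. -/
theorem localOrbit_of_injective_gen (hE : Module.finrank ℝ E = 4) {p : M}
    (h : Function.Injective (T.gen p)) :
    T.LocalOrbit p ∧ ∀ τ, T.act τ p = p → ∀ᶠ x in 𝓝 p, T.act τ x = x := by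
  have hg : ∀ ξ, ξ ≠ 0 → T.gen p ξ ≠ 0 := fun ξ hξ h0 => hξ (T.injective_gen_iff.1 h ξ h0)
  obtain ⟨w₁, z₁, hz₁, hp₁, hw₁⟩ := T.exists_eqFun_of_gen_ne_zero (hg (1, 0) (by simp))
  -- The vector `(-w₁.2, w₁.1)` is killed by `w₁`, so a weight that does not kill it is independent
  -- of `w₁`.
  obtain ⟨w₂, z₂, hz₂, hp₂, hw₂⟩ := T.exists_eqFun_of_gen_ne_zero
    (hg (-(w₁.2 : ℝ), (w₁.1 : ℝ)) (fun h0 => by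
      have := congrArg Prod.snd h0
      simp only [wt] at hw₁
      simp at this hw₁
      exact hw₁ this))
  have hdet : w₁.1 * w₂.2 - w₁.2 * w₂.1 ≠ 0 := by
    intro h0
    apply hw₂
    have : ((w₁.1 * w₂.2 - w₁.2 * w₂.1 : ℤ) : ℝ) = 0 := by exact_mod_cast h0
    push_cast at this
    simp only [wt]
    linarith
  set Θ : M → ℝ × ℝ := fun x => (imDiv (z₁ p) (z₁ x), imDiv (z₂ p) (z₂ x)) with hΘ
  have hΘs : ContMDiff 𝓘(ℝ, E) 𝓘(ℝ, ℝ × ℝ) ∞ Θ :=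
    (T.smooth_imDiv hz₁ _).prodMk_space (T.smooth_imDiv hz₂ _)
  have hψ : ContMDiff 𝓘(ℝ, E) 𝓘(ℝ, (ℝ × ℝ) × (ℝ × ℝ)) ∞ (fun x => (T.mom x, Θ x)) :=
    T.smooth_mom.prodMk_space hΘs
  have hbij : Function.Bijective (dM (fun x => (T.mom x, Θ x)) p : E → _) := by
    rw [dM_prodMk (T.smooth_mom p) (hΘs p)]
    refine bijective_prod_of_surjective (dM (E := E) T.mom p).toLinearMap (dM (E := E) Θ p).toLinearMap
      (by simp [hE]) (T.surjective_dM_mom h) fun c => ?_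
    obtain ⟨ξ, h1, h2⟩ := exists_wt_eq hdet (c.1 / (2 * Real.pi)) (c.2 / (2 * Real.pi))
    refine ⟨T.gen p ξ, T.dM_mom_gen p ξ, ?_⟩
    have h3 : dM Θ p (T.gen p ξ) = c := by
      rw [hΘ, dM_prodMk (T.smooth_imDiv hz₁ _ p) (T.smooth_imDiv hz₂ _ p), T.dM_imDiv hz₁,
        T.dM_imDiv hz₂]
      have e1 := T.imDiv_gen hz₁ hp₁ ξ
      have e2 := T.imDiv_gen hz₂ hp₂ ξ
      ext
      · change imDiv (z₁ p) (dM z₁ p (T.gen p ξ)) = c.1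
        rw [e1, h1]; field_simp
      · change imDiv (z₂ p) (dM z₂ p (T.gen p ξ)) = c.2
        rw [e2, h2]; field_simp
    exact h3
  obtain ⟨W, hW, hinj⟩ := exists_injOn_of_injective (hψ p) hbij.1
  refine ⟨?_, fun τ hτ => ?_⟩
  swap
  · have hc : Tendsto (T.act τ) (𝓝 p) (𝓝 p) := by
      have := (T.smooth_act_right τ).continuous.tendsto p
      rwa [hτ] at this
    have hone : ∀ {w : ℤ × ℤ} {z : M → ℂ}, T.EqFun w z → z p ≠ 0 → expi (wt w τ) = 1 := by
      intro w z hz hp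
      have h4 := hz.act τ p
      rw [hτ] at h4
      exact mul_right_cancel₀ hp (by rw [← h4, one_mul])
    filter_upwards [hW, hc.eventually hW] with x hx hx'
    refine hinj hx' hx ?_
    simp only [hΘ, T.mom_act, hz₁.act, hz₂.act, hone hz₁ hp₁, hone hz₂ hp₂, one_mul]
  -- The angles of `x` relative to `p` are recovered by `arcsin`, and the group element with these
  -- angles by Cramer's rule.
  set a₁ : M → ℝ := fun x => Real.arcsin (imDiv (z₁ p) (z₁ x)) / (2 * Real.pi)
  set a₂ : M → ℝ := fun x => Real.arcsin (imDiv (z₂ p) (z₂ x)) / (2 * Real.pi)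
  have hself : ∀ c : ℂ, c ≠ 0 → imDiv c c = 0 := fun c hc => by simp [imDiv_apply, hc]
  have ha₁ : Tendsto a₁ (𝓝 p) (𝓝 0) :=
    tendsto_arcsin_div (T.smooth_imDiv hz₁ _).continuous.continuousAt (hself _ hp₁)
  have ha₂ : Tendsto a₂ (𝓝 p) (𝓝 0) :=
    tendsto_arcsin_div (T.smooth_imDiv hz₂ _).continuous.continuousAt (hself _ hp₂)
  set ζ : M → ℝ × ℝ := fun x => ((a₁ x * w₂.2 - a₂ x * w₁.2) / (w₁.1 * w₂.2 - w₁.2 * w₂.1),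
    (a₂ x * w₁.1 - a₁ x * w₂.1) / (w₁.1 * w₂.2 - w₁.2 * w₂.1)) with hζ
  have hζ0 : Tendsto ζ (𝓝 p) (𝓝 0) := by
    have e1 := ((ha₁.mul_const (w₂.2 : ℝ)).sub (ha₂.mul_const (w₁.2 : ℝ))).div_const
      ((w₁.1 : ℝ) * w₂.2 - w₁.2 * w₂.1)
    have e2 := ((ha₂.mul_const (w₁.1 : ℝ)).sub (ha₁.mul_const (w₂.1 : ℝ))).div_const
      ((w₁.1 : ℝ) * w₂.2 - w₁.2 * w₂.1)
    have := e1.prodMk_nhds e2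
    simp only [zero_mul, sub_zero, zero_div] at this
    exact this
  have hact : Tendsto (fun x => T.act (ζ x) p) (𝓝 p) (𝓝 p) := by
    have := ((T.smooth_act_left p).continuous.tendsto 0).comp hζ0
    rwa [T.act_zero] at this
  have hsmall : ∀ {w : ℤ × ℤ} {z : M → ℂ}, T.EqFun w z → z p ≠ 0 →
      ∀ᶠ x in 𝓝 p, imDiv (z p) (z x) ∈ Icc (-1 : ℝ) 1 := by
    intro w z hz hp
    refine (T.smooth_imDiv hz _).continuous.continuousAt.eventually ?_
    change ∀ᶠ y in 𝓝 (imDiv (z p) (z p)), y ∈ Icc (-1 : ℝ) 1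
    rw [hself _ hp]
    exact Icc_mem_nhds (by norm_num) (by norm_num)
  filter_upwards [hW, hact.eventually hW, hsmall hz₁ hp₁, hsmall hz₂ hp₂] with x hx hx' h1 h2 hmom
  refine ⟨ζ x, hinj hx hx' ?_⟩
  have e1 : wt w₁ (ζ x) = a₁ x := (wt_cramer hdet (a₁ x) (a₂ x)).1
  have e2 : wt w₂ (ζ x) = a₂ x := (wt_cramer hdet (a₁ x) (a₂ x)).2
  have e3 : ∀ y : ℝ, 2 * Real.pi * (y / (2 * Real.pi)) = y := fun y => by field_simp
  simp only [hΘ, T.mom_act, hmom, T.imDiv_act hz₁ hp₁, T.imDiv_act hz₂ hp₂, e1, e2]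
  simp only [a₁, a₂, e3, Real.sin_arcsin h1.1 h1.2, Real.sin_arcsin h2.1 h2.2]

end TorusHam

end

/-! ### Normal forms at singular points -/

noncomputable section

set_option linter.unusedSectionVars false

/-- Integral vectors of the plane. -/
def IsInt (τ : ℝ × ℝ) : Prop := ∃ m n : ℤ, τ = ((m : ℝ), (n : ℝ))

theorem bijective_prod_of_surjective' {X V W : Type} [AddCommGroup X] [Module ℝ X]
    [AddCommGroup V] [Module ℝ V] [AddCommGroup W] [Module ℝ W] [FiniteDimensional ℝ X]
    [FiniteDimensional ℝ V] [FiniteDimensional ℝ W] (L : X →ₗ[ℝ] V) (g : X →ₗ[ℝ] W)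
    (hd : Module.finrank ℝ X = Module.finrank ℝ V + Module.finrank ℝ W)
    (hL : Function.Surjective L) (hg : ∀ c, ∃ v, L v = 0 ∧ g v = c) :
    Function.Bijective (g.prod L) :=
  (Equiv.prodComm V W).bijective.comp (bijective_prod_of_surjective L g hd hL hg)

namespace TorusHam

variable {E : Type} [NormedAddCommGroup E] [NormedSpace ℝ E]
variable {M : Type*} [TopologicalSpace M] [ChartedSpace E M] [IsManifold 𝓘(ℝ, E) ∞ M]
variable {Ω : SymplecticForm E M} (T : TorusHam Ω)

/-- The stabiliser of `x` is the lattice of integral vectors. -/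
def FreeAt (x : M) : Prop :=
  Function.Injective (T.gen x) ∧ ∀ τ, T.act τ x = x → IsInt τ

/-- `p` is a limit of points of free orbits. -/
def NearFree (p : M) : Prop := ∃ᶠ x in 𝓝 p, T.FreeAt x

variable {T} [FiniteDimensional ℝ E]

/-- An element fixing `p` and all chart coordinates acts trivially near `p`, in particular on a
nearby point with stabiliser ℤ². -/
theorem CircleChart.isInt {ξ : ℝ × ℝ} {p : M} {z : M → ℂ} {u : M → ℝ × ℝ}
    (C : T.CircleChart ξ p z u) (hfree : T.NearFree p) {τ : ℝ × ℝ} (hτ : T.act τ p = p)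
    (hz : ∀ x, z (T.act τ x) = z x) (hu : ∀ x, u (T.act τ x) = u x) : IsInt τ := by
  obtain ⟨W, hW, hinj⟩ := exists_injOn_of_injective (C.smooth_pair p) C.bij.1
  have hc : Tendsto (T.act τ) (𝓝 p) (𝓝 p) := by
    have := (T.smooth_act_right τ).continuous.tendsto p
    rwa [hτ] at this
  obtain ⟨x, hx, hxW, hxW'⟩ := (hfree.and_eventually ((hc.eventually hW).and hW)).exists
  refine hx.2 τ (hinj hxW hxW' ?_)
  simp only [hz, hu]

/-- The full turn is the identity in the chart. -/
theorem CircleChart.isInt_self {ξ : ℝ × ℝ} {p : M} {z : M → ℂ} {u : M → ℝ × ℝ}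
    (C : T.CircleChart ξ p z u) (hfree : T.NearFree p) : IsInt ξ := by
  have h1 : T.act ξ p = p := by simpa using C.act_center 1
  refine C.isInt hfree h1 (fun x => ?_) (fun x => ?_)
  · have := C.rot 1 x
    rw [one_smul] at this
    rw [this, show (1 : ℝ) = ((1 : ℤ) : ℝ) by simp, expi_int, one_mul]
  · simpa using C.inv 1 x

/-- Near its centre, the momentum level of the centre of a circle chart has vanishing complex
coordinate. -/
theorem CircleChart.eventually_eq_zero_of_mom_eq {ξ : ℝ × ℝ} {p : M} {z : M → ℂ} {u : M → ℝ × ℝ}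
    (C : T.CircleChart ξ p z u) : ∀ᶠ x in 𝓝 p, T.mom x = T.mom p → z x = 0 := by
  obtain ⟨m, hm, hmz, hm0⟩ := C.exists_mom
  have h1 : ∀ᶠ x in 𝓝 p, m x ≠ 0 := hm.self_of_nhds.continuousAt.eventually_ne hm0
  filter_upwards [hmz, h1] with x h2 h3 h4
  rw [h4, sub_self] at h2
  simpa [h3] using h2.symm

/-- An equivariant function and invariant functions form a circle chart. -/
theorem EqFun.circleChart (hE : Module.finrank ℝ E = 4) {w : ℤ × ℤ} {z f : M → ℂ}
    (hz : T.EqFun w z) {p : M} {ξ : ℝ × ℝ} (hw : wt w ξ = 1) (hg : T.gen p ξ = 0)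
    (hf : ContMDiff 𝓘(ℝ, E) 𝓘(ℝ, ℂ) ∞ f) (hinv : ∀ (s : ℝ) x, f (T.act (s • ξ) x) = f x)
    (hsurj : Function.Surjective (dM f p : E → ℂ)) {v : E} (hv : dM f p v = 0)
    (hv' : dM z p v ≠ 0) : T.CircleChart ξ p z (fun x => ((f x).re, (f x).im)) := by
  set P : ℂ →L[ℝ] ℝ × ℝ := Complex.reCLM.prod Complex.imCLM
  have hPf : (fun x => ((f x).re, (f x).im)) = P ∘ f := rfl
  have hus : ContMDiff 𝓘(ℝ, E) 𝓘(ℝ, ℝ × ℝ) ∞ (fun x => ((f x).re, (f x).im)) :=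
    P.contDiff.contMDiff.comp hf
  have hdu : dM (fun x => ((f x).re, (f x).im)) p = P.comp (dM (E := E) f p) :=
    dM_comp (hf p) P.hasFDerivAt
  have hPi : ∀ c : ℂ, P c = 0 ↔ c = 0 := fun c => by
    simp [P, Complex.ext_iff, Prod.ext_iff]
  have hw0 : wt w ξ ≠ 0 := by rw [hw]; exact one_ne_zero
  refine ⟨hz.smooth, hus, fun s x => ?_, fun s x => ?_, hz.eq_zero_of_fixed hg hw0, ?_⟩
  · rw [hz.act, wt_smul, hw, mul_one]
  · simp only [hinv]
  · rw [dM_prodMk (hz.smooth p) (hus p)]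
    refine bijective_prod_of_surjective' (dM (E := E) (fun x => ((f x).re, (f x).im)) p).toLinearMap
      (dM (E := E) z p).toLinearMap (by simp [hE]) ?_ fun c => ?_
    · rintro ⟨a, b⟩
      obtain ⟨v, hv⟩ := hsurj ⟨a, b⟩
      refine ⟨v, ?_⟩
      rw [hdu]
      change P (dM f p v) = _
      rw [hv]
      rfl
    · have hfix := T.act_smul_eq_self hg
      obtain ⟨v', h1, h2⟩ := hz.surjective_of_rotation hfix hw0 (K := fun v => dM f p v = 0)
        (fun a b v v' h h' => by rw [map_add, map_smul, map_smul, h, h']; simp)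
        (fun t v h => by
          rw [T.dM_act_fixed (hfix t) (hf p)]
          simp only [hinv]
          exact h) hv hv' c
      refine ⟨v', ?_, h2⟩
      rw [hdu]
      change P (dM f p v') = 0
      rw [h1, map_zero]

variable [T2Space M]

/-- Otherwise every equivariant function whose differential is non-zero somewhere on the kernel of
`df` would have weight zero on `ξ`. Then `f` and the equivariant functions of weight zero on `ξ`,
all invariant under the group of `ξ`, would separate tangent vectors at `p`, and that group would
act trivially near `p`. -/
theorem exists_eqFun_wt_ne_zero {p : M} (hfree : T.NearFree p) {ξ : ℝ × ℝ} (hξ : ξ ≠ 0)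
    {f : M → ℂ} (hf : ContMDiff 𝓘(ℝ, E) 𝓘(ℝ, ℂ) ∞ f)
    (hinv : ∀ (s : ℝ) x, f (T.act (s • ξ) x) = f x) :
    ∃ w z, T.EqFun w z ∧ wt w ξ ≠ 0 ∧ ∃ v, dM f p v = 0 ∧ dM (E := E) z p v ≠ 0 := by
  by_contra hcon
  push Not at hcon
  have h1 : ∀ᶠ x in 𝓝 p, T.gen x ξ = 0 := by
    refine T.eventually_gen_eq_zero fun v hv => ?_
    by_cases hfv : dM f p v = 0
    · obtain ⟨w, z, hz, hne⟩ : ∃ w z, T.EqFun w z ∧ dM z p v ≠ 0 := by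
        by_contra hall
        push Not at hall
        exact hv (T.eq_zero_of_dM_eqFun p v hall)
      have hw : wt w ξ = 0 := by
        by_contra hw
        exact hne (hcon w z hz hw v hfv)
      refine ⟨z, hz.smooth, fun s x => ?_, hne⟩
      rw [hz.act, wt_smul, hw, mul_zero, expi_zero, one_mul]
    · exact ⟨f, hf, hinv, hfv⟩
  obtain ⟨x, hx, hx'⟩ := (hfree.and_eventually h1).exists
  exact hξ (T.injective_gen_iff.1 hx.1 ξ hx')

variable (T) in
/-- The normal form of the action at a point of a one-dimensional orbit. -/
structure RankOne (p : M) (w : ℤ × ℤ) (z : M → ℂ) (ξ : ℝ × ℝ) : Prop where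
  eqFun : T.EqFun w z
  wt_eq : wt w ξ = 1
  chart : ∃ u, T.CircleChart ξ p z u
  isInt : IsInt ξ
  degenerate : ∀ᶠ x in 𝓝 p, ¬ Function.Injective (T.gen x) → z x = 0
  stab : ∀ τ, T.act τ p = p → IsInt (τ - wt w τ • ξ)
  localOrbit : T.LocalOrbit p

/-- Along the one-dimensional orbit and across its momentum levels, coordinates are given by the
momentum of `η` and the angle of an equivariant function `z₁` non-vanishing at `p`. Both are
invariant under `ξ₀`. The remaining complex coordinate is an equivariant function of non-zero weight
on `ξ₀`, which is rescaled so that this weight is one. -/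
theorem exists_rankOne (hE : Module.finrank ℝ E = 4) {p : M} (hfree : T.NearFree p)
    {ξ₀ η : ℝ × ℝ} (hξ₀ : ξ₀ ≠ 0) (hgξ : T.gen p ξ₀ = 0) (hgη : T.gen p η ≠ 0) :
    ∃ w z ξ, T.RankOne p w z ξ := by
  obtain ⟨w₁, z₁, hz₁, hp₁, hw₁⟩ := T.exists_eqFun_of_gen_ne_zero hgη
  have hw₁0 := hz₁.wt_eq_zero hgξ hp₁
  set f₂ : M → ℝ := fun x => imDiv (z₁ p) (z₁ x) with hf₂
  have hf₁s := T.smooth_dot_mom η 0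
  have hf₂s := T.smooth_imDiv hz₁ (z₁ p)
  set f : M → ℂ := fun x => Complex.equivRealProdCLM.symm (dot (T.mom x) η - 0, f₂ x) with hf
  have hfs : ContMDiff 𝓘(ℝ, E) 𝓘(ℝ, ℂ) ∞ f :=
    Complex.equivRealProdCLM.symm.contDiff.contMDiff.comp (hf₁s.prodMk_space hf₂s)
  have hdf : ∀ v : E, dM f p v = Complex.equivRealProdCLM.symm
      (dot (dM T.mom p v) η, imDiv (z₁ p) (dM z₁ p v)) := by
    intro v
    have h1 : dM (E := E) f p = _ := dM_comp ((hf₁s.prodMk_space hf₂s) p)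
      Complex.equivRealProdCLM.symm.hasFDerivAt
    rw [h1, dM_prodMk (hf₁s p) (hf₂s p), T.dM_imDiv hz₁]
    simp only [ContinuousLinearMap.comp_apply, ContinuousLinearMap.prod_apply, T.dM_dot_mom]
    rfl
  have hinv₁ : ∀ τ, expi (wt w₁ τ) = 1 → ∀ x, f (T.act τ x) = f x := by
    intro τ hτ x
    simp only [hf, hf₂, T.mom_act, hz₁.act, hτ, one_mul]
  have hinv : ∀ (s : ℝ) x, f (T.act (s • ξ₀) x) = f x := fun s x =>
    hinv₁ _ (by rw [wt_smul, hw₁0, mul_zero, expi_zero]) x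
  obtain ⟨w, z, hz, hw, v, hv, hv'⟩ := exists_eqFun_wt_ne_zero hfree hξ₀ hfs hinv
  set ξ : ℝ × ℝ := (1 / wt w ξ₀) • ξ₀ with hξ
  have hwξ : wt w ξ = 1 := by rw [hξ, wt_smul]; field_simp
  have hgξ' : T.gen p ξ = 0 := by rw [hξ, map_smul, hgξ, smul_zero]
  have hinvξ : ∀ (s : ℝ) x, f (T.act (s • ξ) x) = f x := fun s x => by
    rw [hξ, smul_smul]; exact hinv _ x
  have hsurj : Function.Surjective (dM f p : E → ℂ) := by
    obtain ⟨v₀, hv₀⟩ : ∃ v₀ : E, dot (dM T.mom p v₀) η ≠ 0 := by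
      by_contra hall
      push Not at hall
      exact hgη (Ω.om_nondeg p fun w => by rw [T.om_gen, hall])
    intro c
    have h1 := T.imDiv_gen hz₁ hp₁ η
    have h0 := T.dM_mom_gen p η
    set d := dot (dM T.mom p v₀) η with hd
    set e := imDiv (z₁ p) (dM z₁ p v₀)
    refine ⟨(c.re / d) • v₀ + ((c.im - c.re / d * e) / (2 * Real.pi * wt w₁ η)) • T.gen p η, ?_⟩
    rw [hdf]
    have e1 : dot (dM T.mom p ((c.re / d) • v₀ +
        ((c.im - c.re / d * e) / (2 * Real.pi * wt w₁ η)) • T.gen p η)) η = c.re := by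
      rw [map_add, map_smul, map_smul, h0, smul_zero, add_zero]
      have : dot ((c.re / d) • dM T.mom p v₀) η = c.re / d * d := by
        simp only [hd, dot, Prod.smul_fst, Prod.smul_snd, smul_eq_mul]; ring
      rw [this, div_mul_cancel₀ _ hv₀]
    have e2 : imDiv (z₁ p) (dM z₁ p ((c.re / d) • v₀ +
        ((c.im - c.re / d * e) / (2 * Real.pi * wt w₁ η)) • T.gen p η)) = c.im := by
      rw [map_add, map_smul, map_smul, map_add, map_smul, map_smul, h1, smul_eq_mul, smul_eq_mul,
        div_mul_cancel₀ _ (by positivity)]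
      ring
    rw [e1, e2]
    rfl
  have C := hz.circleChart hE hwξ hgξ' hfs hinvξ hsurj hv hv'
  have hdet : w₁.1 * w.2 - w₁.2 * w.1 ≠ 0 := by
    intro h0
    have h1 := wt_det w₁ w ξ₀ η
    rw [h0, hw₁0] at h1
    simp only [Int.cast_zero, zero_mul, zero_sub, zero_eq_neg, mul_eq_zero] at h1
    exact h1.elim hw₁ hw
  refine ⟨w, z, ξ, hz, hwξ, ⟨_, C⟩, C.isInt_self hfree, ?_, ?_, ?_⟩
  -- Where `z₁` and `z` are both non-zero, a direction with vanishing generator is killed by two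
  -- independent weights.
  · filter_upwards [hz₁.smooth.continuous.continuousAt.eventually_ne hp₁] with x hx hinj
    rw [T.injective_gen_iff] at hinj
    push Not at hinj
    obtain ⟨ζ, h1, h2⟩ := hinj
    by_contra hzx
    exact h2 (eq_zero_of_wt_eq_zero hdet (hz₁.wt_eq_zero h1 hx) (hz.wt_eq_zero h1 hzx))
  -- Subtracting the multiple of `ξ` that accounts for the rotation of `z` leaves an element fixing
  -- `p` and all chart coordinates.
  · intro τ hτ
    have h1 : T.act (τ - wt w τ • ξ) p = p := by
      rw [sub_eq_add_neg, T.act_add, ← neg_smul, C.act_center, hτ]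
    have h2 : wt w (τ - wt w τ • ξ) = 0 := by rw [wt_sub, wt_smul, hwξ]; ring
    have h3 : expi (wt w₁ (τ - wt w τ • ξ)) = 1 := by
      have h4 := hz₁.act (τ - wt w τ • ξ) p
      rw [h1] at h4
      exact mul_right_cancel₀ hp₁ (by rw [← h4, one_mul])
    refine C.isInt hfree h1 (fun x => ?_) (fun x => ?_)
    · rw [hz.act, h2, expi_zero, one_mul]
    · simp only [hinv₁ _ h3]
  -- On the momentum level of `p` the coordinate `z` vanishes and only the angle `f₂` is free;
  -- moving `p` along `η` adjusts it.
  · obtain ⟨W, hW, hinj⟩ := exists_injOn_of_injective (C.smooth_pair p) C.bij.1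
    set s : M → ℝ := fun x => Real.arcsin (f₂ x) / (2 * Real.pi) / wt w₁ η with hs
    have hself : f₂ p = 0 := by simp only [hf₂, imDiv_apply, inv_mul_cancel₀ hp₁, Complex.one_im]
    have hf₂c : ContinuousAt f₂ p := hf₂s.continuous.continuousAt
    have hs0 : Tendsto s (𝓝 p) (𝓝 0) := by
      have := (tendsto_arcsin_div hf₂c hself).div_const (wt w₁ η)
      rwa [zero_div] at this
    have hact : Tendsto (fun x => T.act (s x • η) p) (𝓝 p) (𝓝 p) := by
      have h1 : Tendsto (fun x => s x • η) (𝓝 p) (𝓝 0) := by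
        have := hs0.smul_const η
        rwa [zero_smul] at this
      have := ((T.smooth_act_left p).continuous.tendsto 0).comp h1
      rwa [T.act_zero] at this
    have hsmall : ∀ᶠ x in 𝓝 p, f₂ x ∈ Icc (-1 : ℝ) 1 := by
      refine hf₂c.eventually ?_
      rw [hself]
      exact Icc_mem_nhds (by norm_num) (by norm_num)
    filter_upwards [hW, hact.eventually hW, hsmall, C.eventually_eq_zero_of_mom_eq]
      with x hx hx' h1 h2 hmom
    refine ⟨s x • η, hinj hx hx' ?_⟩
    have e1 : wt w₁ (s x • η) = Real.arcsin (f₂ x) / (2 * Real.pi) := by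
      rw [wt_smul, hs]; exact div_mul_cancel₀ _ hw₁
    have e2 : f₂ (T.act (s x • η) p) = f₂ x := by
      have h3 := T.imDiv_act hz₁ hp₁ (s x • η)
      rw [e1, mul_div_cancel₀ _ (by positivity), Real.sin_arcsin h1.1 h1.2] at h3
      exact h3
    have e3 : f (T.act (s x • η) p) = f x := by simp only [hf, e2, T.mom_act, hmom]
    simp only [e3, hz.act, C.z_eq, h2 hmom, mul_zero]

variable (T) in
/-- The normal form of the action at a fixed point. -/
structure RankZero (p : M) (w₁ : ℤ × ℤ) (z₁ : M → ℂ) (w₂ : ℤ × ℤ) (z₂ : M → ℂ)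
    (ξ₁ ξ₂ : ℝ × ℝ) : Prop where
  eqFun₁ : T.EqFun w₁ z₁
  eqFun₂ : T.EqFun w₂ z₂
  wt₁₁ : wt w₁ ξ₁ = 1
  wt₁₂ : wt w₁ ξ₂ = 0
  wt₂₁ : wt w₂ ξ₁ = 0
  wt₂₂ : wt w₂ ξ₂ = 1
  chart₁ : ∃ u, T.CircleChart ξ₁ p z₁ u
  chart₂ : ∃ u, T.CircleChart ξ₂ p z₂ u
  isInt₁ : IsInt ξ₁
  isInt₂ : IsInt ξ₂
  degenerate : ∀ᶠ x in 𝓝 p, ¬ Function.Injective (T.gen x) → z₁ x = 0 ∨ z₂ x = 0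
  localOrbit : T.LocalOrbit p

/-- At a fixed point two complex coordinates with independent weights are obtained one after the
other. The vectors `ξ₁`, `ξ₂` are dual to the weights, so each rotates one coordinate and fixes the
other, and there is a circle chart for each. -/
theorem exists_rankZero (hE : Module.finrank ℝ E = 4) {p : M} (hfree : T.NearFree p)
    (hg : ∀ ξ, T.gen p ξ = 0) : ∃ w₁ z₁ w₂ z₂ ξ₁ ξ₂, T.RankZero p w₁ z₁ w₂ z₂ ξ₁ ξ₂ := by
  obtain ⟨w₁, z₁, hz₁, hw₁, v₁, -, hv₁⟩ := exists_eqFun_wt_ne_zero hfree (ξ := ((1, 0) : ℝ × ℝ))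
    (by simp) (f := fun _ => 0) contMDiff_const (fun _ _ => rfl)
  have hw₁1 : (w₁.1 : ℝ) ≠ 0 := by simpa [wt] using hw₁
  have hwz : wt w₁ (-(w₁.2 : ℝ), (w₁.1 : ℝ)) = 0 := by simp only [wt]; ring
  -- The second weight is non-zero on a vector killed by the first, and `dz₂` is non-zero on the
  -- kernel of `dz₁`.
  obtain ⟨w₂, z₂, hz₂, hw₂, v₂, hv₂, hv₂'⟩ := exists_eqFun_wt_ne_zero hfree
    (ξ := (-(w₁.2 : ℝ), (w₁.1 : ℝ))) (fun h => hw₁1 (congrArg Prod.snd h)) hz₁.smooth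
    (fun s x => by rw [hz₁.act, wt_smul, hwz, mul_zero, expi_zero, one_mul])
  have hdet : w₁.1 * w₂.2 - w₁.2 * w₂.1 ≠ 0 := by
    intro h0
    apply hw₂
    have : ((w₁.1 * w₂.2 - w₁.2 * w₂.1 : ℤ) : ℝ) = 0 := by exact_mod_cast h0
    push_cast at this
    simp only [wt]
    linarith
  obtain ⟨ξ₁, h11, h21⟩ := exists_wt_eq hdet 1 0
  obtain ⟨ξ₂, h12, h22⟩ := exists_wt_eq hdet 0 1
  have hinv₁ : ∀ (s : ℝ) x, z₁ (T.act (s • ξ₂) x) = z₁ x := fun s x => by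
    rw [hz₁.act, wt_smul, h12, mul_zero, expi_zero, one_mul]
  have hinv₂ : ∀ (s : ℝ) x, z₂ (T.act (s • ξ₁) x) = z₂ x := fun s x => by
    rw [hz₂.act, wt_smul, h21, mul_zero, expi_zero, one_mul]
  have hfix : ∀ τ, T.act τ p = p := fun τ => by simpa using T.act_smul_eq_self (hg τ) 1
  have hs₁ : Function.Surjective (dM z₁ p : E → ℂ) := fun c => by
    obtain ⟨v, -, hv⟩ := hz₁.surjective_of_rotation (fun t => hfix (t • ξ₁))
      (by rw [h11]; exact one_ne_zero) (K := fun _ => True) (fun _ _ _ _ _ _ => trivial)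
      (fun _ _ _ => trivial) (v := v₁) trivial hv₁ c
    exact ⟨v, hv⟩
  have hs₂ : ∀ c, ∃ v, dM z₁ p v = 0 ∧ dM (E := E) z₂ p v = c :=
    hz₂.surjective_of_rotation (fun t => hfix (t • ξ₂)) (by rw [h22]; exact one_ne_zero)
      (K := fun v => dM z₁ p v = 0)
      (fun a b v v' h h' => by rw [map_add, map_smul, map_smul, h, h']; simp)
      (fun t v h => by
        rw [T.dM_act_fixed (hfix _) (hz₁.smooth p)]
        simp only [hinv₁]
        exact h) hv₂ hv₂'
  have C₂ := hz₂.circleChart hE h22 (hg ξ₂) hz₁.smooth hinv₁ hs₁ hv₂ hv₂'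
  -- For the chart of the first circle the roles of the coordinates are exchanged: `a - b` lies in
  -- the kernel of `dz₂` and `dz₁` maps it to one.
  obtain ⟨a, ha⟩ := hs₁ 1
  obtain ⟨b, hb, hb'⟩ := hs₂ (dM z₂ p a)
  have C₁ := hz₁.circleChart hE h11 (hg ξ₁) hz₂.smooth hinv₂
    (fun c => (hs₂ c).imp fun v hv => hv.2) (v := a - b) (by rw [map_sub, hb', sub_self])
    (by rw [map_sub, ha, hb, sub_zero]; exact one_ne_zero)
  refine ⟨w₁, z₁, w₂, z₂, ξ₁, ξ₂, hz₁, hz₂, h11, h12, h21, h22, ⟨_, C₁⟩, ⟨_, C₂⟩,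
    C₁.isInt_self hfree, C₂.isInt_self hfree, ?_, ?_⟩
  · refine Eventually.of_forall fun x hinj => ?_
    rw [T.injective_gen_iff] at hinj
    push Not at hinj
    obtain ⟨ζ, h1, h2⟩ := hinj
    by_contra! hzx
    exact h2 (eq_zero_of_wt_eq_zero hdet (hz₁.wt_eq_zero h1 hzx.1) (hz₂.wt_eq_zero h1 hzx.2))
  · obtain ⟨W, hW, hinj⟩ := exists_injOn_of_injective (C₁.smooth_pair p) C₁.bij.1
    filter_upwards [hW, C₁.eventually_eq_zero_of_mom_eq, C₂.eventually_eq_zero_of_mom_eq]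
      with x hx h1 h2 hmom
    refine ⟨0, ?_⟩
    rw [T.act_zero]
    refine hinj hx (mem_of_mem_nhds hW) ?_
    simp only [h1 hmom, h2 hmom, C₁.z_eq, C₂.z_eq]

end TorusHam

end

/-! ### Toric models -/

noncomputable section

set_option linter.unusedSectionVars false

variable {M : Type*} [TopologicalSpace M]
variable {B : Type*} [TopologicalSpace B]

section

variable {E : Type} [NormedAddCommGroup E] [NormedSpace ℝ E]
variable [ChartedSpace E M] [IsManifold 𝓘(ℝ, E) ∞ M]
variable {Ω : SymplecticForm E M}

/-- A proper map with connected fibres through which, up to a locally injective map of the base,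
the momentum map factors, such that the action is free over a dense set. -/
structure ToricModel (T : TorusHam Ω) (F : M → B) (Φ : B → ℝ × ℝ) : Prop where
  mom_eq : ∀ x, T.mom x = Φ (F x)
  locInj : ∀ b, ∃ U ∈ 𝓝 b, InjOn Φ U
  proper : IsProperMap F
  conn : ∀ b, IsConnected (F ⁻¹' {b})
  dense : Dense {b | (∀ x, F x = b → Function.Injective (T.gen x)) ∧
    ∀ τ, (∀ x, F x = b → T.act τ x = x) → IsInt τ}

namespace ToricModel

variable {T : TorusHam Ω} {F : M → B} {Φ : B → ℝ × ℝ}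

theorem surjective (h : ToricModel T F Φ) : Function.Surjective F := fun b =>
  (h.conn b).nonempty

/-- Proper maps are closed, so a neighbourhood of one fibre contains all nearby fibres. -/
theorem exists_nhds_preimage_subset (h : ToricModel T F Φ) {b : B} {N : Set M} (hN : IsOpen N)
    (hb : ∀ x, F x = b → x ∈ N) : ∀ᶠ b' in 𝓝 b, ∀ x, F x = b' → x ∈ N := by
  have h1 : IsClosed (F '' Nᶜ) := h.proper.isClosedMap _ hN.isClosed_compl
  have h2 : b ∈ (F '' Nᶜ)ᶜ := by
    rintro ⟨x, hx, rfl⟩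
    exact hx (hb x rfl)
  filter_upwards [h1.isOpen_compl.mem_nhds h2] with b' hb' x hx
  by_contra hxN
  exact hb' ⟨x, hxN, hx⟩

/-- Along an orbit the momentum `Φ ∘ F` is constant; as `Φ` is locally injective, `F` is locally
constant along it. -/
theorem F_act [T2Space B] (h : ToricModel T F Φ) (ξ : ℝ × ℝ) (x : M) : F (T.act ξ x) = F x := by
  set c : ℝ → B := fun t => F (T.act (t • ξ) x)
  have hc : Continuous c := h.proper.continuous.comp
    ((T.smooth_act_left x).continuous.comp (by fun_prop))
  have hΦ : ∀ t, Φ (c t) = T.mom x := fun t => by rw [← h.mom_eq, T.mom_act]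
  have hcl : IsClopen {t | c t = c 0} := by
    refine ⟨isClosed_eq hc continuous_const, ?_⟩
    rw [isOpen_iff_mem_nhds]
    intro t ht
    obtain ⟨U, hU, hinj⟩ := h.locInj (c t)
    filter_upwards [hc.continuousAt.eventually hU] with s hs
    have : c s = c t := hinj hs (mem_of_mem_nhds hU) (by rw [hΦ, hΦ])
    exact this.trans ht
  have h1 : (1 : ℝ) ∈ {t | c t = c 0} := by
    rw [hcl.eq_univ ⟨0, rfl⟩]; trivial
  simpa [c, T.act_zero] using h1

/-- The saturation of a neighbourhood of `p` is a neighbourhood of the whole orbit. It serves to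
spread properties that hold near `p`. -/
theorem eventually_orbit_subset {p : M} {W : Set M} (hW : W ∈ 𝓝 p) :
    ∃ N : Set M, IsOpen N ∧ (∀ ζ, T.act ζ p ∈ N) ∧ ∀ x ∈ N, ∃ ζ, ∃ y ∈ W, x = T.act ζ y := by
  refine ⟨⋃ ζ, T.actHomeo ζ '' interior W, isOpen_iUnion fun ζ =>
    (T.actHomeo ζ).isOpenMap _ isOpen_interior, fun ζ => ?_, ?_⟩
  · exact mem_iUnion.2 ⟨ζ, p, mem_interior_iff_mem_nhds.2 hW, rfl⟩
  · intro x hx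
    obtain ⟨ζ, y, hy, rfl⟩ := mem_iUnion.1 hx
    exact ⟨ζ, y, interior_subset hy, rfl⟩

theorem isCompact_orbit (p : M) : IsCompact (range fun ξ => T.act ξ p) := by
  have h1 : (range fun ξ => T.act ξ p) = (fun ξ => T.act ξ p) '' (Icc (0 : ℝ) 1 ×ˢ Icc (0 : ℝ) 1) := by
    refine Subset.antisymm ?_ (image_subset_range _ _)
    rintro _ ⟨ξ, rfl⟩
    refine ⟨(Int.fract ξ.1, Int.fract ξ.2), ⟨⟨Int.fract_nonneg _, (Int.fract_lt_one _).le⟩,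
      ⟨Int.fract_nonneg _, (Int.fract_lt_one _).le⟩⟩, ?_⟩
    have h2 := T.act_add_int (Int.fract ξ.1, Int.fract ξ.2) ⌊ξ.1⌋ ⌊ξ.2⌋ p
    simp only
    rw [← h2]
    congr 1
    ext
    · exact Int.fract_add_floor ξ.1
    · exact Int.fract_add_floor ξ.2
  rw [h1]
  exact (isCompact_Icc.prod isCompact_Icc).image (T.smooth_act_left p).continuous

/-- The orbit of `p` is compact, hence closed. Since the momentum level locally lies in the orbit,
the orbit is also relatively open in the fibre, which is connected. -/
theorem fibre_eq_orbit [T2Space M] (h : ToricModel T F Φ) {p : M} (hp : T.LocalOrbit p)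
    {x : M} (hx : F x = F p) : ∃ ξ, x = T.act ξ p := by
  by_contra hcon
  obtain ⟨N, hNo, hN, hN'⟩ := eventually_orbit_subset (T := T) hp
  set O := range fun ξ => T.act ξ p
  have hO : IsOpen Oᶜ := (isCompact_orbit (T := T) p).isClosed.isOpen_compl
  have key : ∀ y ∈ N, F y = F p → y ∈ O := by
    intro y hy hyF
    obtain ⟨ζ, y', hy', rfl⟩ := hN' y hy
    have : T.mom y' = T.mom p := by
      rw [← T.mom_act ζ y', h.mom_eq, h.mom_eq, hyF]
    obtain ⟨ξ, rfl⟩ := hy' this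
    exact ⟨ζ + ξ, T.act_add ζ ξ p⟩
  have hpN : p ∈ N := by simpa [T.act_zero] using hN 0
  obtain ⟨y, hyF, hyN, hyO⟩ := (h.conn (F p)).isPreconnected N Oᶜ hNo hO
    (fun y hy => by
      by_cases hyO : y ∈ O
      · obtain ⟨ζ, rfl⟩ := hyO; exact Or.inl (hN ζ)
      · exact Or.inr hyO)
    ⟨p, rfl, hpN⟩ ⟨x, hx, fun ⟨ξ, hξ⟩ => hcon ⟨ξ, hξ.symm⟩⟩
  exact hyO (key y hyN hyF)

variable [T2Space M]

/-- Points over nearby points of the base may be found near a given point of the fibre. -/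
theorem eventually_exists_mem [T2Space B] (h : ToricModel T F Φ) {p : M} (hp : T.LocalOrbit p)
    {W : Set M} (hW : W ∈ 𝓝 p) : ∀ᶠ b in 𝓝 (F p), ∃ x ∈ W, F x = b := by
  obtain ⟨N, hNo, hN, hN'⟩ := eventually_orbit_subset (T := T) hW
  have h1 := h.exists_nhds_preimage_subset (b := F p) hNo fun x hx => by
    obtain ⟨ξ, rfl⟩ := h.fibre_eq_orbit hp hx
    exact hN ξ
  filter_upwards [h1] with b hb
  obtain ⟨x, rfl⟩ := h.surjective b
  obtain ⟨ζ, y, hy, rfl⟩ := hN' x (hb x rfl)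
  exact ⟨y, hy, (h.F_act ζ y).symm⟩

variable [FiniteDimensional ℝ E]

/-- If no point over `b` were such a limit, then by properness the same would hold over nearby good
base points. Over a good base point the fibre is one orbit of an abelian group, so an element fixing
one point fixes the fibre and is integral. -/
theorem exists_nearFree (hE : Module.finrank ℝ E = 4) (h : ToricModel T F Φ) (b : B) :
    ∃ p, F p = b ∧ T.NearFree p := by
  by_contra hcon
  push Not at hcon
  set N : Set M := {p | ¬ T.NearFree p}
  have hNo : IsOpen N := by
    have : N = {p | ∀ᶠ x in 𝓝 p, ¬ T.FreeAt x} := by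
      ext p; simp [N, TorusHam.NearFree]
    rw [this]
    exact isOpen_setOfPred_eventually_nhds
  obtain ⟨b', ⟨hb1, hb2⟩, hb'⟩ :=
    (h.dense.inter_nhds_nonempty (h.exists_nhds_preimage_subset hNo hcon))
  obtain ⟨x, rfl⟩ := h.surjective b'
  have hgen := hb1 x rfl
  have hfree : T.FreeAt x := by
    refine ⟨hgen, fun τ hτ => hb2 τ fun y hy => ?_⟩
    obtain ⟨ξ, rfl⟩ := h.fibre_eq_orbit (T.localOrbit_of_injective_gen hE hgen).1 hy
    rw [T.act_comm, hτ]
  refine hb' x rfl fun hcon => ?_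
  exact hcon.self_of_nhds hfree

end ToricModel

end

end

/-! ### The dimension of fibres -/

noncomputable section

set_option linter.unusedSectionVars false

variable {E : Type} [NormedAddCommGroup E] [NormedSpace ℝ E]
variable {M : Type*} [TopologicalSpace M] [ChartedSpace E M] [IsManifold 𝓘(ℝ, E) ∞ M]

/-- The dimension of an immersed manifold is at most that of any manifold parametrising it. -/
theorem finrank_le_of_range_subset [FiniteDimensional ℝ E] {V V' : Type}
    [NormedAddCommGroup V] [NormedSpace ℝ V] [FiniteDimensional ℝ V]
    [NormedAddCommGroup V'] [NormedSpace ℝ V'] [FiniteDimensional ℝ V']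
    {c : V → M} {c' : V' → M} {v : V} (hc : ContMDiffAt 𝓘(ℝ, V) 𝓘(ℝ, E) ∞ c v)
    (hc' : ContMDiff 𝓘(ℝ, V') 𝓘(ℝ, E) ∞ c')
    (hinj : Function.Injective (dMap (E := E) (E' := V) c v : V → E))
    (hsub : range c ⊆ range c') : Module.finrank ℝ V ≤ Module.finrank ℝ V' := by
  have : CompleteSpace V := FiniteDimensional.complete ℝ V
  have hcs : c v ∈ (ch E (c v)).source := mem_ch_source (E := E) (c v)
  have h1 : ContDiffAt ℝ ∞ (ch E (c v) ∘ c) v :=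
    (ContMDiffAt.comp v (contMDiffAt_ch hcs) hc).contDiffAt
  obtain ⟨L, hL⟩ := ContinuousLinearMap.HasLeftInverse.of_injective_of_finiteDimensional hinj
  have h2 : HasStrictFDerivAt (L ∘ (ch E (c v) ∘ c))
      ((ContinuousLinearEquiv.refl ℝ V : V ≃L[ℝ] V) : V →L[ℝ] V) v := by
    have h3 : HasStrictFDerivAt (L ∘ (ch E (c v) ∘ c))
        (L.comp (dMap (E := E) (E' := V) c v)) v :=
      L.hasStrictFDerivAt.comp v (h1.hasStrictFDerivAt (by simp))
    have h4 : L.comp (dMap (E := E) (E' := V) c v) =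
        ((ContinuousLinearEquiv.refl ℝ V : V ≃L[ℝ] V) : V →L[ℝ] V) := by
      ext w
      exact hL w
    rwa [h4] at h3
  have h5 : c ⁻¹' (ch E (c v)).source ∈ 𝓝 v :=
    hc.continuousAt.preimage_mem_nhds (ch_source_mem_nhds hcs)
  have h6 : (L ∘ (ch E (c v) ∘ c)) '' (c ⁻¹' (ch E (c v)).source) ∈
      𝓝 ((L ∘ (ch E (c v) ∘ c)) v) := by
    rw [← h2.map_nhds_eq_of_equiv]
    exact image_mem_map h5
  have h7 : (L ∘ (ch E (c v) ∘ c)) '' (c ⁻¹' (ch E (c v)).source) ⊆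
      (L ∘ (ch E (c v) ∘ c')) '' (c' ⁻¹' (ch E (c v)).source) := by
    rintro _ ⟨w, hw, rfl⟩
    obtain ⟨w', hw'⟩ := hsub ⟨w, rfl⟩
    refine ⟨w', ?_, ?_⟩
    · rw [mem_preimage, hw']; exact hw
    · simp only [Function.comp_apply, hw']
  -- Smooth maps are locally Lipschitz and do not raise the Hausdorff dimension, while the set on
  -- the left contains a neighbourhood in `V`.
  have h8 : dimH ((L ∘ (ch E (c v) ∘ c')) '' (c' ⁻¹' (ch E (c v)).source)) ≤
      dimH (c' ⁻¹' (ch E (c v)).source) := by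
    refine dimH_image_le_of_locally_lipschitzOn fun w hw => ?_
    have h9 : ContDiffAt ℝ ∞ (L ∘ (ch E (c v) ∘ c')) w :=
      L.contDiff.contDiffAt.comp w (ContMDiffAt.comp w (contMDiffAt_ch hw) (hc' w)).contDiffAt
    obtain ⟨K, t, ht, hK⟩ := (h9.of_le (m := 1) (by simp)).exists_lipschitzOnWith
    exact ⟨K, t, mem_nhdsWithin_of_mem_nhds ht, hK⟩
  have h10 := (dimH_mono h7).trans (h8.trans (dimH_mono (subset_univ _)))
  rw [Real.dimH_of_mem_nhds h6, Real.dimH_univ_eq_finrank] at h10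
  exact_mod_cast h10

theorem mfderiv_eq_dMap {V : Type} [NormedAddCommGroup V] [NormedSpace ℝ V] {c : V → M} {v : V}
    (hc : ContMDiffAt 𝓘(ℝ, V) 𝓘(ℝ, E) ∞ c v) :
    mfderiv 𝓘(ℝ, V) 𝓘(ℝ, E) c v =
      (show TangentSpace 𝓘(ℝ, V) v →L[ℝ] TangentSpace 𝓘(ℝ, E) (c v) from
        dMap (E := E) (E' := V) c v) := by
  refine HasMFDerivAt.mfderiv ⟨hc.continuousAt, ?_⟩
  simp only [writtenInExtChartAt, extChartAt_model_space_eq_id, modelWithCornersSelf_coe, range_id]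
  have h1 : ContDiffAt ℝ ∞ (ch E (c v) ∘ c) v :=
    (ContMDiffAt.comp v (contMDiffAt_ch (mem_ch_source (E := E) (c v))) hc).contDiffAt
  exact (h1.differentiableAt (by simp)).hasFDerivAt.hasFDerivWithinAt

variable {Ω : SymplecticForm E M} [T2Space M] [FiniteDimensional ℝ E]
variable {B : Type*} [TopologicalSpace B] [T2Space B]

/-- The fibre of the momentum map being an embedded torus, its dimension is the rank of the action. -/
theorem ToricModel.finrank_ker_gen {T : TorusHam Ω} {F : M → B} {Φ : B → ℝ × ℝ}
    (h : ToricModel T F Φ) {p : M} (hp : T.LocalOrbit p) {l : ℕ}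
    (hl : IsEmbeddedTorus E l (F ⁻¹' {F p})) :
    Module.finrank ℝ (LinearMap.ker (T.gen p).toLinearMap) + l = 2 := by
  obtain ⟨f, hf, hrange, hsm, hinj⟩ := hl
  -- A complement of the isotropy algebra parametrises the whole orbit, immersively at `0`. The
  -- fibre is thus covered both by a map from `K` and by one from `ℝˡ`, and the dimensions are
  -- compared both ways.
  obtain ⟨K, hK⟩ := Submodule.exists_isCompl (LinearMap.ker (T.gen p).toLinearMap)
  have hdim := Submodule.finrank_add_eq_of_isCompl hK
  rw [Module.finrank_prod, Module.finrank_self] at hdim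
  set c : K → M := fun v => T.act (v : ℝ × ℝ) p with hcdef
  have hcs : ContMDiff 𝓘(ℝ, K) 𝓘(ℝ, E) ∞ c :=
    (T.smooth_act_left p).comp K.subtypeL.contDiff.contMDiff
  have hcinj : Function.Injective (dMap (E := E) (E' := K) c 0 : K → E) := by
    have h1 : dMap (E := E) (E' := K) c 0 = (T.gen p).comp K.subtypeL := by
      have h2 := dMap_comp (E := E) (E' := ℝ × ℝ) (E'' := K) (g := fun ξ => T.act ξ p)
        (h := K.subtypeL) (x := (0 : K)) (T.smooth_act_left p _) (K.subtypeL.contDiff.contMDiff _)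
      have h3 : dMap (E := ℝ × ℝ) (E' := K) K.subtypeL 0 = K.subtypeL :=
        (K.subtypeL.hasFDerivAt (x := 0)).fderiv
      have h4 : dMap (E := E) (E' := ℝ × ℝ) (fun ξ => T.act ξ p) 0 = T.gen p :=
        T.dMap_act_zero p
      rw [h3, map_zero, h4] at h2
      exact h2
    rw [h1, injective_iff_map_eq_zero]
    intro v hv
    have : (v : ℝ × ℝ) ∈ LinearMap.ker (T.gen p).toLinearMap ⊓ K := ⟨hv, v.2⟩
    rw [hK.inf_eq_bot] at this
    simpa using this
  have hcr : range c = F ⁻¹' {F p} := by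
    refine Subset.antisymm ?_ fun x hx => ?_
    · rintro _ ⟨v, rfl⟩
      exact h.F_act v p
    · obtain ⟨ξ, rfl⟩ := h.fibre_eq_orbit hp hx
      obtain ⟨k, hk, v, hv, rfl⟩ : ∃ k ∈ LinearMap.ker (T.gen p).toLinearMap, ∃ v ∈ K, k + v = ξ :=
        Submodule.mem_sup.1 (by rw [hK.sup_eq_top]; trivial)
      refine ⟨⟨v, hv⟩, ?_⟩
      have h1 := T.act_smul_eq_self (x := p) (ξ := k) hk 1
      rw [one_smul] at h1
      rw [add_comm, T.act_add, h1]
  have hfr : range (fun ξ : EuclideanSpace ℝ (Fin l) => f (torusExp ξ)) = F ⁻¹' {F p} := by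
    rw [← hrange]
    refine Subset.antisymm ?_ ?_
    · rintro _ ⟨ξ, rfl⟩; exact ⟨_, rfl⟩
    · rintro _ ⟨θ, rfl⟩
      choose s hs using fun i => QuotientAddGroup.mk_surjective (θ i)
      refine ⟨WithLp.toLp 2 s, ?_⟩
      exact congrArg f (funext hs)
  have e1 := finrank_le_of_range_subset (hcs 0) hsm hcinj (by rw [hcr, hfr])
  have e2 := finrank_le_of_range_subset (hsm 0) hcs (by
    have := hinj 0
    rw [mfderiv_eq_dMap (hsm 0)] at this
    exact this) (by rw [hcr, hfr])
  rw [finrank_euclideanSpace, Fintype.card_fin] at e1 e2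
  omega

end

/-! ### Rectangles starting on the reduced boundary -/

noncomputable section

set_option linter.unusedSectionVars false

variable {E : Type} [NormedAddCommGroup E] [NormedSpace ℝ E]
variable {M : Type*} [TopologicalSpace M] [ChartedSpace E M] [IsManifold 𝓘(ℝ, E) ∞ M]

theorem contDiff_normSq : ContDiff ℝ ∞ (fun a : ℂ => Complex.normSq a) := by
  have : (fun a : ℂ => Complex.normSq a) = fun a : ℂ => a.re * a.re + a.im * a.im := by
    ext a; exact Complex.normSq_apply a
  rw [this]
  exact (Complex.reCLM.contDiff.mul Complex.reCLM.contDiff).add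
    (Complex.imCLM.contDiff.mul Complex.imCLM.contDiff)

theorem smoothAt_normSq {z : M → ℂ} {x : M} (hz : SmoothAt (E := E) z x) :
    SmoothAt (E := E) (fun x => Complex.normSq (z x)) x :=
  ContMDiffAt.comp x (contDiff_normSq.contMDiff _) hz

theorem SmoothAt.cmul {f g : M → ℂ} {x : M} (hf : SmoothAt (E := E) f x)
    (hg : SmoothAt (E := E) g x) : SmoothAt (E := E) (fun x => f x * g x) x :=
  ContMDiffAt.comp x (g := fun a : ℂ × ℂ => a.1 * a.2) (f := fun x => (f x, g x))
    (contDiff_mul.contMDiff _) (hf.prodMk_space hg)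

theorem SmoothAt.cdiv {f g : M → ℂ} {x : M} (hf : SmoothAt (E := E) f x)
    (hg : SmoothAt (E := E) g x) (hx : g x ≠ 0) : SmoothAt (E := E) (fun x => f x / g x) x := by
  simp only [div_eq_mul_inv]
  exact hf.cmul (ContMDiffAt.comp x (contDiffAt_inv ℝ hx).contMDiffAt hg)

variable {Ω : SymplecticForm E M} [T2Space M] [FiniteDimensional ℝ E]
variable {B : Type*} [TopologicalSpace B] [T2Space B]

namespace ToricModel

variable {T : TorusHam Ω} {F : M → B} {Φ : B → ℝ × ℝ}

theorem localOrbit_of_nearFree (hE : Module.finrank ℝ E = 4) {p : M} (hp : T.NearFree p) :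
    T.LocalOrbit p := by
  by_cases h1 : Function.Injective (T.gen p)
  · exact (T.localOrbit_of_injective_gen hE h1).1
  by_cases h2 : ∀ ξ, T.gen p ξ = 0
  · obtain ⟨_, _, _, _, _, _, h⟩ := TorusHam.exists_rankZero hE hp h2
    exact h.localOrbit
  · push Not at h2
    rw [T.injective_gen_iff] at h1
    push Not at h1
    obtain ⟨η, hη⟩ := h2
    obtain ⟨ξ, hξ, hξ0⟩ := h1
    obtain ⟨_, _, _, h⟩ := TorusHam.exists_rankOne hE hp hξ0 hξ hη
    exact h.localOrbit

/-- Some point of the fibre is near free points; near such a point the normal forms give local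
orbits, so the fibre is a single orbit, and the group action carries the property to all its points.
-/
theorem nearFree (hE : Module.finrank ℝ E = 4) (h : ToricModel T F Φ) (p : M) : T.NearFree p := by
  obtain ⟨p', hp', hfree⟩ := h.exists_nearFree hE (F p)
  obtain ⟨ζ, rfl⟩ := h.fibre_eq_orbit (localOrbit_of_nearFree hE hfree) hp'.symm
  have hc : Tendsto (T.act ζ) (𝓝 p') (𝓝 (T.act ζ p')) :=
    (T.smooth_act_right ζ).continuous.tendsto p'
  refine hc.frequently (hfree.mono fun x hx => ⟨T.injective_gen_act_iff.2 hx.1, fun τ hτ => ?_⟩)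
  refine hx.2 τ ?_
  rw [T.act_comm] at hτ
  have := congrArg (T.act (-ζ)) hτ
  rwa [T.act_neg_act, T.act_neg_act] at this

theorem localOrbit (hE : Module.finrank ℝ E = 4) (h : ToricModel T F Φ) (p : M) :
    T.LocalOrbit p :=
  localOrbit_of_nearFree hE (h.nearFree hE p)

end ToricModel

/-- A rectangle in the base of a toric model on which the momentum map is the identity, starting
on the reduced boundary. -/
structure RectModel (T : TorusHam Ω) (F : M → B) (Φ : B → ℝ × ℝ) (j : ℝ × ℝ → B) (R a : ℝ) :
    Prop where
  model : ToricModel T F Φ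
  dim : Module.finrank ℝ E = 4
  pos_R : 0 < R
  pos_a : 0 < a
  inv : ∀ q ∈ Icc 0 R ×ˢ Icc 0 a, Φ (j q) = q
  cont : ContinuousOn j (Icc 0 R ×ˢ Icc 0 a)
  torus : ∀ y ∈ Icc 0 a, ∃ l, IsEmbeddedTorus E l (F ⁻¹' {j (0, y)}) ∧
    ∀ x ∈ Ioo 0 R, IsEmbeddedTorus E (l + 1) (F ⁻¹' {j (x, y)})

/-- Equivariance of weight `(1, 0)`. -/
def TorusHam.Equivariant (T : TorusHam Ω) (z : M → ℂ) : Prop :=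
  ∀ ζ x, z (T.act ζ x) = expi ζ.1 * z x

/-- `z` is smooth near `p` and its squared norm is the first momentum, up to a positive smooth
factor. -/
structure TorusHam.Adm (T : TorusHam Ω) (z : M → ℂ) (p : M) : Prop where
  smooth : ∀ᶠ x in 𝓝 p, SmoothAt (E := E) z x
  mom : ∃ m : M → ℝ, (∀ᶠ x in 𝓝 p, SmoothAt (E := E) m x) ∧
    (∀ᶠ x in 𝓝 p, (T.mom x).1 = Complex.normSq (z x) * m x) ∧ 0 < m p

theorem TorusHam.EqFun.equivariant {T : TorusHam Ω} {z : M → ℂ} (hz : T.EqFun (1, 0) z) :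
    T.Equivariant z := fun ζ x => by rw [hz.act]; simp [wt]

/-- A circle chart along the first circle and an equivariant function of weight `(1, 0)` of
proportional norm. -/
structure TorusHam.EdgeChart (T : TorusHam Ω) (p : M) (ε : ℝ) (z : M → ℂ) (z' g : M → ℂ) :
    Prop where
  ne_zero : ε ≠ 0
  chart : ∃ u, T.CircleChart (ε, 0) p z u
  eqFun : T.EqFun (1, 0) z'
  smooth_g : ContMDiff 𝓘(ℝ, E) 𝓘(ℝ, ℂ) ∞ g
  norm_eq : ∀ x, Complex.normSq (z' x) = Complex.normSq (z x) * Complex.normSq (g x)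
  g_ne_zero : g p ≠ 0

/-- Since `w.1 * n = 1` in the integers, `w.1 = ±1`, and conjugation makes it one. The second
component of the weight is removed by a factor `g` of opposite weight not vanishing at `p`; it
exists because that character is trivial on the stabiliser. -/
theorem TorusHam.exists_edgeChart {T : TorusHam Ω} {p : M} {w : ℤ × ℤ} {z : M → ℂ} {n : ℤ}
    {u : M → ℝ × ℝ} (hz : T.EqFun w z) (C : T.CircleChart ((n : ℝ), 0) p z u)
    (hw : wt w ((n : ℝ), 0) = 1) (hstab : ∀ τ, T.act τ p = p → ∃ k : ℤ, w.2 * τ.2 = k) :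
    ∃ ε z z' g, T.EdgeChart p ε z z' g := by
  have h1 : w.1 * n = 1 := by
    have : (w.1 : ℝ) * n = 1 := by simpa [wt] using hw
    exact_mod_cast this
  have hn : (n : ℝ) ≠ 0 := by
    have : n ≠ 0 := by rintro rfl; simp at h1
    exact_mod_cast this
  obtain ⟨w', z', hz', hw', hnorm, hw2⟩ : ∃ (w' : ℤ × ℤ) (z' : M → ℂ), T.EqFun w' z' ∧ w'.1 = 1 ∧
      (∀ x, Complex.normSq (z' x) = Complex.normSq (z x)) ∧ (w'.2 = w.2 ∨ w'.2 = -w.2) := by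
    rcases Int.isUnit_iff.1 (IsUnit.of_mul_eq_one n h1) with h | h
    · exact ⟨w, z, hz, h, fun _ => rfl, Or.inl rfl⟩
    · exact ⟨_, _, hz.conj, by simp [h], fun x => Complex.normSq_conj _, Or.inr rfl⟩
  obtain ⟨g, hg, hgp⟩ := T.exists_eqFun_ne_zero (0, -w'.2) p fun τ hτ => by
    obtain ⟨k, hk⟩ := hstab τ hτ
    rcases hw2 with h | h
    · exact ⟨-k, by simp [wt, h, hk]⟩
    · exact ⟨k, by simp [wt, h, hk]⟩
  have h3 := hz'.mul hg
  have h4 : w' + (0, -w'.2) = (1, 0) := by ext <;> simp [hw']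
  rw [h4] at h3
  exact ⟨n, z, _, g, hn, ⟨u, C⟩, h3, hg.smooth, fun x => by rw [Complex.normSq_mul, hnorm], hgp⟩

namespace RectModel

variable {T : TorusHam Ω} {F : M → B} {Φ : B → ℝ × ℝ} {j : ℝ × ℝ → B} {R a : ℝ}

theorem mom_eq (h : RectModel T F Φ j R a) {x : M} {q : ℝ × ℝ} (hq : q ∈ Icc 0 R ×ˢ Icc 0 a)
    (hx : F x = j q) : T.mom x = q := by
  rw [h.model.mom_eq, hx, h.inv q hq]

theorem eventually_exists (h : RectModel T F Φ j R a) {p : M} {q : ℝ × ℝ}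
    (hq : q ∈ Icc 0 R ×ˢ Icc 0 a) (hp : F p = j q) {W : Set M} (hW : W ∈ 𝓝 p) :
    ∀ᶠ q' in 𝓝[Icc 0 R ×ˢ Icc 0 a] q, ∃ x ∈ W, F x = j q' := by
  have h1 := h.model.eventually_exists_mem (h.model.localOrbit h.dim p) hW
  rw [hp] at h1
  exact (h.cont q hq).eventually h1

/-- Near a point over the rectangle there are points over nearby points of the rectangle to the
right. -/
theorem exists_right (h : RectModel T F Φ j R a) {p : M} {x₀ y₀ : ℝ}
    (hx : x₀ ∈ Ico 0 R) (hy : y₀ ∈ Icc 0 a) (hp : F p = j (x₀, y₀)) {W : Set M} (hW : W ∈ 𝓝 p) :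
    ∃ x ∈ W, ∃ x₁ ∈ Ioo x₀ R, F x = j (x₁, y₀) := by
  have h1 := h.eventually_exists ⟨⟨hx.1, hx.2.le⟩, hy⟩ hp hW
  have h2 : Tendsto (fun t : ℝ => (t, y₀)) (𝓝[Ioo x₀ R] x₀) (𝓝[Icc 0 R ×ˢ Icc 0 a] (x₀, y₀)) := by
    refine tendsto_nhdsWithin_iff.2 ⟨?_, ?_⟩
    · have : Continuous fun t : ℝ => (t, y₀) := by fun_prop
      exact (this.tendsto x₀).mono_left nhdsWithin_le_nhds
    · filter_upwards [self_mem_nhdsWithin] with t ht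
      exact ⟨⟨hx.1.trans ht.1.le, ht.2.le⟩, hy⟩
  have : NeBot (𝓝[Ioo x₀ R] x₀) := by
    rw [nhdsWithin_Ioo_eq_nhdsGT hx.2]; infer_instance
  obtain ⟨t, ⟨x, hxW, hxF⟩, ht⟩ := ((h2.eventually h1).and self_mem_nhdsWithin).exists
  exact ⟨x, hxW, t, ht, hxF⟩

/-- Near a point over the edge there are points over other nearby points of the edge. -/
theorem exists_edge (h : RectModel T F Φ j R a) {p : M} {y₀ : ℝ}
    (hy : y₀ ∈ Icc 0 a) (hp : F p = j (0, y₀)) {W : Set M} (hW : W ∈ 𝓝 p) :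
    ∃ x ∈ W, ∃ y₁ ∈ Icc 0 a, y₁ ≠ y₀ ∧ F x = j (0, y₁) := by
  have h1 := h.eventually_exists (q := (0, y₀)) ⟨⟨le_rfl, h.pos_R.le⟩, hy⟩ hp hW
  have h2 : Tendsto (fun t : ℝ => ((0 : ℝ), t)) (𝓝[Icc 0 a \ {y₀}] y₀)
      (𝓝[Icc 0 R ×ˢ Icc 0 a] (0, y₀)) := by
    refine tendsto_nhdsWithin_iff.2 ⟨?_, ?_⟩
    · have : Continuous fun t : ℝ => ((0 : ℝ), t) := by fun_prop
      exact (this.tendsto y₀).mono_left nhdsWithin_le_nhds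
    · filter_upwards [self_mem_nhdsWithin] with t ht
      exact ⟨⟨le_rfl, h.pos_R.le⟩, ht.1⟩
  have : NeBot (𝓝[Icc 0 a \ {y₀}] y₀) := by
    rw [← mem_closure_iff_nhdsWithin_neBot]
    rcases hy.2.lt_or_eq with h3 | h3
    · have h4 : Ioo y₀ a ⊆ Icc 0 a \ {y₀} := fun t ht =>
        ⟨⟨hy.1.trans ht.1.le, ht.2.le⟩, ht.1.ne'⟩
      refine closure_mono h4 ?_
      rw [closure_Ioo h3.ne]
      exact ⟨le_rfl, h3.le⟩
    · have h4 : Ioo 0 a ⊆ Icc 0 a \ {y₀} := fun t ht =>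
        ⟨⟨ht.1.le, ht.2.le⟩, (h3 ▸ ht.2).ne⟩
      refine closure_mono h4 ?_
      rw [closure_Ioo h.pos_a.ne]
      exact hy
  obtain ⟨t, ⟨x, hxW, hxF⟩, ht⟩ := ((h2.eventually h1).and self_mem_nhdsWithin).exists
  exact ⟨x, hxW, t, ht.1, ht.2, hxF⟩

/-- Translates the dimensions of the fibres into ranks of the action. As `l + 1` is at most two,
orbits over the left edge have dimension at most one. -/
theorem finrank_ker_eq (h : RectModel T F Φ j R a) {y : ℝ} (hy : y ∈ Icc 0 a) :
    ∃ l : ℕ, (∀ p, F p = j (0, y) →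
        Module.finrank ℝ (LinearMap.ker (T.gen p).toLinearMap) + l = 2) ∧
      (∀ x ∈ Ioo 0 R, ∀ p, F p = j (x, y) →
        Module.finrank ℝ (LinearMap.ker (T.gen p).toLinearMap) + (l + 1) = 2) ∧ l ≤ 1 := by
  obtain ⟨l, h1, h2⟩ := h.torus y hy
  have h3 : ∀ x ∈ Ioo 0 R, ∀ p, F p = j (x, y) →
      Module.finrank ℝ (LinearMap.ker (T.gen p).toLinearMap) + (l + 1) = 2 := fun x hx p hp =>
    h.model.finrank_ker_gen (h.model.localOrbit h.dim p) (by rw [hp]; exact h2 x hx)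
  refine ⟨l, fun p hp => h.model.finrank_ker_gen (h.model.localOrbit h.dim p)
    (by rw [hp]; exact h1), h3, ?_⟩
  obtain ⟨p, hp⟩ := h.model.surjective (j (R / 2, y))
  have := h3 (R / 2) ⟨by linarith [h.pos_R], by linarith [h.pos_R]⟩ p hp
  omega

theorem not_injective_of_edge (h : RectModel T F Φ j R a) {y : ℝ} (hy : y ∈ Icc 0 a) {p : M}
    (hp : F p = j (0, y)) : ¬ Function.Injective (T.gen p) := by
  obtain ⟨l, h1, -, hl⟩ := h.finrank_ker_eq hy
  intro hinj
  have h2 := h1 p hp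
  have h3 : LinearMap.ker (T.gen p).toLinearMap = ⊥ := LinearMap.ker_eq_bot.2 hinj
  rw [h3, finrank_bot] at h2
  omega

theorem dot_mom_eq {ξ : ℝ × ℝ} {p x : M} {z : M → ℂ} (hx : z x = 0 → dot (T.mom x) ξ - dot (T.mom p) ξ = 0)
    (hz : z x = 0) : (T.mom x - T.mom p).1 * ξ.1 + (T.mom x - T.mom p).2 * ξ.2 = 0 := by
  have := hx hz
  simp only [dot, Prod.fst_sub, Prod.snd_sub] at this ⊢
  linarith

/-- The circle collapsing at `p` is located by looking at nearby degenerate points: where its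
complex coordinate vanishes, its momentum is that of `p`, so it is orthogonal to the displacement in
the rectangle. Along the left edge this forces a horizontal direction. -/
theorem exists_edgeChart (h : RectModel T F Φ j R a) {y : ℝ} (hy : y ∈ Icc 0 a) {p : M}
    (hp : F p = j (0, y)) : ∃ ε z z' g, T.EdgeChart p ε z z' g := by
  have hfree := h.model.nearFree h.dim p
  have hmp := h.mom_eq ⟨⟨le_rfl, h.pos_R.le⟩, hy⟩ hp
  have hm0 : ∀ {x : M} {y₁ : ℝ}, y₁ ∈ Icc 0 a → F x = j (0, y₁) → T.mom x = (0, y₁) :=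
    fun hy₁ hx => h.mom_eq ⟨⟨le_rfl, h.pos_R.le⟩, hy₁⟩ hx
  have hninj := h.not_injective_of_edge hy hp
  by_cases hz : ∀ ξ, T.gen p ξ = 0
  · obtain ⟨w₁, z₁, w₂, z₂, ξ₁, ξ₂, N⟩ := TorusHam.exists_rankZero h.dim hfree hz
    obtain ⟨u₁, C₁⟩ := N.chart₁
    obtain ⟨u₂, C₂⟩ := N.chart₂
    have hW := (N.degenerate.and (C₁.eventually_mom_eq_of_eq_zero.and
      C₂.eventually_mom_eq_of_eq_zero))
    -- Nearby points over the left edge are degenerate, so one of the coordinates vanishes there,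
    -- and the displacement is vertical.
    have e1 : ξ₁.2 = 0 ∨ ξ₂.2 = 0 := by
      obtain ⟨x, ⟨hx1, hx2, hx3⟩, y₁, hy₁, hne, hxF⟩ := h.exists_edge hy hp hW
      have hne' := sub_ne_zero.2 hne
      rcases hx1 (h.not_injective_of_edge hy₁ hxF) with h0 | h0
      · have := dot_mom_eq hx2 h0
        rw [hm0 hy₁ hxF, hmp] at this
        left; simpa [hne'] using this
      · have := dot_mom_eq hx3 h0
        rw [hm0 hy₁ hxF, hmp] at this
        right; simpa [hne'] using this
    -- At a corner `l = 0`, so the points to the right have one-dimensional orbits; these are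
    -- degenerate as well, with horizontal displacement.
    have e2 : ξ₁.1 = 0 ∨ ξ₂.1 = 0 := by
      obtain ⟨x, ⟨hx1, hx2, hx3⟩, x₁, hx₁, hxF⟩ := h.exists_right ⟨le_rfl, h.pos_R⟩ hy hp hW
      have hxm := h.mom_eq (q := (x₁, y)) ⟨⟨hx₁.1.le, hx₁.2.le⟩, hy⟩ hxF
      have hni : ¬ Function.Injective (T.gen x) := by
        obtain ⟨l, k1, k2, -⟩ := h.finrank_ker_eq hy
        intro hinj
        have h3 : LinearMap.ker (T.gen x).toLinearMap = ⊥ := LinearMap.ker_eq_bot.2 hinj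
        have h4 : LinearMap.ker (T.gen p).toLinearMap = ⊤ := by
          rw [eq_top_iff]; exact fun ξ _ => hz ξ
        have h5 := k1 p hp
        have h6 := k2 x₁ hx₁ x hxF
        rw [h4, finrank_top, Module.finrank_prod, Module.finrank_self] at h5
        rw [h3, finrank_bot] at h6
        omega
      have hne' : x₁ ≠ 0 := hx₁.1.ne'
      rcases hx1 hni with h0 | h0
      · have := dot_mom_eq hx2 h0
        rw [hxm, hmp] at this
        left; simpa [hne'] using this
      · have := dot_mom_eq hx3 h0
        rw [hxm, hmp] at this
        right; simpa [hne'] using this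
    -- With the other circle vertical, the weight of the horizontal one has no second component, and
    -- the condition on the stabiliser is void.
    have key : ∀ {w : ℤ × ℤ} {z : M → ℂ} {ξ ξ' : ℝ × ℝ} {u : M → ℝ × ℝ}, T.EqFun w z →
        T.CircleChart ξ p z u → IsInt ξ → wt w ξ = 1 → wt w ξ' = 0 → ξ.2 = 0 → ξ' ≠ 0 →
        ξ'.1 = 0 → ∃ ε z z' g, T.EdgeChart p ε z z' g := by
      rintro w z ξ ξ' u hz C ⟨m, n, rfl⟩ hw hw' h2 h3 h4
      simp only at h2
      rw [h2] at C hw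
      have h5 : ξ'.2 ≠ 0 := fun h6 => h3 (Prod.ext h4 h6)
      have h6 : (w.2 : ℝ) = 0 := by simpa [wt, h4, h5] using hw'
      exact TorusHam.exists_edgeChart hz C hw fun τ _ => ⟨0, by simp [h6]⟩
    have n1 : ξ₁ ≠ 0 := fun h0 => by have := N.wt₁₁; simp [h0, wt] at this
    have n2 : ξ₂ ≠ 0 := fun h0 => by have := N.wt₂₂; simp [h0, wt] at this
    have n1' : ξ₁.1 = 0 → ξ₁.2 ≠ 0 := fun h1 h2 => n1 (Prod.ext h1 h2)
    have n2' : ξ₂.1 = 0 → ξ₂.2 ≠ 0 := fun h1 h2 => n2 (Prod.ext h1 h2)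
    rcases e1 with e1 | e1
    · exact key N.eqFun₁ C₁ N.isInt₁ N.wt₁₁ N.wt₁₂ e1 n2 (e2.resolve_left fun h0 => n1' h0 e1)
    · exact key N.eqFun₂ C₂ N.isInt₂ N.wt₂₂ N.wt₂₁ e1 n1 (e2.resolve_right fun h0 => n2' h0 e1)
  · push Not at hz
    obtain ⟨η, hη⟩ := hz
    rw [T.injective_gen_iff] at hninj
    push Not at hninj
    obtain ⟨ξ₀, hξ, hξ0⟩ := hninj
    obtain ⟨w, z, ξ, N⟩ := TorusHam.exists_rankOne h.dim hfree hξ0 hξ hη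
    obtain ⟨u, C⟩ := N.chart
    have h2 : ξ.2 = 0 := by
      obtain ⟨x, ⟨hx1, hx2⟩, y₁, hy₁, hne, hxF⟩ :=
        h.exists_edge hy hp (N.degenerate.and C.eventually_mom_eq_of_eq_zero)
      have hne' := sub_ne_zero.2 hne
      have := dot_mom_eq hx2 (hx1 (h.not_injective_of_edge hy₁ hxF))
      rw [hm0 hy₁ hxF, hmp] at this
      simpa [hne'] using this
    obtain ⟨m, n, rfl⟩ := N.isInt
    have hw := N.wt_eq
    have hst := N.stab
    simp only at h2
    rw [h2] at C hw hst
    refine TorusHam.exists_edgeChart N.eqFun C hw fun τ hτ => ?_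
    obtain ⟨k, l, hkl⟩ := hst τ hτ
    have := congrArg Prod.snd hkl
    simp at this
    -- As `ξ` is horizontal, the second component of a stabilising element is an integer.
    exact ⟨w.2 * l, by rw [this]; push_cast; ring⟩

/-- Over the interior of the rectangle there are non-vanishing functions of weight `(1, 0)`. -/
theorem exists_eqFun_of_pos (h : RectModel T F Φ j R a) {x y : ℝ} (hx : x ∈ Ioo 0 R)
    (hy : y ∈ Icc 0 a) {p : M} (hp : F p = j (x, y)) : ∃ z, T.EqFun (1, 0) z ∧ z p ≠ 0 := by
  have hfree := h.model.nearFree h.dim p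
  refine T.exists_eqFun_ne_zero (1, 0) p ?_
  by_cases hinj : Function.Injective (T.gen p)
  -- At a point of full rank, a stabilising element acts trivially nearby, hence on free orbits, and
  -- is integral.
  · intro τ hτ
    have h1 := (T.localOrbit_of_injective_gen h.dim hinj).2 τ hτ
    obtain ⟨x, hx, hx'⟩ := (hfree.and_eventually h1).exists
    obtain ⟨m, n, rfl⟩ := hx.2 τ hx'
    exact ⟨m, by simp [wt]⟩
  have hmp := h.mom_eq (q := (x, y)) ⟨⟨hx.1.le, hx.2.le⟩, hy⟩ hp
  obtain ⟨l, -, h3, -⟩ := h.finrank_ker_eq hy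
  have hnz : ¬ ∀ ξ, T.gen p ξ = 0 := by
    intro hz
    have h4 : LinearMap.ker (T.gen p).toLinearMap = ⊤ := by
      rw [eq_top_iff]; exact fun ξ _ => hz ξ
    have h5 := h3 x hx p hp
    rw [h4, finrank_top, Module.finrank_prod, Module.finrank_self] at h5
    omega
  push Not at hnz
  obtain ⟨η, hη⟩ := hnz
  have hninj := hinj
  rw [T.injective_gen_iff] at hninj
  push Not at hninj
  obtain ⟨ξ₀, hξ, hξ0⟩ := hninj
  obtain ⟨w, z, ξ, N⟩ := TorusHam.exists_rankOne h.dim hfree hξ0 hξ hη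
  obtain ⟨u, C⟩ := N.chart
  have hni : ∀ {p' : M} {x' : ℝ}, x' ∈ Ioo 0 R → F p' = j (x', y) →
      ¬ Function.Injective (T.gen p') := by
    intro p' x' hx' hp' hinj'
    have k1 := h3 x hx p hp
    have k2 := h3 x' hx' p' hp'
    have k3 : LinearMap.ker (T.gen p').toLinearMap = ⊥ := LinearMap.ker_eq_bot.2 hinj'
    rw [k3, finrank_bot] at k2
    exact hinj (LinearMap.ker_eq_bot.1 (Submodule.finrank_eq_zero.1 (by omega)))
  -- Points further to the right on the same horizontal line have orbits of the same dimension. They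
  -- are degenerate too, so the collapsing circle is vertical, and a stabilising element has
  -- integral first component.
  have h2 : ξ.1 = 0 := by
    obtain ⟨x', ⟨hx1, hx2⟩, x₁, hx₁, hxF⟩ := h.exists_right ⟨hx.1.le, hx.2⟩ hy hp
      (N.degenerate.and C.eventually_mom_eq_of_eq_zero)
    have hx₁' : x₁ ∈ Ioo 0 R := ⟨hx.1.trans hx₁.1, hx₁.2⟩
    have hxm := h.mom_eq (q := (x₁, y)) ⟨⟨hx₁'.1.le, hx₁'.2.le⟩, hy⟩ hxF
    have hne' := sub_ne_zero.2 hx₁.1.ne'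
    have := dot_mom_eq hx2 (hx1 (hni hx₁' hxF))
    rw [hxm, hmp] at this
    simpa [hne'] using this
  intro τ hτ
  obtain ⟨k, l, hkl⟩ := N.stab τ hτ
  have := congrArg Prod.fst hkl
  simp [h2] at this
  exact ⟨k, by simp [wt, this]⟩

/-- The first momentum does not vanish identically near points over the rectangle. -/
theorem frequently_mom_ne_zero (h : RectModel T F Φ j R a) {p : M} {q : ℝ × ℝ}
    (hq : q ∈ Ico 0 R ×ˢ Icc 0 a) (hp : F p = j q) : ∃ᶠ x in 𝓝 p, 0 < (T.mom x).1 := by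
  rw [frequently_iff]
  intro W hW
  obtain ⟨x, hx, x₁, hx₁, hxF⟩ := h.exists_right hq.1 hq.2 hp hW
  refine ⟨x, hx, ?_⟩
  have h0 : 0 < x₁ := hq.1.1.trans_lt hx₁.1
  rw [h.mom_eq (q := (x₁, q.2)) ⟨⟨h0.le, hx₁.2.le⟩, hq.2⟩ hxF]
  exact h0

/-- A negative value would persist nearby and contradict the points of positive first momentum to
the right. -/
theorem pos_of_mom_eq (h : RectModel T F Φ j R a) {p : M} {q : ℝ × ℝ}
    (hq : q ∈ Ico 0 R ×ˢ Icc 0 a) (hp : F p = j q) {z : M → ℂ} {m : M → ℝ} (hm : ContinuousAt m p)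
    (hmz : ∀ᶠ x in 𝓝 p, (T.mom x).1 = Complex.normSq (z x) * m x) (hne : m p ≠ 0) : 0 < m p := by
  by_contra hneg
  have h1 : m p < 0 := lt_of_le_of_ne (not_lt.1 hneg) hne
  obtain ⟨x, hx, hx1, hx2⟩ := ((h.frequently_mom_ne_zero hq hp).and_eventually
    (hmz.and (hm.eventually (gt_mem_nhds h1)))).exists
  rw [hx1] at hx
  nlinarith [Complex.normSq_nonneg (z x)]

/-- Functions of weight `(1, 0)` which are admissible at a given point. -/
theorem exists_adm (h : RectModel T F Φ j R a) {p : M} {q : ℝ × ℝ}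
    (hq : q ∈ Ico 0 R ×ˢ Icc 0 a) (hp : F p = j q) : ∃ z, T.Equivariant z ∧ T.Adm z p := by
  obtain ⟨x, y⟩ := q
  -- Off the left edge a non-vanishing function serves, with the quotient as factor. On the edge the
  -- factor comes from the momentum of the collapsing circle.
  rcases hq.1.1.lt_or_eq with h0 | h0
  · obtain ⟨z, hz, hzp⟩ := h.exists_eqFun_of_pos ⟨h0, hq.1.2⟩ hq.2 hp
    have hzs : ∀ x, SmoothAt (E := E) z x := fun x => hz.smooth x
    have hne : ∀ᶠ x in 𝓝 p, z x ≠ 0 := hz.smooth.continuous.continuousAt.eventually_ne hzp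
    refine ⟨z, hz.equivariant, Eventually.of_forall hzs,
      fun x => (T.mom x).1 / Complex.normSq (z x), ?_, ?_, ?_⟩
    · filter_upwards [hne] with x hx
      have h1 : SmoothAt (E := E) (fun x => (T.mom x).1) x :=
        ContMDiffAt.comp x (contDiff_fst.contMDiff _) (T.smooth_mom x)
      exact ContMDiffAt.div₀ h1 (smoothAt_normSq (hzs x)) (by simpa using hx)
    · filter_upwards [hne] with x hx
      have : Complex.normSq (z x) ≠ 0 := by simpa using hx
      field_simp
    · have := h.mom_eq (q := (x, y)) ⟨⟨hq.1.1, hq.1.2.le⟩, hq.2⟩ hp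
      change 0 < (T.mom p).1 / Complex.normSq (z p)
      rw [this]
      exact div_pos h0 (Complex.normSq_pos.2 hzp)
  · simp only at h0
    subst h0
    obtain ⟨ε, z, z', g, N⟩ := h.exists_edgeChart hq.2 hp
    obtain ⟨u, C⟩ := N.chart
    obtain ⟨m, hm, hmz, hm0⟩ := C.exists_mom
    have hg : ∀ x, SmoothAt (E := E) g x := fun x => N.smooth_g x
    have hgne : ∀ᶠ x in 𝓝 p, g x ≠ 0 := N.smooth_g.continuous.continuousAt.eventually_ne N.g_ne_zero
    have hmp := h.mom_eq (q := (0, y)) ⟨⟨le_rfl, h.pos_R.le⟩, hq.2⟩ hp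
    have k1 : ∀ᶠ x in 𝓝 p,
        SmoothAt (E := E) (fun x => m x / (Complex.normSq (g x) * ε)) x := by
      filter_upwards [hm, hgne] with x h1 h2
      exact ContMDiffAt.div₀ h1 ((smoothAt_normSq (hg x)).mul contMDiffAt_const)
        (mul_ne_zero (by simpa using h2) N.ne_zero)
    have k2 : ∀ᶠ x in 𝓝 p, (T.mom x).1 = Complex.normSq (z' x) *
        (m x / (Complex.normSq (g x) * ε)) := by
      filter_upwards [hmz, hgne] with x h1 h2
      have h3 : Complex.normSq (g x) ≠ 0 := by simpa using h2
      have h4 := N.ne_zero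
      simp only [dot, hmp, mul_zero, add_zero, zero_mul, sub_zero] at h1
      rw [N.norm_eq]
      field_simp
      exact h1
    refine ⟨z', N.eqFun.equivariant, Eventually.of_forall fun x => N.eqFun.smooth x, _, k1, k2,
      h.pos_of_mom_eq hq hp k1.self_of_nhds.continuousAt k2 ?_⟩
    exact div_ne_zero hm0 (mul_ne_zero (by simpa using N.g_ne_zero) N.ne_zero)

end RectModel

end

/-! ### Gluing equivariant coordinates -/

noncomputable section

set_option linter.unusedSectionVars false

variable {E : Type} [NormedAddCommGroup E] [NormedSpace ℝ E]
variable {M : Type*} [TopologicalSpace M] [ChartedSpace E M] [IsManifold 𝓘(ℝ, E) ∞ M]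
variable {Ω : SymplecticForm E M}

namespace TorusHam

variable {T : TorusHam Ω} {z z' ρ : M → ℂ} {p : M}

theorem tendsto_act_neg (T : TorusHam Ω) (ζ : ℝ × ℝ) (p : M) :
    Tendsto (T.act (-ζ)) (𝓝 (T.act ζ p)) (𝓝 p) := by
  have := (T.smooth_act_right (-ζ)).continuous.tendsto (T.act ζ p)
  rwa [T.act_neg_act] at this

theorem smoothAt_comp_act {V : Type} [NormedAddCommGroup V] [NormedSpace ℝ V] {f : M → V}
    {ζ : ℝ × ℝ} {x : M} (hf : SmoothAt (E := E) f (T.act ζ x)) :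
    SmoothAt (E := E) (fun x => f (T.act ζ x)) x :=
  ContMDiffAt.comp x hf (T.smooth_act_right ζ x)

namespace Adm

theorem eventually (h : T.Adm z p) : ∀ᶠ x in 𝓝 p, T.Adm z x := by
  obtain ⟨m, hm, hmz, hm0⟩ := h.mom
  have hmc : ContinuousAt m p := hm.self_of_nhds.continuousAt
  filter_upwards [eventually_eventually_nhds.2 h.smooth, eventually_eventually_nhds.2 hm,
    eventually_eventually_nhds.2 hmz, hmc.eventually (lt_mem_nhds hm0)] with x h1 h2 h3 h4
  exact ⟨h1, m, h2, h3, h4⟩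

theorem act (h : T.Adm z p) (hz : T.Equivariant z) (ζ : ℝ × ℝ) : T.Adm z (T.act ζ p) := by
  obtain ⟨m, hm, hmz, hm0⟩ := h.mom
  have ht := T.tendsto_act_neg ζ p
  refine ⟨?_, fun x => m (T.act (-ζ) x), ?_, ?_, ?_⟩
  · filter_upwards [ht.eventually h.smooth] with x hx
    have h1 : z = fun x => expi ζ.1 * z (T.act (-ζ) x) := by
      ext x
      rw [hz, ← mul_assoc, ← expi_add]
      simp
    rw [h1]
    exact SmoothAt.cmul contMDiffAt_const (smoothAt_comp_act hx)
  · filter_upwards [ht.eventually hm] with x hx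
    exact smoothAt_comp_act hx
  · filter_upwards [ht.eventually hmz] with x hx
    rw [T.mom_act] at hx
    rw [hx, hz, Complex.normSq_mul, Complex.normSq_eq_norm_sq (expi _), norm_expi]
    ring
  · change 0 < m (T.act (-ζ) (T.act ζ p))
    rwa [T.act_neg_act]

theorem congr (h : T.Adm z p) (hz : z' =ᶠ[𝓝 p] z) : T.Adm z' p := by
  obtain ⟨m, hm, hmz, hm0⟩ := h.mom
  refine ⟨?_, m, hm, ?_, hm0⟩
  · filter_upwards [h.smooth, eventually_eventually_nhds.2 hz] with x h1 h2
    exact ContMDiffAt.congr_of_eventuallyEq h1 h2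
  · filter_upwards [hmz, hz] with x h1 h2
    rw [h1, h2]

theorem mul (h : T.Adm z p) (hρ : ∀ᶠ x in 𝓝 p, SmoothAt (E := E) ρ x) (hp : ρ p ≠ 0) :
    T.Adm (fun x => ρ x * z x) p := by
  obtain ⟨m, hm, hmz, hm0⟩ := h.mom
  have hne : ∀ᶠ x in 𝓝 p, ρ x ≠ 0 := hρ.self_of_nhds.continuousAt.eventually_ne hp
  refine ⟨?_, fun x => m x / Complex.normSq (ρ x), ?_, ?_, ?_⟩
  · filter_upwards [h.smooth, hρ] with x h1 h2
    exact SmoothAt.cmul h2 h1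
  · filter_upwards [hm, hρ, hne] with x h1 h2 h3
    exact ContMDiffAt.div₀ h1 (smoothAt_normSq h2) (by simpa using h3)
  · filter_upwards [hmz, hne] with x h1 h2
    have : Complex.normSq (ρ x) ≠ 0 := by simpa using h2
    rw [h1, Complex.normSq_mul]
    field_simp
  · exact div_pos hm0 (Complex.normSq_pos.2 hp)

/-- Admissible equivariant functions can be normalised. -/
theorem normalize (h : T.Adm z p) :
    (∀ᶠ x in 𝓝 p, SmoothAt (E := E)
      (fun x => z x * ((√((T.mom x).1 / Real.pi) / ‖z x‖ : ℝ) : ℂ)) x) ∧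
    ∀ᶠ x in 𝓝 p, Real.pi * Complex.normSq (z x * ((√((T.mom x).1 / Real.pi) / ‖z x‖ : ℝ) : ℂ)) =
      (T.mom x).1 := by
  obtain ⟨m, hm, hmz, hm0⟩ := h.mom
  have hmc : ContinuousAt m p := hm.self_of_nhds.continuousAt
  -- Where `z ≠ 0`, the normalising factor is `√(m/π)`, which is smooth; where `z = 0`, both
  -- products vanish. This removes the apparent singularity.
  have key : ∀ᶠ x in 𝓝 p, z x * ((√((T.mom x).1 / Real.pi) / ‖z x‖ : ℝ) : ℂ) =
      z x * ((√(m x / Real.pi) : ℝ) : ℂ) := by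
    filter_upwards [hmz] with x h1
    by_cases h2 : z x = 0
    · rw [h2, zero_mul, zero_mul]
    · have h3 : ‖z x‖ ≠ 0 := by simpa using h2
      rw [h1, Complex.normSq_eq_norm_sq, mul_div_assoc, Real.sqrt_mul (by positivity),
        Real.sqrt_sq (norm_nonneg _), mul_div_cancel_left₀ _ h3]
  constructor
  · filter_upwards [eventually_eventually_nhds.2 key, hm, h.smooth,
      hmc.eventually (lt_mem_nhds hm0)] with x h1 h2 h3 h4
    refine ContMDiffAt.congr_of_eventuallyEq ?_ h1
    have h5 : ContDiffAt ℝ ∞ (fun s : ℝ => ((√(s / Real.pi) : ℝ) : ℂ)) (m x) :=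
      Complex.ofRealCLM.contDiff.contDiffAt.comp _
        ((contDiffAt_id.div_const _).sqrt (div_pos h4 Real.pi_pos).ne')
    exact SmoothAt.cmul h3 (ContMDiffAt.comp x h5.contMDiffAt h2)
  · filter_upwards [key, hmz, hmc.eventually (lt_mem_nhds hm0)] with x h1 h2 h3
    rw [h1, h2, Complex.normSq_mul, Complex.normSq_ofReal,
      Real.mul_self_sqrt (div_pos h3 Real.pi_pos).le]
    field_simp

end Adm

end TorusHam

variable [T2Space M] [FiniteDimensional ℝ E]
variable {B : Type*} [TopologicalSpace B] [T2Space B]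

namespace RectModel

variable {T : TorusHam Ω} {F : M → B} {Φ : B → ℝ × ℝ} {j : ℝ × ℝ → B} {R a : ℝ}
variable {p : M} {q : ℝ × ℝ} {z₁ z₂ : M → ℂ}

/-- The first momentum is positive, and hence `z₂ ≠ 0`, at points arbitrarily near `p`, so
continuous ratios agree at `p`. -/
theorem ratio_unique (h : RectModel T F Φ j R a) (hq : q ∈ Ico 0 R ×ˢ Icc 0 a) (hp : F p = j q)
    (h₂ : T.Adm z₂ p) {ρ ρ' : M → ℂ} (hρ : ContinuousAt ρ p) (hρ' : ContinuousAt ρ' p)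
    (h1 : ∀ᶠ x in 𝓝 p, z₁ x = ρ x * z₂ x) (h2 : ∀ᶠ x in 𝓝 p, z₁ x = ρ' x * z₂ x) :
    ρ p = ρ' p := by
  obtain ⟨m, hm, hmz, hm0⟩ := h₂.mom
  by_contra hne
  have h3 : ∀ᶠ x in 𝓝 p, ρ x - ρ' x ≠ 0 := (hρ.sub hρ').eventually_ne (sub_ne_zero.2 hne)
  obtain ⟨x, hx, k1, k2, k3, k4⟩ := ((h.frequently_mom_ne_zero hq hp).and_eventually
    (h1.and (h2.and (h3.and hmz)))).exists
  have : (ρ x - ρ' x) * z₂ x = 0 := by rw [sub_mul, ← k1, ← k2, sub_self]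
  rcases mul_eq_zero.1 this with h5 | h5
  · exact k3 h5
  · rw [k4, h5] at hx
    simp at hx

/-- Two admissible functions differ by a non-vanishing smooth factor. -/
theorem exists_ratio (h : RectModel T F Φ j R a) (hq : q ∈ Ico 0 R ×ˢ Icc 0 a) (hp : F p = j q)
    (hz₁ : T.Equivariant z₁) (hz₂ : T.Equivariant z₂) (h₁ : T.Adm z₁ p) (h₂ : T.Adm z₂ p) :
    ∃ ρ : M → ℂ, (∀ᶠ x in 𝓝 p, SmoothAt (E := E) ρ x) ∧ (∀ᶠ x in 𝓝 p, z₁ x = ρ x * z₂ x) ∧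
      ρ p ≠ 0 := by
  obtain ⟨m₁, hm₁, hmz₁, hm₁0⟩ := h₁.mom
  obtain ⟨m₂, hm₂, hmz₂, hm₂0⟩ := h₂.mom
  have hc₁ : ContinuousAt m₁ p := hm₁.self_of_nhds.continuousAt
  have hc₂ : ContinuousAt m₂ p := hm₂.self_of_nhds.continuousAt
  have hpos₁ := hc₁.eventually (lt_mem_nhds hm₁0)
  obtain ⟨ρ, hρ, hρz⟩ : ∃ ρ : M → ℂ, (∀ᶠ x in 𝓝 p, SmoothAt (E := E) ρ x) ∧
      ∀ᶠ x in 𝓝 p, z₁ x = ρ x * z₂ x := by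
    have hmp := h.mom_eq ⟨⟨hq.1.1, hq.1.2.le⟩, hq.2⟩ hp
    obtain ⟨x₀, y₀⟩ := q
    rcases hq.1.1.lt_or_eq with h0 | h0
    · have hzp : z₂ p ≠ 0 := by
        intro h1
        have h2 := hmz₂.self_of_nhds
        rw [hmp, h1] at h2
        simp only [map_zero, zero_mul] at h2
        exact h0.ne' h2
      have hne : ∀ᶠ x in 𝓝 p, z₂ x ≠ 0 :=
        h₂.smooth.self_of_nhds.continuousAt.eventually_ne hzp
      refine ⟨fun x => z₁ x / z₂ x, ?_, ?_⟩
      · filter_upwards [h₁.smooth, h₂.smooth, hne] with x k1 k2 k3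
        exact SmoothAt.cdiv k1 k2 k3
      · filter_upwards [hne] with x k3
        field_simp
    · simp only at h0
      subst h0
      obtain ⟨ε, z, z', g, N⟩ := h.exists_edgeChart hq.2 hp
      obtain ⟨u, C⟩ := N.chart
      obtain ⟨m, hm, hmz, hm0⟩ := C.exists_mom
      have hmc : ContinuousAt m p := hm.self_of_nhds.continuousAt
      have hmne := hmc.eventually_ne hm0
      -- On the edge both functions may vanish. The product of `z₁` with the conjugate of `z₂` is
      -- invariant under the circle and vanishes with `z`, so it is divisible by `|z|²`.
      obtain ⟨k, hk, hkz⟩ := C.exists_quotient (f := fun x => z₁ x * (starRingEnd ℂ) (z₂ x))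
        (by
          filter_upwards [h₁.smooth, h₂.smooth] with x k1 k2
          exact SmoothAt.cmul k1 (ContMDiffAt.comp x (Complex.conjCLE.contDiff.contMDiff _) k2))
        (Eventually.of_forall fun x s => by
          simp only [hz₁ _ x, hz₂ _ x, map_mul, conj_expi]
          calc expi (s • ((ε, 0) : ℝ × ℝ)).1 * z₁ x *
                (expi (-(s • ((ε, 0) : ℝ × ℝ)).1) * (starRingEnd ℂ) (z₂ x))
              = (expi (s • ((ε, 0) : ℝ × ℝ)).1 * expi (-(s • ((ε, 0) : ℝ × ℝ)).1)) *
                (z₁ x * (starRingEnd ℂ) (z₂ x)) := by ring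
            _ = _ := by rw [← expi_add, add_neg_cancel, expi_zero, one_mul])
        (by
          filter_upwards [C.eventually_mom_eq_of_eq_zero, hmz₁, hpos₁] with x k1 k2 k3 k4
          have k5 := k1 k4
          simp only [dot, hmp, mul_zero, add_zero, zero_mul, sub_zero] at k5
          have k6 : (T.mom x).1 = 0 := by simpa [N.ne_zero] using k5
          rw [k6] at k2
          have k7 : z₁ x = 0 := by simpa [k3.ne'] using k2.symm
          rw [k7, zero_mul])
      -- Comparing the two expressions for the first momentum gives `|z|² = (ε m₂ / m) |z₂|²`, which
      -- supplies this factor.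
      refine ⟨fun x => ((ε * m₂ x / m x : ℝ) : ℂ) * k x, ?_, ?_⟩
      · filter_upwards [hm₂, hm, hk, hmne] with x k1 k2 k3 k4
        exact SmoothAt.cmul (ContMDiffAt.comp x (Complex.ofRealCLM.contDiff.contMDiff _)
          (ContMDiffAt.div₀ (contMDiffAt_const.mul k1) k2 k4)) k3
      · filter_upwards [hmz, hkz, hmne, hmz₁, hmz₂, hpos₁] with x k1 k2 k3 k4 k5 k6
        simp only [dot, hmp, mul_zero, add_zero, zero_mul, sub_zero] at k1
        by_cases h0 : z₂ x = 0
        · rw [h0] at k5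
          simp only [map_zero, zero_mul] at k5
          rw [k5] at k4
          have k7 : z₁ x = 0 := by simpa [k6.ne'] using k4.symm
          rw [k7, h0, mul_zero]
        · have h1 : (starRingEnd ℂ) (z₂ x) ≠ 0 := by simpa using h0
          have h2 : Complex.normSq (z x) = ε * m₂ x / m x * Complex.normSq (z₂ x) := by
            field_simp
            rw [← k1, k5]
            ring
          refine mul_right_cancel₀ h1 ?_
          rw [k2, h2, mul_assoc, Complex.mul_conj, Complex.real_smul]
          push_cast
          ring
  refine ⟨ρ, hρ, hρz, fun hρ0 => ?_⟩
  have hρc : ContinuousAt ρ p := hρ.self_of_nhds.continuousAt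
  -- Equality of `|z₁|² m₁` and `|z₂|² m₂` forces `|ρ|² m₁ = m₂` where `z₂ ≠ 0`. This fails near `p`
  -- if `ρ p = 0`, since `m₂ p > 0`.
  have h3 : ContinuousAt (fun x => Complex.normSq (ρ x) * m₁ x - m₂ x) p :=
    ((Complex.continuous_normSq.continuousAt.comp hρc).mul hc₁).sub hc₂
  have h4 : Complex.normSq (ρ p) * m₁ p - m₂ p ≠ 0 := by
    rw [hρ0, map_zero, zero_mul, zero_sub]
    exact neg_ne_zero.2 hm₂0.ne'
  obtain ⟨x, hx, k1, k2, k3, k4⟩ := ((h.frequently_mom_ne_zero hq hp).and_eventually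
    (hρz.and (hmz₁.and (hmz₂.and (h3.eventually_ne h4))))).exists
  have h5 : Complex.normSq (z₂ x) ≠ 0 := fun h5 => by rw [k3, h5, zero_mul] at hx; exact hx.false
  rw [k3, k1, Complex.normSq_mul] at k2
  refine k4 (mul_left_cancel₀ h5 ?_)
  rw [mul_zero]
  linarith

end RectModel

/-- There is an equivariant function admissible at all points over `D`. -/
def TorusHam.Glued (T : TorusHam Ω) (F : M → B) (j : ℝ × ℝ → B) (D : Set (ℝ × ℝ)) : Prop :=
  ∃ z, T.Equivariant z ∧ ∀ p, ∀ q ∈ D, F p = j q → T.Adm z p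

namespace RectModel

variable {T : TorusHam Ω} {F : M → B} {Φ : B → ℝ × ℝ} {j : ℝ × ℝ → B} {R a : ℝ}

theorem eventually_fibre_subset (h : RectModel T F Φ j R a) {q : ℝ × ℝ}
    (hq : q ∈ Ico 0 R ×ˢ Icc 0 a) {N : Set M} (hN : IsOpen N) (hqN : ∀ p, F p = j q → p ∈ N)
    {D : Set (ℝ × ℝ)} (hD : D ⊆ Ico 0 R ×ˢ Icc 0 a) :
    ∀ᶠ q' in 𝓝 q, q' ∈ D → ∀ p, F p = j q' → p ∈ N := by
  have h1 := h.model.exists_nhds_preimage_subset hN hqN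
  have h2 : Ico 0 R ×ˢ Icc 0 a ⊆ Icc 0 R ×ˢ Icc 0 a := prod_mono_left Ico_subset_Icc_self
  have h3 := ((h.cont q (h2 hq)).mono (hD.trans h2)).eventually h1
  exact eventually_nhdsWithin_iff.1 h3

/-- A function admissible at one point is admissible along its orbit by equivariance, that is on the
fibre, and by properness on nearby fibres. -/
theorem glued_local (h : RectModel T F Φ j R a) {q : ℝ × ℝ} (hq : q ∈ Ico 0 R ×ˢ Icc 0 a) :
    ∃ U ∈ 𝓝 q, ∀ D ⊆ Ico 0 R ×ˢ Icc 0 a, D ⊆ U → T.Glued F j D := by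
  obtain ⟨p, hp⟩ := h.model.surjective (j q)
  obtain ⟨z, hz, hzp⟩ := h.exists_adm hq hp
  have hN : IsOpen {x | ∀ᶠ y in 𝓝 x, T.Adm z y} := isOpen_setOfPred_eventually_nhds
  refine ⟨_, h.eventually_fibre_subset hq hN (fun x hx => ?_) Subset.rfl, fun D hD hDU =>
    ⟨z, hz, fun p q' hq' hp => (hDU hq' (hD hq') p hp).self_of_nhds⟩⟩
  obtain ⟨ζ, rfl⟩ := h.model.fibre_eq_orbit (h.model.localOrbit h.dim p) (hx.trans hp.symm)
  exact (hzp.act hz ζ).eventually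

end RectModel

end

/-! ### The coordinate over a rectangle -/

noncomputable section

set_option linter.unusedSectionVars false

/-- At the supremum of the `t` with `Q α t`, a short interval around it can be merged, which extends
`Q α t` beyond it unless it is `β`. -/
theorem interval_glue {α β : ℝ} (hαβ : α ≤ β) (Q : ℝ → ℝ → Prop)
    (hmerge : ∀ s m t, α ≤ s → s ≤ m → m ≤ t → t ≤ β → Q s m → Q m t → Q s t)
    (hloc : ∀ x ∈ Icc α β, ∃ δ > 0, ∀ s t, α ≤ s → s ≤ t → t ≤ β → x - δ < s → t < x + δ → Q s t) :
    Q α β := by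
  set S : Set ℝ := {t | t ∈ Icc α β ∧ Q α t} with hS
  have hα : α ∈ S := by
    obtain ⟨δ, hδ, h⟩ := hloc α ⟨le_rfl, hαβ⟩
    exact ⟨⟨le_rfl, hαβ⟩, h α α le_rfl le_rfl hαβ (by linarith) (by linarith)⟩
  have hbdd : BddAbove S := ⟨β, fun t ht => ht.1.2⟩
  set x := sSup S
  have hx : x ∈ Icc α β := ⟨le_csSup hbdd hα, csSup_le ⟨α, hα⟩ fun t ht => ht.1.2⟩
  obtain ⟨δ, hδ, h⟩ := hloc x hx
  obtain ⟨s, hs, hsx⟩ := exists_lt_of_lt_csSup ⟨α, hα⟩ (show x - δ < sSup S by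
    change x - δ < x; linarith)
  have hsx' : s ≤ x := le_csSup hbdd hs
  set t := min β (x + δ / 2) with ht
  have hst : s ≤ t := le_min hs.1.2 (by linarith)
  have htβ : t ≤ β := min_le_left _ _
  have h1 : Q s t := h s t hs.1.1 hst htβ hsx ((min_le_right _ _).trans_lt (by linarith))
  have h2 : Q α t := hmerge α s t le_rfl hs.1.1 hst htβ hs.2 h1
  have h3 : t ≤ x := le_csSup hbdd ⟨⟨hs.1.1.trans hst, htβ⟩, h2⟩
  rcases min_choice β (x + δ / 2) with h4 | h4
  · rw [← ht] at h4
    rwa [h4] at h2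
  · rw [← ht] at h4
    linarith

variable {E : Type} [NormedAddCommGroup E] [NormedSpace ℝ E]
variable {M : Type*} [TopologicalSpace M] [ChartedSpace E M] [IsManifold 𝓘(ℝ, E) ∞ M]
variable {Ω : SymplecticForm E M}

variable [T2Space M] [FiniteDimensional ℝ E]
variable {B : Type*} [TopologicalSpace B] [T2Space B]

namespace RectModel

variable {T : TorusHam Ω} {F : M → B} {Φ : B → ℝ × ℝ} {j : ℝ × ℝ → B} {R a : ℝ}
variable {z₁ z₂ : M → ℂ}

/-- The numbers close to the ratio of `z₁` and `z₂` at all points over the point of `D` with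
coordinates `c` and `t`. -/
def nearRatio (F : M → B) (j : ℝ × ℝ → B) (z₁ z₂ : M → ℂ) (D : Set (ℝ × ℝ))
    (e e' : ℝ × ℝ →L[ℝ] ℝ) (c t : ℝ) : Set ℂ :=
  {v | ∀ p, ∀ q ∈ D, e q = c → e' q = t → F p = j q → ∀ ρ : M → ℂ, ContinuousAt ρ p →
    (∀ᶠ x in 𝓝 p, z₁ x = ρ x * z₂ x) → ‖v - ρ p‖ ≤ 1 / 2 * ‖ρ p‖}

theorem convex_nearRatio (D : Set (ℝ × ℝ)) (e e' : ℝ × ℝ →L[ℝ] ℝ) (c t : ℝ) :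
    Convex ℝ (nearRatio F j z₁ z₂ D e e' c t) := by
  intro v hv v' hv' a b ha hb hab p q hq h1 h2 hp ρ hρ hρz
  have k1 := hv p q hq h1 h2 hp ρ hρ hρz
  have k2 := hv' p q hq h1 h2 hp ρ hρ hρz
  have := convex_closedBall (ρ p) (1 / 2 * ‖ρ p‖) (mem_closedBall_iff_norm.2 k1)
    (mem_closedBall_iff_norm.2 k2) ha hb hab
  exact mem_closedBall_iff_norm.1 this

/-- By continuity the value of the ratio at one point is within the tolerance at nearby points. By
equivariance the ratio is constant along orbits, so the bound holds on whole fibres over nearby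
points of the cut. -/
theorem exists_nearRatio (h : RectModel T F Φ j R a) {D : Set (ℝ × ℝ)} (hDc : IsCompact D)
    (hD : D ⊆ Ico 0 R ×ˢ Icc 0 a) {e e' : ℝ × ℝ →L[ℝ] ℝ}
    (he : ∀ q q', e q = e q' → e' q = e' q' → q = q') {c : ℝ}
    (hz₁ : T.Equivariant z₁) (hz₂ : T.Equivariant z₂)
    (h₁ : ∀ p, ∀ q ∈ D, e q = c → F p = j q → T.Adm z₁ p)
    (h₂ : ∀ p, ∀ q ∈ D, e q = c → F p = j q → T.Adm z₂ p) (t₀ : ℝ) :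
    ∃ v, ∀ᶠ t in 𝓝 t₀, v ∈ nearRatio F j z₁ z₂ D e e' c t := by
  have hD' : IsCompact (D ∩ {q | e q = c}) :=
    hDc.inter_right (isClosed_eq e.continuous continuous_const)
  by_cases hex : ∃ q ∈ D, e q = c ∧ e' q = t₀
  · obtain ⟨q₀, hq₀, hq₀c, hq₀t⟩ := hex
    obtain ⟨p₀, hp₀⟩ := h.model.surjective (j q₀)
    obtain ⟨ρ₀, hρ₀, hρ₀z, hρ₀0⟩ := h.exists_ratio (hD hq₀) hp₀ hz₁ hz₂ (h₁ _ _ hq₀ hq₀c hp₀)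
      (h₂ _ _ hq₀ hq₀c hp₀)
    have hW : {x | ContinuousAt ρ₀ x ∧ (∀ᶠ y in 𝓝 x, z₁ y = ρ₀ y * z₂ y) ∧
        ‖ρ₀ p₀ - ρ₀ x‖ ≤ 1 / 2 * ‖ρ₀ x‖} ∈ 𝓝 p₀ := by
      have hc : ContinuousAt ρ₀ p₀ := hρ₀.self_of_nhds.continuousAt
      have h1 : ContinuousAt (fun x => 1 / 2 * ‖ρ₀ x‖ - ‖ρ₀ p₀ - ρ₀ x‖) p₀ :=
        (hc.norm.const_mul _).sub (continuousAt_const.sub hc).norm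
      have h2 : 0 < 1 / 2 * ‖ρ₀ p₀‖ - ‖ρ₀ p₀ - ρ₀ p₀‖ := by
        rw [sub_self, norm_zero, sub_zero]; positivity
      filter_upwards [hρ₀, eventually_eventually_nhds.2 hρ₀z, h1.eventually (lt_mem_nhds h2)]
        with x k1 k2 k3
      exact ⟨k1.continuousAt, k2, by linarith⟩
    obtain ⟨N, hNo, hN, hN'⟩ := ToricModel.eventually_orbit_subset (T := T) hW
    have hfib := h.eventually_fibre_subset (hD hq₀) hNo (fun x hx => by
      obtain ⟨ζ, rfl⟩ := h.model.fibre_eq_orbit (h.model.localOrbit h.dim p₀) (hx.trans hp₀.symm)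
      exact hN ζ) hD
    obtain ⟨O, hO, hOo, hq₀O⟩ := eventually_nhds_iff.1 hfib
    have hcl : IsClosed (e' '' ((D ∩ {q | e q = c}) \ O)) :=
      ((hD'.diff hOo).image e'.continuous).isClosed
    have ht₀ : t₀ ∈ (e' '' ((D ∩ {q | e q = c}) \ O))ᶜ := by
      rintro ⟨q, ⟨⟨hq, hqc⟩, hqO⟩, hqt⟩
      have : q = q₀ := he q q₀ (by rw [hqc, hq₀c]) (by rw [hqt, hq₀t])
      exact hqO (this ▸ hq₀O)
    refine ⟨ρ₀ p₀, ?_⟩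
    filter_upwards [hcl.isOpen_compl.mem_nhds ht₀] with t ht p q hq hqc hqt hp ρ hρ hρz
    have hqO : q ∈ O := by
      by_contra hqO
      exact ht ⟨q, ⟨⟨hq, hqc⟩, hqO⟩, hqt⟩
    obtain ⟨ζ, y, ⟨hy1, hy2, hy3⟩, rfl⟩ := hN' p (hO q hqO hq p hp)
    have hyF : F y = j q := by rw [← hp, h.model.F_act]
    have hact : ContinuousAt (T.act ζ) y := (T.smooth_act_right ζ).continuous.continuousAt
    have hρ' : ContinuousAt (fun x => ρ (T.act ζ x)) y := ContinuousAt.comp hρ hact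
    -- Both functions have the same weight, so translating a ratio by `ζ` gives another ratio of
    -- them; uniqueness applies.
    have h4 : ρ₀ y = ρ (T.act ζ y) := by
      refine h.ratio_unique (hD hq) hyF (h₂ _ _ hq hqc hyF) hy1 hρ' hy2 ?_
      filter_upwards [hact.eventually hρz] with x hx
      rw [hz₁, hz₂] at hx
      exact mul_left_cancel₀ (expi_ne_zero ζ.1) (by rw [hx]; ring)
    rw [← h4]
    exact hy3
  -- No point of the cut has coordinate `t₀`, nor any nearby coordinate by compactness, so the
  -- condition is void.
  · refine ⟨0, ?_⟩
    have hcl : IsClosed (e' '' (D ∩ {q | e q = c})) := (hD'.image e'.continuous).isClosed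
    have ht₀ : t₀ ∈ (e' '' (D ∩ {q | e q = c}))ᶜ := by
      rintro ⟨q, ⟨hq, hqc⟩, hqt⟩
      exact hex ⟨q, hq, hqc, hqt⟩
    filter_upwards [hcl.isOpen_compl.mem_nhds ht₀] with t ht p q hq hqc hqt
    exact absurd ⟨q, ⟨hq, hqc⟩, hqt⟩ ht

/-- On the cut `e = c` the two functions have a non-vanishing ratio `ρ`. It is approximated by a
smooth function `v` of the momentum coordinate `e'`, with `|v - ρ| ≤ |ρ|/2`. With a cutoff `χ`
across the cut, `(1 - χ) z₁ + χ v z₂` equals `((1 - χ) ρ + χ v) z₂` near the cut, and the segment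
from `ρ` to `v` avoids zero. -/
theorem glued_merge (h : RectModel T F Φ j R a) {D : Set (ℝ × ℝ)} (hDc : IsCompact D)
    (hD : D ⊆ Ico 0 R ×ˢ Icc 0 a) {e e' : ℝ × ℝ →L[ℝ] ℝ}
    (he : ∀ q q', e q = e q' → e' q = e' q' → q = q') {c : ℝ}
    (hproj : ∀ q ∈ D, ∃ q' ∈ D, e q' = c ∧ e' q' = e' q)
    (hle : T.Glued F j (D ∩ {q | e q ≤ c})) (hge : T.Glued F j (D ∩ {q | c ≤ e q})) :
    T.Glued F j D := by
  obtain ⟨z₁, hz₁, hA₁⟩ := hle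
  obtain ⟨z₂, hz₂, hA₂⟩ := hge
  have h₁ : ∀ p, ∀ q ∈ D, e q = c → F p = j q → T.Adm z₁ p := fun p q hq hqc hp =>
    hA₁ p q ⟨hq, hqc.le⟩ hp
  have h₂ : ∀ p, ∀ q ∈ D, e q = c → F p = j q → T.Adm z₂ p := fun p q hq hqc hp =>
    hA₂ p q ⟨hq, hqc.ge⟩ hp
  have hmom : ∀ {p : M} {q : ℝ × ℝ}, q ∈ D → F p = j q → T.mom p = q := fun hq hp =>
    h.mom_eq ⟨⟨(hD hq).1.1, (hD hq).1.2.le⟩, (hD hq).2⟩ hp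
  -- The admissible values form convex sets and locally a constant is admissible, so a partition of
  -- unity provides `v`.
  obtain ⟨v, hv⟩ := exists_contMDiffMap_forall_mem_convex_of_local_const (n := (⊤ : ℕ∞)) 𝓘(ℝ, ℝ)
    (t := fun t => nearRatio F j z₁ z₂ D e e' c t) (fun t => convex_nearRatio D e e' c t)
    (h.exists_nearRatio hDc hD he hz₁ hz₂ h₁ h₂)
  have hvs : ∀ x, SmoothAt (E := E) (fun x => v (e' (T.mom x))) x := fun x =>
    (v.contMDiff.comp (e'.contDiff.contMDiff.comp T.smooth_mom)) x
  have hvc : ∀ x, ContinuousAt (fun x => v (e' (T.mom x))) x := fun x => (hvs x).continuousAt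
  set Q : M → Prop := fun x => T.Adm z₂ x ∧ ∃ ρ : M → ℂ, (∀ᶠ y in 𝓝 x, SmoothAt (E := E) ρ y) ∧
    (∀ᶠ y in 𝓝 x, z₁ y = ρ y * z₂ y) ∧ ‖v (e' (T.mom x)) - ρ x‖ < ‖ρ x‖ with hQ
  have hQe : ∀ p, ∀ q ∈ D, e q = c → F p = j q → (∀ᶠ x in 𝓝 p, Q x) ∧ v (e' q) ≠ 0 := by
    intro p q hq hqc hp
    obtain ⟨ρ, hρ, hρz, hρ0⟩ := h.exists_ratio (hD hq) hp hz₁ hz₂ (h₁ _ _ hq hqc hp)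
      (h₂ _ _ hq hqc hp)
    have hρc : ContinuousAt ρ p := hρ.self_of_nhds.continuousAt
    have h3 := hv (e' q) p q hq hqc rfl hp ρ hρc hρz
    have hpos : 0 < ‖ρ p‖ := norm_pos_iff.2 hρ0
    have h4 : ‖v (e' (T.mom p)) - ρ p‖ < ‖ρ p‖ := by
      rw [hmom hq hp]; linarith
    refine ⟨?_, fun h0 => ?_⟩
    · have h5 : ContinuousAt (fun x => ‖ρ x‖ - ‖v (e' (T.mom x)) - ρ x‖) p :=
        hρc.norm.sub ((hvc p).sub hρc).norm
      filter_upwards [(h₂ _ _ hq hqc hp).eventually, eventually_eventually_nhds.2 hρ,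
        eventually_eventually_nhds.2 hρz, h5.eventually (lt_mem_nhds (sub_pos.2 h4))]
        with x k1 k2 k3 k4
      exact ⟨k1, ρ, k2, k3, sub_pos.1 k4⟩
    · rw [h0, zero_sub, norm_neg] at h3
      linarith
  -- Beyond the cut the glued function is `v z₂`, so `v` must not vanish at any level of `e'` in
  -- `D`; each level meets the cut.
  have hvne : ∀ q ∈ D, v (e' q) ≠ 0 := by
    intro q hq
    obtain ⟨q', hq', hc', he'⟩ := hproj q hq
    obtain ⟨p, hp⟩ := h.model.surjective (j q')
    rw [← he']
    exact (hQe p q' hq' hc' hp).2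
  -- Compactness of `D` turns the neighbourhoods of the points of the cut into a strip of uniform
  -- width.
  obtain ⟨δ, hδ, hQδ⟩ : ∃ δ > 0, ∀ q ∈ D, |e q - c| < δ → ∀ p, F p = j q → Q p := by
    set U : Set (ℝ × ℝ) := interior {q | q ∈ D → ∀ p, F p = j q → p ∈ {x | ∀ᶠ y in 𝓝 x, Q y}}
    have hU : ∀ q ∈ D, e q = c → q ∈ U := fun q hq hqc =>
      mem_interior_iff_mem_nhds.2 (h.eventually_fibre_subset (hD hq)
        isOpen_setOfPred_eventually_nhds (fun p hp => (hQe p q hq hqc hp).1) hD)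
    obtain ⟨δ, hδ, hδ'⟩ := (hDc.diff isOpen_interior).exists_forall_le' (s := D \ U)
      (f := fun q => |e q - c|) (a := 0) (by fun_prop) (fun q hq => by
        refine abs_pos.2 (sub_ne_zero.2 fun h0 => hq.2 (hU q hq.1 h0)))
    refine ⟨δ, hδ, fun q hq hlt p hp => ?_⟩
    have hqU : q ∈ U := by
      by_contra hqU
      exact absurd (hδ' q ⟨hq, hqU⟩) (not_le.2 hlt)
    exact Eventually.self_of_nhds (interior_subset hqU hq p hp)
  set δ' := δ / 2 with hδ'
  set χ : M → ℝ := fun x => Real.smoothTransition ((e (T.mom x) - (c - δ')) / (2 * δ')) with hχ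
  have hχs : ∀ x, SmoothAt (E := E) (fun x => ((χ x : ℝ) : ℂ)) x := by
    intro x
    have h1 : ContDiff ℝ ∞ (fun q : ℝ × ℝ =>
        ((Real.smoothTransition ((e q - (c - δ')) / (2 * δ')) : ℝ) : ℂ)) :=
      Complex.ofRealCLM.contDiff.comp (Real.smoothTransition.contDiff.comp
        ((e.contDiff.sub contDiff_const).div_const _))
    exact (h1.contMDiff.comp T.smooth_mom) x
  have hec : Continuous fun x => e (T.mom x) := e.continuous.comp T.smooth_mom.continuous
  refine ⟨fun x => (1 - (χ x : ℂ)) * z₁ x + χ x * v (e' (T.mom x)) * z₂ x, ?_, ?_⟩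
  · intro ζ x
    simp only [hχ, T.mom_act, hz₁ ζ x, hz₂ ζ x]
    ring
  · intro p q hq hp
    have hmp := hmom hq hp
    by_cases hlt : e q < c - δ'
    · refine (hA₁ p q ⟨hq, by change e q ≤ c; linarith⟩ hp).congr ?_
      rw [← hmp] at hlt
      filter_upwards [hec.continuousAt.eventually (gt_mem_nhds hlt)] with x hx
      have : χ x = 0 := Real.smoothTransition.zero_of_nonpos
        (div_nonpos_of_nonpos_of_nonneg (by linarith) (by positivity))
      rw [this]
      simp
    by_cases hgt : c + δ' < e q
    · refine ((hA₂ p q ⟨hq, by change c ≤ e q; linarith⟩ hp).mul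
        (Eventually.of_forall hvs) (by rw [hmp]; exact hvne q hq)).congr ?_
      rw [← hmp] at hgt
      filter_upwards [hec.continuousAt.eventually (lt_mem_nhds hgt)] with x hx
      have : χ x = 1 := Real.smoothTransition.one_of_one_le
        ((one_le_div (by positivity)).2 (by linarith))
      rw [this]
      simp
    · have habs : |e q - c| < δ := by
        rw [abs_lt]; constructor <;> linarith
      obtain ⟨hA, ρ, hρ, hρz, hρv⟩ := hQδ q hq habs p hp
      refine (hA.mul (ρ := fun x => (1 - (χ x : ℂ)) * ρ x + χ x * v (e' (T.mom x))) ?_ ?_).congr ?_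
      · filter_upwards [hρ] with x hx
        exact (SmoothAt.cmul (contMDiffAt_const.sub (hχs x)) hx).add (SmoothAt.cmul (hχs x) (hvs x))
      · have h1 : (1 - (χ p : ℂ)) * ρ p + χ p * v (e' (T.mom p)) =
            ρ p + χ p * (v (e' (T.mom p)) - ρ p) := by ring
        rw [h1]
        intro h0
        have h2 : ‖ρ p‖ = ‖(χ p : ℂ) * (v (e' (T.mom p)) - ρ p)‖ := by
          rw [← norm_neg, ← eq_neg_of_add_eq_zero_right h0]
        rw [norm_mul, Complex.norm_real, Real.norm_of_nonneg (Real.smoothTransition.nonneg _)] at h2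
        have h3 : χ p ≤ 1 := Real.smoothTransition.le_one _
        nlinarith [norm_nonneg (v (e' (T.mom p)) - ρ p)]
      · filter_upwards [hρz] with x hx
        rw [hx]
        ring

theorem _root_.TorusHam.Glued.mono {D D' : Set (ℝ × ℝ)} (h : T.Glued F j D) (hD : D' ⊆ D) :
    T.Glued F j D' := by
  obtain ⟨z, hz, hA⟩ := h
  exact ⟨z, hz, fun p q hq => hA p q (hD hq)⟩

/-- Two nested inductions over intervals: thin vertical strips are assembled from small rectangles,
then joined from left to right. -/
theorem glued (h : RectModel T F Φ j R a) {b : ℝ} (hb0 : 0 ≤ b) (hb : b < R) :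
    T.Glued F j (Icc 0 b ×ˢ Icc 0 a) := by
  have hsub : ∀ {s t u v : ℝ}, 0 ≤ u → v ≤ b → 0 ≤ s → t ≤ a →
      Icc u v ×ˢ Icc s t ⊆ Ico 0 R ×ˢ Icc 0 a := fun h1 h2 h3 h4 =>
    prod_mono (fun x hx => ⟨h1.trans hx.1, (hx.2.trans h2).trans_lt hb⟩) (Icc_subset_Icc h3 h4)
  refine interval_glue hb0 (fun u v => T.Glued F j (Icc u v ×ˢ Icc 0 a)) ?_ fun x₀ hx₀ => ?_
  · intro s m t h1 h2 h3 h4 hQ1 hQ2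
    refine h.glued_merge (isCompact_Icc.prod isCompact_Icc) (hsub h1 h4 le_rfl le_rfl)
      (e := ContinuousLinearMap.fst ℝ ℝ ℝ) (e' := ContinuousLinearMap.snd ℝ ℝ ℝ)
      (fun q q' h h' => Prod.ext h h') (c := m) (fun q hq => ⟨(m, q.2), ⟨⟨h2, h3⟩, hq.2⟩, rfl, rfl⟩)
      (hQ1.mono fun q hq => ⟨⟨hq.1.1.1, hq.2⟩, hq.1.2⟩)
      (hQ2.mono fun q hq => ⟨⟨hq.2, hq.1.1.2⟩, hq.1.2⟩)
  -- The width `δ` of the strip belongs to the inductive claim, and merging takes the smaller of two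
  -- widths.
  · refine interval_glue h.pos_a.le (fun s t => ∃ δ > 0, ∀ u v, 0 ≤ u → u ≤ v → v ≤ b →
      x₀ - δ < u → v < x₀ + δ → T.Glued F j (Icc u v ×ˢ Icc s t)) ?_ fun y₀ hy₀ => ?_
    · rintro s m t h1 h2 h3 h4 ⟨δ₁, hδ₁, hQ1⟩ ⟨δ₂, hδ₂, hQ2⟩
      refine ⟨min δ₁ δ₂, lt_min hδ₁ hδ₂, fun u v k1 k2 k3 k4 k5 => ?_⟩
      have l1 := min_le_left δ₁ δ₂
      have l2 := min_le_right δ₁ δ₂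
      refine h.glued_merge (isCompact_Icc.prod isCompact_Icc) (hsub k1 k3 h1 h4)
        (e := ContinuousLinearMap.snd ℝ ℝ ℝ) (e' := ContinuousLinearMap.fst ℝ ℝ ℝ)
        (fun q q' h h' => Prod.ext h' h) (c := m) (fun q hq => ⟨(q.1, m), ⟨hq.1, ⟨h2, h3⟩⟩, rfl, rfl⟩)
        ((hQ1 u v k1 k2 k3 (by linarith) (by linarith)).mono
          fun q hq => ⟨hq.1.1, ⟨hq.1.2.1, hq.2⟩⟩)
        ((hQ2 u v k1 k2 k3 (by linarith) (by linarith)).mono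
          fun q hq => ⟨hq.1.1, ⟨hq.2, hq.1.2.2⟩⟩)
    · obtain ⟨U, hU, hUD⟩ := h.glued_local (q := (x₀, y₀)) ⟨⟨hx₀.1, hx₀.2.trans_lt hb⟩, hy₀⟩
      obtain ⟨δ, hδ, hball⟩ := Metric.mem_nhds_iff.1 hU
      refine ⟨δ, hδ, fun s t h1 h2 h3 h4 h5 => ⟨δ, hδ, fun u v k1 k2 k3 k4 k5 =>
        hUD _ (hsub k1 k3 h1 h3) fun q hq => hball ?_⟩⟩
      rw [Metric.mem_ball, Prod.dist_eq, max_lt_iff, Real.dist_eq, Real.dist_eq, abs_lt, abs_lt]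
      have := hq.1.1
      have := hq.1.2
      have := hq.2.1
      have := hq.2.2
      exact ⟨⟨by linarith, by linarith⟩, ⟨by linarith, by linarith⟩⟩

/-- The normalised complex coordinate over a rectangle. -/
theorem exists_coordinate (h : RectModel T F Φ j R a) {b : ℝ} (hb0 : 0 ≤ b) (hb : b < R) :
    ∃ z, T.Equivariant z ∧ ∀ p, ∀ q ∈ Icc 0 b ×ˢ Icc 0 a, F p = j q →
      (∀ᶠ x in 𝓝 p, SmoothAt (E := E) z x) ∧
      ∀ᶠ x in 𝓝 p, Real.pi * Complex.normSq (z x) = (T.mom x).1 := by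
  obtain ⟨z, hz, hA⟩ := h.glued hb0 hb
  refine ⟨_, fun ζ x => ?_, fun p q hq hp => (hA p q hq hp).normalize⟩
  simp only [T.mom_act, hz ζ x, norm_mul, norm_expi, one_mul]
  ring

end RectModel

end

/-! ### The displacing Hamiltonian of the plane -/

noncomputable section

/-- This representation shows the smoothness of `sinc` at the origin. -/
theorem Real.sinc_eq_integral (x : ℝ) : Real.sinc x = ∫ t in (0 : ℝ)..1, Real.cos (x * t) := by
  by_cases hx : x = 0
  · simp [hx]
  · rw [Real.sinc_of_ne_zero hx, intervalIntegral.integral_comp_mul_left (fun t => Real.cos t) hx]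
    simp [div_eq_inv_mul]

theorem Real.contDiff_sinc : ContDiff ℝ ∞ Real.sinc := by
  have h1 : Real.sinc = fun x => ∫ t in (0 : ℝ)..1, Real.cos (x * t) := by
    ext x; exact Real.sinc_eq_integral x
  rw [h1, contDiff_iff_contDiffAt]
  intro x
  refine contDiffAt_intervalIntegral (f := fun q : ℝ × ℝ => Real.cos (q.1 * q.2)) fun t _ => ?_
  exact (Real.contDiff_cos.comp (contDiff_fst.mul contDiff_snd)).contDiffAt

theorem Real.mul_sinc (x : ℝ) : x * Real.sinc x = Real.sin x := by
  by_cases hx : x = 0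
  · simp [hx]
  · rw [Real.sinc_of_ne_zero hx]; field_simp

theorem Real.hasDerivAt_sinc (x : ℝ) : HasDerivAt Real.sinc (deriv Real.sinc x) x :=
  (Real.contDiff_sinc.differentiable (by simp) x).hasDerivAt

theorem Real.mul_deriv_sinc (x : ℝ) : x * deriv Real.sinc x = Real.cos x - Real.sinc x := by
  have h1 : HasDerivAt (fun x => x * Real.sinc x) (1 * Real.sinc x + x * deriv Real.sinc x) x :=
    (hasDerivAt_id' x).mul (Real.hasDerivAt_sinc x)
  have h2 : (fun x => x * Real.sinc x) = Real.sin := by ext x; exact Real.mul_sinc x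
  rw [h2] at h1
  have := h1.unique (Real.hasDerivAt_sin x)
  linarith

theorem Real.sinc_abs (x : ℝ) : Real.sinc |x| = Real.sinc x := by
  rcases abs_choice x with h | h <;> rw [h]
  exact Real.sinc_neg x

theorem Real.cos_le_sinc {x : ℝ} (h : |x| ≤ Real.pi / 2) : Real.cos x ≤ Real.sinc x := by
  rw [← Real.cos_abs, ← Real.sinc_abs]
  rcases (abs_nonneg x).lt_or_eq with h0 | h0
  · rw [Real.sinc_of_ne_zero h0.ne', le_div_iff₀ h0]
    rcases h.lt_or_eq with h1 | h1
    · have h2 := Real.lt_tan h0 h1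
      rw [Real.tan_eq_sin_div_cos, lt_div_iff₀ (Real.cos_pos_of_mem_Ioo
        ⟨by linarith [abs_nonneg x], h1⟩)] at h2
      linarith
    · rw [h1]; simp
  · rw [← h0]; simp

/-- A smooth truncation of the identity function. -/
theorem exists_truncation {η : ℝ} (hη : 0 < η) : ∃ m m' : ℝ → ℝ, ContDiff ℝ ∞ m ∧
    (∀ s, HasDerivAt m (m' s) s) ∧ (∀ s, 0 ≤ m' s) ∧ (∀ s ≤ 1, m s = s) ∧
    (∀ s ≤ 1, m' s = 1) ∧ (∀ s ≥ 1, 1 ≤ m s ∧ m s ≤ 1 + η) := by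
  -- The truncation is the integral of a smooth function with values in `[0, 1]`, equal to one up to
  -- `1` and to zero beyond `1 + η`.
  set f : ℝ → ℝ := fun s => 1 - Real.smoothTransition ((s - 1) / η) with hf
  have hfs : ContDiff ℝ ∞ f := contDiff_const.sub
    (Real.smoothTransition.contDiff.comp ((contDiff_id.sub contDiff_const).div_const _))
  have hf0 : ∀ s, 0 ≤ f s := fun s => sub_nonneg.2 (Real.smoothTransition.le_one _)
  have hf1 : ∀ s, f s ≤ 1 := fun s => sub_le_self _ (Real.smoothTransition.nonneg _)
  have hfl : ∀ s ≤ 1, f s = 1 := fun s hs => by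
    simp only [hf]
    rw [Real.smoothTransition.zero_of_nonpos
      (div_nonpos_of_nonpos_of_nonneg (by linarith) hη.le), sub_zero]
  have hfr : ∀ s ≥ 1 + η, f s = 0 := fun s hs => by
    simp only [hf]
    rw [Real.smoothTransition.one_of_one_le ((one_le_div hη).2 (by linarith)), sub_self]
  set m : ℝ → ℝ := fun s => ∫ t in (0 : ℝ)..s, f t with hm
  have hd : ∀ s, HasDerivAt m (f s) s := fun s =>
    intervalIntegral.integral_hasDerivAt_right (hfs.continuous.intervalIntegrable _ _)
      (hfs.continuous.stronglyMeasurableAtFilter _ _) hfs.continuous.continuousAt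
  have hle : ∀ s ≤ 1, m s = s := by
    intro s hs
    have h1 : ∀ t ∈ uIcc 0 s, f t = 1 := fun t ht => by
      refine hfl t ?_
      rcases le_total 0 s with h | h
      · rw [uIcc_of_le h] at ht; exact ht.2.trans hs
      · rw [uIcc_of_ge h] at ht; linarith [ht.2]
    simp only [hm]
    rw [intervalIntegral.integral_congr h1]
    simp
  have hmono : Monotone m := monotone_of_hasDerivAt_nonneg hd hf0
  have h1 : m 1 = 1 := hle 1 le_rfl
  have hb : ∀ s, 1 ≤ s → s ≤ 1 + η → m s ≤ s := by
    intro s hs _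
    have := image_le_of_deriv_right_le_deriv_boundary (f := m) (f' := f) (B := fun s => s)
      (B' := fun _ => 1) (a := 1) (b := s)
      (fun x _ => (hd x).continuousAt.continuousWithinAt) (fun x _ => (hd x).hasDerivWithinAt)
      h1.le continuousOn_id (fun x _ => (hasDerivAt_id' x).hasDerivWithinAt)
      (fun x _ => hf1 x)
    exact this ⟨hs, le_rfl⟩
  refine ⟨m, f, ?_, hd, hf0, hle, hfl, fun s hs => ⟨?_, ?_⟩⟩
  · rw [contDiff_infty_iff_deriv]
    refine ⟨fun s => (hd s).differentiableAt, ?_⟩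
    rwa [show deriv m = f from funext fun s => (hd s).deriv]
  · rw [← h1]; exact hmono hs
  · rcases le_total s (1 + η) with h | h
    · exact (hb s hs h).trans h
    · have h2 : m s = m (1 + η) := by
        have h3 := intervalIntegral.integral_add_adjacent_intervals (μ := MeasureTheory.volume)
          (hfs.continuous.intervalIntegrable 0 (1 + η)) (hfs.continuous.intervalIntegrable (1 + η) s)
        have h4 : ∫ t in (1 + η)..s, f t = 0 := by
          rw [intervalIntegral.integral_congr (g := fun _ => (0 : ℝ)) fun t ht => ?_]
          · simp
          · rw [uIcc_of_le h] at ht; exact hfr t ht.1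
        rw [h4, add_zero] at h3
        exact h3.symm
      rw [h2]
      exact hb _ (by linarith) le_rfl

/-! ### Height function, displacing Hamiltonian, and their smoothness across the slit. -/

section Planar

variable (κ : ℝ)

/-- The height function of the displacing Hamiltonian. -/
def height (z : ℂ) : ℝ := κ * ‖z‖ * Real.sinc z.arg

/-- The displacing Hamiltonian of the plane. -/
def planarHam (c : ℝ) (m : ℝ → ℝ) (z : ℂ) : ℝ :=
  open Classical in
  if z ∈ Complex.slitPlane then c * z.arg * m (height κ z) else c * κ * z.im

variable {κ}

theorem height_eq_zero {z : ℂ} (hz : z ∉ Complex.slitPlane) : height κ z = 0 := by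
  by_cases h0 : z = 0
  · simp [height, h0]
  · have h1 : z.arg = Real.pi := by
      by_contra h
      exact hz (Complex.mem_slitPlane_iff_arg.2 ⟨h, h0⟩)
    rw [height, h1, Real.sinc_of_ne_zero Real.pi_ne_zero]
    simp

/-- The reason for the factor `sinc` in the height: the discontinuous angle times the height is a
multiple of `Im z`, which is smooth across the slit. -/
theorem arg_mul_height (z : ℂ) : z.arg * height κ z = κ * z.im := by
  have h1 := Real.mul_sinc z.arg
  have h2 : ‖z‖ * Real.sin z.arg = z.im := Complex.norm_mul_sin_arg z
  rw [height, ← h2, ← h1]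
  ring

theorem re_le_height (hκ : 0 < κ) (z : ℂ) (h : 0 ≤ z.re) : κ * z.re ≤ height κ z := by
  have h1 := Real.cos_le_sinc (Complex.abs_arg_le_pi_div_two_iff.2 h)
  have h2 : ‖z‖ * Real.cos z.arg = z.re := Complex.norm_mul_cos_arg z
  rw [height, ← h2, mul_assoc]
  gcongr

theorem Complex.arg_eq_imCLM_comp_log : Complex.arg = Complex.imCLM ∘ Complex.log := by
  ext w; exact (Complex.log_im w).symm

theorem contDiffAt_arg {z : ℂ} (hz : z ∈ Complex.slitPlane) : ContDiffAt ℝ ∞ Complex.arg z := by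
  have h1 : ContDiffAt ℝ ∞ Complex.log z := (Complex.contDiffAt_log hz).restrict_scalars ℝ
  rw [Complex.arg_eq_imCLM_comp_log]
  exact Complex.imCLM.contDiff.contDiffAt.comp z h1

theorem contDiffAt_height {z : ℂ} (hz : z ∈ Complex.slitPlane) : ContDiffAt ℝ ∞ (height κ) z :=
  (contDiffAt_const.mul (contDiffAt_norm ℝ (Complex.slitPlane_ne_zero hz))).mul
    (Real.contDiff_sinc.contDiffAt.comp z (contDiffAt_arg hz))

theorem continuous_height : Continuous (height κ) := by
  rw [continuous_iff_continuousAt]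
  intro z
  by_cases hz : z ∈ Complex.slitPlane
  · exact (contDiffAt_height hz).continuousAt
  have h0 := height_eq_zero (κ := κ) hz
  rw [ContinuousAt, h0, tendsto_zero_iff_abs_tendsto_zero]
  by_cases hz0 : z = 0
  · refine squeeze_zero (fun _ => abs_nonneg _) (g := fun w => |κ| * ‖w‖) (fun w => ?_) ?_
    · simp only [Function.comp_apply, height, abs_mul, abs_norm]
      exact mul_le_of_le_one_right (by positivity) (Real.abs_sinc_le_one _)
    · have : Continuous fun w : ℂ => |κ| * ‖w‖ := by fun_prop
      simpa [hz0] using this.tendsto z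
  · have hz' : z.re < 0 ∧ z.im = 0 := by
      rw [Complex.mem_slitPlane_iff] at hz
      push Not at hz
      refine ⟨lt_of_le_of_ne hz.1 fun h => hz0 (Complex.ext h hz.2), hz.2⟩
    -- Near the negative axis `|arg| ≥ 1`, so `|arg| |height| = |κ| |Im|` bounds the height.
    refine squeeze_zero' (g := fun w => |κ| * |w.im|) (Eventually.of_forall fun _ => abs_nonneg _)
      ?_ ?_
    · filter_upwards [Complex.continuous_re.continuousAt.eventually (gt_mem_nhds hz'.1)] with w hw
      have h1 := arg_mul_height (κ := κ) w
      have h2 : Real.pi / 2 < |w.arg| := by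
        by_contra h
        exact absurd (Complex.abs_arg_le_pi_div_two_iff.1 (not_lt.1 h)) (not_le.2 hw)
      have h3 : |w.arg| * |height κ w| = |κ| * |w.im| := by rw [← abs_mul, h1, abs_mul]
      have h4 : 1 ≤ |w.arg| := by linarith [Real.two_le_pi]
      simp only [Function.comp_apply]
      rw [← h3]
      exact le_mul_of_one_le_left (abs_nonneg _) h4
    · have : Continuous fun w : ℂ => |κ| * |w.im| := by fun_prop
      simpa [hz'.2] using this.tendsto z

theorem planarHam_of_height_le {c : ℝ} {m : ℝ → ℝ} (hm : ∀ s ≤ 1, m s = s) {z : ℂ}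
    (h : height κ z ≤ 1) : planarHam κ c m z = c * κ * z.im := by
  rw [planarHam]
  split_ifs with hz
  · rw [hm _ h, mul_assoc, arg_mul_height]; ring
  · rfl

/-- The height vanishes on the slit, so near it the truncation is the identity and the Hamiltonian
is the linear function `c κ Im z`. -/
theorem contDiff_planarHam {c : ℝ} {m : ℝ → ℝ} (hm : ContDiff ℝ ∞ m) (hm1 : ∀ s ≤ 1, m s = s) :
    ContDiff ℝ ∞ (planarHam κ c m) := by
  rw [contDiff_iff_contDiffAt]
  intro z
  by_cases hz : z ∈ Complex.slitPlane
  · have h1 : planarHam κ c m =ᶠ[𝓝 z] fun z => c * z.arg * m (height κ z) := by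
      filter_upwards [Complex.isOpen_slitPlane.mem_nhds hz] with w hw
      rw [planarHam, if_pos hw]
    exact ((contDiffAt_const.mul (contDiffAt_arg hz)).mul
      (hm.contDiffAt.comp z (contDiffAt_height hz))).congr_of_eventuallyEq h1
  · have h0 : height κ z < 1 := by rw [height_eq_zero hz]; exact one_pos
    have h1 : planarHam κ c m =ᶠ[𝓝 z] fun z => c * κ * z.im := by
      filter_upwards [continuous_height.continuousAt.eventually (gt_mem_nhds h0)] with w hw
      exact planarHam_of_height_le hm1 hw.le
    exact (contDiffAt_const.mul Complex.imCLM.contDiff.contDiffAt).congr_of_eventuallyEq h1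

/-- The Hamiltonian vector field of a function on the plane. -/
def planarField (G : ℂ → ℝ) (z : ℂ) : ℂ := ⟨fderiv ℝ G z Complex.I, -fderiv ℝ G z 1⟩

/-- In the region of small height the flow is translation to the right with speed `c κ`. -/
theorem planarField_of_height_lt {c : ℝ} {m : ℝ → ℝ} (hm : ∀ s ≤ 1, m s = s) {z : ℂ}
    (h : height κ z < 1) : planarField (planarHam κ c m) z = ((c * κ : ℝ) : ℂ) := by
  have h1 : planarHam κ c m =ᶠ[𝓝 z] fun z => c * κ * z.im := by
    filter_upwards [continuous_height.continuousAt.eventually (gt_mem_nhds h)] with w hw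
    exact planarHam_of_height_le hm hw.le
  have h2 : HasFDerivAt (fun z : ℂ => c * κ * z.im) ((c * κ) • Complex.imCLM) z :=
    Complex.imCLM.hasFDerivAt.const_mul (c * κ)
  rw [planarField, h1.fderiv_eq, h2.fderiv]
  apply Complex.ext <;> simp

theorem hasFDerivAt_arg {z : ℂ} (hz : z ∈ Complex.slitPlane) :
    HasFDerivAt Complex.arg (Complex.imCLM.comp (ContinuousLinearMap.mul ℝ ℂ z⁻¹)) z := by
  have h1 : HasFDerivAt Complex.log (ContinuousLinearMap.mul ℝ ℂ z⁻¹) z := by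
    refine ((Complex.hasStrictDerivAt_log hz).hasDerivAt.hasFDerivAt.restrictScalars ℝ).congr_fderiv
      ?_
    ext w; simp [mul_comm]
  rw [Complex.arg_eq_imCLM_comp_log]
  exact Complex.imCLM.hasFDerivAt.comp z h1

end Planar

end

/-! ### Trajectories of the displacing Hamiltonian -/

noncomputable section

theorem hasFDerivAt_height (κ : ℝ) {z : ℂ} (hz : z ∈ Complex.slitPlane) :
    HasFDerivAt (height κ) ((κ * ‖z‖ * deriv Real.sinc z.arg) •
      (Complex.imCLM.comp (ContinuousLinearMap.mul ℝ ℂ z⁻¹)) +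
      (κ * Real.sinc z.arg / ‖z‖) • innerSL ℝ z) z := by
  have h0 : ‖z‖ ≠ 0 := norm_ne_zero_iff.2 (Complex.slitPlane_ne_zero hz)
  have h1 : HasFDerivAt (fun w : ℂ => Real.sinc w.arg) _ z :=
    (Real.hasDerivAt_sinc z.arg).comp_hasFDerivAt z (hasFDerivAt_arg hz)
  have h2 : HasFDerivAt (fun w : ℂ => ‖w‖) ((1 / ‖z‖) • innerSL ℝ z) z := by
    have h3 : HasFDerivAt (fun w : ℂ => ‖w‖ ^ 2) (2 • innerSL ℝ z) z :=
      (hasStrictFDerivAt_norm_sq z).hasFDerivAt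
    have h4 := h3.sqrt (by positivity)
    have h5 : (fun w : ℂ => √(‖w‖ ^ 2)) = fun w => ‖w‖ := by
      ext w; exact Real.sqrt_sq (norm_nonneg _)
    rw [h5] at h4
    refine h4.congr_fderiv ?_
    rw [Real.sqrt_sq (norm_nonneg _)]
    ext w
    simp
    field_simp
  refine ((h2.const_mul κ).mul h1).congr_fderiv ?_
  ext w
  simp
  ring

/-- The derivative of the displacing Hamiltonian along the angle. -/
def anglePart (κ c : ℝ) (m m' : ℝ → ℝ) (z : ℂ) : ℝ :=
  c * (m (height κ z) + m' (height κ z) * κ * ‖z‖ * (Real.cos z.arg - Real.sinc z.arg))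

/-! ### Derivatives along trajectories and growth of the norm. -/

section Along

variable {κ c : ℝ} {m m' : ℝ → ℝ}

theorem hasFDerivAt_planarHam (hm' : ∀ s, HasDerivAt m (m' s) s) {z : ℂ}
    (hz : z ∈ Complex.slitPlane) :
    HasFDerivAt (planarHam κ c m) (anglePart κ c m m' z •
      (Complex.imCLM.comp (ContinuousLinearMap.mul ℝ ℂ z⁻¹)) +
      (c * z.arg * m' (height κ z) * (κ * Real.sinc z.arg / ‖z‖)) • innerSL ℝ z) z := by
  have h1 : planarHam κ c m =ᶠ[𝓝 z] fun z => c * z.arg * m (height κ z) := by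
    filter_upwards [Complex.isOpen_slitPlane.mem_nhds hz] with w hw
    rw [planarHam, if_pos hw]
  have h2 : HasFDerivAt (fun w => m (height κ w)) _ z :=
    (hm' (height κ z)).comp_hasFDerivAt z (hasFDerivAt_height κ hz)
  refine ((((hasFDerivAt_arg hz).const_mul c).mul h2).congr_of_eventuallyEq h1).congr_fderiv ?_
  ext w
  have h3 := Real.mul_deriv_sinc z.arg
  simp only [anglePart]
  simp
  linear_combination (c * m' (height κ z) * κ * ‖z‖ *
    (z.re * (Complex.normSq z)⁻¹ * w.im - (Complex.normSq z)⁻¹ * z.im * w.re)) * h3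

theorem im_inv_mul_planarField (hm' : ∀ s, HasDerivAt m (m' s) s) {z : ℂ}
    (hz : z ∈ Complex.slitPlane) :
    (z⁻¹ * planarField (planarHam κ c m) z).im =
      -(c * z.arg * m' (height κ z) * (κ * Real.sinc z.arg / ‖z‖)) := by
  have h0 : z.re ^ 2 + z.im ^ 2 ≠ 0 := by
    have := (Complex.normSq_pos.2 (Complex.slitPlane_ne_zero hz)).ne'
    rwa [Complex.normSq_apply, ← pow_two, ← pow_two] at this
  rw [planarField, (hasFDerivAt_planarHam hm' hz).fderiv]
  generalize anglePart κ c m m' z = P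
  generalize c * z.arg * m' (height κ z) * (κ * Real.sinc z.arg / ‖z‖) = Q
  simp [Complex.inner, Complex.normSq_apply]
  field_simp
  ring

/-- The field is the gradient turned by a right angle, so its inner product with the position vector
is the angular derivative of the Hamiltonian. -/
theorem inner_planarField (hm' : ∀ s, HasDerivAt m (m' s) s) {z : ℂ}
    (hz : z ∈ Complex.slitPlane) :
    inner ℝ z (planarField (planarHam κ c m) z) = anglePart κ c m m' z := by
  have h0 : z.re ^ 2 + z.im ^ 2 ≠ 0 := by
    have := (Complex.normSq_pos.2 (Complex.slitPlane_ne_zero hz)).ne'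
    rwa [Complex.normSq_apply, ← pow_two, ← pow_two] at this
  rw [planarField, (hasFDerivAt_planarHam hm' hz).fderiv]
  generalize anglePart κ c m m' z = P
  generalize c * z.arg * m' (height κ z) * (κ * Real.sinc z.arg / ‖z‖) = Q
  simp [Complex.inner, Complex.normSq_apply]
  field_simp
  ring

variable {γ : ℝ → ℂ} {t : ℝ}

theorem hasDerivAt_normSq (hγ : HasDerivAt γ (planarField (planarHam κ c m) (γ t)) t)
    (hm' : ∀ s, HasDerivAt m (m' s) s) (hz : γ t ∈ Complex.slitPlane) :
    HasDerivAt (fun t => ‖γ t‖ ^ 2) (2 * anglePart κ c m m' (γ t)) t := by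
  have h := hγ.norm_sq
  rwa [inner_planarField hm' hz] at h

/-- The part of the field coming from `m(height)` is tangent to the level sets of the height. What
remains is `m` times the radial field of `c arg`, and the height is homogeneous of degree one in the
radius. -/
theorem hasDerivAt_height (hγ : HasDerivAt γ (planarField (planarHam κ c m) (γ t)) t)
    (hm' : ∀ s, HasDerivAt m (m' s) s) (hz : γ t ∈ Complex.slitPlane) :
    HasDerivAt (fun t => height κ (γ t))
      (c * m (height κ (γ t)) * height κ (γ t) / ‖γ t‖ ^ 2) t := by
  have h0 : ‖γ t‖ ≠ 0 := norm_ne_zero_iff.2 (Complex.slitPlane_ne_zero hz)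
  refine ((hasFDerivAt_height κ hz).comp_hasDerivAt t hγ).congr_deriv ?_
  have h3 := Real.mul_deriv_sinc (γ t).arg
  simp only [add_apply, smul_apply, innerSL_apply_apply, inner_planarField hm' hz,
    ContinuousLinearMap.comp_apply, ContinuousLinearMap.mul_apply', Complex.imCLM_apply,
    im_inv_mul_planarField hm' hz, smul_eq_mul, anglePart]
  rw [← h3, eq_div_iff (by positivity)]
  generalize m (height κ (γ t)) = a
  generalize m' (height κ (γ t)) = b
  rw [height]
  field_simp
  ring


/-- A point of height at most one has real part at most `1/κ`. A translation to the right that keeps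
the height this small therefore cannot go far, nor add more than `(1/κ)²` to the squared norm. -/
theorem norm_sq_le_of_height_lt (hκ : 0 < κ) {v : ℝ} (hv : 0 ≤ v) {z : ℂ}
    (h : height κ (z + v) ≤ 1) :
    ‖z + v‖ ^ 2 ≤ ‖z‖ ^ 2 + (1 / κ) ^ 2 ∧ v ≤ 1 / κ + ‖z‖ := by
  have h1 : -‖z‖ ≤ z.re := (abs_le.1 (Complex.abs_re_le_norm z)).1
  have h2 : (z + v).re ≤ 1 / κ := by
    rcases le_total (z + v).re 0 with h0 | h0
    · exact h0.trans (by positivity)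
    · rw [le_div_iff₀ hκ, mul_comm]
      exact (re_le_height hκ _ h0).trans h
  refine ⟨?_, ?_⟩
  · rw [← Complex.normSq_eq_norm_sq, ← Complex.normSq_eq_norm_sq, Complex.normSq_apply,
      Complex.normSq_apply]
    simp only [Complex.add_re, Complex.add_im, Complex.ofReal_re, Complex.ofReal_im,
      add_zero] at h2 ⊢
    have h3 : 0 < 1 / κ := by positivity
    rcases le_total (z.re + v) 0 with h0 | h0 <;> nlinarith
  · simp only [Complex.add_re, Complex.ofReal_re] at h2
    linarith

theorem HasDerivAt.eventually_lt_right {f : ℝ → ℝ} {f' x : ℝ} (h : HasDerivAt f f' x)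
    (hf : 0 < f') : ∀ᶠ y in 𝓝[>] x, f x < f y := by
  have h1 := hasDerivWithinAt_iff_tendsto_slope' (self_notMem_Ioi) |>.1
    (h.hasDerivWithinAt (s := Ioi x))
  filter_upwards [h1.eventually (lt_mem_nhds hf), self_mem_nhdsWithin] with y hy hxy
  rw [slope_def_field] at hy
  have := (div_pos_iff_of_pos_right (sub_pos.2 hxy)).1 hy
  linarith

theorem height_mem_slitPlane {z : ℂ} (h : 1 ≤ height κ z) : z ∈ Complex.slitPlane := by
  by_contra hz
  rw [height_eq_zero hz] at h
  linarith

/-- At height at least one the height has positive derivative, so a trajectory cannot fall back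
below one. -/
theorem one_le_height_of_le (hc : 0 < c) (hm' : ∀ s, HasDerivAt m (m' s) s)
    (hm1 : ∀ s ≥ 1, 1 ≤ m s) {t₀ t₁ : ℝ}
    (hγ : ∀ t ∈ Icc t₀ t₁, HasDerivAt γ (planarField (planarHam κ c m) (γ t)) t)
    (h0 : 1 ≤ height κ (γ t₀)) : ∀ t ∈ Icc t₀ t₁, 1 ≤ height κ (γ t) := by
  have hcont : ContinuousOn (fun t => height κ (γ t)) (Icc t₀ t₁) :=
    continuous_height.comp_continuousOn fun t ht => (hγ t ht).continuousAt.continuousWithinAt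
  have hcl : IsClosed ({t | 1 ≤ height κ (γ t)} ∩ Icc t₀ t₁) := by
    rw [inter_comm]
    exact hcont.preimage_isClosed_of_isClosed isClosed_Icc isClosed_Ici
  refine fun t ht => hcl.Icc_subset_of_forall_exists_gt h0 (fun x hx y hy => ?_) ht
  have hx1 : 1 ≤ height κ (γ x) := hx.1
  have hz := height_mem_slitPlane hx1
  have hn : 0 < ‖γ x‖ := norm_pos_iff.2 (Complex.slitPlane_ne_zero hz)
  have hpos : 0 < c * m (height κ (γ x)) * height κ (γ x) / ‖γ x‖ ^ 2 := by
    have := hm1 _ hx1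
    positivity
  have h1 := (hasDerivAt_height (hγ x ⟨hx.2.1, hx.2.2.le⟩) hm' hz).eventually_lt_right hpos
  obtain ⟨u, hu, hu'⟩ := (h1.and (Ioc_mem_nhdsGT hy)).exists
  exact ⟨u, hx1.trans hu.le, hu'⟩

/-- Along the part of a trajectory where the height is at least one, the squared norm grows
almost linearly. -/
theorem norm_sq_bounds (hκ : 0 < κ) (hc : 0 < c) {η r : ℝ} (hr : 0 < r)
    (hm' : ∀ s, HasDerivAt m (m' s) s) (hm0 : ∀ s, 0 ≤ m' s)
    (hm1 : ∀ s ≥ 1, 1 ≤ m s ∧ m s ≤ 1 + η) {t₀ t₁ : ℝ} (h01 : t₀ ≤ t₁)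
    (hγ : ∀ t ∈ Icc t₀ t₁, HasDerivAt γ (planarField (planarHam κ c m) (γ t)) t)
    (hn : ∀ t ∈ Icc t₀ t₁, ‖γ t‖ ≤ r) (h0 : 1 ≤ height κ (γ t₀)) :
    ‖γ t₁‖ ^ 2 ≤ ‖γ t₀‖ ^ 2 + 4 * κ * r ^ 3 * η + 2 * c * (1 + η) * (t₁ - t₀) ∧
    ‖γ t₀‖ ^ 2 - 4 * κ * r ^ 3 * η + 2 * c * (t₁ - t₀) ≤ ‖γ t₁‖ ^ 2 := by
  have hh := one_le_height_of_le hc hm' (fun s hs => (hm1 s hs).1) hγ h0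
  have hz : ∀ t ∈ Icc t₀ t₁, γ t ∈ Complex.slitPlane := fun t ht => height_mem_slitPlane (hh t ht)
  set C := 4 * κ * r ^ 3 with hC
  have hC0 : 0 < C := by positivity
  have hd1 : ∀ t ∈ Icc t₀ t₁, HasDerivAt (fun t => ‖γ t‖ ^ 2) (2 * anglePart κ c m m' (γ t)) t :=
    fun t ht => hasDerivAt_normSq (hγ t ht) hm' (hz t ht)
  set e : ℝ → ℝ := fun t => m' (height κ (γ t)) *
    (c * m (height κ (γ t)) * height κ (γ t) / ‖γ t‖ ^ 2) with he
  have hd2 : ∀ t ∈ Icc t₀ t₁, HasDerivAt (fun t => m (height κ (γ t))) (e t) t :=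
    fun t ht => (hm' _).comp t (hasDerivAt_height (hγ t ht) hm' (hz t ht))
  -- The deviation of the growth rate from `2 c m` is controlled by `C` times the derivative of
  -- `m(height)`. The integral of the latter is at most `η`, since `m` stays between `1` and `1 +
  -- η`.
  have hest : ∀ t ∈ Icc t₀ t₁, |2 * anglePart κ c m m' (γ t) - 2 * c * m (height κ (γ t))| ≤
      C * e t := by
    intro t ht
    have hpos : 0 < ‖γ t‖ := norm_pos_iff.2 (Complex.slitPlane_ne_zero (hz t ht))
    have h1 : |Real.cos (γ t).arg - Real.sinc (γ t).arg| ≤ 2 := by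
      have h2 := abs_le.1 (Real.abs_cos_le_one (γ t).arg)
      have h3 := abs_le.1 (Real.abs_sinc_le_one (γ t).arg)
      exact abs_le.2 ⟨by linarith, by linarith⟩
    have h2 : 2 * anglePart κ c m m' (γ t) - 2 * c * m (height κ (γ t)) =
        (2 * c * m' (height κ (γ t)) * κ * ‖γ t‖) *
          (Real.cos (γ t).arg - Real.sinc (γ t).arg) := by
      rw [anglePart]; ring
    have hm0' := hm0 (height κ (γ t))
    rw [h2, abs_mul, abs_of_nonneg (by positivity)]
    have h3 : 1 ≤ m (height κ (γ t)) * height κ (γ t) :=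
      one_le_mul_of_one_le_of_one_le (hm1 _ (hh t ht)).1 (hh t ht)
    have h5 : ‖γ t‖ * ‖γ t‖ ^ 2 ≤ r ^ 3 := by
      have := hn t ht
      calc ‖γ t‖ * ‖γ t‖ ^ 2 = ‖γ t‖ ^ 3 := by ring
        _ ≤ _ := by gcongr
    have h6 : ‖γ t‖ ≤ r ^ 3 * (m (height κ (γ t)) * height κ (γ t) / ‖γ t‖ ^ 2) := by
      rw [← mul_div_assoc, le_div_iff₀ (by positivity)]
      exact h5.trans (le_mul_of_one_le_right (by positivity) h3)
    calc 2 * c * m' (height κ (γ t)) * κ * ‖γ t‖ * |Real.cos (γ t).arg - Real.sinc (γ t).arg|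
        ≤ 2 * c * m' (height κ (γ t)) * κ *
          (r ^ 3 * (m (height κ (γ t)) * height κ (γ t) / ‖γ t‖ ^ 2)) * 2 := by gcongr
      _ = C * e t := by simp only [he, hC]; ring
  have ht0 : t₀ ∈ Icc t₀ t₁ := ⟨le_rfl, h01⟩
  have ht1 : t₁ ∈ Icc t₀ t₁ := ⟨h01, le_rfl⟩
  have hb0 := hm1 _ (hh t₀ ht0)
  have hb1 := hm1 _ (hh t₁ ht1)
  have hsub : ∀ t ∈ Ico t₀ t₁, t ∈ Icc t₀ t₁ := fun t ht => ⟨ht.1, ht.2.le⟩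
  have hdl : ∀ k t : ℝ, HasDerivAt (fun t => k * (t - t₀)) k t := fun k t => by
    simpa using ((hasDerivAt_id' t).sub_const t₀).const_mul k
  constructor
  -- Correcting the squared norm by `C m(height)` absorbs the deviation; the corrected function
  -- grows at a rate at most `2c(1 + η)`.
  · have hf : ∀ t ∈ Icc t₀ t₁, HasDerivAt (fun t => ‖γ t‖ ^ 2 - C * m (height κ (γ t)))
        (2 * anglePart κ c m m' (γ t) - C * e t) t :=
      fun t ht => (hd1 t ht).fun_sub ((hd2 t ht).const_mul C)
    have := image_le_of_deriv_right_le_deriv_boundary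
      (f := fun t => ‖γ t‖ ^ 2 - C * m (height κ (γ t)))
      (B := fun t => ‖γ t₀‖ ^ 2 - C * m (height κ (γ t₀)) + 2 * c * (1 + η) * (t - t₀))
      (B' := fun _ => 2 * c * (1 + η))
      (fun t ht => (hf t ht).continuousAt.continuousWithinAt)
      (fun t ht => (hf t (hsub t ht)).hasDerivWithinAt) (by simp)
      (fun t ht => ((hdl (2 * c * (1 + η)) t).const_add _).continuousAt.continuousWithinAt)
      (fun t ht => ((hdl (2 * c * (1 + η)) t).const_add _).hasDerivWithinAt)
      (fun t ht => ?_) ht1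
    · nlinarith
    · have h1 := (abs_le.1 (hest t (hsub t ht))).2
      have h2 := (hm1 _ (hh t (hsub t ht))).2
      nlinarith
  · have hf : ∀ t ∈ Icc t₀ t₁, HasDerivAt (fun t => ‖γ t‖ ^ 2 + C * m (height κ (γ t)))
        (2 * anglePart κ c m m' (γ t) + C * e t) t :=
      fun t ht => (hd1 t ht).fun_add ((hd2 t ht).const_mul C)
    have := image_le_of_deriv_right_le_deriv_boundary
      (B := fun t => ‖γ t‖ ^ 2 + C * m (height κ (γ t)))
      (f := fun t => ‖γ t₀‖ ^ 2 + C * m (height κ (γ t₀)) + 2 * c * (t - t₀))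
      (f' := fun _ => 2 * c) 
      (fun t ht => ((hdl (2 * c) t).const_add _).continuousAt.continuousWithinAt)
      (fun t ht => ((hdl (2 * c) t).const_add _).hasDerivWithinAt) (by simp)
      (fun t ht => (hf t ht).continuousAt.continuousWithinAt)
      (fun t ht => (hf t (hsub t ht)).hasDerivWithinAt)
      (fun t ht => ?_) ht1
    · nlinarith
    · have h1 := (abs_le.1 (hest t (hsub t ht))).1
      have h2 := (hm1 _ (hh t (hsub t ht))).1
      nlinarith

end Along

/-- A Hamiltonian of the plane whose time-one map, as long as the disk of area `ρ₁` is not left,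
moves the disk of area `ρ₀ < ρ₁ / 2` off itself (areas in units of `π`). -/
theorem exists_planar_hamiltonian {ρ₀ ρ₁ : ℝ} (h0 : 0 < ρ₀) (h01 : 2 * ρ₀ < ρ₁) :
    ∃ G : ℂ → ℝ, ContDiff ℝ ∞ G ∧ ∀ (γ : ℝ → ℂ) (t₁ : ℝ), t₁ ∈ Icc (0 : ℝ) 1 →
      (∀ t ∈ Icc 0 t₁, HasDerivAt γ (planarField G (γ t)) t) →
      (∀ t ∈ Icc 0 t₁, Complex.normSq (γ t) ≤ ρ₁) → Complex.normSq (γ 0) ≤ ρ₀ →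
      (∀ t ∈ Icc 0 t₁, Complex.normSq (γ t) < ρ₁) ∧ (t₁ = 1 → ρ₀ < Complex.normSq (γ 1)) := by
  set δ := ρ₁ / 2 - ρ₀ with hδ
  have hδ0 : 0 < δ := by linarith
  -- The radial phase adds about `2c = ρ₁/2` to the squared norm in unit time. Starting below `ρ₀`,
  -- this leaves a margin `δ` below `ρ₁`; the final value, about `ρ₁/2` at least, exceeds `ρ₀` by
  -- about `δ`.
  set c := ρ₁ / 4 with hc
  have hc0 : 0 < c := by linarith
  -- For large `κ` the initial translation is short in time and hardly increases the norm; `(1/κ +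
  -- √ρ₀)/(c κ)` bounds its duration.
  obtain ⟨κ, hκ, hκ1, hκ2, hκ3⟩ : ∃ κ : ℝ, 0 < κ ∧ (1 / κ) ^ 2 < δ / 2 ∧
      2 * c * ((1 / κ + √ρ₀) / (c * κ)) < δ / 2 ∧ (1 / κ + √ρ₀) / (c * κ) < 1 := by
    have hi : Tendsto (fun κ : ℝ => 1 / κ) atTop (𝓝 0) := by
      simpa using tendsto_inv_atTop_zero (𝕜 := ℝ)
    have h1 : Tendsto (fun κ : ℝ => (1 / κ) ^ 2) atTop (𝓝 0) := by simpa using hi.pow 2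
    have h2 : Tendsto (fun κ : ℝ => (1 / κ + √ρ₀) / (c * κ)) atTop (𝓝 0) := by
      have h3 := ((hi.add_const (√ρ₀)).mul hi).div_const c
      simp only [mul_zero, zero_div] at h3
      refine h3.congr fun κ => ?_
      rw [div_mul_eq_div_div_swap, mul_one_div, div_right_comm, div_right_comm]
    have h4 : Tendsto (fun κ : ℝ => 2 * c * ((1 / κ + √ρ₀) / (c * κ))) atTop (𝓝 0) := by
      simpa using h2.const_mul (2 * c)
    exact ((eventually_gt_atTop 0).and ((h1.eventually (gt_mem_nhds (half_pos hδ0))).and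
      ((h4.eventually (gt_mem_nhds (half_pos hδ0))).and
        (h2.eventually (gt_mem_nhds one_pos))))).exists
  set τ := (1 / κ + √ρ₀) / (c * κ) with hτ
  set C := 4 * κ * √ρ₁ ^ 3 with hC
  have hρ1 : 0 < ρ₁ := by linarith
  have hC0 : 0 < C := by positivity
  -- The truncation is chosen after `κ`, since the error constant `C` depends on `κ`.
  set η := δ / (4 * (C + 2 * c)) with hη
  have hη0 : 0 < η := by positivity
  have hη1 : C * η + 2 * c * η < δ / 2 := by
    have : (C + 2 * c) * η = δ / 4 := by rw [hη]; field_simp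
    linarith
  obtain ⟨m, m', hms, hm', hm0, hml, hml', hm1⟩ := exists_truncation hη0
  refine ⟨planarHam κ c m, contDiff_planarHam hms hml, fun γ t₁ ht₁ hγ hb hb0 => ?_⟩
  simp only [Complex.normSq_eq_norm_sq] at hb hb0 ⊢
  have hn0 : ‖γ 0‖ ≤ √ρ₀ := Real.le_sqrt_of_sq_le hb0
  have hnr : ∀ t ∈ Icc 0 t₁, ‖γ t‖ ≤ √ρ₁ := fun t ht => Real.le_sqrt_of_sq_le (hb t ht)
  -- Until the height reaches one, the motion is the uniform translation.
  have hlin : ∀ s ∈ Icc 0 t₁, (∀ t ∈ Ico 0 s, height κ (γ t) < 1) →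
      ∀ t ∈ Icc 0 s, γ t = γ 0 + ((c * κ * t : ℝ) : ℂ) := by
    intro s hs hlt t ht
    have hd : ∀ u ∈ Icc 0 s, HasDerivAt (fun t => γ t - ((c * κ * t : ℝ) : ℂ))
        (planarField (planarHam κ c m) (γ u) - ((c * κ : ℝ) : ℂ)) u := fun u hu => by
      have h1 : HasDerivAt (fun t : ℝ => c * κ * t) (c * κ) u := by
        simpa using (hasDerivAt_id' u).const_mul (c * κ)
      exact (hγ u ⟨hu.1, hu.2.trans hs.2⟩).fun_sub h1.ofReal_comp
    have := constant_of_has_deriv_right_zero (f := fun t => γ t - ((c * κ * t : ℝ) : ℂ))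
      (fun u hu => (hd u hu).continuousAt.continuousWithinAt) (fun u hu => by
        have h2 := (hd u ⟨hu.1, hu.2.le⟩).hasDerivWithinAt (s := Ici u)
        rwa [planarField_of_height_lt hml (hlt u hu), sub_self] at h2) t ht
    simp only [mul_zero, Complex.ofReal_zero, sub_zero] at this
    rw [← this]; ring
  have hfirst : ∀ s ∈ Icc 0 t₁, (∀ t ∈ Ico 0 s, height κ (γ t) < 1) →
      ∀ t ∈ Icc 0 s, height κ (γ t) ≤ 1 → ‖γ t‖ ^ 2 ≤ ρ₀ + (1 / κ) ^ 2 ∧ t ≤ τ := by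
    intro s hs hlt t ht hle
    have h1 := hlin s hs hlt t ht
    rw [h1] at hle ⊢
    have h2 := norm_sq_le_of_height_lt hκ (v := c * κ * t) (mul_nonneg (by positivity) ht.1) hle
    refine ⟨h2.1.trans (by linarith), ?_⟩
    rw [hτ, le_div_iff₀ (by positivity)]
    linarith [h2.2]
  have hcont : ContinuousOn (fun t => height κ (γ t)) (Icc 0 t₁) :=
    continuous_height.comp_continuousOn fun t ht => (hγ t ht).continuousAt.continuousWithinAt
  by_cases hZ : ∃ t ∈ Icc 0 t₁, 1 ≤ height κ (γ t)
  swap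
  -- If the height stays below one, the translation has lasted less than one unit of time, so `t₁ =
  -- 1` is impossible.
  · push Not at hZ
    have ha : ∀ t ∈ Icc 0 t₁, ‖γ t‖ ^ 2 ≤ ρ₀ + (1 / κ) ^ 2 ∧ t ≤ τ := fun t ht =>
      hfirst t₁ ⟨ht₁.1, le_rfl⟩ (fun u hu => hZ u ⟨hu.1, hu.2.le⟩) t ht (hZ t ht).le
    refine ⟨fun t ht => (ha t ht).1.trans_lt (by linarith), fun h1 => ?_⟩
    exact absurd (ha 1 ⟨zero_le_one, h1.ge⟩).2 (not_le.2 hκ3)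
  set Z := Icc 0 t₁ ∩ {t | 1 ≤ height κ (γ t)} with hZd
  have hZc : IsCompact Z :=
    isCompact_Icc.of_isClosed_subset
      (hcont.preimage_isClosed_of_isClosed isClosed_Icc isClosed_Ici) inter_subset_left
  have hZn : Z.Nonempty := let ⟨t, ht, h⟩ := hZ; ⟨t, ht, h⟩
  -- The first time at which the height is at least one: translation before it, almost radial motion
  -- after it.
  set t₀ := sInf Z with ht₀
  have ht0 : t₀ ∈ Z := hZc.sInf_mem hZn
  have hlt : ∀ t ∈ Ico 0 t₀, height κ (γ t) < 1 := fun t ht => by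
    by_contra h
    exact absurd (csInf_le hZc.bddBelow ⟨⟨ht.1, ht.2.le.trans ht0.1.2⟩, not_lt.1 h⟩)
      (not_le.2 ht.2)
  have hp0 : ‖γ t₀‖ ^ 2 ≤ ρ₀ + (1 / κ) ^ 2 ∧ t₀ ≤ τ := by
    rcases ht0.1.1.lt_or_eq with h | h
    · refine hfirst t₀ ht0.1 hlt t₀ ⟨h.le, le_rfl⟩ ?_
      have h1 : Tendsto (fun t => height κ (γ t)) (𝓝[<] t₀) (𝓝 (height κ (γ t₀))) :=
        (continuous_height.continuousAt.comp (hγ t₀ ht0.1).continuousAt).tendsto.mono_left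
          nhdsWithin_le_nhds
      refine le_of_tendsto h1 ?_
      filter_upwards [Ioo_mem_nhdsLT h] with t ht using (hlt t ⟨ht.1.le, ht.2⟩).le
    · rw [← h]
      exact ⟨hb0.trans (by linarith [sq_nonneg (1 / κ)]), by positivity⟩
  have hafter : ∀ t ∈ Icc t₀ t₁, _ ∧ _ := fun t ht =>
    norm_sq_bounds hκ hc0 (Real.sqrt_pos.2 hρ1) hm' hm0 hm1 ht.1
      (fun u hu => hγ u ⟨ht0.1.1.trans hu.1, hu.2.trans ht.2⟩)
      (fun u hu => hnr u ⟨ht0.1.1.trans hu.1, hu.2.trans ht.2⟩) ht0.2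
  refine ⟨fun t ht => ?_, fun h1 => ?_⟩
  · rcases lt_or_ge t t₀ with h | h
    · exact (hfirst t₀ ht0.1 hlt t ⟨ht.1, h.le⟩ (hlt t ⟨ht.1, h⟩).le).1.trans_lt (by linarith)
    · have h2 := (hafter t ⟨h, ht.2⟩).1
      have h3 : t - t₀ ≤ 1 := by linarith [ht.2, ht₁.2, ht0.1.1]
      have h4 : 2 * c * (1 + η) * (t - t₀) ≤ 2 * c * (1 + η) :=
        mul_le_of_le_one_right (by positivity) h3
      have h5 : 2 * c = ρ₁ / 2 := by rw [hc]; ring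
      have := hp0.1
      nlinarith
  · have h2 := (hafter 1 ⟨ht0.1.2.trans h1.le, h1.ge⟩).2
    have h5 : 2 * c = ρ₁ / 2 := by rw [hc]; ring
    have h6 := hp0.2
    have h7 : 2 * c * t₀ ≤ 2 * c * τ := by gcongr
    have h8 := sq_nonneg ‖γ t₀‖
    have h9 : 0 < 2 * c * η := by positivity
    nlinarith

end

/-! ### Hamiltonians of an equivariant coordinate -/

noncomputable section

section

set_option linter.unusedSectionVars false

variable {E : Type} [NormedAddCommGroup E] [NormedSpace ℝ E]
variable {M : Type*} [TopologicalSpace M] [ChartedSpace E M] [IsManifold 𝓘(ℝ, E) ∞ M]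
variable {Ω : SymplecticForm E M}

theorem TorusHam.Equivariant.dM_gen {T : TorusHam Ω} {z : M → ℂ} (hz : T.Equivariant z) {x : M}
    (hs : SmoothAt (E := E) z x) (ξ : ℝ × ℝ) :
    dM z x (T.gen x ξ) = 2 * Real.pi * Complex.I * ξ.1 * z x := by
  refine T.dM_gen_eq hs ?_
  have h0 : ∀ t : ℝ, z (T.act (t • ξ) x) = expi (t * ξ.1) * z x := fun t => by rw [hz]; rfl
  simp only [h0]
  have h1 : HasDerivAt (fun t : ℝ => t * ξ.1) ξ.1 0 := by
    simpa using (hasDerivAt_id (0 : ℝ)).mul_const ξ.1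
  have h2 := (hasDerivAt_expi (0 * ξ.1)).scomp (0 : ℝ) h1
  refine (h2.mul_const (z x)).congr_deriv ?_
  rw [zero_mul, expi_zero, Complex.real_smul]
  ring

theorem dM_re {z : M → ℂ} {x : M} (hs : SmoothAt (E := E) z x) (v : E) :
    dM (fun x => (z x).re) x v = (dM z x v).re := by
  have := dM_comp hs (Complex.reCLM.hasFDerivAt (x := z x))
  exact congrArg (fun L => L v) this

theorem dM_im {z : M → ℂ} {x : M} (hs : SmoothAt (E := E) z x) (v : E) :
    dM (fun x => (z x).im) x v = (dM z x v).im := by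
  have := dM_comp hs (Complex.imCLM.hasFDerivAt (x := z x))
  exact congrArg (fun L => L v) this

theorem smoothAt_re {z : M → ℂ} {x : M} (hs : SmoothAt (E := E) z x) :
    SmoothAt (E := E) (fun x => (z x).re) x :=
  ContMDiffAt.comp x (Complex.reCLM.contDiff.contMDiff _) hs

theorem smoothAt_im {z : M → ℂ} {x : M} (hs : SmoothAt (E := E) z x) :
    SmoothAt (E := E) (fun x => (z x).im) x :=
  ContMDiffAt.comp x (Complex.imCLM.contDiff.contMDiff _) hs

variable [FiniteDimensional ℝ E]

/-- The Poisson bracket of the real and the imaginary part of an equivariant coordinate. -/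
theorem TorusHam.Equivariant.bracket_of_ne_zero {T : TorusHam Ω} {z : M → ℂ}
    (hz : T.Equivariant z) {x : M} (hs : SmoothAt (E := E) z x)
    (hm : ∀ᶠ y in 𝓝 x, Real.pi * Complex.normSq (z y) = (T.mom y).1) (h0 : z x ≠ 0) :
    dM (fun y => (z y).re) x (Ω.ham (fun y => (z y).im) x) = -1 := by
  set A := Ω.ham (fun y => (z y).re) x with hA
  set C := Ω.ham (fun y => (z y).im) x with hC
  have h1 : ∀ w : E, (dM T.mom x w).1 =
      2 * Real.pi * ((z x).re * (dM z x w).re + (z x).im * (dM z x w).im) := by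
    intro w
    have e1 : dM (fun y => (T.mom y).1) x w = (dM T.mom x w).1 := by
      have := dM_comp (T.smooth_mom x) (hasFDerivAt_fst (𝕜 := ℝ) (p := T.mom x))
      exact congrArg (fun L => L w) this
    have e2 : HasFDerivAt (fun a : ℂ => Real.pi * Complex.normSq a)
        (Real.pi • (2 • innerSL ℝ (z x))) (z x) := by
      have := (hasStrictFDerivAt_norm_sq (F := ℂ) (z x)).hasFDerivAt.const_mul Real.pi
      simpa only [Complex.normSq_eq_norm_sq] using this
    have e3 := dM_comp hs e2
    rw [← e1, ← dM_congr hm]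
    have e4 := congrArg (fun L => L w) e3
    refine Eq.trans e4 ?_
    simp [Complex.inner]
    ring
  -- As the first momentum is `π|z|²`, the generator of the first circle is a combination of the
  -- Hamiltonian fields of the two parts of `z`. Applying `dz` and comparing with `2πi z` determines
  -- the bracket wherever `z ≠ 0`.
  have h2 : T.gen x (1, 0) = (2 * Real.pi * (z x).re) • A + (2 * Real.pi * (z x).im) • C := by
    refine sub_eq_zero.1 (Ω.om_nondeg x fun w => ?_)
    rw [sub_eq_add_neg, Ω.om_add_left, ← neg_one_smul ℝ, Ω.om_smul_left, Ω.om_add_left,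
      Ω.om_smul_left, Ω.om_smul_left, T.om_gen, Ω.om_ham, Ω.om_ham, dM_re hs, dM_im hs, dot, h1]
    ring
  have h3 := hz.dM_gen hs (1, 0)
  have hAA : dM (fun y => (z y).re) x A = 0 := by rw [← Ω.om_ham, Ω.om_self]
  have hCC : dM (fun y => (z y).im) x C = 0 := by rw [← Ω.om_ham, Ω.om_self]
  have hCA : dM (fun y => (z y).im) x A = -dM (fun y => (z y).re) x C := by
    rw [← Ω.om_ham, ← Ω.om_ham, Ω.om_swap]
  have h4 := congrArg Complex.re h3
  have h5 := congrArg Complex.im h3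
  rw [← dM_re hs, h2, map_add, map_smul, map_smul, hAA] at h4
  rw [← dM_im hs, h2, map_add, map_smul, map_smul, hCC, hCA] at h5
  simp at h4 h5
  have hp := Real.pi_ne_zero
  by_cases hb : (z x).im = 0
  · have ha : (z x).re ≠ 0 := fun h => h0 (Complex.ext h hb)
    have h6 : (2 * Real.pi * (z x).re) * (dM (fun y => (z y).re) x C + 1) = 0 := by linarith
    have := (mul_eq_zero.1 h6).resolve_left (by positivity)
    linarith
  · have h6 : (2 * Real.pi * (z x).im) * (dM (fun y => (z y).re) x C + 1) = 0 := by linarith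
    have := (mul_eq_zero.1 h6).resolve_left (by positivity)
    linarith

/-- The bracket is continuous and equals `-1` at the nearby points of positive first momentum, where
`z ≠ 0`; so the value also holds where `z` vanishes. -/
theorem TorusHam.Equivariant.bracket {T : TorusHam Ω} {z : M → ℂ}
    (hz : T.Equivariant z) {x : M} (hs : ∀ᶠ y in 𝓝 x, SmoothAt (E := E) z y)
    (hm : ∀ᶠ y in 𝓝 x, Real.pi * Complex.normSq (z y) = (T.mom y).1)
    (hd : ∃ᶠ y in 𝓝 x, 0 < (T.mom y).1) :
    dM (fun y => (z y).re) x (Ω.ham (fun y => (z y).im) x) = -1 := by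
  have hc : ContinuousAt (fun y => dM (fun y => (z y).re) y (Ω.ham (fun y => (z y).im) y)) x :=
    (Ω.smoothAt_dM_ham (hs.mono fun y hy => smoothAt_re hy)
      (hs.mono fun y hy => smoothAt_im hy)).continuousAt
  by_contra hne
  have h1 := hc.eventually (isOpen_compl_singleton.mem_nhds hne)
  obtain ⟨y, hy, hy1, hy2, hy3⟩ := (hd.and_eventually
    (h1.and (hs.and (eventually_eventually_nhds.2 hm)))).exists
  refine hy1 (hz.bracket_of_ne_zero hy2 hy3 fun h0 => ?_)
  have := hy3.self_of_nhds
  rw [h0] at this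
  simp at this
  linarith

theorem dM_neg_comp {z : M → ℂ} {x : M} (hs : SmoothAt (E := E) z x) {G : ℂ → ℝ}
    (hG : ContDiff ℝ ∞ G) {H : M → ℝ} (hH : ∀ᶠ y in 𝓝 x, H y = -G (z y)) (w : E) :
    dM H x w = -fderiv ℝ G (z x) (dM z x w) := by
  have h1 := dM_comp hs ((hG.differentiable (by simp) (z x)).hasFDerivAt.neg)
  rw [dM_congr (g := (-G) ∘ z) hH]
  exact congrArg (fun L => L w) h1

/-- The Hamiltonian vector field of a function of an equivariant coordinate. -/
theorem dM_ham_neg_comp {z : M → ℂ} {x : M} (hs : SmoothAt (E := E) z x)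
    (hbr : dM (fun y => (z y).re) x (Ω.ham (fun y => (z y).im) x) = -1)
    {G : ℂ → ℝ} (hG : ContDiff ℝ ∞ G) {H : M → ℝ} (hH : ∀ᶠ y in 𝓝 x, H y = -G (z y)) :
    dM z x (Ω.ham H x) = planarField G (z x) := by
  have hL : ∀ v : ℂ, fderiv ℝ G (z x) v =
      v.re * fderiv ℝ G (z x) 1 + v.im * fderiv ℝ G (z x) Complex.I := by
    intro v
    conv_lhs => rw [← Complex.re_add_im v]
    rw [map_add, ← smul_eq_mul (a := (v.re)), ← smul_eq_mul (a := v.im), ← map_smul, ← map_smul]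
    congr 2
    all_goals simp
  -- By the chain rule the field combines those of the two parts of `z`; the constant bracket then
  -- turns it into the planar field of `G`, the minus sign in `H` matching the orientation.
  have hX : Ω.ham H x = (-fderiv ℝ G (z x) 1) • Ω.ham (fun y => (z y).re) x +
      (-fderiv ℝ G (z x) Complex.I) • Ω.ham (fun y => (z y).im) x := by
    refine (Ω.ham_unique fun w => ?_).symm
    rw [Ω.om_add_left, Ω.om_smul_left, Ω.om_smul_left, Ω.om_ham, Ω.om_ham, dM_neg_comp hs hG hH, hL (dM z x w), dM_re hs,
      dM_im hs]
    ring
  have hAA : dM (fun y => (z y).re) x (Ω.ham (fun y => (z y).re) x) = 0 := by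
    rw [← Ω.om_ham, Ω.om_self]
  have hCC : dM (fun y => (z y).im) x (Ω.ham (fun y => (z y).im) x) = 0 := by
    rw [← Ω.om_ham, Ω.om_self]
  have hCA : dM (fun y => (z y).im) x (Ω.ham (fun y => (z y).re) x) = 1 := by
    rw [← Ω.om_ham, Ω.om_swap, Ω.om_ham, hbr, neg_neg]
  apply Complex.ext
  · rw [← dM_re hs, hX, map_add, map_smul, map_smul, hAA, hbr]
    simp [planarField]
  · rw [← dM_im hs, hX, map_add, map_smul, map_smul, hCA, hCC]
    simp [planarField]

/-- The second circle does not move `z`, so a function of `z` Poisson commutes with the second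
momentum. -/
theorem TorusHam.Equivariant.dM_mom_ham {T : TorusHam Ω} {z : M → ℂ}
    (hz : T.Equivariant z) {x : M} (hs : SmoothAt (E := E) z x)
    {G : ℂ → ℝ} (hG : ContDiff ℝ ∞ G) {H : M → ℝ} (hH : ∀ᶠ y in 𝓝 x, H y = -G (z y)) :
    (dM T.mom x (Ω.ham H x)).2 = 0 := by
  have h1 := T.om_gen x (0, 1) (Ω.ham H x)
  rw [Ω.om_swap, Ω.om_ham, dM_neg_comp hs hG hH, hz.dM_gen hs] at h1
  simp [dot] at h1
  exact h1.symm

end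

end

/-! ### Displacing the preimage of a rectangle -/

noncomputable section

/-- A trajectory stays in a closed set if it cannot leave it immediately. -/
theorem IsClosed.mem_of_forall_nhds {X : Type*} [TopologicalSpace X] {K : Set X} (hK : IsClosed K)
    {γ : ℝ → X} (hγ : Continuous γ) (h0 : γ 0 ∈ K)
    (h : ∀ t ∈ Ico (0 : ℝ) 1, (∀ u ∈ Icc 0 t, γ u ∈ K) → ∀ᶠ u in 𝓝 t, γ u ∈ K) :
    ∀ t ∈ Icc (0 : ℝ) 1, γ t ∈ K := by
  -- The times up to which the trajectory has stayed in `K`, written with rescaled times so that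
  -- closedness is evident.
  set s : Set ℝ := {t | ∀ r ∈ Icc (0 : ℝ) 1, γ (r * t) ∈ K} with hs
  have hcl : IsClosed s := by
    have : s = ⋂ r ∈ Icc (0 : ℝ) 1, (fun t => γ (r * t)) ⁻¹' K := by ext t; simp [hs]
    rw [this]
    exact isClosed_biInter fun r _ => hK.preimage (by fun_prop)
  have hsub : ∀ {t}, 0 ≤ t → t ∈ s → ∀ u ∈ Icc 0 t, γ u ∈ K := by
    intro t ht hts u hu
    rcases ht.lt_or_eq with h1 | h1
    · have := hts (u / t) ⟨div_nonneg hu.1 ht, (div_le_one h1).2 hu.2⟩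
      rwa [div_mul_cancel₀ _ h1.ne'] at this
    · rw [← h1] at hu
      rwa [le_antisymm hu.2 hu.1]
  have h1 : Icc (0 : ℝ) 1 ⊆ s := by
    refine (hcl.inter isClosed_Icc).Icc_subset_of_forall_mem_nhdsWithin
      (fun r _ => by rwa [mul_zero]) fun t ht => ?_
    have h2 := h t ht.2 (hsub ht.2.1 ht.1)
    obtain ⟨ε, hε, hball⟩ := Metric.eventually_nhds_iff.1 h2
    filter_upwards [Ioo_mem_nhdsGT (show t < t + ε by linarith)] with t' ht' r hr
    have h3 : r * t' ≤ t' := mul_le_of_le_one_left (ht.2.1.trans ht'.1.le) hr.2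
    have h4 : 0 ≤ r * t' := mul_nonneg hr.1 (ht.2.1.trans ht'.1.le)
    rcases le_or_gt (r * t') t with h5 | h5
    · exact hsub ht.2.1 ht.1 _ ⟨h4, h5⟩
    · refine hball ?_
      rw [Real.dist_eq, abs_of_pos (sub_pos.2 h5)]
      linarith [ht'.2]
  exact fun t ht => by simpa using h1 ht 1 ⟨zero_le_one, le_rfl⟩

/-- Compactly supported smooth functions extending a given one. -/
theorem exists_contMDiff_eventuallyEq {E : Type} [NormedAddCommGroup E] [NormedSpace ℝ E]
    [FiniteDimensional ℝ E]
    {M : Type*} [TopologicalSpace M] [ChartedSpace E M] [IsManifold 𝓘(ℝ, E) ∞ M] [T2Space M]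
    [SecondCountableTopology M] {K : Set M} (hK : IsCompact K) {f : M → ℝ}
    (hf : ∀ p ∈ K, ∀ᶠ x in 𝓝 p, SmoothAt (E := E) f x) :
    ∃ H : M → ℝ, ContMDiff 𝓘(ℝ, E) 𝓘(ℝ, ℝ) ∞ H ∧ HasCompactSupport H ∧
      ∀ p ∈ K, ∀ᶠ x in 𝓝 p, H x = f x := by
  have : LocallyCompactSpace M := Manifold.locallyCompact_of_finiteDimensional 𝓘(ℝ, E)
  set U : Set M := {p | ∀ᶠ x in 𝓝 p, SmoothAt (E := E) f x} with hU
  obtain ⟨K', hK', hKK', hK'U⟩ := exists_compact_between hK isOpen_setOfPred_eventually_nhds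
    (show K ⊆ U from hf)
  obtain ⟨χ, hχ1, hχ0, -⟩ := exists_contMDiffMap_one_nhds_of_subset_interior
    (n := (⊤ : ℕ∞)) 𝓘(ℝ, E) hK.isClosed hKK'
  have hts : tsupport (fun x => χ x * f x) ⊆ K' :=
    closure_minimal (fun x hx => by
      by_contra h
      exact hx (by simp [hχ0 x h])) hK'.isClosed
  refine ⟨fun x => χ x * f x, fun x => ?_, hK'.of_isClosed_subset (isClosed_tsupport _) hts,
    fun p hp => ?_⟩
  · by_cases hx : x ∈ K'
    · exact ContMDiffAt.mul (χ.contMDiff x) (hK'U hx).self_of_nhds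
    · have h1 : (fun x => χ x * f x) =ᶠ[𝓝 x] fun _ => 0 :=
        notMem_tsupport_iff_eventuallyEq.1 fun h => hx (hts h)
      exact contMDiffAt_const.congr_of_eventuallyEq h1
  · filter_upwards [(eventually_nhdsSet_iff_forall.1 hχ1) p hp] with x hx
    rw [hx, one_mul]

section

set_option linter.unusedSectionVars false

variable {E : Type} [NormedAddCommGroup E] [NormedSpace ℝ E]
variable {M : Type*} [TopologicalSpace M] [ChartedSpace E M] [IsManifold 𝓘(ℝ, E) ∞ M]
variable {Ω : SymplecticForm E M} [T2Space M] [SecondCountableTopology M] [FiniteDimensional ℝ E]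
variable {B : Type*} [TopologicalSpace B] [T2Space B]
variable {T : TorusHam Ω} {F : M → B} {Φ : B → ℝ × ℝ} {j : ℝ × ℝ → B} {R a : ℝ}

namespace RectModel

theorem isCompact_preimage (h : RectModel T F Φ j R a) {b : ℝ} (hb : b ≤ R) :
    IsCompact (F ⁻¹' (j '' (Icc 0 b ×ˢ Icc 0 a))) :=
  h.model.proper.isCompact_preimage ((isCompact_Icc.prod isCompact_Icc).image_of_continuousOn
    (h.cont.mono (prod_mono_left (Icc_subset_Icc_right hb))))

/-- Points near the preimage of the rectangle whose momentum lies in the rectangle are in the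
preimage. -/
theorem eventually_mem_preimage (h : RectModel T F Φ j R a) {p : M} {q : ℝ × ℝ}
    (hq : q ∈ Icc 0 R ×ˢ Icc 0 a) (hp : F p = j q) :
    ∀ᶠ x in 𝓝 p, T.mom x ∈ Icc 0 R ×ˢ Icc 0 a → F x = j (T.mom x) := by
  obtain ⟨U, hU, hinj⟩ := h.model.locInj (j q)
  have h1 : ∀ᶠ q' in 𝓝[Icc 0 R ×ˢ Icc 0 a] q, j q' ∈ U := (h.cont q hq) hU
  have h2 : ∀ᶠ q' in 𝓝 q, q' ∈ Icc 0 R ×ˢ Icc 0 a → j q' ∈ U := eventually_nhdsWithin_iff.1 h1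
  have h3 : Tendsto T.mom (𝓝 p) (𝓝 q) := by
    rw [← h.mom_eq hq hp]
    exact T.smooth_mom.continuous.tendsto p
  have h4 : ∀ᶠ x in 𝓝 p, F x ∈ U := by
    have := h.model.proper.continuous.tendsto p
    rw [hp] at this
    exact this hU
  filter_upwards [h3.eventually h2, h4] with x hx hxU hxq
  refine hinj hxU (hx hxq) ?_
  rw [← h.model.mom_eq, h.inv _ hxq]

/-- The first momentum is `π|z|²`, so the planar Hamiltonian applied to `z` pushes it from at most
`d` to above `d` while keeping it below `b`. The second momentum is preserved, which confines the
motion to the preimage `K` of the larger rectangle. -/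
theorem isDisplaceable (h : RectModel T F Φ j R a) {d : ℝ} (hd : 0 < d) (hdR : d < R / 2) :
    IsDisplaceable Ω (F ⁻¹' (j '' (Icc 0 d ×ˢ Icc 0 a))) := by
  obtain ⟨b, hdb, hbR⟩ : ∃ b, 2 * d < b ∧ b < R := exists_between (by linarith)
  have hb0 : 0 < b := by linarith
  have hpi := Real.pi_pos
  obtain ⟨z, hz, hzA⟩ := h.exists_coordinate hb0.le hbR
  obtain ⟨G, hG, hdyn⟩ := exists_planar_hamiltonian (ρ₀ := d / Real.pi) (ρ₁ := b / Real.pi)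
    (by positivity) (by rw [← mul_div_assoc]; gcongr)
  set K := F ⁻¹' (j '' (Icc 0 b ×ˢ Icc 0 a)) with hK
  have hKc : IsCompact K := h.isCompact_preimage hbR.le
  have hsubR : Icc 0 b ×ˢ Icc 0 a ⊆ Icc 0 R ×ˢ Icc 0 a :=
    prod_mono_left (Icc_subset_Icc_right hbR.le)
  have hKq : ∀ x ∈ K, T.mom x ∈ Icc 0 b ×ˢ Icc 0 a ∧ F x = j (T.mom x) := by
    rintro x ⟨q, hq, hx⟩
    rw [h.mom_eq (hsubR hq) hx.symm]
    exact ⟨hq, hx.symm⟩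
  have hzs : ∀ p ∈ K, ∀ᶠ x in 𝓝 p, SmoothAt (E := E) z x := fun p hp =>
    (hzA p _ (hKq p hp).1 (hKq p hp).2).1
  have hzm : ∀ p ∈ K, ∀ᶠ x in 𝓝 p, Real.pi * Complex.normSq (z x) = (T.mom x).1 := fun p hp =>
    (hzA p _ (hKq p hp).1 (hKq p hp).2).2
  obtain ⟨H, hHs, hHc, hHz⟩ := exists_contMDiff_eventuallyEq (f := fun x => -G (z x)) hKc
    fun p hp => (hzs p hp).mono fun x hx =>
      ContMDiffAt.comp x (g := fun w => -G w) (hG.neg.contMDiff (z x)) hx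
  obtain ⟨φ, hφ⟩ := Ω.exists_flow hHs hHc
  have hfield : ∀ p ∈ K, dM z p (Ω.ham H p) = planarField G (z p) := fun p hp =>
    dM_ham_neg_comp (hzs p hp).self_of_nhds (hz.bracket (hzs p hp) (hzm p hp)
      (h.frequently_mom_ne_zero (q := T.mom p)
        ⟨⟨(hKq p hp).1.1.1, (hKq p hp).1.1.2.trans_lt hbR⟩, (hKq p hp).1.2⟩ (hKq p hp).2)) hG
      (hHz p hp)
  have hmom2 : ∀ p ∈ K, ∀ᶠ x in 𝓝 p, (dM T.mom x (Ω.ham H x)).2 = 0 := fun p hp => by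
    filter_upwards [hzs p hp, eventually_eventually_nhds.2 (hHz p hp)] with x hx hx'
    exact hz.dM_mom_ham hx hG hx'
  have htrap : ∀ x ∈ F ⁻¹' (j '' (Icc 0 d ×ˢ Icc 0 a)),
      φ 1 x ∉ F ⁻¹' (j '' (Icc 0 d ×ˢ Icc 0 a)) := by
    rintro x ⟨q, hq, hx⟩ ⟨q', hq', hx'⟩
    have hqb : q ∈ Icc 0 b ×ˢ Icc 0 a := ⟨⟨hq.1.1, hq.1.2.trans (by linarith)⟩, hq.2⟩
    set γ : ℝ → M := fun t => φ t x with hγ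
    have hγ0 : γ 0 = x := (hφ x).1
    have hint := (hφ x).2
    have hγc : Continuous γ := hint.continuous
    have hγ0K : γ 0 ∈ K := by rw [hγ0]; exact ⟨q, hqb, hx⟩
    have hzt : ∀ t, γ t ∈ K → HasDerivAt (fun t => z (γ t)) (planarField G (z (γ t))) t := by
      intro t ht
      rw [← hfield _ ht]
      exact SymplecticForm.hasDerivAt_comp_integralCurve hint (hzs _ ht).self_of_nhds
    have hnorm : ∀ t, γ t ∈ K → Complex.normSq (z (γ t)) = (T.mom (γ t)).1 / Real.pi := by
      intro t ht
      rw [eq_div_iff hpi.ne', mul_comm]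
      exact (hzm _ ht).self_of_nhds
    have hstart : Complex.normSq (z (γ 0)) ≤ d / Real.pi := by
      rw [hnorm 0 hγ0K, hγ0, h.mom_eq (hsubR hqb) hx.symm]
      have := hq.1.2
      gcongr
    have hdyn' : ∀ t ∈ Icc (0 : ℝ) 1, (∀ u ∈ Icc 0 t, γ u ∈ K) → _ := fun t ht hu =>
      hdyn (fun t => z (γ t)) t ht (fun u hu' => hzt u (hu u hu')) (fun u hu' => by
        rw [hnorm u (hu u hu')]
        have := (hKq _ (hu u hu')).1.1.2
        gcongr) hstart
    -- The boundary of the rectangle is not crossed: the planar estimate is strict at `b`, the first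
    -- momentum is non-negative as a squared norm, and the second is constant. Local injectivity of
    -- `Φ` turns this statement on momenta into one on the base.
    have hstay : ∀ t ∈ Icc (0 : ℝ) 1, γ t ∈ K := by
      refine hKc.isClosed.mem_of_forall_nhds hγc hγ0K fun t ht hu => ?_
      have htK : γ t ∈ K := hu t ⟨ht.1, le_rfl⟩
      have h1 := (hdyn' t ⟨ht.1, ht.2.le⟩ hu).1 t ⟨ht.1, le_rfl⟩
      rw [hnorm t htK, div_lt_div_iff_of_pos_right hpi] at h1
      have h2 : ∀ᶠ u in 𝓝 t, (T.mom (γ u)).1 < b :=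
        (T.smooth_mom.continuous.comp hγc).fst.continuousAt.eventually (gt_mem_nhds h1)
      have h3 : ∀ᶠ u in 𝓝 t, 0 ≤ (T.mom (γ u)).1 := by
        filter_upwards [hγc.continuousAt.eventually (hzm _ htK)] with u hu
        rw [← hu]
        exact mul_nonneg hpi.le (Complex.normSq_nonneg _)
      have h4 : ∀ᶠ u in 𝓝 t, (T.mom (γ u)).2 = (T.mom (γ t)).2 := by
        obtain ⟨ε, hε, hball⟩ := Metric.eventually_nhds_iff_ball.1
          (hγc.continuousAt.eventually (hmom2 _ htK))
        have hder : ∀ u ∈ Metric.ball t ε, HasDerivAt (fun u => (T.mom (γ u)).2) 0 u := by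
          intro u hu
          have h5 := SymplecticForm.hasDerivAt_comp_integralCurve hint (T.smooth_mom (γ u))
          have h6 := (hasFDerivAt_snd (𝕜 := ℝ) (p := T.mom (γ u))).comp_hasDerivAt u h5
          refine h6.congr_deriv ?_
          exact hball u hu
        filter_upwards [Metric.ball_mem_nhds t hε] with u hu
        exact (convex_ball t ε).is_const_of_fderivWithin_eq_zero (𝕜 := ℝ)
          (fun v hv => (hder v hv).differentiableAt.differentiableWithinAt) (fun v hv => by
            rw [fderivWithin_of_isOpen Metric.isOpen_ball hv]
            ext; simp [(hder v hv).hasFDerivAt.fderiv]) hu (Metric.mem_ball_self hε)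
      filter_upwards [h2, h3, h4, hγc.continuousAt.eventually (h.eventually_mem_preimage
        (hsubR (hKq _ htK).1) (hKq _ htK).2)] with u k2 k3 k4 k5
      have k6 : T.mom (γ u) ∈ Icc 0 b ×ˢ Icc 0 a :=
        ⟨⟨k3, k2.le⟩, by rw [k4]; exact (hKq _ htK).1.2⟩
      exact ⟨_, k6, (k5 (hsubR k6)).symm⟩
    have h1 := (hdyn' 1 ⟨zero_le_one, le_rfl⟩ hstay).2 rfl
    rw [hnorm 1 (hstay 1 ⟨zero_le_one, le_rfl⟩), div_lt_div_iff_of_pos_right hpi] at h1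
    rw [h.mom_eq (x := γ 1) (q := q')
      ⟨⟨hq'.1.1, hq'.1.2.trans (by linarith)⟩, hq'.2⟩ hx'.symm] at h1
    exact absurd hq'.1.2 (not_le.2 h1)
  refine ⟨H, φ, hHs, hHc, ⟨fun x => Ω.ham H x, fun x w => ?_, hφ⟩, ?_⟩
  · rw [mfderiv_eq_dM (hHs x)]
    exact Ω.om_ham H x w
  · rw [(h.isCompact_preimage (by linarith)).isClosed.closure_eq, eq_empty_iff_forall_notMem]
    rintro _ ⟨⟨x, hx, rfl⟩, hx'⟩
    exact htrap x hx hx'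

end RectModel

end

end

/-! ### Integral affine maps -/

noncomputable section

/-! ### The integral lattice -/

section Lattice

variable {n : ℕ}

theorem single_mem_stdLattice (i : Fin n) : EuclideanSpace.single i (1 : ℝ) ∈ stdLattice n := by
  intro k
  by_cases h : k = i
  · exact ⟨1, by simp [h]⟩
  · exact ⟨0, by simp [h]⟩

theorem exists_int_inner {u v : EuclideanSpace ℝ (Fin n)} (hu : u ∈ stdLattice n)
    (hv : v ∈ stdLattice n) : ∃ k : ℤ, inner ℝ u v = (k : ℝ) := by
  choose a ha using hu
  choose b hb using hv
  refine ⟨∑ i, b i * a i, ?_⟩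
  rw [PiLp.inner_apply]
  push_cast
  exact Finset.sum_congr rfl fun i _ => by rw [ha, hb]; simp [mul_comm]

theorem mem_stdLattice_of_inner {v : EuclideanSpace ℝ (Fin n)}
    (h : ∀ u ∈ stdLattice n, ∃ k : ℤ, inner ℝ u v = (k : ℝ)) : v ∈ stdLattice n := fun i => by
  obtain ⟨k, hk⟩ := h _ (single_mem_stdLattice i)
  exact ⟨k, by rw [← hk, EuclideanSpace.inner_single_left]; simp⟩

theorem adjoint_mem_stdLattice {K : EuclideanSpace ℝ (Fin n) →L[ℝ] EuclideanSpace ℝ (Fin n)}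
    (hK : ∀ u ∈ stdLattice n, K u ∈ stdLattice n) {v : EuclideanSpace ℝ (Fin n)}
    (hv : v ∈ stdLattice n) : ContinuousLinearMap.adjoint K v ∈ stdLattice n :=
  mem_stdLattice_of_inner fun u hu => by
    rw [ContinuousLinearMap.adjoint_inner_right]
    exact exists_int_inner (hK u hu) hv

theorem torusExp_add (ξ ζ : EuclideanSpace ℝ (Fin n)) :
    torusExp (ξ + ζ) = torusExp ξ + torusExp ζ := by
  ext i; simp [torusExp]

theorem torusExp_eq_zero {ξ : EuclideanSpace ℝ (Fin n)} (h : ξ ∈ stdLattice n) :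
    torusExp ξ = 0 := by
  ext i
  obtain ⟨k, hk⟩ := h i
  simp only [torusExp, Pi.zero_apply]
  rw [hk, AddCircle.coe_eq_zero_iff]
  exact ⟨k, by simp⟩

theorem IsPreconnected.eq_of_int {X : Type*} [TopologicalSpace X] {S : Set X}
    (hS : IsPreconnected S) {g : X → ℝ} (hg : ContinuousOn g S) (hi : ∀ p ∈ S, ∃ k : ℤ, g p = k)
    {p q : X} (hp : p ∈ S) (hq : q ∈ S) : g p = g q := by
  refine hS.constant_of_mapsTo (T := range ((↑) : ℤ → ℝ)) ?_ hg (fun p hp => ?_) hp hq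
  · rw [isDiscrete_iff_discreteTopology]
    exact Int.isClosedEmbedding_coe_real.isEmbedding.toHomeomorph.symm.isEmbedding.discreteTopology
  · obtain ⟨k, hk⟩ := hi p hp
    exact ⟨k, hk.symm⟩

/-- A smooth map of a convex domain whose derivative preserves the standard lattice is affine. -/
theorem exists_affine_of_fderivWithin {S : Set (EuclideanSpace ℝ (Fin n))} (hS : Convex ℝ S)
    (hS0 : (interior S).Nonempty) {f : EuclideanSpace ℝ (Fin n) → EuclideanSpace ℝ (Fin n)}
    (hf : ContDiffOn ℝ ∞ f S) (hf' : ∀ p ∈ S, fderivWithin ℝ f S p '' stdLattice n = stdLattice n) :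
    ∃ (L : EuclideanSpace ℝ (Fin n) ≃L[ℝ] EuclideanSpace ℝ (Fin n)) (c : EuclideanSpace ℝ (Fin n)),
      L '' stdLattice n = stdLattice n ∧ ∀ p ∈ S, f p = L p + c := by
  have hu : UniqueDiffOn ℝ S := uniqueDiffOn_convex hS hS0
  obtain ⟨p₀, hp₀⟩ := hS0
  replace hp₀ := interior_subset hp₀
  have hc := hf.continuousOn_fderivWithin hu (by simp)
  set A := fderivWithin ℝ f S p₀ with hA
  -- The matrix entries of the derivative are continuous and integer-valued on a connected set.
  have hconst : ∀ p ∈ S, fderivWithin ℝ f S p = A := by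
    intro p hp
    have h1 : (fderivWithin ℝ f S p).toLinearMap = A.toLinearMap := by
      refine (EuclideanSpace.basisFun (Fin n) ℝ).toBasis.ext fun i => ?_
      simp only [OrthonormalBasis.coe_toBasis, EuclideanSpace.basisFun_apply,
        ContinuousLinearMap.coe_coe]
      ext k
      refine hS.isPreconnected.eq_of_int (g := fun p =>
        fderivWithin ℝ f S p (EuclideanSpace.single i 1) k) ?_ (fun q hq => ?_) hp hp₀
      · have h2 : ContinuousOn (fun p => fderivWithin ℝ f S p (EuclideanSpace.single i (1 : ℝ))) S :=
          hc.clm_apply continuousOn_const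
        exact (EuclideanSpace.proj (𝕜 := ℝ) k).continuous.comp_continuousOn h2
      · have : fderivWithin ℝ f S q (EuclideanSpace.single i (1 : ℝ)) ∈ stdLattice n := by
          rw [← hf' q hq]
          exact mem_image_of_mem _ (single_mem_stdLattice i)
        exact this k
    ext1 v
    exact congrArg (fun L => L v) h1
  have hsurj : Function.Surjective A.toLinearMap := by
    rw [← LinearMap.range_eq_top, eq_top_iff,
      ← (EuclideanSpace.basisFun (Fin n) ℝ).toBasis.span_eq, Submodule.span_le]
    rintro _ ⟨i, rfl⟩
    have h1 : EuclideanSpace.single i (1 : ℝ) ∈ A '' stdLattice n := by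
      rw [hf' p₀ hp₀]; exact single_mem_stdLattice i
    obtain ⟨v, -, hv⟩ := h1
    exact ⟨v, by simpa using hv⟩
  have hinj := LinearMap.injective_iff_surjective.2 hsurj
  set L := (LinearEquiv.ofBijective A.toLinearMap ⟨hinj, hsurj⟩).toContinuousLinearEquiv with hL
  have hLA : ∀ v, L v = A v := fun v => rfl
  refine ⟨L, f p₀ - L p₀, ?_, fun p hp => ?_⟩
  · exact (image_congr fun v _ => hLA v).trans (hf' p₀ hp₀)
  · have hd : DifferentiableOn ℝ (fun p => f p - A p) S :=
      (hf.differentiableOn (by simp)).sub A.differentiableOn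
    have := hS.is_const_of_fderivWithin_eq_zero (𝕜 := ℝ) hd (fun q hq => by
      rw [fderivWithin_fun_sub (hu q hq) (hf.differentiableOn (by simp) q hq)
        A.differentiableAt.differentiableWithinAt, A.fderivWithin (hu q hq), hconst q hq,
        sub_self]) hp hp₀
    rw [hLA, hLA]
    exact (sub_eq_iff_eq_add.1 this).trans (by abel)

end Lattice

/-- A map with injective derivative within a convex set is locally injective. -/
theorem exists_injOn_nhdsWithin {V W : Type*} [NormedAddCommGroup V] [NormedSpace ℝ V]
    [NormedAddCommGroup W] [NormedSpace ℝ W] [FiniteDimensional ℝ V] [FiniteDimensional ℝ W]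
    {S : Set V} (hS : Convex ℝ S) (hu : UniqueDiffOn ℝ S) {f : V → W} {x : V} (hx : x ∈ S)
    (hf : ∀ᶠ y in 𝓝[S] x, ContDiffWithinAt ℝ ∞ f S y)
    (hinj : Function.Injective (fderivWithin ℝ f S x)) : ∃ t ∈ 𝓝[S] x, InjOn f t := by
  set A := fderivWithin ℝ f S x with hA
  obtain ⟨L, hL⟩ := ContinuousLinearMap.HasLeftInverse.of_injective_of_finiteDimensional hinj
  -- Near `x` the difference `f - A` is Lipschitz with this constant, smaller than the reciprocal of
  -- the norm of a left inverse `L` of `A`, so it cannot cancel `A`.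
  set K : NNReal := (‖L‖₊ + 1)⁻¹ with hK
  have hK0 : 0 < K := by positivity
  have hder : ∀ᶠ y in 𝓝[S] x, HasFDerivWithinAt (fun y => f y - A y)
      (fderivWithin ℝ f S y - A) S y := by
    filter_upwards [hf] with y hy
    exact (hy.differentiableWithinAt (by simp)).hasFDerivWithinAt.sub A.hasFDerivWithinAt
  have hcont : ContinuousWithinAt (fun y => fderivWithin ℝ f S y - A) S x :=
    ((((hf.self_of_nhdsWithin hx).fderivWithin_right hu (m := 0) (by simp)
      hx).continuousWithinAt).sub continuousWithinAt_const)
  obtain ⟨t, ht, hlip⟩ := hS.exists_nhdsWithin_lipschitzOnWith_of_hasFDerivWithinAt_of_nnnorm_lt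
    hder hcont K (by simpa [hA] using hK0)
  refine ⟨t, ht, fun a ha b hb hab => ?_⟩
  have h1 := hlip.dist_le_mul a ha b hb
  have h2 : dist (f a - A a) (f b - A b) = ‖A (b - a)‖ := by
    rw [dist_eq_norm, hab, map_sub]
    congr 1
    abel
  have h3 : ‖b - a‖ ≤ ‖L‖ * ‖A (b - a)‖ := by
    have := L.le_opNorm (A (b - a))
    rwa [hL] at this
  rw [h2, dist_comm, dist_eq_norm] at h1
  have h4 : (K : ℝ) * (‖L‖ + 1) = 1 := by
    rw [hK]
    push_cast
    exact inv_mul_cancel₀ (by positivity)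
  have h5 : ‖b - a‖ = 0 := by
    by_contra hne
    have hpos : 0 < ‖b - a‖ := lt_of_le_of_ne (norm_nonneg _) (Ne.symm hne)
    have hKr : (0 : ℝ) < K := hK0
    have h6 : ‖L‖ * ‖A (b - a)‖ ≤ ‖L‖ * (K * ‖b - a‖) := by gcongr
    nlinarith [norm_nonneg L, mul_pos hKr hpos]
  exact (sub_eq_zero.1 (norm_eq_zero.1 h5)).symm

/-- An immersion of a manifold with corners is locally injective. -/
theorem exists_injOn_of_immersion {n : ℕ} {B : Type*} [TopologicalSpace B]
    [ChartedSpace (EuclideanQuadrant n) B] [IsManifold (baseModel n) ∞ B]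
    {V : Type*} [NormedAddCommGroup V] [NormedSpace ℝ V] [FiniteDimensional ℝ V]
    {Φ : B → V} (hΦ : ContMDiff (baseModel n) 𝓘(ℝ, V) ∞ Φ) {b : B}
    (hinj : Function.Injective (mfderiv (baseModel n) 𝓘(ℝ, V) Φ b)) : ∃ U ∈ 𝓝 b, InjOn Φ U := by
  set e := extChartAt (baseModel n) b with he
  have hb : b ∈ e.source := mem_extChartAt_source b
  have hS : Convex ℝ (range (baseModel n)) := (baseModel n).convex_range
  have htgt : e.target ∈ 𝓝[range (baseModel n)] (e b) := extChartAt_target_mem_nhdsWithin b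
  have hcd : ∀ y ∈ e.target, ContDiffWithinAt ℝ ∞ (Φ ∘ e.symm) e.target y := fun y hy =>
    (hΦ.comp_contMDiffOn (contMDiffOn_extChartAt_symm b) y hy).contDiffWithinAt
  have hcd' : ∀ᶠ y in 𝓝[range (baseModel n)] (e b),
      ContDiffWithinAt ℝ ∞ (Φ ∘ e.symm) (range (baseModel n)) y := by
    filter_upwards [htgt] with y hy
    exact (hcd y hy).mono_of_mem_nhdsWithin (extChartAt_target_mem_nhdsWithin_of_mem hy)
  have hd : Function.Injective (fderivWithin ℝ (Φ ∘ e.symm) (range (baseModel n)) (e b)) := by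
    have h1 : MDifferentiableAt (baseModel n) 𝓘(ℝ, V) Φ b := (hΦ b).mdifferentiableAt (by simp)
    rw [h1.mfderiv] at hinj
    exact hinj
  obtain ⟨t, ht, hti⟩ := exists_injOn_nhdsWithin hS (baseModel n).uniqueDiffOn
    (mem_range_self _) hcd' hd
  refine ⟨e.source ∩ e ⁻¹' t, inter_mem (extChartAt_source_mem_nhds b) ?_, ?_⟩
  · have h2 : Tendsto e (𝓝 b) (𝓝[range (baseModel n)] (e b)) := by
      rw [← map_extChartAt_nhds (I := baseModel n) b]
      exact tendsto_map
    exact h2 ht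
  · rintro x ⟨hx, hxt⟩ y ⟨hy, hyt⟩ hxy
    refine e.injOn hx hy (hti hxt hyt ?_)
    simp only [Function.comp_apply, e.left_inv hx, e.left_inv hy, hxy]

end

/-! ### Affine changes of the momentum map -/

noncomputable section

/-- The Euclidean plane as a product. -/
def planeEquiv : EuclideanSpace ℝ (Fin 2) ≃L[ℝ] ℝ × ℝ :=
  (EuclideanSpace.equiv (Fin 2) ℝ).trans (ContinuousLinearEquiv.finTwoArrow ℝ ℝ)

theorem planeEquiv_apply (p : EuclideanSpace ℝ (Fin 2)) : planeEquiv p = (p 0, p 1) := rfl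

theorem planeEquiv_symm_apply (q : ℝ × ℝ) : planeEquiv.symm q = !₂[q.1, q.2] := by
  rw [ContinuousLinearEquiv.symm_apply_eq, planeEquiv_apply]
  simp

theorem dot_planeEquiv (u v : EuclideanSpace ℝ (Fin 2)) :
    dot (planeEquiv u) (planeEquiv v) = inner ℝ u v := by
  simp [dot, planeEquiv_apply, PiLp.inner_apply, Fin.sum_univ_two, mul_comm]

theorem isInt_planeEquiv {u : EuclideanSpace ℝ (Fin 2)} (hu : u ∈ stdLattice 2) :
    IsInt (planeEquiv u) := by
  obtain ⟨m, hm⟩ := hu 0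
  obtain ⟨n, hn⟩ := hu 1
  exact ⟨m, n, by rw [planeEquiv_apply, hm, hn]⟩

theorem planeEquiv_symm_int (m n : ℤ) :
    planeEquiv.symm ((m : ℝ), (n : ℝ)) ∈ stdLattice 2 := by
  rw [planeEquiv_symm_apply]
  intro i
  fin_cases i
  · exact ⟨m, by simp⟩
  · exact ⟨n, by simp⟩

section

variable {E : Type} [NormedAddCommGroup E] [NormedSpace ℝ E] [FiniteDimensional ℝ E]
variable {M : Type*} [TopologicalSpace M] [ChartedSpace E M] [IsManifold 𝓘(ℝ, E) ∞ M]
variable {Ω : SymplecticForm E M}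

/-- A Hamiltonian action of the standard torus, after an integral affine change of the momenta. -/
theorem exists_torusHam [AddAction (StdTorus 2) M] {μ : M → EuclideanSpace ℝ (Fin 2)}
    (hμ : IsHamiltonianTorusAction Ω μ)
    (K : EuclideanSpace ℝ (Fin 2) →L[ℝ] EuclideanSpace ℝ (Fin 2))
    (hK : ∀ u ∈ stdLattice 2, K u ∈ stdLattice 2) (c : EuclideanSpace ℝ (Fin 2)) :
    ∃ T : TorusHam Ω, (∀ x, T.mom x = planeEquiv (K (μ x - c))) ∧
      ∀ ξ x, T.act ξ x = torusExp (ContinuousLinearMap.adjoint K (planeEquiv.symm ξ)) +ᵥ x := by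
  -- Changing the momentum by `K` corresponds to reparametrising the action by the adjoint of `K`,
  -- which preserves the lattice as well.
  set A : ℝ × ℝ →L[ℝ] EuclideanSpace ℝ (Fin 2) := (ContinuousLinearMap.adjoint K).comp
    (planeEquiv.symm : ℝ × ℝ →L[ℝ] EuclideanSpace ℝ (Fin 2)) with hA
  have hmomC : ContDiff ℝ ∞ (fun v : EuclideanSpace ℝ (Fin 2) => planeEquiv (K (v - c))) :=
    planeEquiv.contDiff.comp (K.contDiff.comp (contDiff_id.sub contDiff_const))
  have hmom : ContMDiff 𝓘(ℝ, E) 𝓘(ℝ, ℝ × ℝ) ∞ (fun x => planeEquiv (K (μ x - c))) :=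
    hmomC.contMDiff.comp hμ.smooth_momentum
  have hzero : ∀ x : M, torusExp (A 0) +ᵥ x = x := fun x => by
    rw [map_zero, torusExp_eq_zero (fun i => ⟨0, by simp⟩), zero_vadd]
  have hsm : ContMDiff (𝓘(ℝ, ℝ × ℝ).prod 𝓘(ℝ, E)) 𝓘(ℝ, E) ∞
      (fun p : (ℝ × ℝ) × M => torusExp (A p.1) +ᵥ p.2) :=
    hμ.smooth_action.comp ((A.contDiff.contMDiff.comp contMDiff_fst).prodMk contMDiff_snd)
  refine ⟨{ act := fun ξ x => torusExp (A ξ) +ᵥ x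
            mom := fun x => planeEquiv (K (μ x - c))
            act_zero := hzero
            act_add := fun ξ ζ x => by rw [map_add, torusExp_add, add_vadd]
            act_int := fun m n x => by
              rw [show torusExp (A ((m : ℝ), (n : ℝ))) = 0 from
                torusExp_eq_zero (adjoint_mem_stdLattice hK (planeEquiv_symm_int m n)), zero_vadd]
            smooth_act := hsm
            smooth_mom := hmom
            ham := fun x ξ w => ?_ }, fun x => rfl, fun ξ x => rfl⟩
  obtain ⟨X, hX, hflow⟩ := hμ.flow (A ξ)
  have hint : IsMIntegralCurve (I := 𝓘(ℝ, E)) (fun t => torusExp (t • A ξ) +ᵥ x) X := (hflow x).2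
  set f : M → E := fun y => ch E (torusExp (A 0) +ᵥ x) y with hf
  have hγ0 : torusExp ((0 : ℝ) • A ξ) +ᵥ x = x := (hflow x).1
  have hfs : SmoothAt (E := E) f x :=
    contMDiffAt_ch (by rw [hzero]; exact mem_ch_source x)
  have h1 : HasDerivAt (fun t : ℝ => f (torusExp (t • A ξ) +ᵥ x)) (X x) 0 := by
    have h2 := SymplecticForm.hasDerivAt_comp_integralCurve hint (f := f) (t := 0)
      (by rw [hγ0]; exact hfs)
    refine h2.congr_deriv ?_
    have h3 : ∀ y, y = x → dM (E := E) f y (show E from X y) = dM (E := E) f x (show E from X x) := by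
      rintro _ rfl; rfl
    rw [h3 _ hγ0]
    rw [hf, hzero, dM_ch_self]
    rfl
  have h3 : gener (E := E) (fun ξ x => torusExp (A ξ) +ᵥ x) x ξ = X x := by
    have h4 : ContMDiffAt 𝓘(ℝ, ℝ × ℝ) 𝓘(ℝ, E) ∞ (fun ξ => f (torusExp (A ξ) +ᵥ x)) 0 :=
      ContMDiffAt.comp (I' := 𝓘(ℝ, E)) (0 : ℝ × ℝ) (g := f) (by rw [hzero]; exact hfs)
        ((hsm.comp (contMDiff_id.prodMk contMDiff_const)) 0)
    have h5 := (h4.contDiffAt.differentiableAt (by simp)).hasFDerivAt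
    have h6 : HasDerivAt (fun t : ℝ => t • ξ) ξ 0 := by
      simpa using (hasDerivAt_id (0 : ℝ)).smul_const ξ
    have h7 := h5.comp_hasDerivAt_of_eq (0 : ℝ) h6 (by simp)
    have h8 : gener (E := E) (fun ξ x => torusExp (A ξ) +ᵥ x) x =
        fderiv ℝ (fun ξ => f (torusExp (A ξ) +ᵥ x)) 0 := by
      rw [gener, dMap, dM_model]
      rfl
    rw [h8]
    refine h7.unique (h1.congr_of_eventuallyEq (Eventually.of_forall fun t => ?_))
    simp only [Function.comp_apply, map_smul]
  rw [h3]
  have h9 : Ω.om x (X x) w = dM (fun x => inner ℝ (μ x) (A ξ)) x w := by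
    have h10 : SmoothAt (E := E) (fun x => inner ℝ (μ x) (A ξ)) x :=
      ContMDiffAt.comp x (g := fun v => inner ℝ v (A ξ))
        ((contDiff_id.inner ℝ contDiff_const).contMDiff _) (hμ.smooth_momentum x)
    have h11 := hX x w
    rw [mfderiv_eq_dM h10] at h11
    exact h11
  rw [h9]
  have h12 := dM_comp (hmom x) (dotL ξ).hasFDerivAt
  have h13 : (dotL ξ ∘ fun x => planeEquiv (K (μ x - c))) =
      fun x => inner ℝ (μ x) (A ξ) - inner ℝ c (A ξ) := by
    ext y
    simp only [Function.comp_apply, dotL_apply]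
    conv_lhs => rw [← planeEquiv.apply_symm_apply ξ]
    rw [dot_planeEquiv, ← ContinuousLinearMap.adjoint_inner_right, ← inner_sub_left]
    rfl
  rw [h13] at h12
  have h14 : dM (fun x => inner ℝ (μ x) (A ξ)) x =
      dM (E := E) (fun x => inner ℝ (μ x) (A ξ) - inner ℝ c (A ξ)) x := by
    rw [dM, dM]
    exact (fderiv_sub_const (f := (fun x => inner ℝ (μ x) (A ξ)) ∘ (ch E x).symm) _).symm
  rw [h14, h12]
  simp

end

end

/-! ### Toric fibrations -/

noncomputable section

section

set_option linter.unusedSectionVars false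

variable {E : Type} [NormedAddCommGroup E] [NormedSpace ℝ E] [FiniteDimensional ℝ E]
variable {M : Type*} [TopologicalSpace M] [ChartedSpace E M] [IsManifold 𝓘(ℝ, E) ∞ M]
variable {Ω : SymplecticForm E M}
variable {B : Type*} [TopologicalSpace B] [ChartedSpace (EuclideanQuadrant 2) B]
  [IsManifold (baseModel 2) ∞ B]

/-- A period of the Hamiltonian flow of a function factoring through the fibration gives an isotropy
covector. -/
theorem mem_isotropyCovectors [T2Space M] {H : M → ℝ} {φ : ℝ → M → M} {F : M → B}
    (hH : ContMDiff 𝓘(ℝ, E) 𝓘(ℝ, ℝ) ∞ H) (hφ : IsHamiltonianFlow Ω H φ) {b : B}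
    {α : TangentSpace (baseModel 2) b →L[ℝ] ℝ}
    (hα : ∀ x, F x = b → ∀ w : TangentSpace 𝓘(ℝ, E) x,
      mfderiv 𝓘(ℝ, E) 𝓘(ℝ, ℝ) H x w = α (mfderiv 𝓘(ℝ, E) (baseModel 2) F x w))
    (h1 : ∀ x, F x = b → φ 1 x = x) : α ∈ isotropyCovectors Ω F b := by
  intro X hX γ hγ hγb
  have : CompleteSpace E := FiniteDimensional.complete ℝ E
  have hm : IsManifold 𝓘(ℝ, E) 1 M := IsManifold.of_le (n := ∞) (by simp)
  obtain ⟨Y, hY, hφY⟩ := hφ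
  have hYham : ∀ x, Y x = (show TangentSpace 𝓘(ℝ, E) x from Ω.ham H x) := fun x =>
    Ω.ham_unique fun w => by
      have h2 := hY x w
      rw [mfderiv_eq_dM (hH x)] at h2
      exact h2
  have hXham : ∀ x, F x = b → X x = (show TangentSpace 𝓘(ℝ, E) x from Ω.ham H x) := fun x hx =>
    Ω.ham_unique fun w => by
      have h2 := (hX x hx w).trans (hα x hx w).symm
      rw [mfderiv_eq_dM (hH x)] at h2
      exact h2
  -- Along the fibre both fields agree with the Hamiltonian field of `H`, so the curve is a
  -- trajectory of the given flow by uniqueness.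
  set Z : ∀ x : M, TangentSpace 𝓘(ℝ, E) x := fun x => Ω.ham H x with hZ
  have hYZ : Y = Z := funext hYham
  have hγZ : IsMIntegralCurve (I := 𝓘(ℝ, E)) γ Z := fun t => by
    have h2 := hγ t
    rwa [hXham _ (hγb t)] at h2
  have hφZ : IsMIntegralCurve (I := 𝓘(ℝ, E)) (fun t => φ t (γ 0)) Z := hYZ ▸ (hφY (γ 0)).2
  have h3 := isMIntegralCurve_Ioo_eq_of_contMDiff_boundaryless (t₀ := 0)
    ((Ω.contMDiff_ham hH).of_le (by simp)) hγZ hφZ (hφY (γ 0)).1.symm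
  rw [congrFun h3 1]
  exact h1 _ (hγb 0)

/-- The induced structure enters only here: over regular values it guarantees that the stabilisers
are exactly the integral lattice. -/
theorem exists_toricModel [T2Space M] {F : M → B} {A : IntegralAffineStructure 2 B}
    (hF : IsLagrangianFibration (n := 2) Ω F) (hA : IsInducedAffineStructure Ω F A)
    (hproper : IsProperMap F) (hconn : ∀ b, IsConnected (F ⁻¹' {b}))
    [AddAction (StdTorus 2) M] {Φ : B → EuclideanSpace ℝ (Fin 2)}
    (hΦ : IsIntegralAffineImmersion A Φ) (hact : IsHamiltonianTorusAction Ω (Φ ∘ F))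
    (L : EuclideanSpace ℝ (Fin 2) ≃L[ℝ] EuclideanSpace ℝ (Fin 2))
    (hL : L '' stdLattice 2 = stdLattice 2) (c : EuclideanSpace ℝ (Fin 2)) :
    ∃ T : TorusHam Ω, ToricModel T F (fun b => planeEquiv (L.symm (Φ b - c))) := by
  set K : EuclideanSpace ℝ (Fin 2) →L[ℝ] EuclideanSpace ℝ (Fin 2) :=
    L.symm.toContinuousLinearMap with hK
  have hKl : ∀ u ∈ stdLattice 2, K u ∈ stdLattice 2 := by
    intro u hu
    rw [← hL] at hu
    obtain ⟨v, hv, rfl⟩ := hu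
    simpa [hK] using hv
  obtain ⟨T, hmom, hTact⟩ := exists_torusHam hact K hKl c
  have hFd : ∀ x, MDifferentiableAt 𝓘(ℝ, E) (baseModel 2) F x := fun x =>
    (hF.smooth x).mdifferentiableAt (by simp)
  have hΦd : ∀ b, MDifferentiableAt (baseModel 2) 𝓘(ℝ, EuclideanSpace ℝ (Fin 2)) Φ b := fun b =>
    (hΦ.1 b).mdifferentiableAt (by simp)
  have hcomp : ∀ x (w : E), dM (Φ ∘ F) x w =
      (show EuclideanSpace ℝ (Fin 2) from mfderiv (baseModel 2) 𝓘(ℝ, EuclideanSpace ℝ (Fin 2)) Φ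
        (F x) (mfderiv 𝓘(ℝ, E) (baseModel 2) F x w)) := by
    intro x w
    have h1 := mfderiv_comp x (hΦd (F x)) (hFd x)
    rw [mfderiv_eq_dM (hact.smooth_momentum x)] at h1
    exact congrArg (fun L => L w) h1
  have hsurj : ∀ D : EuclideanSpace ℝ (Fin 2) →L[ℝ] EuclideanSpace ℝ (Fin 2),
      Function.Injective D → Function.Surjective D := fun D hD =>
    LinearMap.injective_iff_surjective (f := D.toLinearMap).1 hD
  have hsurjΦ : ∀ b, Function.Surjective
      (mfderiv (baseModel 2) 𝓘(ℝ, EuclideanSpace ℝ (Fin 2)) Φ b) := fun b =>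
    hsurj _ (hΦ.2 b).1
  refine ⟨T, hmom, fun b => ?_, hproper, hconn, hF.dense_regular.mono fun b hb => ⟨?_, ?_⟩⟩
  · obtain ⟨U, hU, hinj⟩ := exists_injOn_of_immersion hΦ.1 (hΦ.2 b).1
    refine ⟨U, hU, fun x hx y hy hxy => hinj hx hy ?_⟩
    exact sub_left_injective (L.symm.injective (planeEquiv.injective hxy))
  · intro x hx
    rw [T.injective_gen_iff]
    intro ξ hξ
    have h1 : ∀ w : E, dot (dM T.mom x w) ξ = 0 := fun w => by
      rw [← T.om_gen, hξ]
      simpa using Ω.om_smul_left x 0 0 w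
    have h2 : ∀ w : E, dM T.mom x w = planeEquiv (K (dM (Φ ∘ F) x w)) := fun w => by
      have h3 : HasFDerivAt (fun v : EuclideanSpace ℝ (Fin 2) => planeEquiv (K (v - c)))
          ((planeEquiv : EuclideanSpace ℝ (Fin 2) →L[ℝ] ℝ × ℝ).comp K) ((Φ ∘ F) x) :=
        (planeEquiv.hasFDerivAt.comp _ K.hasFDerivAt).comp ((Φ ∘ F) x)
          ((hasFDerivAt_id ((Φ ∘ F) x)).sub_const c)
      have h4 := dM_comp (hact.smooth_momentum x) h3
      rw [show T.mom = (fun v : EuclideanSpace ℝ (Fin 2) => planeEquiv (K (v - c))) ∘ (Φ ∘ F) from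
        funext hmom, h4]
      rfl
    have h5 : ∀ v, ∃ w : E, dM (Φ ∘ F) x w = v := fun v => by
      obtain ⟨u, hu⟩ := hsurjΦ (F x) v
      obtain ⟨w, hw⟩ := hb x hx u
      exact ⟨w, (hcomp x w).trans ((congrArg _ hw).trans hu)⟩
    obtain ⟨w, hw⟩ := h5 (L (planeEquiv.symm ξ))
    have h6 := h1 w
    rw [h2, hw] at h6
    simp only [hK, ContinuousLinearEquiv.coe_coe, L.symm_apply_apply,
      planeEquiv.apply_symm_apply] at h6
    simp only [dot] at h6
    ext <;> simp <;> nlinarith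
  -- An element fixing a regular fibre yields an isotropy covector. It is integral on the lattice of
  -- `A`, because `A` is induced, and `dΦ` carries this lattice onto ℤ².
  · intro τ hτ
    set ζ := ContinuousLinearMap.adjoint K (planeEquiv.symm τ) with hζ
    have hs : ContDiff ℝ ∞ (fun v : EuclideanSpace ℝ (Fin 2) => inner ℝ v ζ) :=
      contDiff_id.inner ℝ contDiff_const
    have hHs : ContMDiff 𝓘(ℝ, E) 𝓘(ℝ, ℝ) ∞ (fun x => inner ℝ ((Φ ∘ F) x) ζ) :=
      hs.contMDiff.comp hact.smooth_momentum
    set α : TangentSpace (baseModel 2) b →L[ℝ] ℝ :=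
      (show EuclideanSpace ℝ (Fin 2) →L[ℝ] ℝ from (innerSL ℝ ζ)).comp
        (mfderiv (baseModel 2) 𝓘(ℝ, EuclideanSpace ℝ (Fin 2)) Φ b) with hα
    have hmem : α ∈ isotropyCovectors Ω F b := by
      refine mem_isotropyCovectors hHs (hact.flow ζ) (fun x hx w => ?_) fun x hx => ?_
      · subst hx
        rw [mfderiv_eq_dM (hHs x)]
        have h1 : HasFDerivAt (fun v : EuclideanSpace ℝ (Fin 2) => inner ℝ v ζ) (innerSL ℝ ζ)
            ((Φ ∘ F) x) := by
          have := (innerSL ℝ ζ).hasFDerivAt (x := (Φ ∘ F) x)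
          refine this.congr_of_eventuallyEq (Eventually.of_forall fun v => ?_)
          exact real_inner_comm _ _
        have h2 := dM_comp (hact.smooth_momentum x) h1
        have h3 := congrArg (fun L => L w) h2
        refine h3.trans ?_
        exact congrArg (innerSL ℝ ζ) (hcomp x w)
      · have := hτ x hx
        rw [hTact] at this
        simpa using this
    have hζl : ζ ∈ stdLattice 2 := by
      refine mem_stdLattice_of_inner fun u hu => ?_
      rw [← (hΦ.2 b).2] at hu
      obtain ⟨v, hv, rfl⟩ := hu
      obtain ⟨k, hk⟩ := (hA b hb v).1 hv α hmem
      exact ⟨k, by rw [← hk]; exact real_inner_comm _ _⟩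
    -- Pairing `τ` with `u` is pairing `ζ` with `L u`, and `L` preserves the lattice.
    have h4 : planeEquiv.symm τ ∈ stdLattice 2 := by
      refine mem_stdLattice_of_inner fun u hu => ?_
      have h5 : L u ∈ stdLattice 2 := by rw [← hL]; exact mem_image_of_mem _ hu
      obtain ⟨k, hk⟩ := exists_int_inner h5 hζl
      refine ⟨k, ?_⟩
      rw [← hk, hζ, ContinuousLinearMap.adjoint_inner_right]
      simp [hK]
    simpa using isInt_planeEquiv h4

end

theorem convex_rectangle (R a : ℝ) : Convex ℝ (rectangle R a) := by
  rintro p ⟨h1, h2, h3, h4⟩ q ⟨k1, k2, k3, k4⟩ s t hs ht hst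
  simp only [rectangle, mem_ofPred_eq, PiLp.add_apply, PiLp.smul_apply, smul_eq_mul]
  have : ∀ r : ℝ, r = s * r + t * r := fun r => by rw [← add_mul, hst, one_mul]
  refine ⟨by positivity, ?_, by positivity, ?_⟩
  · rw [this R]; gcongr
  · rw [this a]; gcongr

theorem interior_rectangle_nonempty {R a : ℝ} (hR : 0 < R) (ha : 0 < a) :
    (interior (rectangle R a)).Nonempty := by
  have h0 : Continuous fun p : EuclideanSpace ℝ (Fin 2) => p 0 :=
    (EuclideanSpace.proj (𝕜 := ℝ) (0 : Fin 2)).continuous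
  have h1 : Continuous fun p : EuclideanSpace ℝ (Fin 2) => p 1 :=
    (EuclideanSpace.proj (𝕜 := ℝ) (1 : Fin 2)).continuous
  have ho : IsOpen ((fun p : EuclideanSpace ℝ (Fin 2) => p 0) ⁻¹' Ioo 0 R ∩
      (fun p : EuclideanSpace ℝ (Fin 2) => p 1) ⁻¹' Ioo 0 a) :=
    (isOpen_Ioo.preimage h0).inter (isOpen_Ioo.preimage h1)
  refine ⟨!₂[R / 2, a / 2], interior_maximal (fun p hp => ?_) ho ?_⟩
  · exact ⟨hp.1.1.le, hp.1.2.le, hp.2.1.le, hp.2.2.le⟩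
  · exact ⟨by simpa using hR, by simpa using ha⟩

theorem vec_mem_rectangle {R a : ℝ} {q : ℝ × ℝ} (hq : q ∈ Icc 0 R ×ˢ Icc 0 a) :
    !₂[q.1, q.2] ∈ rectangle R a := by
  simp only [rectangle, mem_ofPred_eq]
  simpa using ⟨hq.1.1, hq.1.2, hq.2.1, hq.2.2⟩

theorem image_rectangle {X : Type*} (j : EuclideanSpace ℝ (Fin 2) → X) (R a : ℝ) :
    j '' rectangle R a = (fun q : ℝ × ℝ => j !₂[q.1, q.2]) '' (Icc 0 R ×ˢ Icc 0 a) := by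
  ext x
  constructor
  · rintro ⟨p, ⟨h1, h2, h3, h4⟩, rfl⟩
    refine ⟨(p 0, p 1), ⟨⟨h1, h2⟩, ⟨h3, h4⟩⟩, ?_⟩
    simp only
    congr 1
    ext i; fin_cases i <;> simp
  · rintro ⟨q, hq, rfl⟩
    exact ⟨_, vec_mem_rectangle hq, rfl⟩

theorem isDisplaceable_preimage_rectangle
    {M : Type*} [TopologicalSpace M] [T2Space M] [SecondCountableTopology M]
    [ChartedSpace (EuclideanSpace ℝ (Fin 4)) M] [IsManifold 𝓘(ℝ, EuclideanSpace ℝ (Fin 4)) ∞ M]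
    {B : Type*} [TopologicalSpace B] [T2Space B]
    [ChartedSpace (EuclideanQuadrant 2) B] [IsManifold (baseModel 2) ∞ B]
    {Ω : SymplecticForm (EuclideanSpace ℝ (Fin 4)) M}
    {F : M → B} {A : IntegralAffineStructure 2 B}
    (hF : IsToricFibration Ω F A) (hproper : IsProperMap F) (hconn : ∀ b : B, IsConnected (F ⁻¹' {b}))
    {R a h : ℝ} {j : EuclideanSpace ℝ (Fin 2) → B} (ha : 0 < a) (hh : 0 < h) (hR : h < R / 2)
    (hj : IsAffineEmbeddingOn A (rectangle R a) j)
    (hs : StartsOnReducedBoundary (EuclideanSpace ℝ (Fin 4)) F R a j) :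
    IsDisplaceable Ω (F ⁻¹' (j '' rectangle h a)) := by
  obtain ⟨hact0, Φ, hΦ, hact⟩ := hF.exists_action
  have hR0 : 0 < R := by linarith
  have hconv := convex_rectangle R a
  have hint := interior_rectangle_nonempty hR0 ha
  have hu : UniqueDiffOn ℝ (rectangle R a) := uniqueDiffOn_convex hconv hint
  have hsm : ContDiffOn ℝ ∞ (Φ ∘ j) (rectangle R a) := (hΦ.1.comp_contMDiffOn hj.1).contDiffOn
  have hder : ∀ p ∈ rectangle R a,
      fderivWithin ℝ (Φ ∘ j) (rectangle R a) p '' stdLattice 2 = stdLattice 2 := by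
    intro p hp
    have h1 := mfderiv_comp_mfderivWithin (I := 𝓘(ℝ, EuclideanSpace ℝ (Fin 2))) p
      ((hΦ.1 (j p)).mdifferentiableAt (by simp))
      ((hj.1 p hp).mdifferentiableWithinAt (by simp)) (hu p hp).uniqueMDiffWithinAt
    rw [mfderivWithin_eq_fderivWithin] at h1
    have h2 : fderivWithin ℝ (Φ ∘ j) (rectangle R a) p '' stdLattice 2 =
        mfderiv (baseModel 2) 𝓘(ℝ, EuclideanSpace ℝ (Fin 2)) Φ (j p) ''
          (mfderivWithin 𝓘(ℝ, EuclideanSpace ℝ (Fin 2)) (baseModel 2) j (rectangle R a) p ''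
            stdLattice 2) :=
      (image_congr fun v _ => congrArg (fun L => L v) h1).trans (image_image _ _ _).symm
    exact h2.trans ((congrArg _ (hj.2.2 p hp).2).trans (hΦ.2 (j p)).2)
  -- The affine map `Φ ∘ j` is undone in the momentum, which becomes the identity on the rectangle.
  obtain ⟨L, c, hL, hLc⟩ := exists_affine_of_fderivWithin hconv hint hsm hder
  obtain ⟨T, hT⟩ := exists_toricModel hF.lagrangianFibration hF.induced hproper hconn hΦ hact L hL c
  rw [image_rectangle]
  refine RectModel.isDisplaceable (T := T) (R := R)
    (j := fun q => j !₂[q.1, q.2])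
    ⟨hT, by simp, hR0, ha, fun q hq => ?_, ?_, hs⟩ hh hR
  · have h1 := hLc _ (vec_mem_rectangle hq)
    simp only [Function.comp_apply] at h1
    simp only [h1, add_sub_cancel_right, L.symm_apply_apply, planeEquiv_apply]
    simp
  · have h1 : ContinuousOn j (rectangle R a) := hj.1.continuousOn
    have h2 : Continuous fun q : ℝ × ℝ => !₂[q.1, q.2] := by
      rw [show (fun q : ℝ × ℝ => !₂[q.1, q.2]) = planeEquiv.symm from
        funext fun q => (planeEquiv_symm_apply q).symm]
      exact planeEquiv.symm.continuous
    exact h1.comp h2.continuousOn fun q hq => vec_mem_rectangle hq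

end

theorem lemmal
    {M : Type*} [TopologicalSpace M] [T2Space M] [SecondCountableTopology M] [ConnectedSpace M]
    [ChartedSpace (EuclideanSpace ℝ (Fin 4)) M] [IsManifold 𝓘(ℝ, EuclideanSpace ℝ (Fin 4)) ∞ M]
    {B : Type*} [TopologicalSpace B] [T2Space B] [SecondCountableTopology B]
    [ChartedSpace (EuclideanQuadrant 2) B] [IsManifold (baseModel 2) ∞ B]
    (Ω : SymplecticForm (EuclideanSpace ℝ (Fin 4)) M)
    (F : M → B) (A : IntegralAffineStructure 2 B)
    (hF : IsToricFibration Ω F A)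
    (hproper : IsProperMap F)
    (hconn : ∀ b : B, IsConnected (F ⁻¹' {b})) :
    (∀ (R h : ℝ) (j : EuclideanSpace ℝ (Fin 2) → B), 0 < h → h < R / 2 →
      IsAffineEmbeddingOn A (rectangle R h) j →
      StartsOnReducedBoundary (EuclideanSpace ℝ (Fin 4)) F R h j →
      IsDisplaceable Ω (F ⁻¹' (j '' rectangle h h))) ∧
    (∀ (R a h : ℝ) (j : EuclideanSpace ℝ (Fin 2) → B), 0 < a → 0 < h → h < R / 2 →
      IsAffineEmbeddingOn A (rectangle R a) j →
      StartsOnReducedBoundary (EuclideanSpace ℝ (Fin 4)) F R a j →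
      IsDisplaceable Ω (F ⁻¹' (j '' rectangle h a))) := by
  constructor
  -- The square is the case `a = h` of the rectangle.
  · intro R h j hh hR hj hs
    exact isDisplaceable_preimage_rectangle hF hproper hconn hh hh hR hj hs
  · intro R a h j ha hh hR hj hs
    exact isDisplaceable_preimage_rectangle hF hproper hconn ha hh hR hj hs
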